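/- **Setting.** Let $B=B(0,1)\subset\mathbb R^3$. $C^7_c(B)$ is the set of complex-valued $C^7$ functions with compact support in $B$ (extended by $0$ to $\mathbb R^3$), with norm $\|q\|_{C^7}=\sum_{|\beta|\le 7}\sup_B|\partial^\beta q|$. For $q\in C^7_c(B)$ and $|a|=1$ consider the point source problem $$(\partial_t^2-\Delta-q)\,U^a=\delta(x-a,t)\ \text{ in }\mathbb R^3\times\mathbb R,\qquad U^a=0\ \text{ for } t<0,$$ for distributions $U^a$ of order at most $7$ on $\mathbb R^3\times\mathbb R$. A function $f$ is *angularly controlled with constant $S$* if for every $0<r<1$ $$\sum_{i<j}\int_{|x|=r}|\Omega_{ij}f|^2\,d\sigma\le S^2\int_{|x|=r}|f|^2\,d\sigma,\qquad \Omega_{ij}=x_i\partial_j-x_j\partial_i .$$ **Theorem.** Let $\mathcal M>0$ and $0<h<1$. There is $\alpha=\alpha(\mathcal M,h)>0$ such that for every $S>0$ there are constants $0<\mathfrak C,\mathfrak D<\infty$, depending only on $S,\mathcal M,h$, with the following properties. Let $q_1,q_2\in C^7_c(B)$ with $\|q_j\|_{C^7}\le\mathcal M$ and with supports no closer than distance $h$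 from $\partial B$. Then for $j=1,2$ and every $|a|=1$ the point source problem with $q=q_j$ has a unique solution $U^a_j$. For $0<\tau<1$, $U_j^a$ is a continuous function near the point $(x,t)=(a,2\tau)$, the function $\tau\mapsto\tau(U_1^a-U_2^a)(a,2\tau)$ is $C^1$ on $(0,1)$, and the measurement norm $$\|U_1^a-U_2^a\|:=\Big(\sup_{0<\tau<1}\int_{|a|=1}\big|\partial_\tau\big(\tau(U_1^a-U_2^a)(a,2\tau)\big)\big|^2d\sigma(a)\Big)^{1/2}$$ is finite. Moreover: 1. If $q_1-q_2$ is angularly controlled with constant $S$, then for every $r>0$ $$\|q_1-q_2\|_{L^2(\{|x|=r\})}\le e^{\mathfrak C/r^4}\,\|U_1^a-U_2^a\|,$$ and on the full domain $$\|q_1-q_2\|_{L^2(B)}\le\mathfrak D\Big(\ln\frac1{\|U_1^a-U_2^a\|}\Big)^{-1/4}\quad\text{if }\|U_1^a-U_2^a\|<e^{-1}$$ (the right-hand side being $0$ if $\|U_1^a-U_2^a\|=0$), and $\|q_1-q_2\|_{L^2(B)}\le\mathfrak D\|U_1^a-U_2^a\|$ otherwise. 2. If $q_1-q_2$ is radially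 symmetric, then for every $r>0$ $$\|q_1-q_2\|_{L^2(\{|x|=r\})}\le\mathfrak C\,r^{-\alpha}\,\|U_1^a-U_2^a\|,\qquad \|q_1-q_2\|_{L^2(B)}\le\mathfrak D\,\|U_1^a-U_2^a\|^{\frac1{1+\alpha}} .$$ -/

import Mathlib

open MeasureTheory Set Metric TopologicalSpace
open scoped Distributions ENNReal LineDeriv

noncomputable section

/-- Euclidean space `ℝ³`. -/
abbrev R3 : Type := EuclideanSpace ℝ (Fin 3)

/-- Space-time `ℝ³ × ℝ`, points are `(x, t)`. -/
abbrev SpaceTime : Type := R3 × ℝ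

/-- The open unit ball `B` of `ℝ³` as an open set. -/
def unitBall : Opens R3 := ⟨ball 0 1, isOpen_ball⟩

/-- `C^7_c(B)`: complex valued `C^7` functions with compact support in `B`, extended by zero to
`ℝ³`. -/
abbrev Potential : Type := 𝓓^{7}(unitBall, ℂ)

/-- The `i`-th standard basis vector of `ℝ³`. -/
def stdVec (i : Fin 3) : R3 := EuclideanSpace.single i 1

/-- The partial derivative `∂_i f`. -/
def partialD (i : Fin 3) (f : R3 → ℂ) : R3 → ℂ := fun x => fderiv ℝ f x (stdVec i)

/-- `∂^α f` for a multi-index `α`. -/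
def multiD (α : Fin 3 → ℕ) (f : R3 → ℂ) : R3 → ℂ :=
  (partialD 0)^[α 0] ((partialD 1)^[α 1] ((partialD 2)^[α 2] f))

/-- The norm `∑_{|α| ≤ s} sup_{x ∈ B} |∂^α f(x)|` of `C^s(B)`, with values in `[0, ∞]`. -/
def cNorm (s : ℕ) (f : R3 → ℂ) : ℝ≥0∞ :=
  ∑ k ∈ Finset.range (s + 1), ∑ α ∈ Finset.piAntidiag (Finset.univ : Finset (Fin 3)) k,
    ⨆ x ∈ ball (0 : R3) 1, ‖multiD α f x‖ₑ

/-- A-priori class: `C^7` norm at most `M`, support no closer than `h` to the unit sphere. -/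
def Admissible (M h : ℝ) (q : Potential) : Prop :=
  cNorm 7 q ≤ ENNReal.ofReal M ∧
    ∀ x ∈ tsupport q, ∀ y ∈ sphere (0 : R3) 1, h ≤ dist x y

/-- Surface measure of the sphere `|x| = r` (for `r > 0`), as a measure on `ℝ³`: the image of the
surface measure of the unit sphere under `ω ↦ r ω`, multiplied by `r²`. -/
def sphereMeasure (r : ℝ) : Measure R3 :=
  ENNReal.ofReal (r ^ 2) •
    ((volume : Measure R3).toSphere).map (fun ω : sphere (0 : R3) 1 => r • (ω : R3))

/-- The angular derivative `Ω_{ij} f = x_i ∂_j f - x_j ∂_i f`. -/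
def angularD (i j : Fin 3) (f : R3 → ℂ) : R3 → ℂ :=
  fun x => (x i : ℂ) * partialD j f x - (x j : ℂ) * partialD i f x

/-- `f` is angularly controlled with constant `S`. -/
def AngularlyControlled (S : ℝ) (f : R3 → ℂ) : Prop :=
  ∀ r : ℝ, 0 < r → r < 1 →
    ∑ i : Fin 3, ∑ j ∈ Finset.Ioi i, ∫⁻ x, ‖angularD i j f x‖ₑ ^ 2 ∂(sphereMeasure r)
      ≤ ENNReal.ofReal (S ^ 2) * ∫⁻ x, ‖f x‖ₑ ^ 2 ∂(sphereMeasure r)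

/-- `f` is radially symmetric about the origin. -/
def RadiallySymmetric (f : R3 → ℂ) : Prop := ∀ x y : R3, ‖x‖ = ‖y‖ → f x = f y

/-- Complex distributions of order at most `7` on `ℝ³ × ℝ`. -/
abbrev Dist7 : Type := 𝓓'^{7}((⊤ : Opens SpaceTime), ℂ)

/-- The wave operator `∂_t² - Δ` on smooth test functions. -/
def boxTest (φ : 𝓓((⊤ : Opens SpaceTime), ℝ)) : 𝓓((⊤ : Opens SpaceTime), ℝ) :=
  ∂_{((0, 1) : SpaceTime)} (∂_{((0, 1) : SpaceTime)} φ)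
    - ∑ i : Fin 3, ∂_{((stdVec i, 0) : SpaceTime)} (∂_{((stdVec i, 0) : SpaceTime)} φ)

/-- A smooth test function regarded as a `C^7` test function. -/
def toTest7 (φ : 𝓓((⊤ : Opens SpaceTime), ℝ)) : 𝓓^{7}((⊤ : Opens SpaceTime), ℝ) where
  toFun := φ
  contDiff' := φ.contDiff.of_le (by exact_mod_cast (le_top : (7 : ℕ∞) ≤ ⊤))
  hasCompactSupport' := φ.hasCompactSupport
  tsupport_subset' := φ.tsupport_subset

/-- The `C^7` test function `(x, t) ↦ g(x) φ(x, t)`. -/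
def mulTest (g : R3 → ℝ) (hg : ContDiff ℝ 7 g) (φ : 𝓓((⊤ : Opens SpaceTime), ℝ)) :
    𝓓^{7}((⊤ : Opens SpaceTime), ℝ) where
  toFun := fun p => g p.1 * φ p
  contDiff' := (hg.comp contDiff_fst).mul (toTest7 φ).contDiff
  hasCompactSupport' := φ.hasCompactSupport.mul_left
  tsupport_subset' := fun _ _ => trivial

/-- `C^7` regularity of the real part of a potential. -/
theorem Potential.contDiff_re (q : Potential) : ContDiff ℝ 7 (fun x => (q x).re) :=
  Complex.reCLM.contDiff.comp q.contDiff

/-- `C^7` regularity of the imaginary part of a potential. -/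
theorem Potential.contDiff_im (q : Potential) : ContDiff ℝ 7 (fun x => (q x).im) :=
  Complex.imCLM.contDiff.comp q.contDiff

/-- The pairing `⟨q U, φ⟩ = ⟨U, q φ⟩` (test functions are real valued, `U` is extended to complex
valued ones by complex linearity). -/
def potentialPairing (q : Potential) (U : Dist7) (φ : 𝓓((⊤ : Opens SpaceTime), ℝ)) : ℂ :=
  U (mulTest _ q.contDiff_re φ) + Complex.I * U (mulTest _ q.contDiff_im φ)

/-- `U` is a distributional solution, of order at most `7`, of the point source problem
`(∂_t² - Δ - q) U = δ(x - a, t)` in `ℝ³ × ℝ`, `U = 0` for `t < 0`. -/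
def IsPointSourceSolution (q : Potential) (a : R3) (U : Dist7) : Prop :=
  (∀ φ : 𝓓((⊤ : Opens SpaceTime), ℝ),
    U (toTest7 (boxTest φ)) - potentialPairing q U φ = ((φ (a, 0) : ℝ) : ℂ)) ∧
  ∀ φ : 𝓓^{7}((⊤ : Opens SpaceTime), ℝ), tsupport φ ⊆ {p : SpaceTime | p.2 < 0} → U φ = 0

/-- Near `p` the distribution `U` is a continuous function whose value at `p` is `c`. -/
def HasPointValue (U : Dist7) (p : SpaceTime) (c : ℂ) : Prop :=
  ∃ (V : Set SpaceTime) (f : SpaceTime → ℂ), IsOpen V ∧ p ∈ V ∧ ContinuousOn f V ∧ f p = c ∧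
    ∀ φ : 𝓓^{7}((⊤ : Opens SpaceTime), ℝ), tsupport φ ⊆ V → U φ = ∫ y, φ y • f y

open Classical in
/-- The value of `U` at `p` (which is unique if it exists; `0` if there is none). -/
def pointValue (U : Dist7) (p : SpaceTime) : ℂ :=
  if h : ∃ c, HasPointValue U p c then h.choose else 0

/-- `τ ↦ τ (U₁^a - U₂^a)(a, 2τ)`. -/
def backscatterDiff (U₁ U₂ : R3 → Dist7) (a : R3) (τ : ℝ) : ℂ :=
  (τ : ℂ) * (pointValue (U₁ a) (a, 2 * τ) - pointValue (U₂ a) (a, 2 * τ))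

/-- The measurement norm
`(sup_{0<τ<1} ∫_{|a|=1} |∂_τ (τ (U₁^a - U₂^a)(a, 2τ))|² dσ(a))^{1/2}`, in `[0, ∞]`. -/
def dataNorm (U₁ U₂ : R3 → Dist7) : ℝ≥0∞ :=
  (⨆ τ ∈ Ioo (0 : ℝ) 1,
    ∫⁻ a, ‖deriv (backscatterDiff U₁ U₂ a) τ‖ₑ ^ 2 ∂(sphereMeasure 1)) ^ (1 / 2 : ℝ)

end

/-! The solution is the spherical wave δ(t − |x−a|)/(4π|x−a|) plus a regular part r supported in the
cone |x−a| < t. In ellipsoidal coordinates with foci x and a (`lintegral_ellipsoid`), the retarded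
potential of q times the spherical wave is an average of q over the ellipsoid |x−y| + |y−a| = t, so
r has to satisfy the Volterra equation r = `ellAvg` + `retPot` (q r). Since the data involve a time
derivative, the differentiated equation for P = ∂ₜr is solved instead, by contraction in a sup norm
with weight exp(−l t) (`PotBound.exists_tailDensity`). Then r is its limit value on the cone plus
the time primitive of P (`IsTailDensity.waveTail_eq`). The advanced potential inverts the wave
operator (`integral_retarded_box`), and duality with it turns the integral equation into the
distributional one (`IsTail.waveFun_box`). For uniqueness, a solution W of the homogeneous problem
satisfies W φ = W (q `advPot` φ) up to cutoffs. In a weighted C⁷ norm this operation halves every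
bound for W, hence W = 0 (`IsHomogeneousSolution.eq_zero`).

Write q = q₁ − q₂. The difference of the backscattered fields, tested against a time profile, is the
second wave paired with q times the backward wave for the first potential
(`IsTail.timePairing_sub`). Step profiles, integration by parts in time, sorting by arrival time,
and finally differentiation give `waveTail_sub_eq`: (r₁ − r₂)(a, 2τ) is the normalised integral
(32π²)⁻¹ ∫ q(a + τω) dω plus ∫₀^{2τ} A(s) ds. Here A(s) is bounded by the integral of |q(a +
(s/2)ω)| over unit vectors ω and by the integral of |q| over the ball of radius s/2 about a
(`norm_arrivalDensity_le`).

The key computation is `PotBound.meanDeriv_eq`. In spherical coordinates around a with polar axis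
−a, the radial derivative in ∂_τ(τ ∫ q(a + τω) dω) splits into a polar derivative and a derivative
tangent to the spheres |x| = const. Integrating the first by parts leaves the boundary value 2π(1−τ)
q((1−τ)a). The data therefore determine q on the sphere of radius 1−τ, up to angular derivatives and
averages of q at radii at least 1−τ. After squaring and integrating over a, rotation invariance
(`lintegral_shifted_spheres`) gives the closed inequality `PotBound.sphSq_le` for the square norms
on spheres about the origin. The radii that enter are the third sides ℓ(τ,θ) of triangles with sides
1 and τ enclosing the angle θ, integrated against dθ.

Because ℓ(τ,θ) − (1−τ) is at least a multiple of θ², an exponential weight of rate c turns the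
θ-integral into a Gaussian one of size c^(−1/2), and a rate of order Λ² closes the estimate
(`gronwall_sideLength`). Here Λ bounds the angular terms by the norms themselves. Angular control
gives Λ = S²/r² + 1 on |x| ≥ r, hence the factor exp(C/r⁴). Balancing this against the trivial bound
at small radii gives the logarithm to the power −1/4. For radial q the angular derivatives vanish, Λ
= 1, and the estimate on spheres is uniform in r, so that α = 1 can be taken. -/

noncomputable section

/-! ### Surface measure and spherical coordinates -/

/-- The surface measure of the unit sphere of `ℝ³`, as a measure on `ℝ³`. -/
def sph : Measure R3 := (volume : Measure R3).toSphere.map (↑)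

/-- `toSphere` is the dimension times the volume of the cone over a set. Writing that cone by
conditions on x lets `sph_eq_map` compute its volume in spherical coordinates. -/
lemma sph_apply {A : Set R3} (hA : MeasurableSet A) :
    sph A = 3 * volume {x : R3 | x ≠ 0 ∧ ‖x‖ < 1 ∧ ‖x‖⁻¹ • x ∈ A} := by
  rw [sph, Measure.map_apply measurable_subtype_coe hA,
    Measure.toSphere_apply' _ (measurable_subtype_coe hA)]
  congr 1
  · simp
  · congr 1
    ext x
    simp only [Set.mem_smul, mem_image, mem_preimage, Subtype.exists, mem_sphere_iff_norm, sub_zero]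
    constructor
    · rintro ⟨s, ⟨hs0, hs1⟩, y, ⟨z, hz, hzA, rfl⟩, rfl⟩
      have hn : ‖s • z‖ = s := by rw [norm_smul, hz, Real.norm_of_nonneg hs0.le, mul_one]
      refine ⟨fun h => ?_, by rw [hn]; exact hs1, ?_⟩
      · rw [h, norm_zero] at hn; exact hs0.ne hn
      · rw [hn, smul_smul, inv_mul_cancel₀ hs0.ne', one_smul]; exact hzA
    · rintro ⟨h0, h1, hA'⟩
      have hp : 0 < ‖x‖ := norm_pos_iff.2 h0
      refine ⟨‖x‖, ⟨hp, h1⟩, ‖x‖⁻¹ • x, ⟨_, ?_, hA', rfl⟩, ?_⟩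
      · rw [norm_smul, norm_inv, norm_norm, inv_mul_cancel₀ hp.ne']
      · rw [smul_smul, mul_inv_cancel₀ hp.ne', one_smul]

instance : IsFiniteMeasure sph := by unfold sph; infer_instance

lemma sph_ae_norm : ∀ᵐ ω ∂sph, ‖ω‖ = 1 := by
  rw [sph, ae_map_iff measurable_subtype_coe.aemeasurable
    (measurableSet_eq_fun measurable_norm measurable_const)]
  exact Filter.Eventually.of_forall fun ω => by simp

/-- The radial factor of Lebesgue measure in polar coordinates. -/
def radial : Measure ℝ := (volume.restrict (Ioi (0 : ℝ))).withDensity fun s => ENNReal.ofReal (s ^ 2)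

instance : SFinite radial := by unfold radial; infer_instance

lemma lintegral_polar {f : R3 → ℝ≥0∞} (hf : Measurable f) :
    ∫⁻ x, f x = ∫⁻ s in Ioi (0 : ℝ), ENNReal.ofReal (s ^ 2) * ∫⁻ ω, f (s • ω) ∂sph := by
  have h1 : ∫⁻ x, f x = ∫⁻ x : ({(0 : R3)}ᶜ : Set R3), f x ∂((volume : Measure R3).comap Subtype.val) := by
    rw [← lintegral_map hf measurable_subtype_coe,
      map_comap_subtype_coe (measurableSet_singleton _).compl, restrict_compl_singleton]
  have h2 := (volume : Measure R3).measurePreserving_homeomorphUnitSphereProd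
  rw [h1]
  have h3 : ∀ x : ({(0 : R3)}ᶜ : Set R3), f x =
      (fun p : sphere (0 : R3) 1 × Ioi (0 : ℝ) => f (p.2.1 • p.1.1))
        (homeomorphUnitSphereProd R3 x) := by
    intro x
    have h : ‖(x : R3)‖ ≠ 0 := norm_ne_zero_iff.2 x.2
    simp [smul_smul, h]
  simp_rw [h3]
  have hm : Measurable (fun p : sphere (0 : R3) 1 × Ioi (0 : ℝ) => f (p.2.1 • p.1.1)) :=
    hf.comp (by fun_prop)
  have hm2 : Measurable fun p : R3 × ℝ => f (p.2 • p.1) := hf.comp (by fun_prop)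
  rw [h2.lintegral_comp hm, lintegral_prod_symm' _ hm, Measure.volumeIoiPow,
    lintegral_withDensity_eq_lintegral_mul _ (by fun_prop) (by fun_prop)]
  have h5 : ∀ s : ℝ, ∫⁻ ω : sphere (0 : R3) 1, f (s • ω.1) ∂(volume : Measure R3).toSphere
      = ∫⁻ ω, f (s • ω) ∂sph := fun s => by
    rw [sph, lintegral_map (f := fun ω => f (s • ω)) (hf.comp (by fun_prop)) measurable_subtype_coe]
  simp only [Pi.mul_apply, h5]
  have : Module.finrank ℝ R3 - 1 = 2 := by simp
  rw [this, ← map_comap_subtype_coe measurableSet_Ioi,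
    lintegral_map (f := fun s => ENNReal.ofReal (s ^ 2) * ∫⁻ ω, f (s • ω) ∂sph) _
      measurable_subtype_coe]
  refine Measurable.mul (by fun_prop) ?_
  exact hm2.lintegral_prod_left'

lemma volume_eq_map_polar :
    (volume : Measure R3) = (radial.prod sph).map fun p => p.1 • p.2 := by
  ext A hA
  rw [← lintegral_indicator_one hA, lintegral_polar (measurable_one.indicator hA),
    ← lintegral_indicator_one hA, lintegral_map (measurable_one.indicator hA) (by fun_prop),
    lintegral_prod (fun p : ℝ × R3 => A.indicator (1 : R3 → ℝ≥0∞) (p.1 • p.2))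
      ((measurable_one.indicator hA).comp (by fun_prop)).aemeasurable, radial,
    lintegral_withDensity_eq_lintegral_mul _ (by fun_prop)]
  · rfl
  · exact ((measurable_one.indicator hA).comp
      (measurable_fst.smul measurable_snd)).lintegral_prod_right'

/-- Spherical coordinates with respect to an orthonormal basis, with polar axis `b 2`. -/
def sphPt (b : OrthonormalBasis (Fin 3) ℝ R3) (p : ℝ × ℝ) : R3 :=
  (Real.sin p.1 * Real.cos p.2) • b 0 + (Real.sin p.1 * Real.sin p.2) • b 1 + Real.cos p.1 • b 2

lemma continuous_sphPt (b : OrthonormalBasis (Fin 3) ℝ R3) : Continuous (sphPt b) := by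
  unfold sphPt; fun_prop

lemma norm_sq_comb (b : OrthonormalBasis (Fin 3) ℝ R3) (x y z : ℝ) :
    ‖x • b 0 + y • b 1 + z • b 2‖ ^ 2 = x ^ 2 + y ^ 2 + z ^ 2 := by
  have h := b.orthonormal
  rw [← real_inner_self_eq_norm_sq]
  simp only [inner_add_left, inner_add_right, real_inner_smul_left, real_inner_smul_right,
    orthonormal_iff_ite.1 h]
  simp
  ring

lemma norm_sphPt (b : OrthonormalBasis (Fin 3) ℝ R3) (p : ℝ × ℝ) : ‖sphPt b p‖ = 1 := by
  have : ‖sphPt b p‖ ^ 2 = 1 := by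
    rw [sphPt, norm_sq_comb]
    nlinarith [Real.sin_sq_add_cos_sq p.1, Real.sin_sq_add_cos_sq p.2]
  nlinarith [norm_nonneg (sphPt b p)]

lemma lintegral_cart (b : OrthonormalBasis (Fin 3) ℝ R3) {f : R3 → ℝ≥0∞} (hf : Measurable f) :
    ∫⁻ x, f x = ∫⁻ z : ℝ, ∫⁻ q : ℝ × ℝ, f (q.1 • b 0 + q.2 • b 1 + z • b 2) := by
  have e1 := b.repr.symm.measurePreserving
  have e2 := PiLp.volume_preserving_toLp (Fin 3)
  have e3 := (volume_preserving_piFinSuccAbove (fun _ : Fin 3 => ℝ) 2).symm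
  have e4 := (volume_preserving_finTwoArrow ℝ).symm
  have e : MeasurePreserving (fun p : ℝ × ℝ × ℝ => p.2.1 • b 0 + p.2.2 • b 1 + p.1 • b 2) := by
    convert! e1.comp (e2.comp (e3.comp ((MeasurePreserving.id volume).prod e4))) using 1
    ext1 p
    simp only [Function.comp_apply, ← b.sum_repr_symm, Fin.sum_univ_three]
    rfl
  rw [← e.lintegral_comp hf, Measure.volume_eq_prod,
    lintegral_prod (fun p : ℝ × ℝ × ℝ => f (p.2.1 • b 0 + p.2.2 • b 1 + p.1 • b 2))
      (hf.comp (by fun_prop)).aemeasurable]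

/-- Polar coordinates z = r cos θ, s = r sin θ in the half plane s > 0: the cylindrical Jacobian s
times the polar Jacobian r is r² sin θ. -/
lemma lintegral_half_plane {g : ℝ × ℝ → ℝ≥0∞} (hg : Measurable g) :
    ∫⁻ z : ℝ, ∫⁻ s in Ioi (0 : ℝ), ENNReal.ofReal s * g (z, s) =
      ∫⁻ r in Ioi (0 : ℝ), ∫⁻ θ in Ioo 0 Real.pi, ENNReal.ofReal (r ^ 2) *
        (ENNReal.ofReal (Real.sin θ) * g (r * Real.cos θ, r * Real.sin θ)) := by
  -- Truncation in `ENNReal.ofReal s` kills negative s, so the integral may run over the whole plane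
  -- and the library's polar coordinates apply.
  have h1 : ∀ z : ℝ, ∫⁻ s in Ioi (0 : ℝ), ENNReal.ofReal s * g (z, s) =
      ∫⁻ s : ℝ, ENNReal.ofReal s * g (z, s) := fun z => by
    rw [← lintegral_indicator measurableSet_Ioi]
    refine lintegral_congr fun s => ?_
    by_cases hs : s ∈ Ioi (0 : ℝ)
    · rw [indicator_of_mem hs]
    · rw [indicator_of_notMem hs, ENNReal.ofReal_of_nonpos (not_lt.1 hs), zero_mul]
  have hm : Measurable fun p : ℝ × ℝ => ENNReal.ofReal p.2 * g p := by fun_prop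
  simp_rw [h1]
  rw [← lintegral_prod (μ := volume) (ν := volume)
    (fun p : ℝ × ℝ => ENNReal.ofReal p.2 * g p) hm.aemeasurable,
    ← Measure.volume_eq_prod, ← lintegral_comp_polarCoord_symm, polarCoord_target,
    Measure.volume_eq_prod, ← Measure.prod_restrict, lintegral_prod]
  · refine setLIntegral_congr_fun measurableSet_Ioi fun r hr => ?_
    have hr : 0 < r := hr
    rw [← lintegral_indicator measurableSet_Ioo, ← lintegral_indicator measurableSet_Ioo]
    refine lintegral_congr fun θ => ?_
    by_cases h0 : θ ∈ Ioo 0 Real.pi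
    · have h0' : θ ∈ Ioo (-Real.pi) Real.pi := ⟨by linarith [h0.1, Real.pi_pos], h0.2⟩
      rw [indicator_of_mem h0, indicator_of_mem h0']
      simp only [polarCoord_symm_apply, smul_eq_mul]
      rw [ENNReal.ofReal_mul hr.le, pow_two, ENNReal.ofReal_mul hr.le]
      ring
    · rw [indicator_of_notMem h0]
      by_cases h1 : θ ∈ Ioo (-Real.pi) Real.pi
      · rw [indicator_of_mem h1]
        have hθ : θ ≤ 0 := by
          by_contra h
          exact h0 ⟨not_le.1 h, h1.2⟩
        have : r * Real.sin θ ≤ 0 :=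
          mul_nonpos_of_nonneg_of_nonpos hr.le (Real.sin_nonpos_of_nonpos_of_neg_pi_le hθ h1.1.le)
        simp [ENNReal.ofReal_of_nonpos this]
      · rw [indicator_of_notMem h1]
  · refine Measurable.aemeasurable ?_
    exact (ENNReal.measurable_ofReal.comp measurable_fst).smul
      (hm.comp continuous_polarCoord_symm.measurable)

/-- Polar coordinates twice: in the plane of `b 0` and `b 1`, then in the half plane formed by the
height z and the distance from the axis. -/
lemma lintegral_spherical (b : OrthonormalBasis (Fin 3) ℝ R3) {f : R3 → ℝ≥0∞}
    (hf : Measurable f) :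
    ∫⁻ x, f x = ∫⁻ φ in Ioo (-Real.pi) Real.pi, ∫⁻ r in Ioi (0 : ℝ), ∫⁻ θ in Ioo 0 Real.pi,
      ENNReal.ofReal (r ^ 2) * (ENNReal.ofReal (Real.sin θ) * f (r • sphPt b (θ, φ))) := by
  rw [lintegral_cart b hf]
  have h1 : ∀ z : ℝ, ∫⁻ q : ℝ × ℝ, f (q.1 • b 0 + q.2 • b 1 + z • b 2) =
      ∫⁻ φ in Ioo (-Real.pi) Real.pi, ∫⁻ s in Ioi (0 : ℝ), ENNReal.ofReal s *
        f ((s * Real.cos φ) • b 0 + (s * Real.sin φ) • b 1 + z • b 2) := fun z => by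
    rw [← lintegral_comp_polarCoord_symm, polarCoord_target, Measure.volume_eq_prod,
      ← Measure.prod_restrict, lintegral_prod_symm]
    · rfl
    · refine Measurable.aemeasurable ?_
      exact (ENNReal.measurable_ofReal.comp measurable_fst).smul
        (hf.comp (by simp only [polarCoord_symm_apply]; fun_prop))
  simp_rw [h1]
  have hm : Measurable fun p : (ℝ × ℝ) × ℝ => ENNReal.ofReal p.2 *
        f ((p.2 * Real.cos p.1.2) • b 0 + (p.2 * Real.sin p.1.2) • b 1 + p.1.1 • b 2) :=
    (ENNReal.measurable_ofReal.comp measurable_snd).mul (hf.comp (by fun_prop))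
  rw [lintegral_lintegral_swap (by exact hm.lintegral_prod_right'.aemeasurable)]
  refine lintegral_congr fun φ => ?_
  rw [lintegral_half_plane
    (g := fun p => f ((p.2 * Real.cos φ) • b 0 + (p.2 * Real.sin φ) • b 1 + p.1 • b 2))
    (hf.comp (by fun_prop))]
  refine lintegral_congr fun r => lintegral_congr fun θ => ?_
  simp only [sphPt, smul_add, smul_smul, mul_assoc]

/-- The measure `sin θ dθ dφ` on `(0, π) × (-π, π)`. -/
def angular : Measure (ℝ × ℝ) :=
  ((volume.restrict (Ioo 0 Real.pi)).withDensity fun θ => ENNReal.ofReal (Real.sin θ)).prod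
    (volume.restrict (Ioo (-Real.pi) Real.pi))

lemma lintegral_angular {g : ℝ × ℝ → ℝ≥0∞} (hg : Measurable g) :
    ∫⁻ p, g p ∂angular = ∫⁻ φ in Ioo (-Real.pi) Real.pi, ∫⁻ θ in Ioo 0 Real.pi,
      ENNReal.ofReal (Real.sin θ) * g (θ, φ) := by
  rw [angular, lintegral_prod_symm' _ hg]
  refine lintegral_congr fun φ => ?_
  rw [lintegral_withDensity_eq_lintegral_mul _ (by fun_prop) (by fun_prop)]
  rfl

/-- Evaluate the volume of the cone over A in spherical coordinates; the radial factor is ∫₀¹ 3r² dr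
= 1. Having this for every frame gives rotation invariance and allows the polar axis to be chosen
freely later on. -/
lemma sph_eq_map (b : OrthonormalBasis (Fin 3) ℝ R3) : sph = angular.map (sphPt b) := by
  ext A hA
  have hc := (continuous_sphPt b).measurable
  have hi : Measurable (A.indicator (1 : R3 → ℝ≥0∞)) := measurable_one.indicator hA
  have hB : MeasurableSet {x : R3 | x ≠ 0 ∧ ‖x‖ < 1 ∧ ‖x‖⁻¹ • x ∈ A} := by
    refine (measurableSet_singleton (0 : R3)).compl.inter
      ((measurableSet_lt measurable_norm measurable_const).inter ?_)
    exact (measurable_norm.inv.smul measurable_id) hA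
  rw [sph_apply hA, ← lintegral_indicator_one hB,
    lintegral_spherical b (measurable_one.indicator hB), ← lintegral_indicator_one hA,
    lintegral_map hi hc,
    lintegral_angular (g := fun p => A.indicator (1 : R3 → ℝ≥0∞) (sphPt b p)) (hi.comp hc)]
  rw [← lintegral_const_mul']
  swap
  · simp
  refine lintegral_congr fun φ => ?_
  have key : ∀ r ∈ Ioi (0 : ℝ), ∫⁻ θ in Ioo 0 Real.pi, ENNReal.ofReal (r ^ 2) *
      (ENNReal.ofReal (Real.sin θ) *
        {x : R3 | x ≠ 0 ∧ ‖x‖ < 1 ∧ ‖x‖⁻¹ • x ∈ A}.indicator 1 (r • sphPt b (θ, φ))) =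
      (Iio 1).indicator (fun r : ℝ => ENNReal.ofReal (r ^ 2)) r * ∫⁻ θ in Ioo 0 Real.pi,
        ENNReal.ofReal (Real.sin θ) * A.indicator 1 (sphPt b (θ, φ)) := by
    intro r hr
    have hr : 0 < r := hr
    rw [← lintegral_const_mul]
    · refine lintegral_congr fun θ => ?_
      have hn : ‖r • sphPt b (θ, φ)‖ = r := by
        rw [norm_smul, norm_sphPt, mul_one, Real.norm_of_nonneg hr.le]
      have h0 : r • sphPt b (θ, φ) ≠ 0 := by
        rw [← norm_ne_zero_iff, hn]; exact hr.ne'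
      have hmem : ∀ h1 : r < 1, r ∈ Iio (1 : ℝ) := fun h => h
      by_cases h1 : r < 1
      · by_cases h2 : sphPt b (θ, φ) ∈ A
        · rw [indicator_of_mem, indicator_of_mem h2, indicator_of_mem (hmem h1)]
          · rfl
          · refine ⟨h0, by rwa [hn], ?_⟩
            rwa [hn, smul_smul, inv_mul_cancel₀ hr.ne', one_smul]
        · rw [indicator_of_notMem, indicator_of_notMem h2]
          · simp
          · rintro ⟨-, -, h⟩
            rw [hn, smul_smul, inv_mul_cancel₀ hr.ne', one_smul] at h
            exact h2 h
      · rw [indicator_of_notMem, indicator_of_notMem (by exact h1)]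
        · simp
        · rintro ⟨-, h, -⟩
          rw [hn] at h
          exact h1 h
    · exact (by fun_prop : Measurable fun θ => ENNReal.ofReal (Real.sin θ)).mul
        (hi.comp (hc.comp (by fun_prop)))
  rw [setLIntegral_congr_fun measurableSet_Ioi key, lintegral_mul_const _
    ((by fun_prop : Measurable fun r : ℝ => ENNReal.ofReal (r ^ 2)).indicator measurableSet_Iio),
    ← mul_assoc]
  suffices h : 3 * ∫⁻ r in Ioi (0 : ℝ), (Iio 1).indicator (fun r : ℝ => ENNReal.ofReal (r ^ 2)) r = 1 by
    rw [h, one_mul]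
  rw [lintegral_indicator measurableSet_Iio, Measure.restrict_restrict measurableSet_Iio,
    Iio_inter_Ioi, Measure.restrict_congr_set Ioo_ae_eq_Ioc,
    ← ofReal_integral_eq_lintegral_ofReal (intervalIntegral.intervalIntegrable_pow 2).1
      (Filter.Eventually.of_forall fun r => by positivity),
    ← intervalIntegral.integral_of_le zero_le_one]
  rw [integral_pow, show (3 : ℝ≥0∞) = ENNReal.ofReal 3 by simp, ← ENNReal.ofReal_mul (by norm_num)]
  norm_num

/-- An isometry carries the parametrisation by one orthonormal frame to the parametrisation by the
image frame, and both push `angular` to `sph`. -/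
lemma sph_map_isometry (L : R3 ≃ₗᵢ[ℝ] R3) : sph.map L = sph := by
  let b := EuclideanSpace.basisFun (Fin 3) ℝ
  conv_lhs => rw [sph_eq_map b]
  rw [sph_eq_map (b.map L), Measure.map_map L.continuous.measurable (continuous_sphPt b).measurable]
  congr 1
  ext1 p
  simp [sphPt]

lemma sph_univ : sph univ = ENNReal.ofReal (4 * Real.pi) := by
  rw [sph, Measure.map_apply measurable_subtype_coe MeasurableSet.univ, preimage_univ,
    Measure.toSphere_apply_univ, EuclideanSpace.volume_ball_fin_three]
  rw [ENNReal.ofReal_one, one_pow, one_mul, ← ENNReal.ofReal_natCast,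
    ← ENNReal.ofReal_mul (by positivity)]
  congr 1
  simp
  ring

/-! ### Bochner integrals in polar and spherical coordinates -/

section BochnerPolar

variable {E : Type*} [NormedAddCommGroup E] [NormedSpace ℝ E]

set_option linter.unusedSectionVars false

lemma integrable_of_ae_mem_compact {X : Type*} [TopologicalSpace X] [MeasurableSpace X]
    [OpensMeasurableSpace X] [T2Space X] {μ : Measure X} [IsFiniteMeasureOnCompacts μ]
    [PseudoMetrizableSpace X]
    {K : Set X} (hK : IsCompact K) (hμ : ∀ᵐ x ∂μ, x ∈ K) {g : X → E} (hg : ContinuousOn g K) :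
    Integrable g μ := by
  have := hg.integrableOn_compact (μ := μ) hK
  rwa [IntegrableOn, Measure.restrict_eq_self_of_ae_mem hμ] at this

lemma sph_ae_mem : ∀ᵐ ω ∂sph, ω ∈ sphere (0 : R3) 1 := by
  filter_upwards [sph_ae_norm] with ω hω
  simpa using hω

lemma ContinuousOn.integrable_sph {g : R3 → E} (hg : ContinuousOn g (sphere 0 1)) :
    Integrable g sph :=
  integrable_of_ae_mem_compact (isCompact_sphere _ _) sph_ae_mem hg

lemma Continuous.integrable_sph {g : R3 → E} (hg : Continuous g) : Integrable g sph :=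
  hg.continuousOn.integrable_sph

lemma Continuous.integrable_Ioc_sph {g : ℝ × R3 → E} (hg : Continuous g) (A B : ℝ) :
    Integrable g ((volume.restrict (Ioc A B)).prod sph) := by
  refine integrable_of_ae_mem_compact (isCompact_Icc (a := A) (b := B) |>.prod
    (isCompact_sphere (0 : R3) 1)) ?_ hg.continuousOn
  rw [Measure.ae_prod_iff_ae_ae]
  · filter_upwards [ae_restrict_mem measurableSet_Ioc] with s hs
    filter_upwards [sph_ae_mem] with ω hω
    exact ⟨⟨hs.1.le, hs.2⟩, hω⟩
  · exact (isCompact_Icc.isClosed.prod isClosed_sphere).measurableSet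

instance : IsFiniteMeasure angular := by
  refine ⟨?_⟩
  have h := sph_eq_map (EuclideanSpace.basisFun (Fin 3) ℝ)
  have : sph univ = angular univ := by
    rw [h, Measure.map_apply (continuous_sphPt _).measurable MeasurableSet.univ, preimage_univ]
  rw [← this]
  exact measure_lt_top _ _

lemma integral_sph (b : OrthonormalBasis (Fin 3) ℝ R3) {g : R3 → E}
    (hg : AEStronglyMeasurable g sph) :
    ∫ ω, g ω ∂sph = ∫ p, g (sphPt b p) ∂angular := by
  rw [sph_eq_map b] at hg ⊢
  exact integral_map (continuous_sphPt b).aemeasurable hg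

lemma integrable_sph_iff (b : OrthonormalBasis (Fin 3) ℝ R3) {g : R3 → E}
    (hg : AEStronglyMeasurable g sph) :
    Integrable g sph ↔ Integrable (fun p => g (sphPt b p)) angular := by
  rw [sph_eq_map b] at hg ⊢
  exact integrable_map_measure hg (continuous_sphPt b).aemeasurable

lemma measurable_radial_density : Measurable fun s : ℝ => ENNReal.ofReal (s ^ 2) := by fun_prop

lemma integral_radial (g : ℝ → E) :
    ∫ s, g s ∂radial = ∫ s in Ioi (0 : ℝ), s ^ 2 • g s := by
  rw [radial, integral_withDensity_eq_integral_toReal_smul measurable_radial_density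
    (Filter.Eventually.of_forall fun s => ENNReal.ofReal_lt_top)]
  refine integral_congr_ae (Filter.Eventually.of_forall fun s => ?_)
  simp only
  rw [ENNReal.toReal_ofReal (by positivity)]

lemma integrable_polar {f : R3 → E} (hf : Integrable f) :
    Integrable (fun p : ℝ × R3 => f (p.1 • p.2)) (radial.prod sph) := by
  rw [volume_eq_map_polar] at hf
  exact hf.comp_aemeasurable (by fun_prop)

lemma integral_polar {f : R3 → E} (hf : Integrable f) :
    ∫ x, f x = ∫ s in Ioi (0 : ℝ), s ^ 2 • ∫ ω, f (s • ω) ∂sph := by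
  rw [← integral_radial, ← integral_prod (fun p : ℝ × R3 => f (p.1 • p.2)) (integrable_polar hf)]
  conv_lhs => rw [volume_eq_map_polar]
  have h := hf.1
  rw [volume_eq_map_polar] at h
  exact integral_map (by fun_prop) h

end BochnerPolar

lemma integrableOn_inv_norm (R : ℝ) :
    IntegrableOn (fun z : R3 => ‖z‖⁻¹) (ball 0 R) := by
  rw [integrableOn_fun_norm_addHaar (volume : Measure R3) (f := fun s => s⁻¹)]
  have h : IntegrableOn (fun s : ℝ => s) (Ioo 0 R) :=
    (continuous_id.integrableOn_Icc (a := 0) (b := R)).mono_set Ioo_subset_Icc_self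
  refine h.congr_fun (fun s hs => ?_) measurableSet_Ioo
  have : s ≠ 0 := hs.1.ne'
  simp
  field_simp

lemma integrable_inv_norm_smul {E : Type*} [NormedAddCommGroup E] [NormedSpace ℝ E] {g : R3 → E}
    (hg : AEStronglyMeasurable g volume) {C R : ℝ} (hC : ∀ z, ‖g z‖ ≤ C)
    (hR : ∀ z, R ≤ ‖z‖ → g z = 0) :
    Integrable fun z => (4 * Real.pi * ‖z‖)⁻¹ • g z := by
  have h1 : Integrable ((ball (0 : R3) R).indicator fun z => ‖z‖⁻¹) :=
    (integrable_indicator_iff measurableSet_ball).2 (integrableOn_inv_norm R)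
  refine (h1.const_mul ((4 * Real.pi)⁻¹ * C)).mono' ?_ ?_
  · exact (Measurable.aestronglyMeasurable (by fun_prop)).smul hg
  · refine Filter.Eventually.of_forall fun z => ?_
    by_cases hz : ‖z‖ < R
    · rw [indicator_of_mem (by simpa using hz), norm_smul, norm_inv,
        Real.norm_of_nonneg (by positivity), mul_inv]
      have := hC z
      have h0 : 0 ≤ C := (norm_nonneg _).trans this
      rw [mul_assoc, mul_assoc, mul_comm C]
      gcongr
    · rw [hR z (not_lt.1 hz), smul_zero, norm_zero, indicator_of_notMem (by simpa using hz),
        mul_zero]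

/-! ### Integrals of rotational derivatives over the sphere -/

section Rotation

variable {G : R3 → ℝ}

lemma hasDerivAt_sphPt (b : OrthonormalBasis (Fin 3) ℝ R3) (θ φ : ℝ) :
    HasDerivAt (fun φ => sphPt b (θ, φ))
      (b.repr (sphPt b (θ, φ)) 0 • b 1 - b.repr (sphPt b (θ, φ)) 1 • b 0) φ := by
  have h0 : b.repr (sphPt b (θ, φ)) 0 = Real.sin θ * Real.cos φ := by
    simp [sphPt, OrthonormalBasis.repr_self]
  have h1 : b.repr (sphPt b (θ, φ)) 1 = Real.sin θ * Real.sin φ := by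
    simp [sphPt, OrthonormalBasis.repr_self]
  rw [h0, h1]
  unfold sphPt
  have := (((Real.hasDerivAt_cos φ).const_mul (Real.sin θ)).smul_const (b 0)).add
    (((Real.hasDerivAt_sin φ).const_mul (Real.sin θ)).smul_const (b 1)) |>.add_const
      (Real.cos θ • b 2)
  refine this.congr_deriv ?_
  simp only [mul_neg, neg_smul]
  abel

/-- The integrand is the derivative in longitude of a 2π-periodic function. -/
lemma integral_sph_rotation (hG : ContDiff ℝ 1 G) (b : OrthonormalBasis (Fin 3) ℝ R3) :
    ∫ ω, fderiv ℝ G ω (b.repr ω 0 • b 1 - b.repr ω 1 • b 0) ∂sph = 0 := by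
  have hc : Continuous fun ω : R3 => fderiv ℝ G ω (b.repr ω 0 • b 1 - b.repr ω 1 • b 0) := by
    have := hG.continuous_fderiv one_ne_zero
    fun_prop
  rw [integral_sph b hc.aestronglyMeasurable]
  have hi := (integrable_sph_iff b hc.aestronglyMeasurable).1 hc.integrable_sph
  rw [angular] at hi ⊢
  rw [integral_prod _ hi]
  refine integral_eq_zero_of_ae (Filter.Eventually.of_forall fun θ => ?_)
  simp only [Pi.zero_apply]
  rw [← integral_Ioc_eq_integral_Ioo, ← intervalIntegral.integral_of_le (by linarith [Real.pi_pos])]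
  have hd : ∀ φ, HasDerivAt (fun φ => G (sphPt b (θ, φ))) (fderiv ℝ G (sphPt b (θ, φ))
      (b.repr (sphPt b (θ, φ)) 0 • b 1 - b.repr (sphPt b (θ, φ)) 1 • b 0)) φ := fun φ =>
    ((hG.differentiable one_ne_zero _).hasFDerivAt).comp_hasDerivAt φ (hasDerivAt_sphPt b θ φ)
  rw [intervalIntegral.integral_eq_sub_of_hasDerivAt (fun φ _ => hd φ)]
  · simp [sphPt]
  · refine Continuous.intervalIntegrable ?_ _ _
    exact hc.comp ((continuous_sphPt b).comp (by fun_prop : Continuous fun φ : ℝ => (θ, φ)))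

end Rotation

/-! ### The spherical Laplacian and the fundamental solution of the wave operator -/

section Wave

variable {b : OrthonormalBasis (Fin 3) ℝ R3}

/-- The Hessian of a function. -/
abbrev hess {V : Type*} [NormedAddCommGroup V] [NormedSpace ℝ V] (F : V → ℝ) : V → V →L[ℝ] V →L[ℝ] ℝ :=
  fderiv ℝ (fderiv ℝ F)

/-- The generator of the rotations in the plane of `b 0` and `b 1`. -/
def rotGen (b : OrthonormalBasis (Fin 3) ℝ R3) : R3 →L[ℝ] R3 :=
  (innerSL ℝ (b 0)).smulRight (b 1) - (innerSL ℝ (b 1)).smulRight (b 0)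

lemma rotGen_apply (b : OrthonormalBasis (Fin 3) ℝ R3) (z : R3) :
    rotGen b z = b.repr z 0 • b 1 - b.repr z 1 • b 0 := by
  simp [rotGen, b.repr_apply_apply]

lemma rotGen_rotGen (b : OrthonormalBasis (Fin 3) ℝ R3) (z : R3) :
    rotGen b (rotGen b z) = -(b.repr z 0 • b 0) - b.repr z 1 • b 1 := by
  rw [rotGen_apply, rotGen_apply]
  simp
  abel

/-- `integral_sph_rotation` applied to the derivative of F along the rotation field itself. -/
lemma integral_sph_rotation_sq {F : R3 → ℝ} (hF : ContDiff ℝ 2 F)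
    (b : OrthonormalBasis (Fin 3) ℝ R3) :
    ∫ ω, (hess F ω (rotGen b ω) (rotGen b ω) + fderiv ℝ F ω (rotGen b (rotGen b ω))) ∂sph = 0 := by
  have hF1 : ContDiff ℝ 1 (fderiv ℝ F) := hF.fderiv_right (by norm_num)
  have hG : ContDiff ℝ 1 fun z : R3 => fderiv ℝ F z (rotGen b z) :=
    hF1.clm_apply (rotGen b).contDiff
  have h := integral_sph_rotation hG b
  simp only [← rotGen_apply] at h
  rw [← h]
  refine integral_congr_ae (Filter.Eventually.of_forall fun ω => ?_)
  simp only
  rw [((hF1.differentiable one_ne_zero ω).hasFDerivAt.clm_apply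
    (rotGen b).hasFDerivAt).fderiv]
  simp [add_comm]

/-- The squares of the three rotation generators add up to the spherical Laplacian, which on the
unit sphere is Δ − ∂ᵣ² − 2∂ᵣ. Each square integrates to zero. -/
lemma integral_sph_laplacian {F : R3 → ℝ} (hF : ContDiff ℝ 2 F)
    (b : OrthonormalBasis (Fin 3) ℝ R3) :
    ∫ ω, ((∑ i, hess F ω (b i) (b i)) - hess F ω ω ω - 2 * fderiv ℝ F ω ω) ∂sph = 0 := by
  have hF1 : ContDiff ℝ 1 (fderiv ℝ F) := hF.fderiv_right (by norm_num)
  have c0 : Continuous (fderiv ℝ F) := hF1.continuous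
  have c1 : Continuous (hess F) := hF1.continuous_fderiv one_ne_zero
  let g : Fin 3 → Fin 3 → R3 → ℝ := fun i j ω =>
    hess F ω (b.repr ω i • b j - b.repr ω j • b i) (b.repr ω i • b j - b.repr ω j • b i)
      + fderiv ℝ F ω (-(b.repr ω i • b i) - b.repr ω j • b j)
  have key : ∀ i j : Fin 3, i ≠ j → ∫ ω, g i j ω ∂sph = 0 := by
    intro i j hij
    -- Permuting the frame moves the plane of `b i` and `b j` to the first two axes, where `rotGen`
    -- acts.
    obtain ⟨e, h0, h1⟩ : ∃ e : Fin 3 ≃ Fin 3, e 0 = i ∧ e 1 = j := by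
      revert i j; decide
    have := integral_sph_rotation_sq hF (b.reindex e.symm)
    simp only [rotGen_rotGen] at this
    simp only [rotGen_apply] at this
    simpa [h0, h1, g] using this
  have hint : ∀ i j : Fin 3, Integrable (g i j) sph := fun i j => by
    refine Continuous.integrable_sph ?_
    fun_prop
  have hs : ∫ ω, (g 0 1 ω + g 1 2 ω + g 2 0 ω) ∂sph = 0 := by
    rw [integral_add (f := fun ω => g 0 1 ω + g 1 2 ω) ((hint 0 1).add (hint 1 2)) (hint 2 0), integral_add (hint 0 1) (hint 1 2),
      key 0 1 (by decide), key 1 2 (by decide), key 2 0 (by decide)]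
    norm_num
  rw [← hs]
  refine integral_congr_ae ?_
  filter_upwards [sph_ae_norm] with ω hω
  have hx : b.repr ω 0 • b 0 + b.repr ω 1 • b 1 + b.repr ω 2 • b 2 = ω := by
    conv_rhs => rw [← b.sum_repr ω]
    simp [Fin.sum_univ_three]
  have hn : b.repr ω 0 ^ 2 + b.repr ω 1 ^ 2 + b.repr ω 2 ^ 2 = 1 := by
    rw [← norm_sq_comb b, hx, hω, one_pow]
  simp only [g]
  generalize hess F ω = H
  generalize fderiv ℝ F ω = D
  generalize b.repr ω 0 = x at *
  generalize b.repr ω 1 = y at *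
  generalize b.repr ω 2 = z at *
  rw [← hx]
  simp only [Fin.sum_univ_three, map_add, map_sub, map_neg, map_smul, smul_eq_mul,
    _root_.add_apply, _root_.sub_apply, _root_.smul_apply]
  linear_combination (-(H (b 0) (b 0)) - H (b 1) (b 1) - H (b 2) (b 2)) * hn

/-- The wave operator `∂_t² - Δ` in terms of the Hessian. -/
def box (φ : SpaceTime → ℝ) (p : SpaceTime) : ℝ :=
  hess φ p (0, 1) (0, 1) - ∑ i, hess φ p (stdVec i, 0) (stdVec i, 0)

lemma continuous_box {φ : SpaceTime → ℝ} (hφ : ContDiff ℝ 2 φ) : Continuous (box φ) := by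
  have : Continuous (hess φ) :=
    (hφ.fderiv_right (m := 1) (by norm_num)).continuous_fderiv one_ne_zero
  unfold box
  fun_prop

lemma tsupport_box_subset (φ : SpaceTime → ℝ) : tsupport (box φ) ⊆ tsupport φ := by
  refine closure_minimal (fun p hp => ?_) (isClosed_tsupport φ)
  by_contra h
  have h2 : p ∉ tsupport (hess φ) := fun h' =>
    h (tsupport_fderiv_subset ℝ (tsupport_fderiv_subset ℝ h'))
  exact hp (by simp [box, image_eq_zero_of_notMem_tsupport h2])

/-- An explicit antiderivative along the light ray in direction ω. The mixed second derivatives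
cancel by symmetry of the Hessian. -/
lemma hasDerivAt_shift {φ : SpaceTime → ℝ} (hφ : ContDiff ℝ 2 φ) (x : R3) (t : ℝ) (ω : R3) (s : ℝ) :
    HasDerivAt (fun s => s * fderiv ℝ φ (x + s • ω, t + s) (0, 1) - φ (x + s • ω, t + s) -
        s * fderiv ℝ φ (x + s • ω, t + s) (ω, 0))
      (s * (hess φ (x + s • ω, t + s) (0, 1) (0, 1) - hess φ (x + s • ω, t + s) (ω, 0) (ω, 0)) -
        2 * fderiv ℝ φ (x + s • ω, t + s) (ω, 0)) s := by
  have hD : ContDiff ℝ 1 (fderiv ℝ φ) := hφ.fderiv_right (by norm_num)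
  have hp : HasDerivAt (fun s : ℝ => ((x + s • ω, t + s) : SpaceTime)) (ω, 1) s := by
    refine HasDerivAt.prodMk ?_ ?_
    · simpa using ((hasDerivAt_id s).smul_const ω).const_add x
    · simpa using (hasDerivAt_id s).const_add t
  have h0 := (hφ.differentiable two_ne_zero (x + s • ω, t + s)).hasFDerivAt.comp_hasDerivAt s hp
  have h1 := (hD.differentiable one_ne_zero (x + s • ω, t + s)).hasFDerivAt.comp_hasDerivAt s hp
  have h2 := h1.clm_apply (hasDerivAt_const s ((0, 1) : SpaceTime))
  have h3 := h1.clm_apply (hasDerivAt_const s ((ω, 0) : SpaceTime))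
  have hsym := (hφ.contDiffAt (x := (x + s • ω, t + s))).isSymmSndFDerivAt (by simp)
  have e : ((ω, 1) : SpaceTime) = (ω, 0) + (0, 1) := by simp
  refine ((((hasDerivAt_id s).mul h2).sub h0).sub ((hasDerivAt_id s).mul h3)).congr_deriv ?_
  have h4 := hsym.eq (ω, 0) (0, 1)
  simp only [Function.comp_apply, id, e, map_add, _root_.add_apply, map_zero,
    add_zero, one_mul]
  change _ = s * (fderiv ℝ (fderiv ℝ φ) _ _ _ - fderiv ℝ (fderiv ℝ φ) _ _ _) - _
  linear_combination s * h4

/-- `integral_sph_laplacian` for the rescaled function z ↦ φ(x + sz, t + s) replaces the Laplacian,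
under the spherical integral, by radial derivatives. What remains is the exact derivative of
`hasDerivAt_shift`. -/
lemma box_sph_identity {φ : SpaceTime → ℝ} (hφ : ContDiff ℝ 2 φ) (x : R3) (t s : ℝ) (hs : 0 < s) :
    ∫ ω, s * box φ (x + s • ω, t + s) ∂sph =
      ∫ ω, (s * (hess φ (x + s • ω, t + s) (0, 1) (0, 1) -
        hess φ (x + s • ω, t + s) (ω, 0) (ω, 0)) -
        2 * fderiv ℝ φ (x + s • ω, t + s) (ω, 0)) ∂sph := by
  have hD : ContDiff ℝ 1 (fderiv ℝ φ) := hφ.fderiv_right (by norm_num)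
  have cD : Continuous (fderiv ℝ φ) := hD.continuous
  have cH : Continuous (hess φ) := hD.continuous_fderiv one_ne_zero
  let A : R3 →L[ℝ] SpaceTime := s • ContinuousLinearMap.inl ℝ R3 ℝ
  have hA : ∀ z : R3, HasFDerivAt (fun z : R3 => ((x + s • z, t + s) : SpaceTime)) A z := fun z => by
    have := ((ContinuousLinearMap.inl ℝ R3 ℝ).hasFDerivAt (x := z)).const_smul s |>.const_add
      ((x, t + s) : SpaceTime)
    refine this.congr_of_eventuallyEq (Filter.Eventually.of_forall fun z => ?_)
    simp
  let F : R3 → ℝ := fun z => φ (x + s • z, t + s)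
  have hF : ContDiff ℝ 2 F := hφ.comp (by fun_prop)
  have h1 : fderiv ℝ F = fun z => (fderiv ℝ φ (x + s • z, t + s)).comp A := by
    ext1 z
    exact ((hφ.differentiable two_ne_zero _).hasFDerivAt.comp z (hA z)).fderiv
  have h2 : ∀ z v w, hess F z v w = s ^ 2 * hess φ (x + s • z, t + s) (v, 0) (w, 0) := by
    intro z v w
    have h := ((hD.differentiable one_ne_zero (x + s • z, t + s)).hasFDerivAt.comp z (hA z))
    have h' := h.clm_comp (hasFDerivAt_const A z)
    have e := h'.fderiv
    simp only [Function.comp_def] at e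
    rw [hess, h1, e]
    simp [A, hess]
    ring
  have key := integral_sph_laplacian hF (EuclideanSpace.basisFun (Fin 3) ℝ)
  have i1 : Integrable (fun ω => s * box φ (x + s • ω, t + s)) sph := by
    have := continuous_box hφ
    exact Continuous.integrable_sph (by fun_prop)
  have i2 : Integrable (fun ω => s * (hess φ (x + s • ω, t + s) (0, 1) (0, 1) -
        hess φ (x + s • ω, t + s) (ω, 0) (ω, 0)) -
        2 * fderiv ℝ φ (x + s • ω, t + s) (ω, 0)) sph :=
    Continuous.integrable_sph (by fun_prop)
  rw [← sub_eq_zero, ← integral_sub i1 i2]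
  refine Eq.trans ?_ ((congrArg (fun u => -s⁻¹ * u) key).trans (mul_zero _))
  rw [← integral_const_mul]
  refine integral_congr_ae (Filter.Eventually.of_forall fun ω => ?_)
  simp only [h2, h1, box, EuclideanSpace.basisFun_apply]
  have e : ∀ i, ((EuclideanSpace.single i 1 : R3), (0 : ℝ)) = (stdVec i, 0) := fun i => rfl
  have e' : (A : R3 →L[ℝ] SpaceTime) ω = s • (ω, 0) := by simp [A]
  simp only [e, ContinuousLinearMap.comp_apply, e', map_smul, smul_eq_mul, ← Finset.mul_sum]
  field_simp
  ring

/-- In polar coordinates about x the factor s² meets the kernel 1/(4πs), and for each ω the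
integrand becomes an exact derivative along the ray. The contribution at s = R vanishes by compact
support, the one at s = 0 is φ(x, t), and averaging over ω removes the 4π. -/
theorem integral_retarded_box {φ : SpaceTime → ℝ} (hφ : ContDiff ℝ 2 φ) (hc : HasCompactSupport φ)
    (x : R3) (t : ℝ) :
    ∫ z : R3, (4 * Real.pi * ‖z‖)⁻¹ • box φ (x + z, t + ‖z‖) = φ (x, t) := by
  have hD : ContDiff ℝ 1 (fderiv ℝ φ) := hφ.fderiv_right (by norm_num)
  have cD : Continuous (fderiv ℝ φ) := hD.continuous
  have cH : Continuous (hess φ) := hD.continuous_fderiv one_ne_zero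
  have cB := continuous_box hφ
  obtain ⟨R, hR0, hR⟩ : ∃ R > 0, ∀ p : SpaceTime, R ≤ p.2 - t → p ∉ tsupport φ := by
    obtain ⟨R, hR⟩ := hc.isBounded.exists_norm_le
    refine ⟨max 1 (R + |t| + 1), by positivity, fun p hp h => ?_⟩
    have h1 := (norm_snd_le p).trans (hR p h)
    rw [Real.norm_eq_abs] at h1
    have := le_max_right 1 (R + |t| + 1)
    linarith [le_abs_self p.2, neg_abs_le t]
  have hB0 : ∀ p : SpaceTime, R ≤ p.2 - t → box φ p = 0 := fun p hp =>
    image_eq_zero_of_notMem_tsupport fun h => hR p hp (tsupport_box_subset φ h)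
  obtain ⟨C, hC⟩ : ∃ C, ∀ p, ‖box φ p‖ ≤ C := by
    have : HasCompactSupport (box φ) := hc.mono' (subset_closure.trans (tsupport_box_subset φ))
    exact this.exists_bound_of_continuous cB
  have hint := integrable_inv_norm_smul (g := fun z : R3 => box φ (x + z, t + ‖z‖)) (C := C) (R := R)
    (by fun_prop : Continuous _).aestronglyMeasurable (fun z => hC _)
    (fun z hz => hB0 _ (by simpa using hz))
  let k' : ℝ × R3 → ℝ := fun p => p.1 * (hess φ (x + p.1 • p.2, t + p.1) (0, 1) (0, 1) -
        hess φ (x + p.1 • p.2, t + p.1) (p.2, 0) (p.2, 0)) -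
        2 * fderiv ℝ φ (x + p.1 • p.2, t + p.1) (p.2, 0)
  have ck : Continuous k' := by fun_prop
  have hin : ∀ s ∈ Ioi (0 : ℝ), s ^ 2 • ∫ ω, (4 * Real.pi * ‖s • ω‖)⁻¹ •
      box φ (x + s • ω, t + ‖s • ω‖) ∂sph = (Ioc 0 R).indicator
        (fun s => (4 * Real.pi)⁻¹ * ∫ ω, k' (s, ω) ∂sph) s := by
    intro s hs
    have hs : 0 < s := hs
    rw [indicator]
    have : ∫ ω, (4 * Real.pi * ‖s • ω‖)⁻¹ • box φ (x + s • ω, t + ‖s • ω‖) ∂sph =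
        ∫ ω, (4 * Real.pi * s ^ 2)⁻¹ * (s * box φ (x + s • ω, t + s)) ∂sph := by
      refine integral_congr_ae ?_
      filter_upwards [sph_ae_norm] with ω hω
      rw [norm_smul, hω, mul_one, Real.norm_of_nonneg hs.le, smul_eq_mul]
      field_simp
    rw [this, integral_const_mul, box_sph_identity hφ x t s hs, smul_eq_mul, ← mul_assoc]
    have h2 : s ^ 2 * (4 * Real.pi * s ^ 2)⁻¹ = (4 * Real.pi)⁻¹ := by field_simp
    rw [h2]
    split_ifs with h
    · rfl
    · rw [← box_sph_identity hφ x t s hs]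
      have : ∀ ω : R3, s * box φ (x + s • ω, t + s) = 0 := fun ω => by
        rw [hB0, mul_zero]
        have : R < s := by
          by_contra h'
          exact h ⟨hs, not_lt.1 h'⟩
        simpa using this.le
      simp [this]
  rw [integral_polar hint, setIntegral_congr_fun measurableSet_Ioi hin,
    setIntegral_indicator measurableSet_Ioc, show Ioi (0 : ℝ) ∩ Ioc 0 R = Ioc 0 R from inter_eq_right.2 fun s hs => hs.1, integral_const_mul,
    ← integral_prod _ (ck.integrable_Ioc_sph 0 R),
    integral_prod_symm _ (ck.integrable_Ioc_sph 0 R)]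
  have hk : ∀ ω : R3, ∫ s in Ioc 0 R, k' (s, ω) = φ (x, t) := by
    intro ω
    rw [← intervalIntegral.integral_of_le hR0.le,
      intervalIntegral.integral_eq_sub_of_hasDerivAt (fun s _ => hasDerivAt_shift hφ x t ω s)
      ((ck.comp (by fun_prop : Continuous fun s : ℝ => (s, ω))).intervalIntegrable _ _)]
    have h1 : ((x + R • ω, t + R) : SpaceTime) ∉ tsupport φ := hR _ (by simp)
    rw [image_eq_zero_of_notMem_tsupport h1,
      image_eq_zero_of_notMem_tsupport fun h => h1 (tsupport_fderiv_subset ℝ h)]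
    simp
  simp only [hk]
  rw [integral_const, measureReal_def, sph_univ, ENNReal.toReal_ofReal (by positivity), smul_eq_mul]
  field_simp

end Wave

open scoped RealInnerProductSpace

/-! ### Ellipsoidal coordinates -/

section Ellipsoid

/-- The point with parameter `ω` on the ellipsoid `|x - y| + |y - a| = t`. -/
def ellPt (x a : R3) (t : ℝ) (ω : R3) : R3 :=
  (1 / 2 : ℝ) • (x + a) + (√(t ^ 2 - ‖x - a‖ ^ 2) / 2) • ω +
    (⟪ω, x - a⟫ / (2 * (t + √(t ^ 2 - ‖x - a‖ ^ 2)))) • (x - a)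

/-- The ellipsoidal coordinates with foci `x` and `a`, in Cartesian form. -/
def ellMap (x a z : R3) : R3 :=
  (1 / 2 : ℝ) • (x + a) + (1 / 2 : ℝ) • z +
    (⟪z, x - a⟫ * (‖z‖ * √(‖z‖ ^ 2 + ‖x - a‖ ^ 2) + ‖z‖ ^ 2)⁻¹ / 2) • (x - a)

variable {x a z y : R3}

lemma sqrt_sq_sub_sq_cancel (s d : ℝ) (hs : 0 ≤ s) : √(√(s ^ 2 + d ^ 2) ^ 2 - d ^ 2) = s := by
  rw [Real.sq_sqrt (by positivity), add_sub_cancel_right, Real.sqrt_sq hs]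

/-- The radius s of the parameter is twice the minor semi-axis, so the travel time t is given by t²
= s² + |x−a|². -/
lemma ellMap_smul {s : ℝ} (hs : 0 < s) {ω : R3} (hω : ‖ω‖ = 1) :
    ellMap x a (s • ω) = ellPt x a (√(s ^ 2 + ‖x - a‖ ^ 2)) ω := by
  have h : ‖s • ω‖ = s := by rw [norm_smul, hω, mul_one, Real.norm_of_nonneg hs.le]
  rw [ellMap, ellPt, sqrt_sq_sub_sq_cancel _ _ hs.le, h, real_inner_smul_left, smul_smul]
  have hq : 0 ≤ √(s ^ 2 + ‖x - a‖ ^ 2) := Real.sqrt_nonneg _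
  have h1 : s * ⟪ω, x - a⟫ * (s * √(s ^ 2 + ‖x - a‖ ^ 2) + s ^ 2)⁻¹ / 2 =
      ⟪ω, x - a⟫ / (2 * (√(s ^ 2 + ‖x - a‖ ^ 2) + s)) := by
    have : √(s ^ 2 + ‖x - a‖ ^ 2) + s ≠ 0 := by positivity
    field_simp
  have h2 : 1 / 2 * s = s / 2 := by ring
  rw [h1, h2]

/-- The sign ε = ±1 treats both foci at once. Since |d|² = (τ−w)(τ+w), the square of the norm is a
perfect square, and Cauchy–Schwarz decides the sign of its root. -/
lemma norm_ellMap_aux {w τ η : ℝ} {z d : R3} (hz : ‖z‖ = w) (hη : ⟪z, d⟫ = η) (hw : 0 < w)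
    (hτ : τ ^ 2 = w ^ 2 + ‖d‖ ^ 2) (hτ0 : 0 < τ) (ε : ℝ) (hε : ε ^ 2 = 1) :
    ‖z + (ε + η * (w * τ + w ^ 2)⁻¹) • d‖ = τ + ε * η / w := by
  have h2 : ‖z + (ε + η * (w * τ + w ^ 2)⁻¹) • d‖ ^ 2 = (τ + ε * η / w) ^ 2 := by
    rw [norm_add_sq_real, real_inner_smul_right, hη, hz, norm_smul, mul_pow, Real.norm_eq_abs,
      sq_abs]
    have hd : ‖d‖ ^ 2 = (τ - w) * (τ + w) := by linarith
    have hne : τ + w ≠ 0 := by positivity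
    rw [hd, show w * τ + w ^ 2 = w * (τ + w) by ring]
    field_simp
    linear_combination ((τ + w) * (w ^ 2 * τ ^ 2 - w ^ 4 - η ^ 2)) * hε
  have habs : |η| ≤ w * ‖d‖ := by rw [← hη, ← hz]; exact abs_real_inner_le_norm z d
  have hdτ : ‖d‖ ≤ τ := by nlinarith [norm_nonneg d]
  have h3 : 0 ≤ τ + ε * η / w := by
    have he : |ε| = 1 := by
      rw [← sq_eq_sq₀ (abs_nonneg _) zero_le_one, sq_abs, hε, one_pow]
    have : |ε * η / w| ≤ τ := by
      rw [abs_div, abs_mul, he, one_mul, abs_of_pos hw, div_le_iff₀ hw]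
      nlinarith
    linarith [neg_abs_le (ε * η / w)]
  exact (sq_eq_sq₀ (norm_nonneg _) h3).1 h2

lemma abs_inner_lt_mul_sqrt (hz : z ≠ 0) (d : R3) :
    |⟪z, d⟫| / ‖z‖ < √(‖z‖ ^ 2 + ‖d‖ ^ 2) := by
  have hp : 0 < ‖z‖ := norm_pos_iff.2 hz
  rw [div_lt_iff₀ hp]
  refine (abs_real_inner_le_norm z d).trans_lt ?_
  rw [mul_comm]
  refine mul_lt_mul_of_pos_right ?_ hp
  exact Real.lt_sqrt_of_sq_lt (by nlinarith)

lemma norm_ellMap_sub (hz : z ≠ 0) :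
    ‖ellMap x a z - a‖ = (√(‖z‖ ^ 2 + ‖x - a‖ ^ 2) + ⟪z, x - a⟫ / ‖z‖) / 2 := by
  have hp : 0 < ‖z‖ := norm_pos_iff.2 hz
  have h := norm_ellMap_aux (z := z) (d := x - a) rfl rfl hp (Real.sq_sqrt (by positivity))
    (by positivity) 1 (by norm_num)
  have e : ellMap x a z - a = (1 / 2 : ℝ) • (z + (1 + ⟪z, x - a⟫ *
      (‖z‖ * √(‖z‖ ^ 2 + ‖x - a‖ ^ 2) + ‖z‖ ^ 2)⁻¹) • (x - a)) := by
    rw [ellMap]; module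
  rw [e, norm_smul, h]
  norm_num
  ring

lemma norm_sub_ellMap (hz : z ≠ 0) :
    ‖x - ellMap x a z‖ = (√(‖z‖ ^ 2 + ‖x - a‖ ^ 2) - ⟪z, x - a⟫ / ‖z‖) / 2 := by
  have hp : 0 < ‖z‖ := norm_pos_iff.2 hz
  have h := norm_ellMap_aux (z := z) (d := x - a) rfl rfl hp (Real.sq_sqrt (by positivity))
    (by positivity) (-1) (by norm_num)
  have e : x - ellMap x a z = (-1 / 2 : ℝ) • (z + (-1 + ⟪z, x - a⟫ *
      (‖z‖ * √(‖z‖ ^ 2 + ‖x - a‖ ^ 2) + ‖z‖ ^ 2)⁻¹) • (x - a)) := by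
    rw [ellMap]; module
  rw [e, norm_smul, h]
  norm_num
  ring

/-- The sum and the difference of the focal distances recover |z| and ⟪z, x−a⟫. Once these are
known, `ellMap` differs from z/2 by a constant. -/
lemma injOn_ellMap : InjOn (ellMap x a) {0}ᶜ := by
  intro z hz z' hz' h
  have hp : 0 < ‖z‖ := norm_pos_iff.2 hz
  have hp' : 0 < ‖z'‖ := norm_pos_iff.2 hz'
  have h1 := norm_ellMap_sub (x := x) (a := a) hz
  have h2 := norm_sub_ellMap (x := x) (a := a) hz
  rw [h, norm_ellMap_sub hz'] at h1
  rw [h, norm_sub_ellMap hz'] at h2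
  have hτ : √(‖z'‖ ^ 2 + ‖x - a‖ ^ 2) = √(‖z‖ ^ 2 + ‖x - a‖ ^ 2) := by linarith
  have hη : ⟪z', x - a⟫ / ‖z'‖ = ⟪z, x - a⟫ / ‖z‖ := by linarith
  have hn : ‖z'‖ = ‖z‖ := by
    have := (Real.sqrt_inj (by positivity) (by positivity)).1 hτ
    exact (sq_eq_sq₀ (norm_nonneg _) (norm_nonneg _)).1 (by linarith)
  rw [hn] at hη
  have hi : ⟪z', x - a⟫ = ⟪z, x - a⟫ := by
    field_simp at hη; exact hη
  rw [ellMap, ellMap, hn, hi] at h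
  have h3 := add_right_cancel h
  have h4 := add_left_cancel h3
  exact smul_right_injective R3 (by norm_num : (1 / 2 : ℝ) ≠ 0) h4

lemma mem_range_ellMap (hy : ‖x - a‖ < ‖y - a‖ + ‖x - y‖) : y ∈ ellMap x a '' {0}ᶜ := by
  set d := x - a with hd
  set u := (2 : ℝ) • y - (x + a) with hu
  set τ := ‖y - a‖ + ‖x - y‖ with hτ
  set δ := ‖y - a‖ - ‖x - y‖ with hδ
  set w := √(τ ^ 2 - ‖d‖ ^ 2) with hw
  have hw2 : w ^ 2 = τ ^ 2 - ‖d‖ ^ 2 := Real.sq_sqrt (by nlinarith [norm_nonneg d])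
  have hw0 : 0 < w := Real.sqrt_pos.2 (by nlinarith [norm_nonneg d])
  have hτ0 : 0 < τ := (norm_nonneg d).trans_lt hy
  have e1 : y - a = (1 / 2 : ℝ) • (u + d) := by rw [hu, hd]; module
  have e2 : x - y = (-1 / 2 : ℝ) • (u - d) := by rw [hu, hd]; module
  have n1 : ‖y - a‖ ^ 2 = (‖u‖ ^ 2 + 2 * ⟪u, d⟫ + ‖d‖ ^ 2) / 4 := by
    rw [e1, norm_smul, mul_pow, norm_add_sq_real]; norm_num; ring
  have n2 : ‖x - y‖ ^ 2 = (‖u‖ ^ 2 - 2 * ⟪u, d⟫ + ‖d‖ ^ 2) / 4 := by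
    rw [e2, norm_smul, mul_pow, norm_sub_sq_real]; norm_num; ring
  have hud : ⟪u, d⟫ = δ * τ := by rw [hδ, hτ]; linarith
  have huu : ‖u‖ ^ 2 = τ ^ 2 + δ ^ 2 - ‖d‖ ^ 2 := by rw [hδ, hτ]; linarith
  have hne : τ + w ≠ 0 := by positivity
  have hd2 : ‖d‖ ^ 2 = (τ - w) * (τ + w) := by linarith
  -- Solving y = `ellMap x a z` for z under the ansatz |z| = w and ⟪z, d⟫ = wδ; both are verified
  -- next.
  set z := u - (δ / (τ + w)) • d with hz
  have hzd : ⟪z, d⟫ = w * δ := by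
    rw [hz, inner_sub_left, real_inner_smul_left, hud, real_inner_self_eq_norm_sq, hd2]
    field_simp
    ring
  have hzz : ‖z‖ = w := by
    refine (sq_eq_sq₀ (norm_nonneg _) hw0.le).1 ?_
    rw [hz, norm_sub_sq_real, real_inner_smul_right, hud, norm_smul, mul_pow, Real.norm_eq_abs,
      sq_abs, huu, hd2]
    field_simp
    ring
  refine ⟨z, fun h => ?_, ?_⟩
  · rw [mem_singleton_iff] at h
    rw [h, norm_zero] at hzz
    exact hw0.ne hzz
  · have hs : √(w ^ 2 + ‖d‖ ^ 2) = τ := by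
      rw [hw2, sub_add_cancel, Real.sqrt_sq hτ0.le]
    rw [ellMap, ← hd, hzd, hzz, hs]
    have : w * δ * (w * τ + w ^ 2)⁻¹ / 2 = δ / (τ + w) / 2 := by
      have : w * τ + w ^ 2 = w * (τ + w) := by ring
      rw [this]
      field_simp
    rw [this, hz, hu]
    module

/-- The derivative of `ellMap`. -/
def ellMapDeriv (x a z : R3) : R3 →L[ℝ] R3 :=
  (1 / 2 : ℝ) • (ContinuousLinearMap.id ℝ R3 +
    ((‖z‖ * √(‖z‖ ^ 2 + ‖x - a‖ ^ 2) + ‖z‖ ^ 2)⁻¹ • innerSL ℝ (x - a) -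
      (⟪z, x - a⟫ / (‖z‖ ^ 3 * √(‖z‖ ^ 2 + ‖x - a‖ ^ 2))) • innerSL ℝ z).smulRight (x - a))

lemma hasFDerivAt_ellMap (hz : z ≠ 0) : HasFDerivAt (ellMap x a) (ellMapDeriv x a z) z := by
  have hp : 0 < ‖z‖ := norm_pos_iff.2 hz
  set τ := √(‖z‖ ^ 2 + ‖x - a‖ ^ 2) with hτ
  have hτ0 : 0 < τ := Real.sqrt_pos.2 (by positivity)
  have hsq : HasFDerivAt (fun z : R3 => ‖z‖ ^ 2) (2 • innerSL ℝ z) z :=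
    (hasStrictFDerivAt_norm_sq z).hasFDerivAt
  have hn : HasFDerivAt (fun z : R3 => ‖z‖) (‖z‖⁻¹ • innerSL ℝ z) z := by
    have h := hsq.sqrt (by positivity)
    simp only [Real.sqrt_sq (norm_nonneg _)] at h
    refine h.congr_fderiv ?_
    ext v
    simp
    field_simp
  have ht : HasFDerivAt (fun z : R3 => √(‖z‖ ^ 2 + ‖x - a‖ ^ 2)) (τ⁻¹ • innerSL ℝ z) z := by
    refine ((hsq.add_const (‖x - a‖ ^ 2)).sqrt (by positivity)).congr_fderiv ?_
    ext v
    simp [← hτ]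
    field_simp
  have hb := ((hn.mul ht).add hsq)
  have hb' := (hasDerivAt_inv (x := ‖z‖ * τ + ‖z‖ ^ 2) (by positivity)).comp_hasFDerivAt z hb
  have hi : HasFDerivAt (fun z : R3 => ⟪z, x - a⟫) (innerSL ℝ (x - a)) z := by
    have := (innerSL ℝ (x - a)).hasFDerivAt (x := z)
    refine this.congr_of_eventuallyEq (Filter.Eventually.of_forall fun v => ?_)
    simp only [innerSL_apply_apply, real_inner_comm]
  have hc : HasFDerivAt
      (fun z => ⟪z, x - a⟫ * (‖z‖ * √(‖z‖ ^ 2 + ‖x - a‖ ^ 2) + ‖z‖ ^ 2)⁻¹ / 2)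
      ((1 / 2 : ℝ) • ((‖z‖ * τ + ‖z‖ ^ 2)⁻¹ • innerSL ℝ (x - a) -
      (⟪z, x - a⟫ / (‖z‖ ^ 3 * τ)) • innerSL ℝ z)) z := by
    refine ((hi.mul hb').mul_const (1 / 2 : ℝ)).congr_fderiv ?_ |>.congr_of_eventuallyEq
      (Filter.Eventually.of_forall fun v => ?_)
    · ext v
      have h1 : ‖z‖ * τ + ‖z‖ ^ 2 ≠ 0 := by positivity
      have h2 : ‖z‖ + τ ≠ 0 := by positivity
      have h3 : ‖z‖ * τ + ‖z‖ ^ 2 = ‖z‖ * (‖z‖ + τ) := by ring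
      simp only [← hτ, h3, Function.comp_apply, Pi.add_apply, Pi.mul_apply, _root_.add_apply,
        _root_.smul_apply, _root_.sub_apply, innerSL_apply_apply, smul_eq_mul, nsmul_eq_mul,
        Nat.cast_ofNat]
      field_simp
      ring
    · simp [div_eq_mul_inv]
  refine (((((hasFDerivAt_id z).const_smul (1 / 2 : ℝ)).const_add ((1 / 2 : ℝ) • (x + a))).add
    (hc.smul_const (x - a))).congr_fderiv ?_).congr_of_eventuallyEq
    (Filter.Eventually.of_forall fun v => ?_)
  · ext1 v
    simp only [ellMapDeriv, ← hτ, _root_.add_apply, _root_.smul_apply, _root_.sub_apply,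
      ContinuousLinearMap.smulRight_apply, ContinuousLinearMap.id_apply]
    module
  · simp [ellMap]

/-- The derivative is half of a transvection, that is, of the identity plus a rank one map, so its
determinant is (1/2)³ times one plus the value of the functional at x−a. -/
lemma det_ellMapDeriv (hz : z ≠ 0) :
    (ellMapDeriv x a z).det = (√(‖z‖ ^ 2 + ‖x - a‖ ^ 2) ^ 2 - (⟪z, x - a⟫ / ‖z‖) ^ 2) /
      (8 * (‖z‖ * √(‖z‖ ^ 2 + ‖x - a‖ ^ 2))) := by
  have hp : 0 < ‖z‖ := norm_pos_iff.2 hz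
  set τ := √(‖z‖ ^ 2 + ‖x - a‖ ^ 2) with hτ
  have hτ0 : 0 < τ := Real.sqrt_pos.2 (by positivity)
  have hτ2 : τ ^ 2 = ‖z‖ ^ 2 + ‖x - a‖ ^ 2 := Real.sq_sqrt (by positivity)
  let ℓ : R3 →L[ℝ] ℝ := (‖z‖ * τ + ‖z‖ ^ 2)⁻¹ • innerSL ℝ (x - a) -
      (⟪z, x - a⟫ / (‖z‖ ^ 3 * τ)) • innerSL ℝ z
  have e : ((ellMapDeriv x a z : R3 →L[ℝ] R3) : R3 →ₗ[ℝ] R3) =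
      (1 / 2 : ℝ) • LinearMap.transvection (ℓ : R3 →ₗ[ℝ] ℝ) (x - a) := by
    ext1 v
    simp only [ellMapDeriv, ← hτ, LinearMap.smul_apply, LinearMap.transvection.apply]
    rfl
  rw [ContinuousLinearMap.det, e, LinearMap.det_smul, LinearMap.transvection.det]
  have h1 : ‖z‖ * τ + ‖z‖ ^ 2 = ‖z‖ * (‖z‖ + τ) := by ring
  have h2 : ‖z‖ + τ ≠ 0 := by positivity
  have h3 : ‖x - a‖ ^ 2 = (τ - ‖z‖) * (‖z‖ + τ) := by linarith
  simp only [ℓ, ContinuousLinearMap.coe_coe, _root_.sub_apply, _root_.smul_apply, innerSL_apply_apply,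
    real_inner_self_eq_norm_sq, smul_eq_mul, h1, h3, finrank_euclideanSpace, Fintype.card_fin]
  field_simp
  ring

lemma volume_segment : volume {y : R3 | ‖y - a‖ + ‖x - y‖ ≤ ‖x - a‖} = 0 := by
  have hne : line[ℝ, a, x] ≠ ⊤ := by
    intro h
    have h2 := (collinear_pair ℝ a x).finrank_le_one
    rw [← direction_affineSpan, h, AffineSubspace.direction_top, finrank_top] at h2
    simp at h2
  refine measure_mono_null (fun y hy => ?_) (Measure.addHaar_affineSubspace volume _ hne)
  have h1 : dist a y + dist y x = dist a x := by
    refine le_antisymm ?_ (dist_triangle _ _ _)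
    rw [dist_comm a y, dist_comm y x, dist_comm a x, dist_eq_norm, dist_eq_norm, dist_eq_norm]
    exact hy
  exact (dist_add_dist_eq_iff.1 h1).mem_affineSpan

lemma measurable_ellPt : Measurable fun p : ℝ × R3 => ellPt x a p.1 p.2 := by
  unfold ellPt; fun_prop

lemma measurable_ellPt_right (t : ℝ) : Measurable fun ω => ellPt x a t ω := by
  unfold ellPt; fun_prop

/-- The focal distances are (τ ± η)/2, so the Jacobian equals |x−y||y−a|/(2|z|τ) and cancels the
weight. The image misses only the segment between the foci, which lies on a null line. -/
lemma lintegral_ellMap (x a : R3) (f : R3 → ℝ≥0∞) :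
    ∫⁻ y, ENNReal.ofReal (2 / (‖x - y‖ * ‖y - a‖)) * f y =
      ∫⁻ z, ENNReal.ofReal (‖z‖ * √(‖z‖ ^ 2 + ‖x - a‖ ^ 2))⁻¹ * f (ellMap x a z) := by
  have hr : volume (ellMap x a '' {0}ᶜ)ᶜ = 0 := by
    refine measure_mono_null (fun y hy => ?_) (volume_segment (x := x) (a := a))
    by_contra h
    exact hy (mem_range_ellMap (not_le.1 h))
  rw [← setLIntegral_univ, setLIntegral_congr (ae_eq_univ.2 hr).symm,
    lintegral_image_eq_lintegral_abs_det_fderiv_mul volume (measurableSet_singleton (0 : R3)).compl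
      (fun z hz => (hasFDerivAt_ellMap hz).hasFDerivWithinAt) injOn_ellMap]
  conv_rhs => rw [← restrict_compl_singleton (μ := (volume : Measure R3)) 0]
  refine setLIntegral_congr_fun (measurableSet_singleton (0 : R3)).compl (fun z hz => ?_)
  have hz : z ≠ 0 := hz
  have hp : 0 < ‖z‖ := norm_pos_iff.2 hz
  set τ := √(‖z‖ ^ 2 + ‖x - a‖ ^ 2) with hτ
  have hτ0 : 0 < τ := Real.sqrt_pos.2 (by positivity)
  have hlt : |⟪z, x - a⟫ / ‖z‖| < τ := by
    rw [abs_div, abs_norm]; exact abs_inner_lt_mul_sqrt hz _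
  obtain ⟨hl1, hl2⟩ := abs_lt.1 hlt
  rw [det_ellMapDeriv hz, norm_sub_ellMap hz, norm_ellMap_sub hz, ← hτ, ← mul_assoc,
    ← ENNReal.ofReal_mul (abs_nonneg _)]
  congr 2
  generalize ⟪z, x - a⟫ / ‖z‖ = η at *
  have h1 : 0 < τ - η := by linarith
  have h2 : 0 < τ + η := by linarith
  rw [sq_sub_sq, abs_of_pos (by positivity)]
  field_simp
  norm_num

/-- Integration in ellipsoidal coordinates with foci `x` and `a`. -/
theorem lintegral_ellipsoid (x a : R3) {f : R3 → ℝ≥0∞} (hf : Measurable f) :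
    ∫⁻ y, ENNReal.ofReal (2 / (‖x - y‖ * ‖y - a‖)) * f y =
      ∫⁻ t in Ioi ‖x - a‖, ∫⁻ ω, f (ellPt x a t ω) ∂sph := by
  have hmeas : Measurable (ellMap x a) := by unfold ellMap; fun_prop
  let τ : ℝ → ℝ := fun s => √(s ^ 2 + ‖x - a‖ ^ 2)
  have hm2 : Measurable fun z : R3 => ENNReal.ofReal (‖z‖ * τ ‖z‖)⁻¹ * f (ellMap x a z) :=
    (Measurable.ennreal_ofReal (by fun_prop)).mul (hf.comp hmeas)
  rw [lintegral_ellMap, lintegral_polar hm2]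
  have himg : τ '' Ioi 0 = Ioi ‖x - a‖ := by
    ext t
    simp only [mem_image, mem_Ioi, τ]
    constructor
    · rintro ⟨s, hs, rfl⟩
      exact Real.lt_sqrt_of_sq_lt (by nlinarith)
    · intro ht
      have h0 := norm_nonneg (x - a)
      refine ⟨√(t ^ 2 - ‖x - a‖ ^ 2), Real.sqrt_pos.2 (by nlinarith), ?_⟩
      rw [Real.sq_sqrt (by nlinarith), sub_add_cancel, Real.sqrt_sq (by linarith)]
  have hder : ∀ s ∈ Ioi (0 : ℝ), HasDerivWithinAt τ (s / τ s) (Ioi 0) s := by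
    intro s hs
    have hs : 0 < s := hs
    have := ((hasDerivAt_pow 2 s).add_const (‖x - a‖ ^ 2)).sqrt (by positivity)
    refine (this.congr_deriv ?_).hasDerivWithinAt
    simp only [τ]
    field_simp
    ring
  have hinj : InjOn τ (Ioi 0) := by
    intro s hs s' hs' h
    have := (Real.sqrt_inj (by positivity) (by positivity)).1 h
    exact (sq_eq_sq₀ (le_of_lt hs) (le_of_lt hs')).1 (by linarith)
  rw [← himg, lintegral_image_eq_lintegral_abs_deriv_mul measurableSet_Ioi hder hinj]
  refine setLIntegral_congr_fun measurableSet_Ioi fun s hs => ?_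
  have hs : 0 < s := hs
  have hτs : 0 < τ s := Real.sqrt_pos.2 (by positivity)
  have h3 : ∫⁻ ω, ENNReal.ofReal (‖s • ω‖ * τ ‖s • ω‖)⁻¹ * f (ellMap x a (s • ω)) ∂sph =
      ENNReal.ofReal (s * τ s)⁻¹ * ∫⁻ ω, f (ellPt x a (τ s) ω) ∂sph := by
    have hm3 : Measurable fun ω => f (ellPt x a (τ s) ω) :=
      hf.comp (measurable_ellPt_right _)
    rw [← lintegral_const_mul _ hm3]
    refine lintegral_congr_ae ?_
    filter_upwards [sph_ae_norm] with ω hω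
    rw [ellMap_smul hs hω, norm_smul, hω, mul_one, Real.norm_of_nonneg hs.le]
  -- With t² = s² + |x−a|² one has s² · (st)⁻¹ ds = (s/t) ds = dt, which is why no weight is left.
  rw [h3, ← mul_assoc, ← ENNReal.ofReal_mul (by positivity), abs_of_pos (by positivity)]
  congr 2
  field_simp

end Ellipsoid

/-! ### The light cone and null sets of ellipsoids -/

open scoped RealInnerProductSpace Topology
open Filter

/-- The interior of the light cone `{|x - a| < t}`. -/
def lightCone (a : R3) : Set SpaceTime := {p | ‖p.1 - a‖ < p.2}

lemma isOpen_lightCone (a : R3) : IsOpen (lightCone a) :=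
  isOpen_lt (by fun_prop) (by fun_prop)

/-- A twice differentiable potential bounded by `M` in `C^{1,1}` which vanishes for `|x| > 1 - h`. -/
structure PotBound (M h : ℝ) (q : R3 → ℂ) : Prop where
  contDiff : ContDiff ℝ 1 q
  bound : ∀ x, ‖q x‖ ≤ M
  bound_fderiv : ∀ x, ‖fderiv ℝ q x‖ ≤ M
  lipschitz : ∀ x y, ‖fderiv ℝ q x - fderiv ℝ q y‖ ≤ M * ‖x - y‖
  zero : ∀ x, 1 - h < ‖x‖ → q x = 0

section EllipsoidMeasure

variable (x a : R3)

lemma withDensity_ellipsoid :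
    (volume : Measure R3).withDensity (fun y => ENNReal.ofReal (2 / (‖x - y‖ * ‖y - a‖))) =
      ((volume.restrict (Ioi ‖x - a‖)).prod sph).map (fun p => ellPt x a p.1 p.2) := by
  ext A hA
  have hi : Measurable (A.indicator (1 : R3 → ℝ≥0∞)) := measurable_one.indicator hA
  rw [← lintegral_indicator_one hA, ← lintegral_indicator_one hA,
    lintegral_withDensity_eq_lintegral_mul _ (by fun_prop) hi, lintegral_map hi measurable_ellPt,
    lintegral_prod (fun p : ℝ × R3 => A.indicator (1 : R3 → ℝ≥0∞) (ellPt x a p.1 p.2))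
      (hi.comp measurable_ellPt).aemeasurable]
  exact lintegral_ellipsoid x a hi

lemma ae_ellipsoid_weight_ne_zero : ∀ᵐ y : R3, y ≠ x ∧ y ≠ a := by
  have h : ∀ c : R3, ∀ᵐ y : R3, y ≠ c := fun c => by rw [ae_iff]; simp
  filter_upwards [h x, h a] with y h1 h2 using ⟨h1, h2⟩

variable {x a} {E : Type*} [NormedAddCommGroup E] [NormedSpace ℝ E]

lemma integral_ellipsoid {F : R3 → E} (hF : StronglyMeasurable F) :
    ∫ p : ℝ × R3, F (ellPt x a p.1 p.2) ∂((volume.restrict (Ioi ‖x - a‖)).prod sph) =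
      ∫ y, (2 / (‖x - y‖ * ‖y - a‖)) • F y := by
  rw [← integral_map (f := F) measurable_ellPt.aemeasurable hF.aestronglyMeasurable,
    ← withDensity_ellipsoid, integral_withDensity_eq_integral_toReal_smul (by fun_prop)
    (Eventually.of_forall fun _ => ENNReal.ofReal_lt_top)]
  refine integral_congr_ae (Eventually.of_forall fun y => ?_)
  simp only
  rw [ENNReal.toReal_ofReal (by positivity)]

lemma ellPt_eq_ellMap {t : ℝ} (ht : ‖x - a‖ < t) {ω : R3} (hω : ‖ω‖ = 1) :
    ellPt x a t ω = ellMap x a (√(t ^ 2 - ‖x - a‖ ^ 2) • ω) := by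
  have h0 := norm_nonneg (x - a)
  have hw : 0 < √(t ^ 2 - ‖x - a‖ ^ 2) := Real.sqrt_pos.2 (by nlinarith)
  rw [ellMap_smul hw hω, Real.sq_sqrt (by nlinarith), sub_add_cancel, Real.sqrt_sq (by linarith)]

lemma norm_ellPt_sub_add {t : ℝ} (ht : ‖x - a‖ < t) {ω : R3} (hω : ‖ω‖ = 1) :
    ‖x - ellPt x a t ω‖ + ‖ellPt x a t ω - a‖ = t := by
  have h0 := norm_nonneg (x - a)
  have hw : 0 < √(t ^ 2 - ‖x - a‖ ^ 2) := Real.sqrt_pos.2 (by nlinarith)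
  have hn : ‖√(t ^ 2 - ‖x - a‖ ^ 2) • ω‖ = √(t ^ 2 - ‖x - a‖ ^ 2) := by
    rw [norm_smul, hω, mul_one, Real.norm_of_nonneg hw.le]
  have hne : √(t ^ 2 - ‖x - a‖ ^ 2) • ω ≠ 0 := by
    rw [← norm_ne_zero_iff, hn]; exact hw.ne'
  rw [ellPt_eq_ellMap ht hω, norm_sub_ellMap hne, norm_ellMap_sub hne, hn,
    Real.sq_sqrt (by nlinarith), sub_add_cancel, Real.sqrt_sq (by linarith)]
  ring

/-- In ellipsoidal coordinates the set is a single value of the product coordinate t. This makes the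
jump of a density across the cone invisible to retarded integrals. -/
lemma volume_ellipsoid (t : ℝ) :
    volume {y : R3 | ‖x - y‖ + ‖y - a‖ = t} = 0 := by
  have hA : MeasurableSet {y : R3 | ‖x - y‖ + ‖y - a‖ = t} :=
    measurableSet_eq_fun (by fun_prop) (by fun_prop)
  have h1 : ((volume : Measure R3).withDensity
      (fun y => ENNReal.ofReal (2 / (‖x - y‖ * ‖y - a‖)))) {y : R3 | ‖x - y‖ + ‖y - a‖ = t} = 0 := by
    rw [withDensity_ellipsoid, Measure.map_apply measurable_ellPt hA,
      Measure.measure_prod_null (measurable_ellPt hA)]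
    filter_upwards [ae_restrict_mem measurableSet_Ioi,
      ae_restrict_of_ae (show ∀ᵐ s : ℝ, s ≠ t by rw [ae_iff]; simp)] with s hs hst
    refine measure_mono_null (t := {ω | ¬ ‖ω‖ = 1}) (fun ω hω h => ?_) (ae_iff.1 sph_ae_norm)
    have := norm_ellPt_sub_add (x := x) (a := a) hs h
    exact hst (this.symm.trans hω)
  have h2 := (withDensity_apply_eq_zero' (by fun_prop)).1 h1
  refine measure_mono_null (t := {y | ENNReal.ofReal (2 / (‖x - y‖ * ‖y - a‖)) ≠ 0} ∩
    {y : R3 | ‖x - y‖ + ‖y - a‖ = t} ∪ {y | ¬ (y ≠ x ∧ y ≠ a)}) (fun y hy => ?_)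
    (measure_union_null h2 (ae_iff.1 (ae_ellipsoid_weight_ne_zero x a)))
  by_cases h : y ≠ x ∧ y ≠ a
  · refine Or.inl ⟨?_, hy⟩
    have h3 : 0 < ‖x - y‖ := norm_pos_iff.2 (sub_ne_zero.2 h.1.symm)
    have h4 : 0 < ‖y - a‖ := norm_pos_iff.2 (sub_ne_zero.2 h.2)
    simp only [ne_eq, mem_ofPred_eq, ENNReal.ofReal_eq_zero, not_le]
    positivity
  · exact Or.inr h

end EllipsoidMeasure

/-! ### Averages over ellipsoids and their time derivative -/

section Average

variable {a : R3}

lemma continuousAt_ellPt {p : SpaceTime} (hp : 0 < p.2) (ω : R3) :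
    ContinuousAt (fun p : SpaceTime => ellPt p.1 a p.2 ω) p := by
  unfold ellPt
  have h : 2 * (p.2 + √(p.2 ^ 2 - ‖p.1 - a‖ ^ 2)) ≠ 0 := by positivity
  fun_prop (disch := exact h)

/-- The average of `g` over the ellipsoid with foci `x` and `a`. -/
def ellAvg (a : R3) (g : R3 → ℂ) (p : SpaceTime) : ℂ :=
  (32 * Real.pi ^ 2)⁻¹ • ∫ ω, g (ellPt p.1 a p.2 ω) ∂sph

lemma sph_real_univ : sph.real univ = 4 * Real.pi := by
  rw [measureReal_def, sph_univ, ENNReal.toReal_ofReal (by positivity)]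

/-- The total mass 4π is smaller than the normalisation 32π², so averaging does not enlarge bounds.
-/
lemma norm_sph_average_le {G : R3 → ℂ} {C : ℝ} (hC : 0 ≤ C) (hG : ∀ ω, ‖ω‖ = 1 → ‖G ω‖ ≤ C) :
    ‖(32 * Real.pi ^ 2)⁻¹ • ∫ ω, G ω ∂sph‖ ≤ C := by
  have h := norm_integral_le_of_norm_le_const (μ := sph) (f := G) (C := C) (by
    filter_upwards [sph_ae_norm] with ω hω using hG ω hω)
  rw [sph_real_univ] at h
  rw [norm_smul, norm_inv, Real.norm_of_nonneg (by positivity)]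
  have hpi := Real.pi_gt_three
  rw [inv_mul_le_iff₀ (by positivity)]
  refine h.trans ?_
  nlinarith [mul_nonneg hC (by nlinarith : (0:ℝ) ≤ 32 * Real.pi ^ 2 - 4 * Real.pi)]

lemma norm_ellAvg_le {g : R3 → ℂ} {C : ℝ} (hg : ∀ y, ‖g y‖ ≤ C) (p : SpaceTime) :
    ‖ellAvg a g p‖ ≤ C :=
  norm_sph_average_le ((norm_nonneg _).trans (hg 0)) fun _ _ => hg _

lemma continuousAt_ellAvg {g : R3 → ℂ} {C : ℝ} (hg : ∀ y, ‖g y‖ ≤ C) (hc : Continuous g)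
    {p : SpaceTime} (hp : 0 < p.2) : ContinuousAt (ellAvg a g) p := by
  unfold ellAvg
  suffices hs : ContinuousAt (fun p : SpaceTime => ∫ ω, g (ellPt p.1 a p.2 ω) ∂sph) p from
    hs.const_smul ((32 * Real.pi ^ 2)⁻¹)
  refine continuousAt_of_dominated (bound := fun _ => C) ?_ ?_ (integrable_const _) ?_
  · exact Eventually.of_forall fun p =>
      (hc.measurable.comp (measurable_ellPt_right _)).aestronglyMeasurable
  · exact Eventually.of_forall fun p => Eventually.of_forall fun ω => hg _
  · exact Eventually.of_forall fun ω => hc.continuousAt.comp (continuousAt_ellPt hp ω)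

/-- The velocity of `ellPt` with respect to `t`. -/
def ellVel (x a : R3) (t : ℝ) (ω : R3) : R3 :=
  (t / (2 * √(t ^ 2 - ‖x - a‖ ^ 2))) • ω -
    (⟪ω, x - a⟫ / (2 * (√(t ^ 2 - ‖x - a‖ ^ 2) * (t + √(t ^ 2 - ‖x - a‖ ^ 2))))) • (x - a)

lemma hasDerivAt_ellPt {x : R3} {t : ℝ} (ht : ‖x - a‖ < t) (ω : R3) :
    HasDerivAt (fun t => ellPt x a t ω) (ellVel x a t ω) t := by
  have h0 := norm_nonneg (x - a)
  have hw : 0 < t ^ 2 - ‖x - a‖ ^ 2 := by nlinarith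
  have hs : 0 < √(t ^ 2 - ‖x - a‖ ^ 2) := Real.sqrt_pos.2 hw
  have ht0 : 0 < t := h0.trans_lt ht
  have h1 : HasDerivAt (fun t => √(t ^ 2 - ‖x - a‖ ^ 2)) (t / √(t ^ 2 - ‖x - a‖ ^ 2)) t := by
    refine (((hasDerivAt_pow 2 t).sub_const (‖x - a‖ ^ 2)).sqrt hw.ne').congr_deriv ?_
    field_simp
    ring
  have h2 := ((h1.div_const 2).smul_const ω).const_add ((1 / 2 : ℝ) • (x + a))
  have h3 := ((hasDerivAt_const t ⟪ω, x - a⟫).div (((hasDerivAt_id t).add h1).const_mul 2)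
    (by simp only [Pi.add_apply, id]; positivity)).smul_const (x - a)
  refine (h2.add h3).congr_deriv ?_
  simp only [ellVel, Pi.add_apply, id]
  generalize √(t ^ 2 - ‖x - a‖ ^ 2) = w at *
  have e1 : t / w / 2 = t / (2 * w) := by field_simp
  have e2 : (0 * (2 * (t + w)) - ⟪ω, x - a⟫ * (2 * (1 + t / w))) / (2 * (t + w)) ^ 2 =
      -(⟪ω, x - a⟫ / (2 * (w * (t + w)))) := by
    field_simp
    ring
  rw [e1, e2, neg_smul, ← sub_eq_add_neg]

/-- This bound blows up at the cone. It serves for domination on neighbourhoods inside the cone; the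
bound up to the cone is `PotBound.norm_ellAvgDeriv_le`. -/
lemma norm_ellVel_le {x : R3} {t : ℝ} (ht : ‖x - a‖ < t) {ω : R3} (hω : ‖ω‖ = 1) :
    ‖ellVel x a t ω‖ ≤ t / √(t ^ 2 - ‖x - a‖ ^ 2) := by
  have h0 := norm_nonneg (x - a)
  have hw : 0 < t ^ 2 - ‖x - a‖ ^ 2 := by nlinarith
  have hs : 0 < √(t ^ 2 - ‖x - a‖ ^ 2) := Real.sqrt_pos.2 hw
  have ht0 : 0 < t := h0.trans_lt ht
  have hi : |⟪ω, x - a⟫| ≤ ‖x - a‖ := by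
    simpa [hω] using abs_real_inner_le_norm ω (x - a)
  unfold ellVel
  generalize √(t ^ 2 - ‖x - a‖ ^ 2) = w at *
  refine (norm_sub_le _ _).trans ?_
  rw [norm_smul, norm_smul, hω, Real.norm_of_nonneg (by positivity), norm_div, Real.norm_eq_abs,
    Real.norm_of_nonneg (by positivity), mul_one]
  have : |⟪ω, x - a⟫| / (2 * (w * (t + w))) * ‖x - a‖ ≤ t / (2 * w) := by
    rw [div_mul_eq_mul_div, div_le_div_iff₀ (by positivity) (by positivity)]
    have h5 : |⟪ω, x - a⟫| * ‖x - a‖ ≤ t * (t + w) := by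
      calc |⟪ω, x - a⟫| * ‖x - a‖ ≤ t * t := by
            apply mul_le_mul (hi.trans ht.le) ht.le h0 ht0.le
        _ ≤ t * (t + w) := by nlinarith
    nlinarith
  calc _ ≤ t / (2 * w) + t / (2 * w) := by gcongr
    _ = t / w := by field_simp; norm_num

/-- The time derivative of `ellAvg`. -/
def ellAvgDeriv (a : R3) (q : R3 → ℂ) (p : SpaceTime) : ℂ :=
  (32 * Real.pi ^ 2)⁻¹ • ∫ ω, fderiv ℝ q (ellPt p.1 a p.2 ω) (ellVel p.1 a p.2 ω) ∂sph

lemma measurable_ellVel (x : R3) (t : ℝ) : Measurable fun ω => ellVel x a t ω := by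
  unfold ellVel; fun_prop

variable {M h : ℝ} {q : R3 → ℂ}

lemma PotBound.continuous_fderiv (hq : PotBound M h q) : Continuous (fderiv ℝ q) :=
  hq.contDiff.continuous_fderiv one_ne_zero

lemma PotBound.nonneg (hq : PotBound M h q) : 0 ≤ M := (norm_nonneg _).trans (hq.bound 0)

lemma PotBound.measurable_integrand (hq : PotBound M h q) (x : R3) (t : ℝ) :
    AEStronglyMeasurable (fun ω => fderiv ℝ q (ellPt x a t ω) (ellVel x a t ω)) sph := by
  have h1 : Continuous fun p : R3 × R3 => fderiv ℝ q p.1 p.2 := by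
    have := hq.continuous_fderiv
    fun_prop
  exact (h1.measurable.comp ((measurable_ellPt_right (x := x) (a := a) t).prodMk
    (measurable_ellVel x t))).aestronglyMeasurable

lemma exists_nhds_velocity_bound {p : SpaceTime} (hp : p ∈ lightCone a) :
    ∃ C : ℝ, ∀ᶠ p' in 𝓝 p, p' ∈ lightCone a ∧ ∀ ω, ‖ω‖ = 1 → ‖ellVel p'.1 a p'.2 ω‖ ≤ C := by
  have hlt : ‖p.1 - a‖ < p.2 := hp
  have h0 := norm_nonneg (p.1 - a)
  have hs : √(p.2 ^ 2 - ‖p.1 - a‖ ^ 2) ≠ 0 := (Real.sqrt_pos.2 (by nlinarith)).ne'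
  have hc : ContinuousAt (fun p : SpaceTime => p.2 / √(p.2 ^ 2 - ‖p.1 - a‖ ^ 2)) p := by
    fun_prop (disch := exact hs)
  refine ⟨p.2 / √(p.2 ^ 2 - ‖p.1 - a‖ ^ 2) + 1, ?_⟩
  filter_upwards [hc.eventually_lt continuousAt_const (lt_add_one _),
    (isOpen_lightCone a).mem_nhds hp] with p' h1 h2
  exact ⟨h2, fun ω hω => (norm_ellVel_le h2 hω).trans h1.le⟩

lemma PotBound.norm_integrand_le (hq : PotBound M h q) {x : R3} {t C : ℝ} {ω : R3}
    (hC : ‖ellVel x a t ω‖ ≤ C) :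
    ‖fderiv ℝ q (ellPt x a t ω) (ellVel x a t ω)‖ ≤ M * C :=
  (ContinuousLinearMap.le_opNorm _ _).trans
    (mul_le_mul (hq.bound_fderiv _) hC (norm_nonneg _) hq.nonneg)

lemma PotBound.continuousOn_ellAvgDeriv (hq : PotBound M h q) :
    ContinuousOn (ellAvgDeriv a q) (lightCone a) := by
  intro p hp
  unfold ellAvgDeriv
  refine ContinuousAt.continuousWithinAt ?_
  suffices hs : ContinuousAt (fun p : SpaceTime =>
      ∫ ω, fderiv ℝ q (ellPt p.1 a p.2 ω) (ellVel p.1 a p.2 ω) ∂sph) p from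
    hs.const_smul ((32 * Real.pi ^ 2)⁻¹)
  obtain ⟨C, hC⟩ := exists_nhds_velocity_bound hp
  have hlt : ‖p.1 - a‖ < p.2 := hp
  have h0 := norm_nonneg (p.1 - a)
  refine continuousAt_of_dominated (bound := fun _ => M * C)
    (Eventually.of_forall fun p => hq.measurable_integrand p.1 p.2) ?_ (integrable_const _) ?_
  · filter_upwards [hC] with p' hp'
    filter_upwards [sph_ae_norm] with ω hω
    exact hq.norm_integrand_le (hp'.2 ω hω)
  · refine Eventually.of_forall fun ω => ?_
    have h1 : ContinuousAt (fun p : SpaceTime => ellVel p.1 a p.2 ω) p := by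
      unfold ellVel
      have hs : 0 < √(p.2 ^ 2 - ‖p.1 - a‖ ^ 2) := Real.sqrt_pos.2 (by nlinarith)
      have hs1 : 2 * √(p.2 ^ 2 - ‖p.1 - a‖ ^ 2) ≠ 0 := by positivity
      have ht : 0 < p.2 := h0.trans_lt hlt
      have hs2 : 2 * (√(p.2 ^ 2 - ‖p.1 - a‖ ^ 2) * (p.2 + √(p.2 ^ 2 - ‖p.1 - a‖ ^ 2))) ≠ 0 := by
        positivity
      fun_prop (disch := assumption)
    have h2 := (hq.continuous_fderiv.continuousAt (x := ellPt p.1 a p.2 ω)).comp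
      (f := fun p : SpaceTime => ellPt p.1 a p.2 ω) (x := p)
      (continuousAt_ellPt (h0.trans_lt hlt) ω)
    exact h2.clm_apply h1

lemma PotBound.hasDerivAt_ellAvg (hq : PotBound M h q) {x : R3} {t : ℝ} (ht : ‖x - a‖ < t) :
    HasDerivAt (fun t => ellAvg a q (x, t)) (ellAvgDeriv a q (x, t)) t := by
  obtain ⟨C, hC⟩ := exists_nhds_velocity_bound (a := a) (p := (x, t)) ht
  have hC' : ∀ᶠ s in 𝓝 t, (x, s) ∈ lightCone a ∧ ∀ ω, ‖ω‖ = 1 → ‖ellVel x a s ω‖ ≤ C :=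
    (by fun_prop : Continuous fun s : ℝ => ((x, s) : SpaceTime)).continuousAt.eventually hC
  unfold ellAvg ellAvgDeriv
  refine HasDerivAt.const_smul (R := ℝ) (f := fun t : ℝ => ∫ ω, q (ellPt x a t ω) ∂sph)
    ((32 * Real.pi ^ 2)⁻¹) ?_
  refine (hasDerivAt_integral_of_dominated_loc_of_deriv_le (bound := fun _ => M * C)
    (F := fun s ω => q (ellPt x a s ω))
    (F' := fun s ω => fderiv ℝ q (ellPt x a s ω) (ellVel x a s ω)) hC'
    (Eventually.of_forall fun s => ?_) ?_ (hq.measurable_integrand x t) ?_ (integrable_const _)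
    ?_).2
  · exact (hq.contDiff.continuous.measurable.comp (measurable_ellPt_right s)).aestronglyMeasurable
  · refine Integrable.of_bound
      (hq.contDiff.continuous.measurable.comp (measurable_ellPt_right t)).aestronglyMeasurable M
      (Eventually.of_forall fun ω => hq.bound _)
  · filter_upwards [sph_ae_norm] with ω hω s hs
    exact hq.norm_integrand_le (hs.2 ω hω)
  · refine Eventually.of_forall fun ω s hs => ?_
    exact ((hq.contDiff.differentiable one_ne_zero _).hasFDerivAt).comp_hasDerivAt s
      (hasDerivAt_ellPt hs.1 ω)

lemma sph_map_eq_integral (L : R3 ≃ₗᵢ[ℝ] R3) (F : R3 → ℂ) :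
    ∫ ω, F (L ω) ∂sph = ∫ ω, F ω ∂sph := by
  conv_rhs => rw [← sph_map_isometry L]
  exact (L.toHomeomorph.measurableEmbedding.integral_map F).symm

/-- The reflection across the line through the foci turns the singular part of the velocity into a
difference, so the time derivative stays bounded up to the light cone. -/
lemma PotBound.norm_ellAvgDeriv_le (hq : PotBound M h q) {p : SpaceTime} (hp : p ∈ lightCone a) :
    ‖ellAvgDeriv a q p‖ ≤ M * (1 + p.2) := by
  obtain ⟨x, t⟩ := p
  have ht : ‖x - a‖ < t := hp
  have h0 := norm_nonneg (x - a)
  have hw : 0 < t ^ 2 - ‖x - a‖ ^ 2 := by nlinarith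
  have hs : 0 < √(t ^ 2 - ‖x - a‖ ^ 2) := Real.sqrt_pos.2 hw
  have ht0 : 0 < t := h0.trans_lt ht
  have hM := hq.nonneg
  set L := (Submodule.span ℝ {x - a}).reflection with hL
  set F : R3 → ℂ := fun ω => fderiv ℝ q (ellPt x a t ω) (ellVel x a t ω) with hF
  have hFi : Integrable F sph := by
    refine Integrable.of_bound (hq.measurable_integrand x t) (M * (t / √(t ^ 2 - ‖x - a‖ ^ 2))) ?_
    filter_upwards [sph_ae_norm] with ω hω
    exact hq.norm_integrand_le (norm_ellVel_le ht hω)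
  have hFL : Integrable (fun ω => F (L ω)) sph := by
    rw [← sph_map_isometry L] at hFi
    exact (L.toHomeomorph.measurableEmbedding.integrable_map_iff).1 hFi
  have hsum : ∫ ω, F ω ∂sph = ∫ ω, (1 / 2 : ℝ) • (F ω + F (L ω)) ∂sph := by
    rw [integral_smul, integral_add hFi hFL, sph_map_eq_integral L F, ← two_smul ℝ, smul_smul]
    norm_num
  unfold ellAvgDeriv
  simp only
  rw [hsum]
  refine norm_sph_average_le (by positivity) fun ω hω => ?_
  have hLn : ‖L ω‖ = 1 := by rw [L.norm_map, hω]
  have hLω : L ω = (2 * (⟪x - a, ω⟫ / ‖x - a‖ ^ 2)) • (x - a) - ω := by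
    have := Submodule.reflection_singleton_apply (𝕜 := ℝ) (x - a) ω
    rw [hL, this, ← Nat.cast_smul_eq_nsmul ℝ, smul_smul]
    simp
  have hinner : ⟪L ω, x - a⟫ = ⟪ω, x - a⟫ := by
    rw [hLω, inner_sub_left, inner_smul_left, real_inner_self_eq_norm_sq, real_inner_comm]
    by_cases hd : ‖x - a‖ = 0
    · have : x - a = 0 := norm_eq_zero.1 hd
      simp [this]
    · simp only [conj_trivial]
      field_simp
      ring
  -- The components of ω orthogonal (e) and parallel (f) to the axis through the foci; L changes the
  -- sign of e only.
  set e : R3 := (1 / 2 : ℝ) • (ω - L ω) with he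
  set f : R3 := (1 / 2 : ℝ) • (ω + L ω) with hf
  have hfd : ⟪ω, x - a⟫ • (x - a) = ‖x - a‖ ^ 2 • f := by
    rw [hf, hLω, add_sub_cancel, smul_smul, smul_smul, real_inner_comm]
    by_cases hd : ‖x - a‖ = 0
    · have : x - a = 0 := norm_eq_zero.1 hd
      simp [this]
    · congr 1
      field_simp
  have hen : ‖e‖ ≤ 1 := by
    rw [he, norm_smul]
    have := norm_sub_le ω (L ω)
    rw [hLn, hω] at this
    norm_num
    linarith
  have hfn : ‖f‖ ≤ 1 := by
    rw [hf, norm_smul]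
    have := norm_add_le ω (L ω)
    rw [hLn, hω] at this
    norm_num
    linarith
  have hω' : ω = f + e := by rw [hf, he]; module
  have hLω' : L ω = f - e := by rw [hf, he]; module
  set w := √(t ^ 2 - ‖x - a‖ ^ 2) with hwdef
  have hw2 : w ^ 2 = t ^ 2 - ‖x - a‖ ^ 2 := Real.sq_sqrt hw.le
  have hvel : ∀ η : R3, ⟪η, x - a⟫ = ⟪ω, x - a⟫ →
      ellVel x a t η = (t / (2 * w)) • η - ((t - w) / (2 * w)) • f := by
    intro η hη
    unfold ellVel
    rw [hη, ← hwdef, div_eq_mul_inv ⟪ω, x - a⟫, mul_comm ⟪ω, x - a⟫, mul_smul, hfd, smul_smul]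
    congr 2
    have : ‖x - a‖ ^ 2 = (t - w) * (t + w) := by linear_combination hw2
    rw [this]
    have : t + w ≠ 0 := by positivity
    field_simp
  have hv1 : ellVel x a t ω = (1 / 2 : ℝ) • f + (t / (2 * w)) • e := by
    rw [hvel ω rfl]
    nth_rw 1 [hω']
    have : (1 / 2 : ℝ) = t / (2 * w) - (t - w) / (2 * w) := by field_simp; ring
    rw [this]; module
  have hv2 : ellVel x a t (L ω) = (1 / 2 : ℝ) • f - (t / (2 * w)) • e := by
    rw [hvel (L ω) hinner, hLω']
    have : (1 / 2 : ℝ) = t / (2 * w) - (t - w) / (2 * w) := by field_simp; ring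
    rw [this]; module
  -- The two reflected points are at distance at most w, so the Lipschitz bound on the gradient
  -- supplies exactly the factor that cancels the singular coefficient t/(2w).
  have hY : ellPt x a t ω - ellPt x a t (L ω) = w • e := by
    unfold ellPt
    rw [hinner, hLω', ← hwdef]
    nth_rw 1 [hω']
    module
  have key : F ω + F (L ω) =
      (fderiv ℝ q (ellPt x a t ω)) f * (1 / 2 : ℝ) + (fderiv ℝ q (ellPt x a t (L ω))) f * (1 / 2 : ℝ)
      + (t / (2 * w) : ℝ) * (fderiv ℝ q (ellPt x a t ω) - fderiv ℝ q (ellPt x a t (L ω))) e := by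
    simp only [hF]
    rw [hv1, hv2]
    simp only [map_add, map_sub, map_smul, _root_.sub_apply, Complex.real_smul]
    ring
  have b1 : ∀ y, ‖(fderiv ℝ q y) f * ((1 / 2 : ℝ) : ℂ)‖ ≤ M * (1 / 2) := fun y => by
    rw [norm_mul, Complex.norm_real, Real.norm_of_nonneg (by norm_num)]
    gcongr
    exact (ContinuousLinearMap.le_opNorm _ _).trans
      ((mul_le_mul (hq.bound_fderiv y) hfn (norm_nonneg _) hM).trans (by simp))
  have b2 : ‖((t / (2 * w) : ℝ) : ℂ) *
      (fderiv ℝ q (ellPt x a t ω) - fderiv ℝ q (ellPt x a t (L ω))) e‖ ≤ M * (t / 2) := by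
    rw [norm_mul, Complex.norm_real, Real.norm_of_nonneg (by positivity)]
    have h1 : ‖fderiv ℝ q (ellPt x a t ω) - fderiv ℝ q (ellPt x a t (L ω))‖ ≤ M * w := by
      refine (hq.lipschitz _ _).trans ?_
      rw [hY, norm_smul, Real.norm_of_nonneg hs.le]
      have : w * ‖e‖ ≤ w * 1 := by gcongr
      nlinarith
    have h2 := (ContinuousLinearMap.le_opNorm (fderiv ℝ q (ellPt x a t ω) -
      fderiv ℝ q (ellPt x a t (L ω))) e).trans (mul_le_mul h1 hen (norm_nonneg _) (by positivity))
    calc _ ≤ t / (2 * w) * (M * w * 1) := by gcongr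
      _ = M * (t / 2) := by field_simp
  rw [norm_smul, key]
  have h3 := (norm_add_le _ _).trans (add_le_add ((norm_add_le _ _).trans
    (add_le_add (b1 (ellPt x a t ω)) (b1 (ellPt x a t (L ω))))) b2)
  rw [Real.norm_of_nonneg (by norm_num)]
  nlinarith [mul_nonneg hM ht0.le, norm_nonneg (F ω + F (L ω))]

lemma norm_ellPt_sub_le {x : R3} {t : ℝ} (ht : ‖x - a‖ ≤ t) {ω : R3} (hω : ‖ω‖ = 1) :
    ‖ellPt x a t ω - a‖ ≤ t := by
  have h0 := norm_nonneg (x - a)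
  have hw : 0 ≤ t ^ 2 - ‖x - a‖ ^ 2 := by nlinarith
  have hs : 0 ≤ √(t ^ 2 - ‖x - a‖ ^ 2) := Real.sqrt_nonneg _
  have hw2 := Real.sq_sqrt hw
  have hi : |⟪ω, x - a⟫| ≤ ‖x - a‖ := by
    simpa [hω] using abs_real_inner_le_norm ω (x - a)
  unfold ellPt
  generalize √(t ^ 2 - ‖x - a‖ ^ 2) = w at *
  have e : (1 / 2 : ℝ) • (x + a) + (w / 2) • ω + (⟪ω, x - a⟫ / (2 * (t + w))) • (x - a) - a =
      (1 / 2 : ℝ) • (x - a) + (w / 2) • ω + (⟪ω, x - a⟫ / (2 * (t + w))) • (x - a) := by module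
  rw [e]
  refine (norm_add₃_le).trans ?_
  rw [norm_smul, norm_smul, norm_smul, hω, norm_div ⟪ω, x - a⟫, Real.norm_eq_abs ⟪ω, x - a⟫,
    Real.norm_of_nonneg (by norm_num : (0:ℝ) ≤ 1 / 2), Real.norm_of_nonneg (by positivity : 0 ≤ w / 2),
    Real.norm_of_nonneg (by linarith : 0 ≤ 2 * (t + w))]
  have h3 : |⟪ω, x - a⟫| / (2 * (t + w)) * ‖x - a‖ ≤ (t - w) / 2 := by
    rcases (by linarith : 0 ≤ t + w).eq_or_lt with h | h
    · rw [← h]; simp; nlinarith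
    · rw [div_mul_eq_mul_div, div_le_div_iff₀ (by positivity) (by positivity)]
      nlinarith [mul_le_mul_of_nonneg_right hi h0]
  linarith

/-- The boundary value of `ellAvg` on the light cone. -/
def coneVal (a : R3) (q : R3 → ℂ) (x : R3) : ℂ := ellAvg a q (x, ‖x - a‖)

lemma PotBound.eq_zero_near (hq : PotBound M h q) (ha : ‖a‖ = 1) {y : R3} (hy : ‖y - a‖ < h) :
    q y = 0 := by
  refine hq.zero y ?_
  have := norm_sub_norm_le a y
  rw [norm_sub_rev] at this
  linarith

lemma PotBound.coneVal_eq_zero (hq : PotBound M h q) (ha : ‖a‖ = 1) {x : R3} (hx : ‖x - a‖ < h) :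
    coneVal a q x = 0 := by
  unfold coneVal ellAvg
  rw [integral_eq_zero_of_ae, smul_zero]
  filter_upwards [sph_ae_norm] with ω hω
  exact hq.eq_zero_near ha ((norm_ellPt_sub_le le_rfl hω).trans_lt hx)

lemma PotBound.norm_coneVal_le (hq : PotBound M h q) (x : R3) : ‖coneVal a q x‖ ≤ M :=
  norm_ellAvg_le hq.bound _

lemma PotBound.continuous_coneVal (hq : PotBound M h q) (ha : ‖a‖ = 1) (hh : 0 < h) :
    Continuous (coneVal a q) := by
  refine continuous_iff_continuousAt.2 fun x => ?_
  by_cases hx : x = a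
  · subst hx
    refine continuousAt_const.congr (f := fun _ => (0 : ℂ)) ?_
    filter_upwards [Metric.ball_mem_nhds x hh] with y hy
    exact (hq.coneVal_eq_zero ha (by simpa [dist_eq_norm] using hy)).symm
  · exact (continuousAt_ellAvg hq.bound hq.contDiff.continuous (p := (x, ‖x - a‖))
      (norm_pos_iff.2 (sub_ne_zero.2 hx))).comp (f := fun x : R3 => ((x, ‖x - a‖) : SpaceTime))
      (by fun_prop)

end Average

open scoped RealInnerProductSpace Topology NNReal

/-! ### The damped Newton kernel -/

section Kernel

/-- The exponentially damped Newton kernel. -/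
def expKernel (l : ℝ) (z : R3) : ℝ := (4 * Real.pi * ‖z‖)⁻¹ * Real.exp (-(l * ‖z‖))

lemma expKernel_nonneg (l : ℝ) (z : R3) : 0 ≤ expKernel l z := by
  unfold expKernel; positivity

/-- The gain 1/l² is the norm of the retarded potential on functions growing like exp(lt). It makes
the Volterra equation a contraction for large l, and likewise the equation used for uniqueness. -/
lemma integral_expKernel {l : ℝ} (hl : 0 < l) : ∫ z, expKernel l z = 1 / l ^ 2 := by
  have h := integral_fun_norm_addHaar (volume : Measure R3)
    (fun s : ℝ => (4 * Real.pi * s)⁻¹ * Real.exp (-(l * s)))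
  have hv : (volume : Measure R3).real (ball 0 1) = 4 / 3 * Real.pi := by
    have h1 : (4 / 3 * Real.pi) = (4 * Real.pi) / 3 := by ring
    rw [measureReal_def, EuclideanSpace.volume_ball_fin_three, ENNReal.toReal_mul,
      ENNReal.toReal_pow, ENNReal.toReal_ofReal zero_le_one, ENNReal.toReal_ofReal (by positivity),
      h1]
    ring
  have hg : ∫ s in Ioi (0:ℝ), s ^ 2 • ((4 * Real.pi * s)⁻¹ * Real.exp (-(l * s))) =
      (4 * Real.pi)⁻¹ * (1 / l ^ 2) := by
    have h2 := Real.integral_rpow_mul_exp_neg_mul_Ioi (a := 2) (r := l) (by norm_num) hl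
    rw [Real.Gamma_two, mul_one] at h2
    have h3 : (1 / l) ^ (2:ℝ) = 1 / l ^ 2 := by
      rw [show (2:ℝ) = ((2:ℕ):ℝ) by norm_num, Real.rpow_natCast]; field_simp
    rw [← h3, ← h2, ← integral_const_mul]
    refine setIntegral_congr_fun measurableSet_Ioi fun s hs => ?_
    have hs : 0 < s := hs
    have : s ^ ((2:ℝ) - 1) = s := by norm_num
    simp only [smul_eq_mul, this]
    field_simp
  unfold expKernel
  rw [h, hv]
  simp only [finrank_euclideanSpace, Fintype.card_fin, Nat.reduceSub]
  rw [hg]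
  have := Real.pi_pos
  simp only [nsmul_eq_mul, smul_eq_mul]
  push_cast
  field_simp

lemma integrable_expKernel {l : ℝ} (hl : 0 < l) : Integrable (expKernel l) :=
  Integrable.of_integral_ne_zero (by rw [integral_expKernel hl]; positivity)

end Kernel

/-! ### Retarded potentials of functions supported in the cone -/

section ConeFunctions

variable {a : R3} {F : SpaceTime → ℂ}

lemma measurable_of_continuousOn_cone (hF : ContinuousOn F (lightCone a))
    (h0 : ∀ p ∉ lightCone a, F p = 0) : Measurable F := by
  classical
  have h : F = (lightCone a).piecewise F (fun _ => 0) := by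
    funext p
    by_cases hp : p ∈ lightCone a
    · rw [piecewise_eq_of_mem _ _ _ hp]
    · rw [piecewise_eq_of_notMem _ _ _ hp, h0 p hp]
  rw [h]
  exact hF.measurable_piecewise continuousOn_const (isOpen_lightCone a).measurableSet

/-- F can jump only on the cone, and the shifts z that bring p onto the cone form a translated
ellipsoid, which is null. Hence dominated convergence makes retarded potentials continuous across
the cone. -/
lemma ae_continuousAt_retarded (hF : ContinuousOn F (lightCone a))
    (h0 : ∀ p ∉ lightCone a, F p = 0) (p : SpaceTime) :
    ∀ᵐ z : R3, ContinuousAt (fun p : SpaceTime => F (p.1 + z, p.2 - ‖z‖)) p := by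
  have hnull : ∀ᵐ z : R3, ‖p.1 + z - a‖ ≠ p.2 - ‖z‖ := by
    have h1 := volume_ellipsoid (x := p.1) (a := a) p.2
    rw [← measure_preimage_add volume p.1] at h1
    refine measure_mono_null (fun z hz => ?_) h1
    simp only [ne_eq, mem_compl_iff, mem_ofPred_eq, not_not] at hz
    simp only [mem_preimage, mem_ofPred_eq, sub_add_cancel_left, norm_neg, hz]
    ring
  filter_upwards [hnull] with z hz
  have hc : ContinuousAt (fun p : SpaceTime => ((p.1 + z, p.2 - ‖z‖) : SpaceTime)) p := by fun_prop
  refine ContinuousAt.comp (g := F) ?_ hc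
  rcases lt_or_gt_of_ne hz with h | h
  · exact hF.continuousAt ((isOpen_lightCone a).mem_nhds h)
  · refine continuousAt_const.congr (f := fun _ => (0:ℂ)) ?_
    have : IsOpen {p : SpaceTime | p.2 < ‖p.1 - a‖} := isOpen_lt (by fun_prop) (by fun_prop)
    filter_upwards [this.mem_nhds h] with p' hp'
    exact (h0 p' (not_lt.2 (le_of_lt hp'))).symm

lemma notMem_lightCone_retarded {p : SpaceTime} (hp : p ∉ lightCone a) (z : R3) :
    (p.1 + z, p.2 - ‖z‖) ∉ lightCone a := by
  simp only [lightCone, mem_ofPred_eq, not_lt] at hp ⊢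
  have := norm_sub_norm_le (p.1 - a) (-z)
  rw [norm_neg, show p.1 - a - -z = p.1 + z - a by abel] at this
  linarith

/-- The retarded potential of `F`. -/
def retPot (F : SpaceTime → ℂ) (p : SpaceTime) : ℂ :=
  ∫ z : R3, (4 * Real.pi * ‖z‖)⁻¹ • F (p.1 + z, p.2 - ‖z‖)

lemma measurable_retarded (hF : Measurable F) (p : SpaceTime) :
    Measurable fun z : R3 => F (p.1 + z, p.2 - ‖z‖) :=
  hF.comp (by fun_prop)

lemma norm_retarded_le {C l : ℝ} (hb : ∀ p, ‖F p‖ ≤ C * Real.exp (l * p.2)) (p : SpaceTime)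
    (z : R3) : ‖(4 * Real.pi * ‖z‖)⁻¹ • F (p.1 + z, p.2 - ‖z‖)‖ ≤
      C * Real.exp (l * p.2) * expKernel l z := by
  rw [norm_smul, Real.norm_of_nonneg (by positivity)]
  refine (mul_le_mul_of_nonneg_left (hb _) (by positivity)).trans (le_of_eq ?_)
  unfold expKernel
  simp only
  rw [mul_sub, sub_eq_add_neg, Real.exp_add]
  ring

lemma integrable_retarded {C l : ℝ} (hl : 0 < l) (hF : Measurable F)
    (hb : ∀ p, ‖F p‖ ≤ C * Real.exp (l * p.2)) (p : SpaceTime) :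
    Integrable fun z : R3 => (4 * Real.pi * ‖z‖)⁻¹ • F (p.1 + z, p.2 - ‖z‖) := by
  refine ((integrable_expKernel hl).const_mul (C * Real.exp (l * p.2))).mono' ?_
    (Eventually.of_forall fun z => norm_retarded_le hb p z)
  have h1 : Measurable fun z : R3 => (4 * Real.pi * ‖z‖)⁻¹ := by fun_prop
  exact (h1.smul (measurable_retarded hF p)).aestronglyMeasurable

lemma norm_retPot_le {C l : ℝ} (hl : 0 < l) (hb : ∀ p, ‖F p‖ ≤ C * Real.exp (l * p.2))
    (p : SpaceTime) : ‖retPot F p‖ ≤ C / l ^ 2 * Real.exp (l * p.2) := by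
  refine (norm_integral_le_of_norm_le ((integrable_expKernel hl).const_mul _)
    (Eventually.of_forall fun z => norm_retarded_le hb p z)).trans (le_of_eq ?_)
  rw [integral_const_mul, integral_expKernel hl]
  ring

lemma continuous_retPot {C l : ℝ} (hl : 0 < l) (hF : ContinuousOn F (lightCone a))
    (h0 : ∀ p ∉ lightCone a, F p = 0) (hb : ∀ p, ‖F p‖ ≤ C * Real.exp (l * p.2)) :
    Continuous (retPot F) := by
  have hm := measurable_of_continuousOn_cone hF h0
  have hC : 0 ≤ C := by
    have := (norm_nonneg _).trans (hb 0)
    simpa using this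
  refine continuous_iff_continuousAt.2 fun p => ?_
  refine continuousAt_of_dominated
    (bound := fun z => C * Real.exp (l * (p.2 + 1)) * expKernel l z)
    (Eventually.of_forall fun p' => (integrable_retarded hl hm hb p').aestronglyMeasurable) ?_
    ((integrable_expKernel hl).const_mul _) ?_
  · have : ∀ᶠ p' : SpaceTime in 𝓝 p, p'.2 < p.2 + 1 :=
      continuousAt_snd.eventually_lt continuousAt_const (lt_add_one p.2)
    filter_upwards [this] with p' hp'
    refine Eventually.of_forall fun z => (norm_retarded_le hb p' z).trans ?_
    have := expKernel_nonneg l z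
    gcongr
  · filter_upwards [ae_continuousAt_retarded hF h0 p] with z hz
    exact hz.const_smul ((4 * Real.pi * ‖z‖)⁻¹)

lemma retPot_eq_zero (h0 : ∀ p ∉ lightCone a, F p = 0) {p : SpaceTime} (hp : p ∉ lightCone a) :
    retPot F p = 0 := by
  unfold retPot
  rw [integral_eq_zero_of_ae]
  refine Eventually.of_forall fun z => ?_
  simp [h0 _ (notMem_lightCone_retarded hp z)]

lemma retPot_sub {G : SpaceTime → ℂ} {C l : ℝ} (hl : 0 < l) (hF : Measurable F) (hG : Measurable G)
    (hbF : ∀ p, ‖F p‖ ≤ C * Real.exp (l * p.2)) (hbG : ∀ p, ‖G p‖ ≤ C * Real.exp (l * p.2))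
    (p : SpaceTime) : retPot (fun p => F p - G p) p = retPot F p - retPot G p := by
  unfold retPot
  rw [← integral_sub (integrable_retarded hl hF hbF p) (integrable_retarded hl hG hbG p)]
  simp only [smul_sub]

end ConeFunctions

/-! ### The Volterra equation in the cone -/

section Volterra

variable {a : R3}

/-- The function on space-time with weighted values `f` on the light cone. -/
def coneExt (a : R3) (l : ℝ) (f : lightCone a → ℂ) (p : SpaceTime) : ℂ :=
  Real.exp (l * p.2) • Function.extend (Subtype.val : lightCone a → SpaceTime) f 0 p

lemma coneExt_of_mem (l : ℝ) (f : lightCone a → ℂ) (p : lightCone a) :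
    coneExt a l f p = Real.exp (l * p.1.2) • f p := by
  rw [coneExt, Subtype.val_injective.extend_apply]

lemma coneExt_of_notMem (l : ℝ) (f : lightCone a → ℂ) {p : SpaceTime} (hp : p ∉ lightCone a) :
    coneExt a l f p = 0 := by
  rw [coneExt, Function.extend_apply' _ _ _ (by simpa using hp)]
  simp

lemma norm_coneExt_le (l : ℝ) {f : lightCone a → ℂ} {C : ℝ} (h0 : 0 ≤ C) (hC : ∀ p, ‖f p‖ ≤ C)
    (p : SpaceTime) : ‖coneExt a l f p‖ ≤ C * Real.exp (l * p.2) := by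
  by_cases hp : p ∈ lightCone a
  · rw [coneExt_of_mem l f ⟨p, hp⟩, norm_smul, Real.norm_of_nonneg (Real.exp_pos _).le, mul_comm]
    gcongr
    exact hC _
  · rw [coneExt_of_notMem l f hp, norm_zero]; positivity

lemma continuousOn_coneExt (l : ℝ) {f : lightCone a → ℂ} (hf : Continuous f) :
    ContinuousOn (coneExt a l f) (lightCone a) := by
  rw [continuousOn_iff_continuous_domRestrict]
  have : (lightCone a).domRestrict (coneExt a l f) = fun p => Real.exp (l * p.1.2) • f p := by
    funext p; exact coneExt_of_mem l f p
  rw [this]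
  fun_prop

/-- Solution of the Volterra type equation `P = b + retPot (g P)` in the light cone. -/
theorem exists_retPot_fixedPoint {g : R3 → ℂ} {b : SpaceTime → ℂ} {M β l : ℝ} (hl : 0 < l)
    (hg : Continuous g) (hgM : ∀ x, ‖g x‖ ≤ M) (hMl : M / l ^ 2 ≤ 1 / 2) (hβ : 0 ≤ β)
    (hb : ContinuousOn b (lightCone a))
    (hbβ : ∀ p ∈ lightCone a, ‖b p‖ ≤ β * Real.exp (l * p.2)) :
    ∃ P : SpaceTime → ℂ, ContinuousOn P (lightCone a) ∧ (∀ p ∉ lightCone a, P p = 0) ∧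
      (∀ p, ‖P p‖ ≤ 2 * β * Real.exp (l * p.2)) ∧
      ∀ p ∈ lightCone a, P p = b p + retPot (fun p => g p.1 * P p) p := by
  have hM : 0 ≤ M := (norm_nonneg _).trans (hgM 0)
  have hGc : ∀ f : BoundedContinuousFunction (lightCone a) ℂ,
      ContinuousOn (fun p : SpaceTime => g p.1 * coneExt a l f p) (lightCone a) := fun f =>
    (hg.comp continuous_fst).continuousOn.mul (continuousOn_coneExt l f.continuous)
  have hG0 : ∀ f : BoundedContinuousFunction (lightCone a) ℂ, ∀ p ∉ lightCone a,
      g p.1 * coneExt a l f p = 0 := fun f p hp => by rw [coneExt_of_notMem l f hp, mul_zero]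
  have hGb' : ∀ (f : BoundedContinuousFunction (lightCone a) ℂ) (C : ℝ), 0 ≤ C →
      (∀ p, ‖f p‖ ≤ C) → ∀ p : SpaceTime,
      ‖g p.1 * coneExt a l f p‖ ≤ M * C * Real.exp (l * p.2) := fun f C h0 hC p => by
    rw [norm_mul, mul_assoc]
    exact mul_le_mul (hgM _) (norm_coneExt_le l h0 hC p) (norm_nonneg _) hM
  have hGb : ∀ (f : BoundedContinuousFunction (lightCone a) ℂ) (p : SpaceTime),
      ‖g p.1 * coneExt a l f p‖ ≤ M * ‖f‖ * Real.exp (l * p.2) := fun f =>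
    hGb' f ‖f‖ (norm_nonneg f) f.norm_coe_le_norm
  have hstep : ∀ (f : BoundedContinuousFunction (lightCone a) ℂ) (C : ℝ), 0 ≤ C →
      (∀ p, ‖f p‖ ≤ C) → ∀ p : SpaceTime,
      ‖Real.exp (-(l * p.2)) • retPot (fun p => g p.1 * coneExt a l f p) p‖ ≤ 1 / 2 * C := by
    intro f C h0 hC p
    rw [norm_smul, Real.norm_of_nonneg (Real.exp_pos _).le]
    have h := norm_retPot_le hl (hGb' f C h0 hC) p
    calc _ ≤ Real.exp (-(l * p.2)) * (M * C / l ^ 2 * Real.exp (l * p.2)) := by gcongr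
      _ = M / l ^ 2 * C * (Real.exp (-(l * p.2)) * Real.exp (l * p.2)) := by ring
      _ = M / l ^ 2 * C := by rw [← Real.exp_add]; simp
      _ ≤ 1 / 2 * C := by gcongr
  have hbn : ∀ p : lightCone a, ‖Real.exp (-(l * p.1.2)) • b p.1‖ ≤ β := by
    intro p
    rw [norm_smul, Real.norm_of_nonneg (Real.exp_pos _).le]
    calc _ ≤ Real.exp (-(l * p.1.2)) * (β * Real.exp (l * p.1.2)) := by
          gcongr; exact hbβ _ p.2
      _ = β * (Real.exp (-(l * p.1.2)) * Real.exp (l * p.1.2)) := by ring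
      _ = β := by rw [← Real.exp_add]; simp
  -- The unknown is exp(−lt)P, a bounded continuous function on the open cone. Working on this
  -- subtype avoids any condition at the boundary, where P may jump.
  let T : BoundedContinuousFunction (lightCone a) ℂ → BoundedContinuousFunction (lightCone a) ℂ :=
    fun f => BoundedContinuousFunction.ofNormedAddCommGroup
      (fun p : lightCone a => Real.exp (-(l * p.1.2)) • b p.1 +
        Real.exp (-(l * p.1.2)) • retPot (fun p => g p.1 * coneExt a l f p) p.1)
      (by
        have h1 : Continuous fun p : lightCone a => b p.1 :=
          continuousOn_iff_continuous_domRestrict.1 hb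
        have h2 := continuous_retPot hl (hGc f) (hG0 f) (hGb f)
        exact ((by fun_prop : Continuous fun p : lightCone a => Real.exp (-(l * p.1.2))).smul h1).add
          ((by fun_prop : Continuous fun p : lightCone a => Real.exp (-(l * p.1.2))).smul
            (h2.comp continuous_subtype_val)))
      (β + 1 / 2 * ‖f‖)
      (fun p => (norm_add_le _ _).trans
        (add_le_add (hbn p) (hstep f _ (norm_nonneg f) f.norm_coe_le_norm p)))
  have hT : ∀ f p, T f p = Real.exp (-(l * p.1.2)) • b p.1 +
        Real.exp (-(l * p.1.2)) • retPot (fun p => g p.1 * coneExt a l f p) p.1 := fun _ _ => rfl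
  have hdiff : ∀ f f' : BoundedContinuousFunction (lightCone a) ℂ, ∀ p : lightCone a,
      T f p - T f' p =
        Real.exp (-(l * p.1.2)) • retPot (fun p => g p.1 * coneExt a l (f - f') p) p.1 := by
    intro f f' p
    rw [hT, hT, add_sub_add_left_eq_sub, ← smul_sub]
    congr 1
    have e : (fun p : SpaceTime => g p.1 * coneExt a l (f - f') p) =
        fun p => g p.1 * coneExt a l f p - g p.1 * coneExt a l f' p := by
      funext p
      by_cases hp : p ∈ lightCone a
      · simp only [coneExt_of_mem l _ ⟨p, hp⟩]
        simp only [Pi.sub_apply, smul_sub, mul_sub]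
      · simp only [coneExt_of_notMem l _ hp, mul_zero, sub_zero]
    rw [e]
    have hmax : ∀ {k : ℝ} {p : SpaceTime}, k ≤ max (M * ‖f‖) (M * ‖f'‖) →
        k * Real.exp (l * p.2) ≤ max (M * ‖f‖) (M * ‖f'‖) * Real.exp (l * p.2) := fun h =>
      mul_le_mul_of_nonneg_right h (Real.exp_pos _).le
    exact (retPot_sub hl (measurable_of_continuousOn_cone (hGc f) (hG0 f))
      (measurable_of_continuousOn_cone (hGc f') (hG0 f'))
      (fun p => (hGb f p).trans (hmax (le_max_left _ _)))
      (fun p => (hGb f' p).trans (hmax (le_max_right _ _))) p.1).symm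
  have hcontr : ContractingWith (1 / 2 : ℝ≥0) T := by
    refine ⟨by rw [← NNReal.coe_lt_coe]; norm_num, LipschitzWith.of_dist_le_mul fun f f' => ?_⟩
    have hc : ((1 / 2 : ℝ≥0) : ℝ) = 1 / 2 := by norm_num
    rw [hc, dist_eq_norm, dist_eq_norm]
    refine (BoundedContinuousFunction.norm_le (by positivity)).2 fun p => ?_
    rw [BoundedContinuousFunction.sub_apply, hdiff]
    exact hstep (f - f') _ (norm_nonneg _) (f - f').norm_coe_le_norm p
  set f := hcontr.fixedPoint T with hf
  have hfix : T f = f := hcontr.fixedPoint_isFixedPt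
  -- From ‖f‖ ≤ β + ‖f‖/2.
  have hfn : ‖f‖ ≤ 2 * β := by
    have h1 : ‖f‖ ≤ β + 1 / 2 * ‖f‖ := by
      refine (BoundedContinuousFunction.norm_le (by positivity)).2 fun p => ?_
      conv_lhs => rw [← hfix]
      exact (norm_add_le _ _).trans
        (add_le_add (hbn p) (hstep f _ (norm_nonneg f) f.norm_coe_le_norm p))
    linarith
  refine ⟨coneExt a l f, continuousOn_coneExt l f.continuous, fun p hp => coneExt_of_notMem l f hp,
    norm_coneExt_le l (by positivity) fun p => (f.norm_coe_le_norm p).trans hfn, fun p hp => ?_⟩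
  rw [coneExt_of_mem l f ⟨p, hp⟩]
  conv_lhs => rw [← hfix]
  rw [hT, ← smul_add, smul_smul, ← Real.exp_add]
  simp

end Volterra

/-! ### Primitives in time -/

section TimePrimitive

variable {a : R3} {P : SpaceTime → ℂ} {C l : ℝ}

/-- The primitive in time. -/
def timePrim (P : SpaceTime → ℂ) (p : SpaceTime) : ℂ := ∫ s in (0:ℝ)..p.2, P (p.1, s)

lemma intervalIntegral_eq_zero_of_le (h0 : ∀ p ∉ lightCone a, P p = 0) {x : R3} {u v : ℝ}
    (hu : u ≤ ‖x - a‖) (hv : v ≤ ‖x - a‖) : ∫ s in u..v, P (x, s) = 0 := by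
  refine intervalIntegral.integral_zero_ae (Eventually.of_forall fun s hs => h0 _ ?_)
  have h2 := hs.2
  exact not_lt.2 (h2.trans (max_le hu hv))

lemma timePrim_of_notMem (h0 : ∀ p ∉ lightCone a, P p = 0) {p : SpaceTime}
    (hp : p ∉ lightCone a) : timePrim P p = 0 :=
  intervalIntegral_eq_zero_of_le h0 (norm_nonneg _) (not_lt.1 hp)

lemma intervalIntegrable_of_bound (hm : Measurable P)
    (hb : ∀ p, ‖P p‖ ≤ C * Real.exp (l * p.2)) (x : R3) (u v : ℝ) :
    IntervalIntegrable (fun s => P (x, s)) volume u v := by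
  have h1 : IntervalIntegrable (fun s => C * Real.exp (l * s)) volume u v :=
    (by fun_prop : Continuous fun s : ℝ => C * Real.exp (l * s)).intervalIntegrable u v
  exact h1.mono_fun (hm.comp measurable_prodMk_left).aestronglyMeasurable
    (Eventually.of_forall fun s => (hb _).trans (le_abs_self _))

lemma norm_timePrim_sub_le (hl : 0 ≤ l) (hm : Measurable P)
    (hb : ∀ p, ‖P p‖ ≤ C * Real.exp (l * p.2)) (hC : 0 ≤ C) (x : R3) {s t T : ℝ}
    (hs : s ≤ T) (ht : t ≤ T) :
    ‖timePrim P (x, t) - timePrim P (x, s)‖ ≤ C * Real.exp (l * T) * |t - s| := by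
  unfold timePrim
  rw [intervalIntegral.integral_interval_sub_left (intervalIntegrable_of_bound hm hb x _ _)
    (intervalIntegrable_of_bound hm hb x _ _)]
  refine intervalIntegral.norm_integral_le_of_norm_le_const fun u hu => (hb _).trans ?_
  have : u ≤ T := hu.2.trans (max_le hs ht)
  gcongr

/-- Integration of exp(ls) costs 1/l, at most 1 for l ≥ 1, so the same weighted bound is kept. -/
lemma norm_timePrim_le (hl : 1 ≤ l) (h0 : ∀ p ∉ lightCone a, P p = 0)
    (hb : ∀ p, ‖P p‖ ≤ C * Real.exp (l * p.2)) (hC : 0 ≤ C) (p : SpaceTime) :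
    ‖timePrim P p‖ ≤ C * Real.exp (l * p.2) := by
  by_cases hp : p ∈ lightCone a
  · have ht : 0 ≤ p.2 := (norm_nonneg _).trans (le_of_lt hp)
    have h1 : ‖timePrim P p‖ ≤ ∫ s in (0:ℝ)..p.2, C * Real.exp (l * s) :=
      intervalIntegral.norm_integral_le_of_norm_le ht (Eventually.of_forall fun s _ => hb _)
        ((by fun_prop : Continuous fun s : ℝ => C * Real.exp (l * s)).intervalIntegrable _ _)
    refine h1.trans ?_
    have h2 : ∫ s in (0:ℝ)..p.2, C * Real.exp (l * s) =
        C * (l⁻¹ * Real.exp (l * p.2) - l⁻¹ * 1) := by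
      rw [intervalIntegral.integral_const_mul]
      congr 1
      have := intervalIntegral.integral_comp_mul_left (a := 0) (b := p.2)
        (fun s => Real.exp s) (show l ≠ 0 by linarith)
      rw [this, integral_exp, smul_eq_mul]
      simp
      ring
    rw [h2]
    gcongr
    have hl' : l⁻¹ ≤ 1 := inv_le_one_of_one_le₀ hl
    have hl0 : 0 ≤ l⁻¹ := by positivity
    nlinarith [Real.exp_pos (l * p.2)]
  · rw [timePrim_of_notMem h0 hp, norm_zero]; positivity

/-- For fixed t, continuity in x is dominated convergence, as each x sees the jump of P at one time
only. In t the primitive is Lipschitz, uniformly in x. -/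
lemma continuous_timePrim (hl : 0 ≤ l) (hP : ContinuousOn P (lightCone a))
    (h0 : ∀ p ∉ lightCone a, P p = 0) (hb : ∀ p, ‖P p‖ ≤ C * Real.exp (l * p.2)) :
    Continuous (timePrim P) := by
  have hm := measurable_of_continuousOn_cone hP h0
  have hC : 0 ≤ C := by simpa using (norm_nonneg _).trans (hb 0)
  refine continuous_iff_continuousAt.2 fun p => ?_
  have hx : ∀ t : ℝ, Continuous fun x : R3 => timePrim P (x, t) := by
    intro t
    refine continuous_iff_continuousAt.2 fun x => ?_
    refine intervalIntegral.continuousAt_of_dominated_interval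
      (bound := fun s => C * Real.exp (l * s))
      (Eventually.of_forall fun x => (hm.comp measurable_prodMk_left).aestronglyMeasurable)
      (Eventually.of_forall fun x => Eventually.of_forall fun s _ => hb _)
      ((by fun_prop : Continuous fun s : ℝ => C * Real.exp (l * s)).intervalIntegrable _ _) ?_
    filter_upwards [show ∀ᵐ s : ℝ, s ≠ ‖x - a‖ by rw [ae_iff]; simp] with s hs _
    refine ContinuousAt.comp (g := P) (f := fun x : R3 => ((x, s) : SpaceTime)) ?_ (by fun_prop)
    rcases lt_or_gt_of_ne hs with h | h
    · refine continuousAt_const.congr (f := fun _ => (0:ℂ)) ?_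
      have : IsOpen {p : SpaceTime | p.2 < ‖p.1 - a‖} := isOpen_lt (by fun_prop) (by fun_prop)
      filter_upwards [this.mem_nhds (show (x, s) ∈ {p : SpaceTime | p.2 < ‖p.1 - a‖} from h)] with p' hp'
      exact (h0 p' (not_lt.2 (le_of_lt hp'))).symm
    · exact hP.continuousAt ((isOpen_lightCone a).mem_nhds h)
  have hdecomp : timePrim P = fun p' => timePrim P (p'.1, p.2) +
      (timePrim P p' - timePrim P (p'.1, p.2)) := by funext p'; ring
  rw [hdecomp]
  refine ((hx p.2).comp continuous_fst).continuousAt.add ?_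
  have h2 : Tendsto (fun p' : SpaceTime => timePrim P p' - timePrim P (p'.1, p.2)) (𝓝 p) (𝓝 0) := by
    refine squeeze_zero_norm' (a := fun p' : SpaceTime =>
      C * Real.exp (l * (p.2 + 1)) * |p'.2 - p.2|) ?_ ?_
    · have : ∀ᶠ p' : SpaceTime in 𝓝 p, p'.2 < p.2 + 1 :=
        continuousAt_snd.eventually_lt continuousAt_const (lt_add_one p.2)
      filter_upwards [this] with p' hp'
      exact norm_timePrim_sub_le hl hm hb hC p'.1 (by linarith) hp'.le
    · have : Continuous fun p' : SpaceTime => C * Real.exp (l * (p.2 + 1)) * |p'.2 - p.2| := by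
        fun_prop
      simpa using this.tendsto p
  simpa [ContinuousAt] using h2

lemma setIntegral_retPot {F : SpaceTime → ℂ} (hl : 0 < l) (hm : Measurable F) 
    (hb : ∀ p, ‖F p‖ ≤ C * Real.exp (l * p.2)) (x : R3) (r t : ℝ) :
    ∫ s in Ioo r t, retPot F (x, s) =
      ∫ z : R3, (4 * Real.pi * ‖z‖)⁻¹ • ∫ s in Ioo r t, F (x + z, s - ‖z‖) := by
  have hC : 0 ≤ C := by simpa using (norm_nonneg _).trans (hb 0)
  unfold retPot
  rw [integral_integral_swap]
  · simp only [integral_smul]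
  · have h1 : Integrable (fun p : ℝ × R3 => C * Real.exp (l * t) * expKernel l p.2)
        ((volume.restrict (Ioo r t)).prod volume) :=
      ((integrable_expKernel hl).const_mul (C * Real.exp (l * t))).comp_snd (volume.restrict (Ioo r t))
    have hmeas : Measurable (Function.uncurry fun (s : ℝ) (z : R3) =>
        (4 * Real.pi * ‖z‖)⁻¹ • F (x + z, s - ‖z‖)) := by
      have h1 : Measurable fun p : ℝ × R3 => (4 * Real.pi * ‖p.2‖)⁻¹ := by fun_prop
      have h2 : Measurable fun p : ℝ × R3 => ((x + p.2, p.1 - ‖p.2‖) : SpaceTime) := by fun_prop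
      exact h1.smul (hm.comp h2)
    refine h1.mono' hmeas.aestronglyMeasurable ?_
    have hae : ∀ᵐ p : ℝ × R3 ∂((volume.restrict (Ioo r t)).prod volume), p.1 ∈ Ioo r t := by
      have := Measure.quasiMeasurePreserving_fst (μ := volume.restrict (Ioo r t))
        (ν := (volume : Measure R3))
      exact this.ae (ae_restrict_mem measurableSet_Ioo)
    filter_upwards [hae] with p hp
    refine (norm_retarded_le hb (x, p.1) p.2).trans ?_
    have := expKernel_nonneg l p.2
    have := hp.2.le
    simp only
    gcongr

/-- The shifted lower limit |x−a| − |z| does not exceed |x+z−a|, where P(x+z, ·) starts to be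
nonzero, so the integral may as well start at 0. -/
lemma setIntegral_mul_retarded (h0 : ∀ p ∉ lightCone a, P p = 0) (hm : Measurable P)
    (hb : ∀ p, ‖P p‖ ≤ C * Real.exp (l * p.2)) (g : R3 → ℂ) {x : R3} {t : ℝ} (ht : ‖x - a‖ < t)
    (z : R3) : ∫ s in Ioo ‖x - a‖ t, g (x + z) * P (x + z, s - ‖z‖) =
      g (x + z) * timePrim P (x + z, t - ‖z‖) := by
  rw [integral_const_mul, ← integral_Ioc_eq_integral_Ioo, ← intervalIntegral.integral_of_le ht.le,
    intervalIntegral.integral_comp_sub_right (fun s => P (x + z, s))]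
  congr 1
  unfold timePrim
  rw [← intervalIntegral.integral_interval_sub_left (intervalIntegrable_of_bound hm hb (x + z) _ _)
    (intervalIntegrable_of_bound hm hb (x + z) 0 _)]
  rw [intervalIntegral_eq_zero_of_le h0 (norm_nonneg _) (v := ‖x - a‖ - ‖z‖) ?_, sub_zero]
  have := norm_sub_norm_le (x - a) (-z)
  rwa [norm_neg, show x - a - -z = x + z - a by abel] at this

end TimePrimitive

/-! ### Construction of the regular part -/

section Tail

variable {a : R3} {M h : ℝ} {q : R3 → ℂ}

/-- As time runs up to t the ellipsoids sweep out the solid ellipsoid |x−y| + |y−a| < t. -/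
lemma setIntegral_ellAvg {g : R3 → ℂ} {G : ℝ} (hg : Continuous g) (hG : ∀ y, ‖g y‖ ≤ G) (x : R3)
    (t : ℝ) : ∫ s in Ioo ‖x - a‖ t, ellAvg a g (x, s) = (32 * Real.pi ^ 2)⁻¹ •
      ∫ y, (2 / (‖x - y‖ * ‖y - a‖)) • {y | ‖x - y‖ + ‖y - a‖ < t}.indicator g y := by
  have hA : MeasurableSet {y : R3 | ‖x - y‖ + ‖y - a‖ < t} :=
    measurableSet_lt (by fun_prop) (by fun_prop)
  have hF : StronglyMeasurable ({y | ‖x - y‖ + ‖y - a‖ < t}.indicator g) :=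
    hg.stronglyMeasurable.indicator hA
  rw [← integral_ellipsoid hF]
  have hpt : ∀ s, ‖x - a‖ < s → ∀ ω, ‖ω‖ = 1 →
      {y | ‖x - y‖ + ‖y - a‖ < t}.indicator g (ellPt x a s ω) =
      (Iio t).indicator (fun s => g (ellPt x a s ω)) s := by
    intro s hs ω hω
    simp only [indicator, mem_ofPred_eq, norm_ellPt_sub_add hs hω, mem_Iio]
  have hint : Integrable (fun p : ℝ × R3 =>
      {y | ‖x - y‖ + ‖y - a‖ < t}.indicator g (ellPt x a p.1 p.2))
      ((volume.restrict (Ioi ‖x - a‖)).prod sph) := by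
    have h1 : Integrable (fun s : ℝ => (Iio t).indicator (fun _ => G) s)
        (volume.restrict (Ioi ‖x - a‖)) := by
      rw [integrable_indicator_iff measurableSet_Iio, IntegrableOn,
        Measure.restrict_restrict measurableSet_Iio]
      refine integrableOn_const ?_
      rw [inter_comm, Ioi_inter_Iio]
      simp
    refine (h1.comp_fst sph).mono' (hF.measurable.comp measurable_ellPt).aestronglyMeasurable ?_
    have hae1 : ∀ᵐ p : ℝ × R3 ∂((volume.restrict (Ioi ‖x - a‖)).prod sph), ‖x - a‖ < p.1 :=
      (Measure.quasiMeasurePreserving_fst (μ := volume.restrict (Ioi ‖x - a‖)) (ν := sph)).ae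
        (ae_restrict_mem measurableSet_Ioi)
    have hae2 : ∀ᵐ p : ℝ × R3 ∂((volume.restrict (Ioi ‖x - a‖)).prod sph), ‖p.2‖ = 1 :=
      (Measure.quasiMeasurePreserving_snd (μ := volume.restrict (Ioi ‖x - a‖)) (ν := sph)).ae
        sph_ae_norm
    filter_upwards [hae1, hae2] with p h1 h2
    rw [hpt p.1 h1 p.2 h2]
    simp only [indicator]
    split_ifs
    · exact hG _
    · simp
  rw [integral_prod _ hint, ← integral_smul, ← Ioi_inter_Iio, inter_comm,
    ← Measure.restrict_restrict measurableSet_Iio, ← integral_indicator measurableSet_Iio]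
  refine setIntegral_congr_fun measurableSet_Ioi fun s hs => ?_
  simp only
  rw [integral_congr_ae (g := fun ω => (Iio t).indicator (fun s => g (ellPt x a s ω)) s)
    (by filter_upwards [sph_ae_norm] with ω hω using hpt s hs ω hω)]
  simp only [indicator]
  split_ifs
  · rfl
  · simp

/-- The strength of the singular source on the light cone. -/
def coneSource (a : R3) (q : R3 → ℂ) (y : R3) : ℂ :=
  (4 * Real.pi * ‖y - a‖) • (q y * coneVal a q y)

lemma PotBound.norm_coneSource_le (hq : PotBound M h q) (ha : ‖a‖ = 1) (hh : 0 < h) (y : R3) :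
    ‖coneSource a q y‖ ≤ 8 * Real.pi * M ^ 2 := by
  unfold coneSource
  have hpi := Real.pi_pos
  by_cases hy : 1 - h < ‖y‖
  · rw [hq.zero y hy]; simp; positivity
  · have h1 : ‖y - a‖ ≤ 2 := by
      have := norm_sub_le y a
      linarith
    rw [norm_smul, Real.norm_of_nonneg (by positivity), norm_mul]
    have h2 : ‖q y‖ * ‖coneVal a q y‖ ≤ M * M :=
      mul_le_mul (hq.bound y) (hq.norm_coneVal_le y) (norm_nonneg _) hq.nonneg
    calc _ ≤ (4 * Real.pi * 2) * (M * M) := by gcongr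
      _ = _ := by ring

lemma PotBound.continuous_coneSource (hq : PotBound M h q) (ha : ‖a‖ = 1) (hh : 0 < h) :
    Continuous (coneSource a q) := by
  have h1 := hq.continuous_coneVal ha hh
  have h2 := hq.contDiff.continuous
  unfold coneSource
  fun_prop

/-- `P` is the density of the regular part of the point source solution. -/
structure IsTailDensity (a : R3) (q : R3 → ℂ) (K l : ℝ) (P : SpaceTime → ℂ) : Prop where
  continuousOn : ContinuousOn P (lightCone a)
  zero : ∀ p ∉ lightCone a, P p = 0
  bound : ∀ p, ‖P p‖ ≤ K * Real.exp (l * p.2)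
  eqn : ∀ p ∈ lightCone a, P p = ellAvgDeriv a q p + ellAvg a (coneSource a q) p +
    retPot (fun p => q p.1 * P p) p

/-- The source is at most M(1+t) + 8πM², hence at most β exp(lt). The rate l = 1 + 2M satisfies 2M ≤
l², so the potential term has norm at most 1/2, which doubles β into the stated constant. -/
theorem PotBound.exists_tailDensity (hq : PotBound M h q) (ha : ‖a‖ = 1) (hh : 0 < h) :
    ∃ P, IsTailDensity a q (2 * (M + 8 * Real.pi * M ^ 2)) (1 + 2 * M) P := by
  have hM := hq.nonneg
  have hpi := Real.pi_pos
  obtain ⟨P, h1, h2, h3, h4⟩ := exists_retPot_fixedPoint (a := a) (l := 1 + 2 * M)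
    (β := M + 8 * Real.pi * M ^ 2)
    (b := fun p => ellAvgDeriv a q p + ellAvg a (coneSource a q) p)
    (by positivity) hq.contDiff.continuous hq.bound
    (by rw [div_le_div_iff₀ (by positivity) (by norm_num)]; nlinarith [sq_nonneg M]) (by positivity)
    (hq.continuousOn_ellAvgDeriv.add fun p hp => (continuousAt_ellAvg
      (hq.norm_coneSource_le ha hh) (hq.continuous_coneSource ha hh)
      ((norm_nonneg _).trans_lt hp)).continuousWithinAt)
    (fun p hp => by
      have ht : 0 < p.2 := (norm_nonneg _).trans_lt hp
      have e1 : 1 + p.2 ≤ Real.exp ((1 + 2 * M) * p.2) := by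
        refine le_trans (by linarith [Real.add_one_le_exp p.2]) (Real.exp_le_exp.2 ?_)
        · nlinarith
      have e2 : 1 ≤ Real.exp ((1 + 2 * M) * p.2) := by linarith
      calc _ ≤ M * (1 + p.2) + 8 * Real.pi * M ^ 2 * 1 := by
            refine (norm_add_le _ _).trans (add_le_add (hq.norm_ellAvgDeriv_le hp) ?_)
            rw [mul_one]
            exact norm_ellAvg_le (hq.norm_coneSource_le ha hh) p
        _ ≤ M * Real.exp ((1 + 2 * M) * p.2) +
            8 * Real.pi * M ^ 2 * Real.exp ((1 + 2 * M) * p.2) := by gcongr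
        _ = _ := by ring)
  exact ⟨P, h1, h2, h3, h4⟩

/-- The regular part of the point source solution, extended continuously below the cone. -/
def fullTail (a : R3) (q : R3 → ℂ) (P : SpaceTime → ℂ) (p : SpaceTime) : ℂ :=
  coneVal a q p.1 + timePrim P p

/-- The regular part of the point source solution. -/
def waveTail (a : R3) (q : R3 → ℂ) (P : SpaceTime → ℂ) : SpaceTime → ℂ :=
  (lightCone a).indicator (fullTail a q P)

variable {K l : ℝ} {P : SpaceTime → ℂ}

lemma IsTailDensity.nonneg (hP : IsTailDensity a q K l P) : 0 ≤ K := by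
  simpa using (norm_nonneg _).trans (hP.bound 0)

lemma IsTailDensity.measurable (hP : IsTailDensity a q K l P) : Measurable P :=
  measurable_of_continuousOn_cone hP.continuousOn hP.zero

lemma waveTail_of_mem {p : SpaceTime} (hp : p ∈ lightCone a) :
    waveTail a q P p = fullTail a q P p := indicator_of_mem hp _

lemma waveTail_of_notMem {p : SpaceTime} (hp : p ∉ lightCone a) : waveTail a q P p = 0 :=
  indicator_of_notMem hp _

lemma IsTailDensity.continuous_fullTail (hP : IsTailDensity a q K l P) (hq : PotBound M h q)
    (ha : ‖a‖ = 1) (hh : 0 < h) (hl : 1 ≤ l) : Continuous (fullTail a q P) :=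
  ((hq.continuous_coneVal ha hh).comp continuous_fst).add
    (continuous_timePrim (by linarith) hP.continuousOn hP.zero hP.bound)

lemma IsTailDensity.continuousOn_waveTail (hP : IsTailDensity a q K l P) (hq : PotBound M h q)
    (ha : ‖a‖ = 1) (hh : 0 < h) (hl : 1 ≤ l) : ContinuousOn (waveTail a q P) (lightCone a) :=
  (hP.continuous_fullTail hq ha hh hl).continuousOn.congr fun _ hp => waveTail_of_mem hp

lemma IsTailDensity.norm_waveTail_le (hP : IsTailDensity a q K l P) (hq : PotBound M h q)
    (hl : 1 ≤ l) (p : SpaceTime) : ‖waveTail a q P p‖ ≤ (M + K) * Real.exp (l * p.2) := by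
  have hM := hq.nonneg
  have hK := hP.nonneg
  by_cases hp : p ∈ lightCone a
  · have ht : 0 < p.2 := (norm_nonneg _).trans_lt hp
    rw [waveTail_of_mem hp, fullTail, add_mul]
    refine (norm_add_le _ _).trans (add_le_add ((hq.norm_coneVal_le _).trans ?_)
      (norm_timePrim_le hl hP.zero hP.bound hK p))
    exact le_mul_of_one_le_right hM (Real.one_le_exp (by positivity))
  · rw [waveTail_of_notMem hp, norm_zero]; positivity

lemma IsTailDensity.measurable_waveTail (hP : IsTailDensity a q K l P) (hq : PotBound M h q)
    (ha : ‖a‖ = 1) (hh : 0 < h) (hl : 1 ≤ l) : Measurable (waveTail a q P) :=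
  measurable_of_continuousOn_cone (hP.continuousOn_waveTail hq ha hh hl)
    fun _ => waveTail_of_notMem

lemma PotBound.integrableOn_ellAvgDeriv (hq : PotBound M h q) (x : R3) (t : ℝ) :
    IntegrableOn (fun s => ellAvgDeriv a q (x, s)) (Ioo ‖x - a‖ t) := by
  refine Integrable.of_bound ?_ (M * (1 + t)) ?_
  · refine ContinuousOn.aestronglyMeasurable ?_ measurableSet_Ioo
    exact hq.continuousOn_ellAvgDeriv.comp (by fun_prop) fun s hs => hs.1
  · filter_upwards [ae_restrict_mem measurableSet_Ioo] with s hs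
    refine (hq.norm_ellAvgDeriv_le (a := a) (p := (x, s)) hs.1).trans ?_
    have := hq.nonneg
    have := hs.2.le
    simp only
    gcongr

lemma PotBound.setIntegral_ellAvgDeriv (hq : PotBound M h q) (ha : ‖a‖ = 1) (hh : 0 < h) {x : R3}
    {t : ℝ} (ht : ‖x - a‖ < t) :
    ∫ s in Ioo ‖x - a‖ t, ellAvgDeriv a q (x, s) = ellAvg a q (x, t) - coneVal a q x := by
  rw [← integral_Ioc_eq_integral_Ioo, ← intervalIntegral.integral_of_le ht.le]
  refine intervalIntegral.integral_eq_sub_of_hasDerivAt_of_le (f := fun s => ellAvg a q (x, s))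
    ht.le ?_ (fun s hs => hq.hasDerivAt_ellAvg hs.1) ?_
  · intro s hs
    have hs0 : 0 ≤ s := (norm_nonneg _).trans hs.1
    -- Time s = 0 can occur only for x = a, where the ellipsoid degenerates; there the average
    -- vanishes nearby because q vanishes near a.
    rcases hs0.eq_or_lt with h0 | h0
    · refine (continuousWithinAt_const (b := (0:ℂ))).congr_of_eventuallyEq ?_ ?_
      · have : ∀ᶠ s' in 𝓝[Icc ‖x - a‖ t] s, s' < h :=
          (continuousAt_id.eventually_lt continuousAt_const (by simpa [← h0] using hh)).filter_mono
            nhdsWithin_le_nhds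
        filter_upwards [this, self_mem_nhdsWithin] with s' h1 h2
        unfold ellAvg
        rw [integral_eq_zero_of_ae, smul_zero]
        filter_upwards [sph_ae_norm] with ω hω
        exact hq.eq_zero_near ha ((norm_ellPt_sub_le h2.1 hω).trans_lt h1)
      · unfold ellAvg
        rw [integral_eq_zero_of_ae, smul_zero]
        filter_upwards [sph_ae_norm] with ω hω
        exact hq.eq_zero_near ha ((norm_ellPt_sub_le hs.1 hω).trans_lt (h0 ▸ hh))
    · exact ((continuousAt_ellAvg hq.bound hq.contDiff.continuous (p := (x, s)) h0).comp
        (f := fun s : ℝ => ((x, s) : SpaceTime)) (by fun_prop)).continuousWithinAt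
  · rw [intervalIntegrable_iff_integrableOn_Ioo_of_le ht.le]
    exact hq.integrableOn_ellAvgDeriv x t

/-- The regular part satisfies the integral equation with the single scattering term as source. -/
theorem IsTailDensity.waveTail_eq (hP : IsTailDensity a q K l P) (hq : PotBound M h q)
    (ha : ‖a‖ = 1) (hh : 0 < h) (hl : 1 ≤ l) {p : SpaceTime} (hp : p ∈ lightCone a) :
    waveTail a q P p = ellAvg a q p + retPot (fun p => q p.1 * waveTail a q P p) p := by
  obtain ⟨x, t⟩ := p
  have ht : ‖x - a‖ < t := hp
  have ht0 : 0 < t := (norm_nonneg _).trans_lt ht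
  have hM := hq.nonneg
  have hK := hP.nonneg
  have hl0 : 0 < l := by linarith
  have hqm := hq.contDiff.continuous.measurable
  have hqP : Measurable fun p : SpaceTime => q p.1 * P p :=
    (hqm.comp measurable_fst).mul hP.measurable
  have hqPb : ∀ p : SpaceTime, ‖q p.1 * P p‖ ≤ M * K * Real.exp (l * p.2) := fun p => by
    rw [norm_mul, mul_assoc]
    exact mul_le_mul (hq.bound _) (hP.bound _) (norm_nonneg _) hM
  have hqPc : ContinuousOn (fun p : SpaceTime => q p.1 * P p) (lightCone a) :=
    (hq.contDiff.continuous.comp continuous_fst).continuousOn.mul hP.continuousOn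
  have hret : Continuous (retPot fun p => q p.1 * P p) :=
    continuous_retPot hl0 hqPc (fun p hp => by rw [hP.zero p hp, mul_zero]) hqPb
  have hfin : volume (Ioo ‖x - a‖ t) < ∞ := by simp
  have i1 : IntegrableOn (fun s => ellAvgDeriv a q (x, s)) (Ioo ‖x - a‖ t) :=
    hq.integrableOn_ellAvgDeriv x t
  have i2 : IntegrableOn (fun s => ellAvg a (coneSource a q) (x, s)) (Ioo ‖x - a‖ t) := by
    refine Integrable.of_bound ?_ (8 * Real.pi * M ^ 2)
      (Eventually.of_forall fun s => norm_ellAvg_le (hq.norm_coneSource_le ha hh) _)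
    refine ContinuousOn.aestronglyMeasurable (fun s hs => ?_) measurableSet_Ioo
    exact ((continuousAt_ellAvg (hq.norm_coneSource_le ha hh) (hq.continuous_coneSource ha hh)
      (p := (x, s)) ((norm_nonneg _).trans_lt hs.1)).comp
        (f := fun s : ℝ => ((x, s) : SpaceTime)) (by fun_prop)).continuousWithinAt
  have i3 : IntegrableOn (fun s => retPot (fun p => q p.1 * P p) (x, s)) (Ioo ‖x - a‖ t) := by
    have : Continuous fun s : ℝ => retPot (fun p => q p.1 * P p) (x, s) :=
      hret.comp (by fun_prop)
    exact (this.integrableOn_Icc (a := ‖x - a‖) (b := t)).mono_set Ioo_subset_Icc_self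
  have e0 : timePrim P (x, t) = ∫ s in Ioo ‖x - a‖ t, P (x, s) := by
    rw [← integral_Ioc_eq_integral_Ioo, ← intervalIntegral.integral_of_le ht.le]
    have := intervalIntegral.integral_add_adjacent_intervals
      (intervalIntegrable_of_bound hP.measurable hP.bound x 0 ‖x - a‖)
      (intervalIntegrable_of_bound hP.measurable hP.bound x ‖x - a‖ t)
    rw [intervalIntegral_eq_zero_of_le hP.zero (norm_nonneg _) le_rfl, zero_add] at this
    exact this.symm
  have e1 : ∫ s in Ioo ‖x - a‖ t, P (x, s) = (∫ s in Ioo ‖x - a‖ t, ellAvgDeriv a q (x, s)) +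
      (∫ s in Ioo ‖x - a‖ t, ellAvg a (coneSource a q) (x, s)) +
      ∫ s in Ioo ‖x - a‖ t, retPot (fun p => q p.1 * P p) (x, s) := by
    rw [setIntegral_congr_fun measurableSet_Ioo fun s hs => hP.eqn (x, s) hs.1,
      integral_add (f := fun s => ellAvgDeriv a q (x, s) + ellAvg a (coneSource a q) (x, s))
        (i1.add i2) i3, integral_add i1 i2]
  -- The part of q r carried by the limit value of r on the cone; the rest of q r is q times the
  -- primitive of P.
  set F1 : SpaceTime → ℂ := (lightCone a).indicator fun p => q p.1 * coneVal a q p.1 with hF1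
  have hcv := hq.continuous_coneVal ha hh
  -- The factor 4π|y−a| in `coneSource` removes the same factor from the ellipsoidal weight and
  -- leaves the Newton kernel 1/(4π|x−y|) on the solid ellipsoid.
  have e2 : ∫ s in Ioo ‖x - a‖ t, ellAvg a (coneSource a q) (x, s) = retPot F1 (x, t) := by
    rw [setIntegral_ellAvg (hq.continuous_coneSource ha hh) (hq.norm_coneSource_le ha hh),
      ← integral_smul, ← integral_add_left_eq_self _ x]
    unfold retPot
    have hne := (measurePreserving_add_left (volume : Measure R3) x).quasiMeasurePreserving.ae
      (ae_ellipsoid_weight_ne_zero x a)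
    refine integral_congr_ae ?_
    filter_upwards [hne] with z hz
    have hz1 : ‖x - (x + z)‖ = ‖z‖ := by simp
    have hz0 : 0 < ‖z‖ := by
      rw [← hz1]; exact norm_pos_iff.2 (sub_ne_zero.2 hz.1.symm)
    have hza : 0 < ‖x + z - a‖ := norm_pos_iff.2 (sub_ne_zero.2 hz.2)
    simp only [hF1, indicator, mem_ofPred_eq, hz1, lightCone, lt_sub_iff_add_lt', coneSource]
    split_ifs
    · rw [smul_smul, smul_smul]
      congr 1
      have := Real.pi_pos
      field_simp
      norm_num
    · simp
  have e3 : ∫ s in Ioo ‖x - a‖ t, retPot (fun p => q p.1 * P p) (x, s) =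
      retPot (fun p => q p.1 * timePrim P p) (x, t) := by
    rw [setIntegral_retPot hl0 hqP hqPb]
    unfold retPot
    congr 1
    funext z
    congr 1
    exact setIntegral_mul_retarded hP.zero hP.measurable hP.bound q ht z
  have hF1m : Measurable F1 := by
    refine Measurable.indicator ?_ (isOpen_lightCone a).measurableSet
    have := hq.contDiff.continuous
    exact (by fun_prop : Continuous fun p : SpaceTime => q p.1 * coneVal a q p.1).measurable
  have hF1b : ∀ p, ‖F1 p‖ ≤ M * M * Real.exp (l * p.2) := by
    intro p
    simp only [hF1]
    by_cases hp : p ∈ lightCone a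
    · have ht : 0 < p.2 := (norm_nonneg _).trans_lt hp
      rw [indicator_of_mem hp, norm_mul]
      have h1 : 1 ≤ Real.exp (l * p.2) := Real.one_le_exp (by positivity)
      calc _ ≤ M * M := mul_le_mul (hq.bound _) (hq.norm_coneVal_le _) (norm_nonneg _) hM
        _ ≤ _ := le_mul_of_one_le_right (by positivity) h1
    · rw [indicator_of_notMem hp, norm_zero]; positivity
  have hTm : Measurable fun p : SpaceTime => q p.1 * timePrim P p :=
    (hqm.comp measurable_fst).mul
      (continuous_timePrim hl0.le hP.continuousOn hP.zero hP.bound).measurable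
  have hTb : ∀ p : SpaceTime, ‖q p.1 * timePrim P p‖ ≤ M * K * Real.exp (l * p.2) := fun p => by
    rw [norm_mul, mul_assoc]
    exact mul_le_mul (hq.bound _) (norm_timePrim_le hl hP.zero hP.bound hK p)
      (norm_nonneg _) hM
  have e4 : retPot (fun p => q p.1 * waveTail a q P p) (x, t) =
      retPot F1 (x, t) + retPot (fun p => q p.1 * timePrim P p) (x, t) := by
    unfold retPot
    rw [← integral_add (integrable_retarded hl0 hF1m hF1b (x, t))
      (integrable_retarded hl0 hTm hTb (x, t))]
    congr 1
    funext z
    rw [← smul_add]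
    congr 1
    by_cases hp : (x + z, t - ‖z‖) ∈ lightCone a
    · simp only [hF1, indicator_of_mem hp, waveTail_of_mem hp, fullTail]
      ring
    · simp only [hF1, indicator_of_notMem hp, waveTail_of_notMem hp, timePrim_of_notMem hP.zero hp]
      ring
  rw [e4, waveTail_of_mem hp, fullTail, e0, e1, hq.setIntegral_ellAvgDeriv ha hh ht, e2, e3]
  simp only
  ring

end Tail

/-! ### Interchanging observation point and scattering point -/

section Shear

/-- The map (x, z) ↦ (x+z, −z) exchanges the observation point x with the scattering point y = x+z.
Under it a retarded potential of one factor becomes an advanced potential of the other. -/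
lemma measurePreserving_shear : MeasurePreserving (fun p : R3 × R3 => (p.1 + p.2, -p.2))
    ((volume : Measure R3).prod volume) ((volume : Measure R3).prod volume) :=
  (measurePreserving_add_prod_neg (volume : Measure R3) volume).comp Measure.measurePreserving_swap

lemma integrable_shear {f : R3 × R3 → ℂ}
    (hf : Integrable (fun p : R3 × R3 => f (p.1 + p.2, -p.2)) (volume.prod volume)) :
    Integrable f (volume.prod volume) := by
  have h := measurePreserving_shear.integrable_comp_of_integrable hf
  refine h.congr (Eventually.of_forall fun p => ?_)
  simp

lemma integral_shear {f : R3 × R3 → ℂ}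
    (hf : Integrable (fun p : R3 × R3 => f (p.1 + p.2, -p.2)) (volume.prod volume)) :
    ∫ x : R3, ∫ z : R3, f (x, z) = ∫ y : R3, ∫ z : R3, f (y + z, -z) := by
  have h := integrable_shear hf
  rw [← integral_prod _ h, ← integral_prod (fun p : R3 × R3 => f (p.1 + p.2, -p.2)) hf]
  have h2 := integral_map measurePreserving_shear.measurable.aemeasurable
    (f := f) (by rw [measurePreserving_shear.map_eq]; exact h.aestronglyMeasurable)
  rwa [measurePreserving_shear.map_eq] at h2

end Shear

/-! ### Exponential moments in the cone -/

section Exponential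

lemma integrable_expIndicator {m : ℝ} (hm : 0 < m) :
    Integrable ((Ioi (0:ℝ)).indicator fun t => Real.exp (-(m * t))) := by
  rw [integrable_indicator_iff measurableSet_Ioi]
  simpa only [neg_mul] using exp_neg_integrableOn_Ioi 0 hm

lemma integrable_exp_neg_norm {m : ℝ} (hm : 0 < m) (a : R3) :
    Integrable fun x : R3 => Real.exp (-(m * ‖x - a‖)) := by
  have h0 : Integrable fun x : R3 => Real.exp (-(m * ‖x‖)) := by
    rw [integrable_fun_norm_addHaar (volume : Measure R3) (f := fun s => Real.exp (-(m * s)))]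
    have h2 := Real.integral_rpow_mul_exp_neg_mul_Ioi (a := 3) (r := m) (by norm_num) hm
    have h3 : IntegrableOn (fun t : ℝ => t ^ ((3:ℝ) - 1) * Real.exp (-(m * t))) (Ioi 0) := by
      refine Integrable.of_integral_ne_zero ?_
      rw [h2]
      have : 0 < Real.Gamma 3 := Real.Gamma_pos_of_pos (by norm_num)
      positivity
    refine h3.congr_fun (fun t ht => ?_) measurableSet_Ioi
    have : t ^ ((3:ℝ) - 1) = t ^ 2 := by
      rw [show (3:ℝ) - 1 = ((2:ℕ):ℝ) by norm_num, Real.rpow_natCast]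
    simp [this]
  exact h0.comp_sub_right a

lemma exp_mul_exp_neg (l m t : ℝ) :
    Real.exp (l * t) * Real.exp (-(m * t)) = Real.exp (-((m - l) * t)) := by
  rw [← Real.exp_add]; congr 1; ring

variable {a : R3} {r χ : SpaceTime → ℂ} {C D l m : ℝ}

/-- Inside the cone |x−a| < t, so half of the decay exp(−(m−l)t) can be spent on decay in x. This
gives integrability over space-time without compact support. -/
lemma norm_cone_mul_le (h0 : ∀ p ∉ lightCone a, r p = 0)
    (hb : ∀ p, ‖r p‖ ≤ C * Real.exp (l * p.2)) (hχ : ∀ p, ‖χ p‖ ≤ D * Real.exp (-(m * p.2)))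
    (hlm : l < m) (p : SpaceTime) :
    ‖r p * χ p‖ ≤ C * D * (Real.exp (-((m - l) / 2 * ‖p.1 - a‖)) *
      (Ioi (0:ℝ)).indicator (fun t => Real.exp (-((m - l) / 2 * t))) p.2) := by
  have hC : 0 ≤ C := by simpa using (norm_nonneg _).trans (hb 0)
  have hD : 0 ≤ D := by simpa using (norm_nonneg _).trans (hχ 0)
  by_cases hp : p ∈ lightCone a
  · have ht : 0 < p.2 := (norm_nonneg _).trans_lt hp
    rw [indicator_of_mem (show p.2 ∈ Ioi (0:ℝ) from ht), norm_mul]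
    calc _ ≤ (C * Real.exp (l * p.2)) * (D * Real.exp (-(m * p.2))) :=
          mul_le_mul (hb p) (hχ p) (norm_nonneg _) (by positivity)
      _ = C * D * Real.exp (-((m - l) * p.2)) := by rw [← exp_mul_exp_neg]; ring
      _ ≤ _ := by
        rw [← Real.exp_add]
        gcongr
        have hp' : ‖p.1 - a‖ < p.2 := hp
        nlinarith
  · rw [h0 p hp, zero_mul, norm_zero]
    have : 0 ≤ (Ioi (0:ℝ)).indicator (fun t => Real.exp (-((m - l) / 2 * t))) p.2 :=
      indicator_nonneg (fun _ _ => (Real.exp_pos _).le) _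
    positivity

lemma integrable_cone_mul (hm : Measurable r) (h0 : ∀ p ∉ lightCone a, r p = 0)
    (hb : ∀ p, ‖r p‖ ≤ C * Real.exp (l * p.2)) (hχm : Measurable χ)
    (hχ : ∀ p, ‖χ p‖ ≤ D * Real.exp (-(m * p.2))) (hlm : l < m) :
    Integrable fun p => r p * χ p := by
  have hml : 0 < (m - l) / 2 := by linarith
  exact (((integrable_exp_neg_norm hml a).mul_prod
    (integrable_expIndicator hml)).const_mul (C * D)).mono' (hm.mul hχm).aestronglyMeasurable
    (Eventually.of_forall fun p => norm_cone_mul_le h0 hb hχ hlm p)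

lemma norm_integral_cone_mul_le (h0 : ∀ p ∉ lightCone a, r p = 0)
    (hb : ∀ p, ‖r p‖ ≤ C * Real.exp (l * p.2)) {k : ℝ → ℂ} 
    (hk : ∀ t, ‖k t‖ ≤ D * Real.exp (-(m * t))) (hlm : l < m) (x : R3) :
    ‖∫ t, r (x, t) * k t‖ ≤ C * D * (Real.exp (-((m - l) / 2 * ‖x - a‖)) * (2 / (m - l))) := by
  have hml : 0 < (m - l) / 2 := by linarith
  refine (norm_integral_le_of_norm_le
    (((integrable_expIndicator hml).const_mul (Real.exp (-((m - l) / 2 * ‖x - a‖)))).const_mul (C * D))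
    (Eventually.of_forall fun t => norm_cone_mul_le (χ := fun p => k p.2) h0 hb
      (fun p => hk p.2) hlm (x, t))).trans (le_of_eq ?_)
  rw [integral_const_mul, integral_const_mul, integral_indicator measurableSet_Ioi]
  have := integral_exp_mul_Ioi (a := -((m - l) / 2)) (by linarith) 0
  simp only [neg_mul] at this
  rw [this]
  simp

end Exponential

/-! ### Pairing the regular part with source terms -/

section Tail

/-- `r` is the regular part of the solution of the point source problem with source at `a`. -/
structure IsTail (a : R3) (q : R3 → ℂ) (C l : ℝ) (r : SpaceTime → ℂ) : Prop where
  measurable : Measurable r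
  continuousOn : ContinuousOn r (lightCone a)
  zero : ∀ p ∉ lightCone a, r p = 0
  bound : ∀ p, ‖r p‖ ≤ C * Real.exp (l * p.2)
  eqn : ∀ p ∈ lightCone a, r p = ellAvg a q p + retPot (fun p => q p.1 * r p) p

variable {a : R3} {M h C D l m : ℝ} {q : R3 → ℂ} {r : SpaceTime → ℂ}

lemma IsTail.nonneg (hr : IsTail a q C l r) : 0 ≤ C := by
  simpa using (norm_nonneg _).trans (hr.bound 0)

lemma integral_ellAvg_mul {g : R3 → ℂ} {G : ℝ} (hg : Continuous g) (hG : ∀ y, ‖g y‖ ≤ G) (x : R3)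
    {k : ℝ → ℂ} (hkm : Measurable k) (hk : IntegrableOn k (Ioi ‖x - a‖)) :
    IntegrableOn (fun s => ellAvg a g (x, s) * k s) (Ioi ‖x - a‖) ∧
    ∫ s in Ioi ‖x - a‖, ellAvg a g (x, s) * k s = ∫ y, (4 * Real.pi * ‖x - y‖)⁻¹ •
      (4 * Real.pi * ‖y - a‖)⁻¹ • (g y * k (‖x - y‖ + ‖y - a‖)) := by
  have hF : Measurable fun y => g y * k (‖x - y‖ + ‖y - a‖) :=
    hg.measurable.mul (hkm.comp (by fun_prop))
  have hae1 : ∀ᵐ p : ℝ × R3 ∂((volume.restrict (Ioi ‖x - a‖)).prod sph), ‖x - a‖ < p.1 :=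
    (Measure.quasiMeasurePreserving_fst (μ := volume.restrict (Ioi ‖x - a‖)) (ν := sph)).ae
      (ae_restrict_mem measurableSet_Ioi)
  have hae2 : ∀ᵐ p : ℝ × R3 ∂((volume.restrict (Ioi ‖x - a‖)).prod sph), ‖p.2‖ = 1 :=
    (Measure.quasiMeasurePreserving_snd (μ := volume.restrict (Ioi ‖x - a‖)) (ν := sph)).ae
      sph_ae_norm
  have hint : Integrable (fun p : ℝ × R3 => (fun y => g y * k (‖x - y‖ + ‖y - a‖))
      (ellPt x a p.1 p.2)) ((volume.restrict (Ioi ‖x - a‖)).prod sph) := by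
    have h1 : Integrable (fun s : ℝ => G * ‖k s‖) (volume.restrict (Ioi ‖x - a‖)) :=
      hk.norm.const_mul G
    refine (h1.comp_fst sph).mono' (hF.comp measurable_ellPt).aestronglyMeasurable ?_
    filter_upwards [hae1, hae2] with p h1 h2
    simp only [norm_ellPt_sub_add h1 h2, norm_mul]
    gcongr
    exact hG _
  have hcongr : ∀ s, ‖x - a‖ < s → (∫ ω, g (ellPt x a s ω) *
      k (‖x - ellPt x a s ω‖ + ‖ellPt x a s ω - a‖) ∂sph) =
      (∫ ω, g (ellPt x a s ω) ∂sph) * k s := by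
    intro s hs
    rw [← integral_mul_const]
    refine integral_congr_ae ?_
    filter_upwards [sph_ae_norm] with ω hω
    rw [norm_ellPt_sub_add hs hω]
  have e := integral_ellipsoid (x := x) (a := a) hF.stronglyMeasurable
  rw [integral_prod _ hint] at e
  have hl : ∀ s ∈ Ioi ‖x - a‖, ellAvg a g (x, s) * k s = (32 * Real.pi ^ 2)⁻¹ •
      ∫ ω, g (ellPt x a s ω) * k (‖x - ellPt x a s ω‖ + ‖ellPt x a s ω - a‖) ∂sph := by
    intro s hs
    rw [hcongr s hs, ellAvg, smul_mul_assoc]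
  constructor
  · exact IntegrableOn.congr_fun (Integrable.smul ((32 * Real.pi ^ 2)⁻¹) hint.integral_prod_left)
      (fun s hs => by rw [hl s hs]; rfl) measurableSet_Ioi
  · rw [setIntegral_congr_fun measurableSet_Ioi hl, integral_smul, e, ← integral_smul]
    refine integral_congr_ae ?_
    filter_upwards [ae_ellipsoid_weight_ne_zero x a] with y hy
    have h3 : 0 < ‖x - y‖ := norm_pos_iff.2 (sub_ne_zero.2 hy.1.symm)
    have h4 : 0 < ‖y - a‖ := norm_pos_iff.2 (sub_ne_zero.2 hy.2)
    rw [smul_smul, smul_smul]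
    congr 1
    have := Real.pi_pos
    field_simp
    norm_num

/-- The time moments of the regular part. -/
theorem IsTail.integral_mul (hr : IsTail a q C l r) (hq : PotBound M h q) (hl : 0 < l)
    (hlm : l < m) {k : ℝ → ℂ} (hkm : Measurable k) (hk : ∀ t, ‖k t‖ ≤ D * Real.exp (-(m * t)))
    (x : R3) : ∫ t, r (x, t) * k t =
      (∫ z, (4 * Real.pi * ‖z‖)⁻¹ • (4 * Real.pi * ‖x + z - a‖)⁻¹ •
        (q (x + z) * k (‖z‖ + ‖x + z - a‖))) +
      ∫ z, (4 * Real.pi * ‖z‖)⁻¹ • (q (x + z) * ∫ t, r (x + z, t) * k (t + ‖z‖)) := by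
  have hM := hq.nonneg
  have hC := hr.nonneg
  have hD : 0 ≤ D := by simpa using (norm_nonneg _).trans (hk 0)
  have hml : 0 < m - l := by linarith
  have hm0 : 0 < m := by linarith
  have hcone : ∀ t, (x, t) ∈ lightCone a ↔ t ∈ Ioi ‖x - a‖ := fun t => Iff.rfl
  have hqr : Measurable fun p : SpaceTime => q p.1 * r p :=
    (hq.contDiff.continuous.measurable.comp measurable_fst).mul hr.measurable
  have hqr0 : ∀ p ∉ lightCone a, q p.1 * r p = 0 := fun p hp => by rw [hr.zero p hp, mul_zero]
  have hqrb : ∀ p : SpaceTime, ‖q p.1 * r p‖ ≤ M * C * Real.exp (l * p.2) := fun p => by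
    rw [norm_mul, mul_assoc]
    exact mul_le_mul (hq.bound _) (hr.bound _) (norm_nonneg _) hM
  have hkI : IntegrableOn k (Ioi ‖x - a‖) := by
    have h1 : IntegrableOn (fun t => D * Real.exp (-(m * t))) (Ioi ‖x - a‖) := by
      have := (exp_neg_integrableOn_Ioi ‖x - a‖ hm0).const_mul D
      simpa only [neg_mul, IntegrableOn] using this
    exact h1.mono' hkm.aestronglyMeasurable (Eventually.of_forall hk)
  have hprod : Integrable (Function.uncurry fun (t : ℝ) (z : R3) =>
      ((4 * Real.pi * ‖z‖)⁻¹ • (q (x + z) * r (x + z, t - ‖z‖))) * k t) (volume.prod volume) := by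
    have hmeas : Measurable (Function.uncurry fun (t : ℝ) (z : R3) =>
        ((4 * Real.pi * ‖z‖)⁻¹ • (q (x + z) * r (x + z, t - ‖z‖))) * k t) := by
      have h1 : Measurable fun p : ℝ × R3 => (4 * Real.pi * ‖p.2‖)⁻¹ := by fun_prop
      have h2 : Measurable fun p : ℝ × R3 => ((x + p.2, p.1 - ‖p.2‖) : SpaceTime) := by fun_prop
      exact (h1.smul (hqr.comp h2)).mul (hkm.comp measurable_fst)
    refine (((integrable_expIndicator hml).mul_prod (integrable_expKernel hl)).const_mul
      (M * C * D)).mono' hmeas.aestronglyMeasurable (Eventually.of_forall fun ⟨t, z⟩ => ?_)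
    simp only [Function.uncurry]
    have hK := expKernel_nonneg l z
    by_cases hp : (x + z, t - ‖z‖) ∈ lightCone a
    · have ht : 0 < t := by
        have h1 : ‖x + z - a‖ < t - ‖z‖ := hp
        have h2 := norm_nonneg (x + z - a)
        have h3 := norm_nonneg z
        linarith
      rw [indicator_of_mem (show t ∈ Ioi (0:ℝ) from ht), norm_mul]
      have h1 := norm_retarded_le hqrb (x, t) z
      calc _ ≤ (M * C * Real.exp (l * t) * expKernel l z) * (D * Real.exp (-(m * t))) :=
            mul_le_mul h1 (hk t) (norm_nonneg _) (by positivity)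
        _ = M * C * D * ((Real.exp (l * t) * Real.exp (-(m * t))) * expKernel l z) := by ring
        _ = _ := by rw [exp_mul_exp_neg]
    · rw [hr.zero _ hp, mul_zero, smul_zero, zero_mul, norm_zero]
      have : 0 ≤ (Ioi (0:ℝ)).indicator (fun t => Real.exp (-((m - l) * t))) t :=
        indicator_nonneg (fun _ _ => (Real.exp_pos _).le) _
      positivity
  have hret : ∀ t, retPot (fun p => q p.1 * r p) (x, t) * k t =
      ∫ z, ((4 * Real.pi * ‖z‖)⁻¹ • (q (x + z) * r (x + z, t - ‖z‖))) * k t := fun t => by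
    rw [integral_mul_const]; rfl
  have e1 : ∫ t, r (x, t) * k t = ∫ t in Ioi ‖x - a‖, r (x, t) * k t :=
    (setIntegral_eq_integral_of_forall_compl_eq_zero fun t ht => by
      rw [hr.zero (x, t) ht, zero_mul]).symm
  have e2 : ∫ t in Ioi ‖x - a‖, retPot (fun p => q p.1 * r p) (x, t) * k t =
      ∫ t, retPot (fun p => q p.1 * r p) (x, t) * k t :=
    setIntegral_eq_integral_of_forall_compl_eq_zero fun t ht => by
      rw [retPot_eq_zero hqr0 (p := (x, t)) ht, zero_mul]
  have i2 : Integrable fun t => retPot (fun p => q p.1 * r p) (x, t) * k t := by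
    simp only [hret]
    exact hprod.integral_prod_left
  obtain ⟨i1, e3⟩ := integral_ellAvg_mul (a := a) hq.contDiff.continuous hq.bound x hkm hkI
  rw [e1, setIntegral_congr_fun measurableSet_Ioi fun t ht => by
    rw [hr.eqn (x, t) ht, add_mul], integral_add i1 i2.integrableOn, e2, e3]
  congr 1
  · rw [← integral_add_left_eq_self _ x]
    simp
  · simp only [hret]
    rw [integral_integral_swap hprod]
    congr 1
    funext z
    simp only [smul_mul_assoc]
    rw [integral_smul]
    congr 1
    rw [← integral_const_mul, ← integral_add_right_eq_self _ ‖z‖]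
    simp only [add_sub_cancel_right, mul_assoc]

/-- The advanced potential of `χ`. -/
def advPot {E : Type*} [NormedAddCommGroup E] [NormedSpace ℝ E] (χ : SpaceTime → E)
    (p : SpaceTime) : E :=
  ∫ z : R3, (4 * Real.pi * ‖z‖)⁻¹ • χ (p.1 + z, p.2 + ‖z‖)

variable {χ : SpaceTime → ℂ}

lemma norm_advanced_le (hχ : ∀ p, ‖χ p‖ ≤ D * Real.exp (-(m * p.2))) (p : SpaceTime) (z : R3) :
    ‖(4 * Real.pi * ‖z‖)⁻¹ • χ (p.1 + z, p.2 + ‖z‖)‖ ≤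
      D * Real.exp (-(m * p.2)) * expKernel m z := by
  rw [norm_smul, Real.norm_of_nonneg (by positivity)]
  refine (mul_le_mul_of_nonneg_left (hχ _) (by positivity)).trans (le_of_eq ?_)
  unfold expKernel
  simp only
  rw [mul_add, neg_add, Real.exp_add]
  ring

lemma norm_advPot_le (hm : 0 < m) (hχ : ∀ p, ‖χ p‖ ≤ D * Real.exp (-(m * p.2))) (p : SpaceTime) :
    ‖advPot χ p‖ ≤ D / m ^ 2 * Real.exp (-(m * p.2)) := by
  refine (norm_integral_le_of_norm_le ((integrable_expKernel hm).const_mul _)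
    (Eventually.of_forall fun z => norm_advanced_le hχ p z)).trans (le_of_eq ?_)
  rw [integral_const_mul, integral_expKernel hm]
  ring

lemma measurable_advPot_integrand (hχm : Measurable χ) :
    Measurable fun p : SpaceTime × R3 =>
      (4 * Real.pi * ‖p.2‖)⁻¹ • χ (p.1.1 + p.2, p.1.2 + ‖p.2‖) := by
  have h1 : Measurable fun p : SpaceTime × R3 => (4 * Real.pi * ‖p.2‖)⁻¹ := by fun_prop
  have h2 : Measurable fun p : SpaceTime × R3 =>
      ((p.1.1 + p.2, p.1.2 + ‖p.2‖) : SpaceTime) := by fun_prop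
  exact h1.smul (hχm.comp h2)

lemma measurable_advPot (hχm : Measurable χ) : Measurable (advPot χ) :=
  ((measurable_advPot_integrand hχm).stronglyMeasurable.integral_prod_right).measurable

lemma integrable_advanced (hm : 0 < m) (hχm : Measurable χ)
    (hχ : ∀ p, ‖χ p‖ ≤ D * Real.exp (-(m * p.2))) (p : SpaceTime) :
    Integrable fun z : R3 => (4 * Real.pi * ‖z‖)⁻¹ • χ (p.1 + z, p.2 + ‖z‖) :=
  ((integrable_expKernel hm).const_mul _).mono'
    ((measurable_advPot_integrand hχm).comp measurable_prodMk_left).aestronglyMeasurable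
    (Eventually.of_forall fun z => norm_advanced_le hχ p z)

lemma integrable_inv_norm_mul_exp {m : ℝ} (hm : 0 < m) (a : R3) :
    Integrable fun y : R3 => (4 * Real.pi * ‖y - a‖)⁻¹ * Real.exp (-(m * ‖y - a‖)) :=
  (integrable_expKernel hm).comp_sub_right a

/-- Pairing of the regular part with a source term. -/
theorem IsTail.integral_mul_source (hr : IsTail a q C l r) (hq : PotBound M h q) (hl : 0 < l)
    (hlm : l < m) (hχm : Measurable χ) (hχ : ∀ p, ‖χ p‖ ≤ D * Real.exp (-(m * p.2))) :
    ∫ p, r p * χ p =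
      (∫ z, (4 * Real.pi * ‖z‖)⁻¹ • (q (a + z) * advPot χ (a + z, ‖z‖))) +
      ∫ p, r p * (q p.1 * advPot χ p) := by
  have hM := hq.nonneg
  have hC := hr.nonneg
  have hD : 0 ≤ D := by simpa using (norm_nonneg _).trans (hχ 0)
  have hm0 : 0 < m := by linarith
  have hml : 0 < (m - l) / 2 := by linarith
  have hqm := hq.contDiff.continuous.measurable
  have hb := norm_cone_mul_le hr.zero hr.bound hχ hlm
  rw [show (volume : Measure SpaceTime) = (volume : Measure R3).prod volume from rfl,
    integral_prod _ (integrable_cone_mul hr.measurable hr.zero hr.bound hχm hχ hlm)]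
  -- the contribution of the singular part
  set f₁ : R3 × R3 → ℂ := fun p => (4 * Real.pi * ‖p.2‖)⁻¹ • (4 * Real.pi * ‖p.1 + p.2 - a‖)⁻¹ •
    (q (p.1 + p.2) * χ (p.1, ‖p.2‖ + ‖p.1 + p.2 - a‖)) with hf₁
  have hf₁m : Measurable f₁ := by
    have h1 : Measurable fun p : R3 × R3 => (4 * Real.pi * ‖p.2‖)⁻¹ := by fun_prop
    have h2 : Measurable fun p : R3 × R3 => (4 * Real.pi * ‖p.1 + p.2 - a‖)⁻¹ := by fun_prop
    exact h1.smul (h2.smul ((hqm.comp (by fun_prop)).mul (hχm.comp (by fun_prop))))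
  have hf₁i : Integrable (fun p : R3 × R3 => f₁ (p.1 + p.2, -p.2)) (volume.prod volume) := by
    refine (((integrable_inv_norm_mul_exp hm0 a).mul_prod
      (integrable_expKernel hm0)).const_mul (M * D)).mono'
      (hf₁m.comp (by fun_prop)).aestronglyMeasurable (Eventually.of_forall fun ⟨y, z⟩ => ?_)
    simp only [hf₁, norm_neg, add_neg_cancel_right]
    rw [norm_smul, norm_smul, norm_mul, Real.norm_of_nonneg (by positivity),
      Real.norm_of_nonneg (by positivity)]
    have h1 := hχ (y + z, ‖z‖ + ‖y - a‖)
    calc _ ≤ (4 * Real.pi * ‖z‖)⁻¹ * ((4 * Real.pi * ‖y - a‖)⁻¹ *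
          (M * (D * Real.exp (-(m * (‖z‖ + ‖y - a‖)))))) := by
            gcongr
            exact hq.bound _
      _ = _ := by
        unfold expKernel
        rw [mul_add, neg_add, Real.exp_add]
        ring
  -- the contribution of the regular part
  set f₂ : R3 × R3 → ℂ := fun p => (4 * Real.pi * ‖p.2‖)⁻¹ •
    (q (p.1 + p.2) * ∫ t, r (p.1 + p.2, t) * χ (p.1, t + ‖p.2‖)) with hf₂
  have hf₂m : Measurable f₂ := by
    have h1 : Measurable fun p : R3 × R3 => (4 * Real.pi * ‖p.2‖)⁻¹ := by fun_prop
    have h2 : Measurable fun p : (R3 × R3) × ℝ =>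
        r (p.1.1 + p.1.2, p.2) * χ (p.1.1, p.2 + ‖p.1.2‖) :=
      (hr.measurable.comp (by fun_prop)).mul (hχm.comp (by fun_prop))
    exact h1.smul ((hqm.comp (by fun_prop)).mul
      h2.stronglyMeasurable.integral_prod_right.measurable)
  have hshift : ∀ (y z : R3) (t : ℝ), ‖χ (y, t + ‖z‖)‖ ≤
      (D * Real.exp (-(m * ‖z‖))) * Real.exp (-(m * t)) := fun y z t => by
    refine (hχ _).trans (le_of_eq ?_)
    simp only
    rw [mul_add, neg_add, Real.exp_add]
    ring
  have hf₂i : Integrable (fun p : R3 × R3 => f₂ (p.1 + p.2, -p.2)) (volume.prod volume) := by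
    refine (((integrable_exp_neg_norm hml a).mul_prod
      (integrable_expKernel hm0)).const_mul (M * C * D * (2 / (m - l)))).mono'
      (hf₂m.comp (by fun_prop)).aestronglyMeasurable (Eventually.of_forall fun ⟨y, z⟩ => ?_)
    simp only [hf₂, norm_neg, add_neg_cancel_right]
    rw [norm_smul, norm_mul, Real.norm_of_nonneg (by positivity)]
    have h1 := norm_integral_cone_mul_le (k := fun t => χ (y + z, t + ‖z‖)) hr.zero hr.bound
      (hshift (y + z) z) hlm y
    calc _ ≤ (4 * Real.pi * ‖z‖)⁻¹ * (M * (C * (D * Real.exp (-(m * ‖z‖))) *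
          (Real.exp (-((m - l) / 2 * ‖y - a‖)) * (2 / (m - l))))) := by
            gcongr
            exact hq.bound _
      _ = _ := by
        unfold expKernel
        ring
  have hmom : ∀ x, ∫ t, r (x, t) * χ (x, t) = (∫ z, f₁ (x, z)) + ∫ z, f₂ (x, z) := fun x =>
    hr.integral_mul hq hl hlm (hχm.comp measurable_prodMk_left) (fun t => hχ (x, t)) x
  simp only [hmom]
  -- After exchanging x and y, the z-integral acts on χ alone and is its advanced potential: along
  -- the cone in the first term, at the point of r in the second.
  rw [integral_add (integrable_shear hf₁i).integral_prod_left
    (integrable_shear hf₂i).integral_prod_left, integral_shear hf₁i, integral_shear hf₂i]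
  congr 1
  · rw [← integral_add_left_eq_self _ a]
    congr 1
    funext y
    simp only [hf₁, norm_neg, add_neg_cancel_right, add_sub_cancel_left, advPot]
    rw [← integral_const_mul, ← integral_smul]
    congr 1
    funext z
    rw [smul_comm, mul_smul_comm, add_comm ‖z‖]
  · have hadv : ∀ p : SpaceTime, ‖q p.1 * advPot χ p‖ ≤
        M * (D / m ^ 2) * Real.exp (-(m * p.2)) := fun p => by
      rw [norm_mul, mul_assoc]
      exact mul_le_mul (hq.bound _) (norm_advPot_le hm0 hχ p) (norm_nonneg _) hM
    rw [integral_prod (fun p : SpaceTime => r p * (q p.1 * advPot χ p))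
      (integrable_cone_mul hr.measurable hr.zero hr.bound
      ((hqm.comp measurable_fst).mul (measurable_advPot hχm)) hadv hlm)]
    congr 1
    funext y
    simp only [hf₂, norm_neg, add_neg_cancel_right]
    have hsw : Integrable (Function.uncurry fun (z : R3) (t : ℝ) =>
        r (y, t) * (q y * ((4 * Real.pi * ‖z‖)⁻¹ • χ (y + z, t + ‖z‖)))) (volume.prod volume) := by
      have hmeas : Measurable (Function.uncurry fun (z : R3) (t : ℝ) =>
          r (y, t) * (q y * ((4 * Real.pi * ‖z‖)⁻¹ • χ (y + z, t + ‖z‖)))) := by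
        have h1 : Measurable fun p : R3 × ℝ => (4 * Real.pi * ‖p.1‖)⁻¹ := by fun_prop
        exact (hr.measurable.comp (by fun_prop)).mul
          (measurable_const.mul (h1.smul (hχm.comp (by fun_prop))))
      refine (((integrable_expKernel hm0).mul_prod
        ((integrable_expIndicator hml).const_mul (Real.exp (-((m - l) / 2 * ‖y - a‖))))).const_mul
        (M * (C * D))).mono' hmeas.aestronglyMeasurable (Eventually.of_forall fun ⟨z, t⟩ => ?_)
      have h2 := norm_cone_mul_le (χ := fun p => χ (y + z, p.2 + ‖z‖)) hr.zero hr.bound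
        (fun p => hshift (y + z) z p.2) hlm (y, t)
      simp only [Function.uncurry]
      have e : r (y, t) * (q y * ((4 * Real.pi * ‖z‖)⁻¹ • χ (y + z, t + ‖z‖))) =
          (4 * Real.pi * ‖z‖)⁻¹ • (q y * (r (y, t) * χ (y + z, t + ‖z‖))) := by
        simp only [Complex.real_smul]; ring
      rw [e, norm_smul, norm_mul, Real.norm_of_nonneg (by positivity)]
      refine (mul_le_mul_of_nonneg_left (mul_le_mul (hq.bound y) h2 (norm_nonneg _) hM)
        (by positivity)).trans (le_of_eq ?_)
      simp only [expKernel]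
      ring
    have e1 : ∀ z, (4 * Real.pi * ‖z‖)⁻¹ • (q y * ∫ t, r (y, t) * χ (y + z, t + ‖z‖)) =
        ∫ t, r (y, t) * (q y * ((4 * Real.pi * ‖z‖)⁻¹ • χ (y + z, t + ‖z‖))) := fun z => by
      rw [← integral_const_mul, ← integral_smul]
      congr 1
      funext t
      simp only [Complex.real_smul]; ring
    simp only [e1]
    rw [integral_integral_swap hsw]
    congr 1
    funext t
    rw [integral_const_mul, integral_const_mul]
    rfl

end Tail

/-! ### The distributional solution and its point values -/

section WaveFunctional

variable {a : R3} {M h C l : ℝ} {q : R3 → ℂ} {r : SpaceTime → ℂ}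

/-- The functional given by the spherical wave from `a` plus the regular part `r`. -/
def waveFun (a : R3) (r χ : SpaceTime → ℂ) : ℂ :=
  (∫ z : R3, (4 * Real.pi * ‖z‖)⁻¹ • χ (a + z, ‖z‖)) + ∫ p, r p * χ p

/-- The measure `δ(t - |x - a|) / (4π |x - a|)`. -/
def coneMeasure (a : R3) : Measure SpaceTime :=
  ((volume : Measure R3).withDensity fun z => ENNReal.ofReal (4 * Real.pi * ‖z‖)⁻¹).map
    fun z => (a + z, ‖z‖)

instance (a : R3) : IsLocallyFiniteMeasure (coneMeasure a) := by
  have : IsFiniteMeasureOnCompacts (coneMeasure a) := by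
    refine ⟨fun K hK => ?_⟩
    obtain ⟨R, hR⟩ := hK.isBounded.exists_norm_le
    have hm : Measurable fun z : R3 => ((a + z, ‖z‖) : SpaceTime) := by fun_prop
    rw [coneMeasure, Measure.map_apply hm hK.measurableSet,
      withDensity_apply _ (hm hK.measurableSet)]
    have hsub : (fun z : R3 => ((a + z, ‖z‖) : SpaceTime)) ⁻¹' K ⊆ ball 0 (R + 1) := by
      intro z hz
      have := (norm_snd_le _).trans (hR _ hz)
      simp only [norm_norm] at this
      rw [mem_ball_zero_iff]
      linarith
    refine (lintegral_mono_set hsub).trans_lt ?_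
    have h1 := (integrableOn_inv_norm (R + 1)).const_mul (4 * Real.pi)⁻¹
    have h2 := h1.lintegral_lt_top
    refine lt_of_le_of_lt (le_of_eq ?_) h2
    refine lintegral_congr fun z => ?_
    rw [mul_inv]
  exact isLocallyFiniteMeasure_of_isFiniteMeasureOnCompacts

lemma integral_coneMeasure (χ : SpaceTime → ℂ) (hχ : Continuous χ) :
    ∫ p, χ p ∂(coneMeasure a) = ∫ z : R3, (4 * Real.pi * ‖z‖)⁻¹ • χ (a + z, ‖z‖) := by
  have hm : Measurable fun z : R3 => ((a + z, ‖z‖) : SpaceTime) := by fun_prop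
  rw [coneMeasure, integral_map hm.aemeasurable hχ.aestronglyMeasurable,
    integral_withDensity_eq_integral_toReal_smul (by fun_prop)
    (Eventually.of_forall fun _ => ENNReal.ofReal_lt_top)]
  refine integral_congr_ae (Eventually.of_forall fun z => ?_)
  simp only
  rw [ENNReal.toReal_ofReal (by positivity)]

lemma IsTail.locallyIntegrable (hr : IsTail a q C l r) : LocallyIntegrable r := by
  rw [locallyIntegrable_iff]
  intro K hK
  obtain ⟨R, hR⟩ := hK.isBounded.exists_norm_le
  refine Measure.integrableOn_of_bounded (M := C * Real.exp (|l| * R)) hK.measure_lt_top.ne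
    hr.measurable.aestronglyMeasurable ?_
  filter_upwards [ae_restrict_mem hK.measurableSet] with p hp
  refine (hr.bound p).trans ?_
  have h1 : |p.2| ≤ R := (norm_snd_le p).trans (hR p hp)
  have h2 : l * p.2 ≤ |l| * R := by
    calc l * p.2 ≤ |l * p.2| := le_abs_self _
      _ = |l| * |p.2| := abs_mul _ _
      _ ≤ _ := by gcongr
  have := hr.nonneg
  gcongr

/-- The solution of the point source problem as a distribution. -/
def waveDist (a : R3) (r : SpaceTime → ℂ) : Dist7 :=
  ((TestFunction.integralAgainstBilinCLM (ContinuousLinearMap.lsmul ℝ ℝ) (coneMeasure a)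
      (fun _ => (1 : ℂ)) : 𝓓^{7}((⊤ : Opens SpaceTime), ℝ) →L[ℝ] ℂ) +
    TestFunction.integralAgainstBilinCLM (ContinuousLinearMap.lsmul ℝ ℝ) volume r :
    𝓓^{7}((⊤ : Opens SpaceTime), ℝ) →L[ℝ] ℂ)

lemma IsTail.waveDist_apply (hr : IsTail a q C l r) (φ : 𝓓^{7}((⊤ : Opens SpaceTime), ℝ)) :
    waveDist a r φ = waveFun a r fun p => (φ p : ℂ) := by
  have h1 : waveDist a r φ = TestFunction.integralAgainstBilinCLM (ContinuousLinearMap.lsmul ℝ ℝ)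
      (coneMeasure a) (fun _ => (1 : ℂ)) φ + TestFunction.integralAgainstBilinCLM
      (ContinuousLinearMap.lsmul ℝ ℝ) volume r φ := rfl
  have hc : Continuous fun p => (φ p : ℂ) := Complex.continuous_ofReal.comp φ.continuous
  rw [h1, TestFunction.integralAgainstBilinCLM_eq_integral
    ((locallyIntegrable_const _).locallyIntegrableOn _),
    TestFunction.integralAgainstBilinCLM_eq_integral (hr.locallyIntegrable.locallyIntegrableOn _),
    waveFun, ← integral_coneMeasure _ hc]
  congr 1
  · simp
  · refine integral_congr_ae (Eventually.of_forall fun p => ?_)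
    simp [mul_comm]

lemma exists_exp_bound {E : Type*} [NormedAddCommGroup E] {χ : SpaceTime → E} (hχ : Continuous χ)
    (hc : HasCompactSupport χ) (m : ℝ) : ∃ D, ∀ p, ‖χ p‖ ≤ D * Real.exp (-(m * p.2)) := by
  have h1 : Continuous fun p : SpaceTime => Real.exp (m * p.2) * ‖χ p‖ := by fun_prop
  have h2 : HasCompactSupport fun p : SpaceTime => Real.exp (m * p.2) * ‖χ p‖ := hc.norm.mul_left
  obtain ⟨D, hD⟩ := h2.exists_bound_of_continuous h1
  refine ⟨D, fun p => ?_⟩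
  have := (le_abs_self _).trans (hD p)
  rw [Real.exp_neg, ← div_eq_mul_inv, le_div_iff₀ (Real.exp_pos _), mul_comm]
  exact this

lemma two_le_infty : (2 : WithTop ℕ∞) ≤ ((⊤ : ℕ∞) : WithTop ℕ∞) :=
  show ((2 : ℕ∞) : WithTop ℕ∞) ≤ ((⊤ : ℕ∞) : WithTop ℕ∞) from WithTop.coe_le_coe.2 le_top

lemma boxTest_apply (φ : 𝓓((⊤ : Opens SpaceTime), ℝ)) (p : SpaceTime) :
    boxTest φ p = box φ p := by
  have h1 : ∀ (ψ : 𝓓((⊤ : Opens SpaceTime), ℝ)) (v : SpaceTime),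
      ⇑(∂_{v} ψ : 𝓓((⊤ : Opens SpaceTime), ℝ)) = fun x => fderiv ℝ ψ x v := by
    intro ψ v
    funext x
    rw [TestFunction.lineDerivOp_eq_lineDerivCLM ℝ, TestFunction.lineDerivCLM_eq_fderivCLM,
      TestFunction.fderivCLM_apply_of_le _ (by simp)]
  have hφ2 : ContDiff ℝ 2 φ := φ.contDiff.of_le two_le_infty
  have h2 : ∀ (v : SpaceTime), (∂_{v} (∂_{v} φ) : 𝓓((⊤ : Opens SpaceTime), ℝ)) p = hess φ p v v := by
    intro v
    have hd : Differentiable ℝ (fderiv ℝ φ) :=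
      (hφ2.fderiv_right (m := 1) (by norm_num)).differentiable one_ne_zero
    rw [h1, h1]
    simp only
    rw [fderiv_clm_apply hd.differentiableAt (differentiableAt_const v)]
    simp
  unfold boxTest box
  rw [← h2, ← Finset.sum_congr rfl fun i _ => h2 (stdVec i, 0)]
  simp

/-- The wave equation for the distribution defined by a solution of the integral equation. -/
theorem IsTail.waveFun_box (hr : IsTail a q C l r) (hq : PotBound M h q) (hl : 0 < l)
    {φ : SpaceTime → ℝ} (hφ : ContDiff ℝ 2 φ) (hc : HasCompactSupport φ) :
    waveFun a r (fun p => (box φ p : ℂ)) = φ (a, 0) + waveFun a r (fun p => q p.1 * (φ p : ℂ)) := by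
  have hcb : HasCompactSupport (box φ) := hc.mono' (subset_closure.trans (tsupport_box_subset φ))
  have hχc : Continuous fun p => (box φ p : ℂ) :=
    Complex.continuous_ofReal.comp (continuous_box hφ)
  have hχs : HasCompactSupport fun p => (box φ p : ℂ) := hcb.comp_left Complex.ofReal_zero
  obtain ⟨D, hD⟩ := exists_exp_bound hχc hχs (l + 1)
  -- This identity makes the pairing formula with source `box φ` the weak form of the equation; the
  -- spherical wave itself contributes φ(a, 0).
  have hadv : ∀ p, advPot (fun p => (box φ p : ℂ)) p = φ p := by
    intro p
    have := integral_retarded_box hφ hc p.1 p.2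
    unfold advPot
    rw [← this, ← integral_complex_ofReal]
    simp
  have h1 := hr.integral_mul_source hq hl (lt_add_one l) hχc.measurable hD
  have h2 := integral_retarded_box hφ hc a 0
  unfold waveFun
  rw [h1, ← h2, ← integral_complex_ofReal]
  simp [hadv]

lemma integrable_cone_smul {χ : SpaceTime → ℂ} (hχ : Continuous χ) (hc : HasCompactSupport χ) :
    Integrable fun z : R3 => (4 * Real.pi * ‖z‖)⁻¹ • χ (a + z, ‖z‖) := by
  obtain ⟨D, hD⟩ := exists_exp_bound hχ hc 1
  simpa using integrable_advanced one_pos hχ.measurable hD (a, 0)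

lemma IsTail.integrable_mul (hr : IsTail a q C l r) {χ : SpaceTime → ℂ} (hχ : Continuous χ)
    (hc : HasCompactSupport χ) : Integrable fun p => r p * χ p := by
  obtain ⟨D, hD⟩ := exists_exp_bound hχ hc (l + 1)
  exact integrable_cone_mul hr.measurable hr.zero hr.bound hχ.measurable hD (lt_add_one l)

lemma IsTail.waveFun_add (hr : IsTail a q C l r) {χ ψ : SpaceTime → ℂ} (hχ : Continuous χ)
    (hc : HasCompactSupport χ) (hψ : Continuous ψ) (hc' : HasCompactSupport ψ) :
    waveFun a r (fun p => χ p + ψ p) = waveFun a r χ + waveFun a r ψ := by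
  unfold waveFun
  simp only [smul_add, mul_add]
  rw [integral_add (integrable_cone_smul hχ hc) (integrable_cone_smul hψ hc'),
    integral_add (hr.integrable_mul hχ hc) (hr.integrable_mul hψ hc')]
  ring

lemma waveFun_const_mul (c : ℂ) (χ : SpaceTime → ℂ) :
    waveFun a r (fun p => c * χ p) = c * waveFun a r χ := by
  unfold waveFun
  rw [mul_add, ← integral_const_mul, ← integral_const_mul]
  congr 1
  · congr 1; funext z; simp only [Complex.real_smul]; ring
  · congr 1; funext p; ring

theorem IsTail.isPointSourceSolution {Q : Potential} (hr : IsTail a Q C l r) (hq : PotBound M h Q)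
    (hl : 0 < l) : IsPointSourceSolution Q a (waveDist a r) := by
  constructor
  · intro φ
    have hpair : potentialPairing Q (waveDist a r) φ =
        waveFun a r fun p => Q p.1 * (φ p : ℂ) := by
      unfold potentialPairing
      rw [hr.waveDist_apply, hr.waveDist_apply, ← waveFun_const_mul]
      have hc : ∀ (g : R3 → ℝ) (hg : ContDiff ℝ 7 g), (Continuous fun p => (mulTest g hg φ p : ℂ)) ∧
          HasCompactSupport fun p => (mulTest g hg φ p : ℂ) := fun g hg =>
        ⟨Complex.continuous_ofReal.comp (mulTest g hg φ).continuous,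
          (mulTest g hg φ).hasCompactSupport.comp_left Complex.ofReal_zero⟩
      rw [← hr.waveFun_add (ψ := fun p => Complex.I * (mulTest _ Q.contDiff_im φ p : ℂ)) (hc _ _).1
        (hc _ _).2 (continuous_const.mul (hc _ _).1) (hc _ _).2.mul_left]
      congr 1
      funext p
      have e1 : mulTest _ Q.contDiff_re φ p = (Q p.1).re * φ p := rfl
      have e2 : mulTest _ Q.contDiff_im φ p = (Q p.1).im * φ p := rfl
      rw [e1, e2]
      conv_rhs => rw [← Complex.re_add_im (Q p.1)]
      push_cast
      ring
    have hbox : (fun p => (toTest7 (boxTest φ) p : ℂ)) = fun p => (box φ p : ℂ) := by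
      funext p
      exact congrArg _ (boxTest_apply φ p)
    rw [hpair, hr.waveDist_apply, hbox, hr.waveFun_box hq hl
      (φ.contDiff.of_le two_le_infty) φ.hasCompactSupport]
    ring
  · intro φ hφ
    have h0 : ∀ p : SpaceTime, 0 ≤ p.2 → φ p = 0 := fun p hp =>
      image_eq_zero_of_notMem_tsupport fun h => not_lt.2 hp (hφ h)
    rw [hr.waveDist_apply, waveFun, integral_eq_zero_of_ae, integral_eq_zero_of_ae, add_zero]
    · refine Eventually.of_forall fun p => ?_
      by_cases hp : p ∈ lightCone a
      · simp [h0 p ((norm_nonneg _).trans (le_of_lt hp))]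
      · simp [hr.zero p hp]
    · refine Eventually.of_forall fun z => ?_
      simp [h0 (a + z, ‖z‖) (norm_nonneg z)]

lemma IsTail.hasPointValue (hr : IsTail a q C l r) {p : SpaceTime} (hp : p ∈ lightCone a) :
    HasPointValue (waveDist a r) p (r p) := by
  refine ⟨lightCone a, r, isOpen_lightCone a, hp, hr.continuousOn, rfl, fun φ hφ => ?_⟩
  rw [hr.waveDist_apply, waveFun, integral_eq_zero_of_ae, zero_add]
  · refine integral_congr_ae (Eventually.of_forall fun p => ?_)
    simp [mul_comm]
  · refine Eventually.of_forall fun z => ?_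
    have : φ (a + z, ‖z‖) = 0 := image_eq_zero_of_notMem_tsupport fun h => by
      have := hφ h
      simp [lightCone] at this
    simp [this]

/-- The fundamental lemma of the calculus of variations on the common neighbourhood, followed by
continuity. It identifies the value selected by `pointValue`. -/
lemma HasPointValue.unique {U : Dist7} {p : SpaceTime} {c c' : ℂ} (hc : HasPointValue U p c)
    (hc' : HasPointValue U p c') : c = c' := by
  obtain ⟨V, f, hV, hpV, hf, rfl, hU⟩ := hc
  obtain ⟨V', f', hV', hpV', hf', rfl, hU'⟩ := hc'
  have hW : IsOpen (V ∩ V') := hV.inter hV'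
  have hd : ContinuousOn (fun y => f y - f' y) (V ∩ V') :=
    (hf.mono inter_subset_left).sub (hf'.mono inter_subset_right)
  have hae := hW.ae_eq_zero_of_integral_contDiff_smul_eq_zero (μ := (volume : Measure SpaceTime))
    (hd.locallyIntegrableOn hW.measurableSet) (fun g hg hgc hgs => by
      let φ : 𝓓^{7}((⊤ : Opens SpaceTime), ℝ) := ⟨g, hg.of_le (by exact_mod_cast (le_top : (7 : ℕ∞) ≤ ⊤)), hgc,
        fun _ _ => trivial⟩
      have h1 := hU φ (hgs.trans inter_subset_left)
      have h2 := hU' φ (hgs.trans inter_subset_right)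
      have hint : ∀ {k : SpaceTime → ℂ}, ContinuousOn k (V ∩ V') →
          Integrable fun y => g y • k y := by
        intro k hk
        rw [← integrableOn_iff_integrable_of_support_subset (s := tsupport g)
          (fun y hy => subset_tsupport g fun h0 => hy (by simp [h0]))]
        exact (hg.continuous.continuousOn.smul (hk.mono hgs)).integrableOn_compact hgc
      have h3 : ∫ y, g y • (f y - f' y) = (∫ y, g y • f y) - ∫ y, g y • f' y := by
        rw [← integral_sub (hint (hf.mono inter_subset_left)) (hint (hf'.mono inter_subset_right))]
        simp only [smul_sub]
      rw [h3]
      exact sub_eq_zero.2 (h1.symm.trans h2))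
  have hae' : (fun y => f y - f' y) =ᵐ[volume.restrict (V ∩ V')] fun _ => (0:ℂ) := by
    rw [EventuallyEq, ae_restrict_iff' hW.measurableSet]
    exact hae
  have := Measure.eqOn_open_of_ae_eq hae' hW hd continuousOn_const ⟨hpV, hpV'⟩
  exact sub_eq_zero.1 this

lemma HasPointValue.pointValue_eq {U : Dist7} {p : SpaceTime} {c : ℂ} (hc : HasPointValue U p c) :
    pointValue U p = c := by
  have h : ∃ c, HasPointValue U p c := ⟨c, hc⟩
  rw [pointValue, dif_pos h]
  exact h.choose_spec.unique hc

end WaveFunctional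

instance : (volume : Measure SpaceTime).IsAddHaarMeasure :=
  inferInstanceAs ((volume : Measure R3).prod (volume : Measure ℝ)).IsAddHaarMeasure

/-! ### Averages of translates and weighted derivative bounds -/

section Averages

variable {Z : Type*} [MeasurableSpace Z] {μ : Measure Z} {w : Z → ℝ} {T : Z → SpaceTime}
  {E : Type*} [NormedAddCommGroup E] [NormedSpace ℝ E] {φ : SpaceTime → E} {D m I : ℝ}

/-- The weighted average of the translates of `φ`. -/
def avg (μ : Measure Z) (w : Z → ℝ) (T : Z → SpaceTime) (φ : SpaceTime → E) (p : SpaceTime) : E :=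
  ∫ z, w z • φ (p + T z) ∂μ

lemma avg_comp_equiv {F : Type*} [NormedAddCommGroup F] [NormedSpace ℝ F] (L : E ≃ₗᵢ[ℝ] F)
    (φ : SpaceTime → E) (p : SpaceTime) : avg μ w T (fun p => L (φ p)) p = L (avg μ w T φ p) := by
  simp only [avg, ← map_smul]
  exact L.toContinuousLinearEquiv.integral_comp_comm (fun z => w z • φ (p + T z))

/-- The translations `T` with weight `w` have exponential moment at most `I`. -/
structure AvgData (μ : Measure Z) (w : Z → ℝ) (T : Z → SpaceTime) (m I : ℝ) : Prop where
  measurable_weight : Measurable w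
  measurable_shift : Measurable T
  nonneg : ∀ z, 0 ≤ w z
  integrable : Integrable (fun z => w z * Real.exp (-(m * (T z).2))) μ
  integral_le : ∫ z, w z * Real.exp (-(m * (T z).2)) ∂μ ≤ I

lemma AvgData.norm_integrand_le (h : AvgData μ w T m I)
    (hb : ∀ p, ‖φ p‖ ≤ D * Real.exp (-(m * p.2))) (p : SpaceTime) (z : Z) :
    ‖w z • φ (p + T z)‖ ≤ D * Real.exp (-(m * p.2)) * (w z * Real.exp (-(m * (T z).2))) := by
  rw [norm_smul, Real.norm_of_nonneg (h.nonneg z)]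
  refine (mul_le_mul_of_nonneg_left (hb _) (h.nonneg z)).trans (le_of_eq ?_)
  rw [Prod.snd_add, mul_add, neg_add, Real.exp_add]
  ring

lemma AvgData.aestronglyMeasurable (h : AvgData μ w T m I) (hφ : Continuous φ) (p : SpaceTime) :
    AEStronglyMeasurable (fun z => w z • φ (p + T z)) μ := by
  have h1 : StronglyMeasurable fun z => φ (p + T z) :=
    hφ.stronglyMeasurable.comp_measurable (measurable_const.add h.measurable_shift)
  exact (h.measurable_weight.stronglyMeasurable.smul h1).aestronglyMeasurable

lemma AvgData.integrable_integrand (h : AvgData μ w T m I) (hφ : Continuous φ)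
    (hb : ∀ p, ‖φ p‖ ≤ D * Real.exp (-(m * p.2))) (p : SpaceTime) :
    Integrable (fun z => w z • φ (p + T z)) μ :=
  (h.integrable.const_mul _).mono' (h.aestronglyMeasurable hφ p)
    (Eventually.of_forall fun z => h.norm_integrand_le hb p z)

lemma AvgData.norm_avg_le (h : AvgData μ w T m I)
    (hb : ∀ p, ‖φ p‖ ≤ D * Real.exp (-(m * p.2))) (p : SpaceTime) :
    ‖avg μ w T φ p‖ ≤ I * D * Real.exp (-(m * p.2)) := by
  have hD : 0 ≤ D := by simpa using (norm_nonneg _).trans (hb 0)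
  refine (norm_integral_le_of_norm_le (h.integrable.const_mul _)
    (Eventually.of_forall fun z => h.norm_integrand_le hb p z)).trans ?_
  rw [integral_const_mul]
  calc _ ≤ D * Real.exp (-(m * p.2)) * I := by gcongr; exact h.integral_le
    _ = _ := by ring

lemma AvgData.norm_integrand_le_of_mem_ball (h : AvgData μ w T m I) (hm : 0 ≤ m)
    (hb : ∀ p, ‖φ p‖ ≤ D * Real.exp (-(m * p.2))) {p p' : SpaceTime} (hp : p' ∈ ball p 1) (z : Z) :
    ‖w z • φ (p' + T z)‖ ≤
      D * Real.exp (-(m * (p.2 - 1))) * (w z * Real.exp (-(m * (T z).2))) := by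
  have hD : 0 ≤ D := by simpa using (norm_nonneg _).trans (hb 0)
  have h1 : p.2 - 1 ≤ p'.2 := by
    have h2 : ‖p' - p‖ < 1 := by simpa [dist_eq_norm] using hp
    have h3 := (norm_snd_le (p' - p)).trans_lt h2
    rw [Prod.snd_sub, Real.norm_eq_abs] at h3
    linarith [(abs_lt.1 h3).1]
  refine (h.norm_integrand_le hb p' z).trans ?_
  have := h.nonneg z
  gcongr

lemma AvgData.continuous_avg (h : AvgData μ w T m I) (hm : 0 ≤ m) (hφ : Continuous φ)
    (hb : ∀ p, ‖φ p‖ ≤ D * Real.exp (-(m * p.2))) : Continuous (avg μ w T φ) := by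
  refine continuous_iff_continuousAt.2 fun p => ?_
  refine continuousAt_of_dominated
    (bound := fun z => D * Real.exp (-(m * (p.2 - 1))) * (w z * Real.exp (-(m * (T z).2))))
    (Eventually.of_forall fun p' => h.aestronglyMeasurable hφ p') ?_ (h.integrable.const_mul _)
    (Eventually.of_forall fun z => by fun_prop)
  filter_upwards [ball_mem_nhds p one_pos] with p' hp'
  exact Eventually.of_forall fun z => h.norm_integrand_le_of_mem_ball hm hb hp' z

lemma AvgData.hasFDerivAt_avg (h : AvgData μ w T m I) (hm : 0 ≤ m) (hφ : ContDiff ℝ 1 φ)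
    (hb : ∀ p, ‖φ p‖ ≤ D * Real.exp (-(m * p.2)))
    (hb' : ∀ p, ‖fderiv ℝ φ p‖ ≤ D * Real.exp (-(m * p.2))) (p : SpaceTime) :
    HasFDerivAt (avg μ w T φ) (avg μ w T (fderiv ℝ φ) p) p := by
  refine hasFDerivAt_integral_of_dominated_of_fderiv_le
    (F := fun p z => w z • φ (p + T z)) (F' := fun p z => w z • fderiv ℝ φ (p + T z))
    (bound := fun z => D * Real.exp (-(m * (p.2 - 1))) * (w z * Real.exp (-(m * (T z).2))))
    (ball_mem_nhds p one_pos) (Eventually.of_forall fun p' => h.aestronglyMeasurable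
      hφ.continuous p') (h.integrable_integrand hφ.continuous hb p)
    (h.aestronglyMeasurable (hφ.continuous_fderiv one_ne_zero) p)
    (Eventually.of_forall fun z p' hp' => h.norm_integrand_le_of_mem_ball hm hb' hp' z)
    (h.integrable.const_mul _) (Eventually.of_forall fun z p' _ => ?_)
  have h1 := (hφ.differentiable one_ne_zero (p' + T z)).hasFDerivAt.comp p'
    ((hasFDerivAt_id p').add_const (T z))
  exact h1.const_smul (w z)

/-- The derivatives of `φ` up to order `n` are bounded by `D exp (-m t)`. -/
structure DerivBound (n : ℕ) (D m : ℝ) (φ : SpaceTime → E) : Prop where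
  contDiff : ContDiff ℝ n φ
  bound : ∀ j ≤ n, ∀ p, ‖iteratedFDeriv ℝ j φ p‖ ≤ D * Real.exp (-(m * p.2))

lemma DerivBound.nonneg {n : ℕ} (h : DerivBound n D m φ) : 0 ≤ D := by
  simpa using (norm_nonneg _).trans (h.bound 0 (Nat.zero_le _) 0)

/-- Translations commute with differentiation. The induction passes through the currying isometries,
which commute with the integral. The advanced potential and mollification are both instances. -/
lemma AvgData.iteratedFDeriv_avg (h : AvgData μ w T m I) (hm : 0 ≤ m) {n : ℕ}
    (hφ : DerivBound n D m φ) : ∀ j ≤ n,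
    iteratedFDeriv ℝ j (avg μ w T φ) = avg μ w T (iteratedFDeriv ℝ j φ) := by
  intro j
  induction j with
  | zero =>
    intro _
    funext p
    rw [iteratedFDeriv_zero_eq_comp, iteratedFDeriv_zero_eq_comp]
    exact (avg_comp_equiv (continuousMultilinearCurryFin0 ℝ SpaceTime E).symm φ p).symm
  | succ j ih =>
    intro hj
    have hc : ContDiff ℝ 1 (iteratedFDeriv ℝ j φ) :=
      hφ.contDiff.iteratedFDeriv_right (by norm_cast; omega)
    have hd : fderiv ℝ (avg μ w T (iteratedFDeriv ℝ j φ)) =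
        avg μ w T (fderiv ℝ (iteratedFDeriv ℝ j φ)) := by
      funext p
      exact (h.hasFDerivAt_avg hm hc (hφ.bound j (by omega))
        (fun p => by rw [norm_fderiv_iteratedFDeriv]; exact hφ.bound _ hj p) p).fderiv
    funext p
    rw [iteratedFDeriv_succ_eq_comp_left, iteratedFDeriv_succ_eq_comp_left, ih (by omega), hd]
    exact (avg_comp_equiv (μ := μ) (w := w) (T := T) (continuousMultilinearCurryLeftEquiv ℝ (fun _ : Fin (j + 1) =>
      SpaceTime) E).symm (fderiv ℝ (iteratedFDeriv ℝ j φ)) p).symm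

lemma AvgData.derivBound (h : AvgData μ w T m I) (hm : 0 ≤ m) {n : ℕ}
    (hφ : DerivBound n D m φ) : DerivBound n (I * D) m (avg μ w T φ) := by
  have hit := h.iteratedFDeriv_avg hm hφ
  constructor
  · rw [contDiff_nat_iff_continuous_differentiable]
    constructor
    · intro j hj
      have hj' : j ≤ n := by exact_mod_cast hj
      rw [hit j hj']
      exact h.continuous_avg hm (hφ.contDiff.continuous_iteratedFDeriv (by exact_mod_cast hj'))
        (hφ.bound j hj')
    · intro j hj
      have hj' : j < n := by exact_mod_cast hj
      rw [hit j hj'.le]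
      have hc : ContDiff ℝ 1 (iteratedFDeriv ℝ j φ) :=
        hφ.contDiff.iteratedFDeriv_right (by norm_cast; omega)
      exact fun p => (h.hasFDerivAt_avg hm hc (hφ.bound j hj'.le)
        (fun p => by rw [norm_fderiv_iteratedFDeriv]; exact hφ.bound _ hj' p) p).differentiableAt
  · intro j hj p
    rw [hit j hj]
    exact h.norm_avg_le (hφ.bound j hj) p

lemma DerivBound.mul {n : ℕ} {f g : SpaceTime → ℝ} {G : ℝ} (hf : DerivBound n D m f)
    (hg : ContDiff ℝ n g) (hG : ∀ j ≤ n, ∀ p, ‖iteratedFDeriv ℝ j g p‖ ≤ G) :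
    DerivBound n (2 ^ n * G * D) m fun p => g p * f p := by
  refine ⟨hg.mul hf.contDiff, fun j hj p => ?_⟩
  have hG0 : 0 ≤ G := (norm_nonneg _).trans (hG 0 (Nat.zero_le _) 0)
  have hD := hf.nonneg
  refine (norm_iteratedFDeriv_mul_le (hg.of_le (by exact_mod_cast hj))
    (hf.contDiff.of_le (by exact_mod_cast hj)) p le_rfl).trans ?_
  calc _ ≤ ∑ i ∈ Finset.range (j + 1), (j.choose i : ℝ) * (G * (D * Real.exp (-(m * p.2)))) := by
        refine Finset.sum_le_sum fun i hi => ?_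
        rw [mul_assoc]
        have hi' : i ≤ j := by simpa [Nat.lt_succ_iff] using hi
        gcongr
        · exact hG i (hi'.trans hj) p
        · exact hf.bound _ (by omega) p
    _ = 2 ^ j * (G * (D * Real.exp (-(m * p.2)))) := by
        rw [← Finset.sum_mul, ← Nat.cast_sum, Nat.sum_range_choose]
        norm_cast
    _ ≤ 2 ^ n * (G * (D * Real.exp (-(m * p.2)))) := by
        gcongr
        norm_num
    _ = _ := by ring

lemma exists_derivBound {n : ℕ} (hφ : ContDiff ℝ n φ) (hc : HasCompactSupport φ) (m : ℝ) :
    ∃ D, DerivBound n D m φ := by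
  have h : ∀ j : ℕ, ∃ D, 0 ≤ D ∧ (j ≤ n → ∀ p, ‖iteratedFDeriv ℝ j φ p‖ ≤
      D * Real.exp (-(m * p.2))) := by
    intro j
    by_cases hj : j ≤ n
    · obtain ⟨D, hD⟩ := exists_exp_bound (hφ.continuous_iteratedFDeriv (by exact_mod_cast hj))
        (hc.iteratedFDeriv j) m
      exact ⟨D, by simpa using (norm_nonneg _).trans (hD 0), fun _ => hD⟩
    · exact ⟨0, le_rfl, fun h => absurd h hj⟩
  choose D hD0 hD using h
  refine ⟨∑ j ∈ Finset.range (n + 1), D j, hφ, fun j hj p => (hD j hj p).trans ?_⟩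
  gcongr
  exact Finset.single_le_sum (f := D) (fun i _ => hD0 i) (Finset.mem_range.2 (by omega))

lemma avgData_retarded (hm : 0 < m) :
    AvgData (volume : Measure R3) (fun z => (4 * Real.pi * ‖z‖)⁻¹) (fun z => (z, ‖z‖)) m
      (1 / m ^ 2) where
  measurable_weight := by fun_prop
  measurable_shift := by fun_prop
  nonneg z := by positivity
  integrable := integrable_expKernel hm
  integral_le := (integral_expKernel hm).le

lemma advPot_eq_avg (φ : SpaceTime → E) :
    advPot φ = avg (volume : Measure R3) (fun z => (4 * Real.pi * ‖z‖)⁻¹) (fun z => (z, ‖z‖)) φ :=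
  rfl

end Averages

/-! ### Smooth approximation in weighted norms -/

section Mollification

lemma avgData_bump (f : ContDiffBump (0 : SpaceTime)) (m : ℝ) :
    ∃ I, AvgData (volume : Measure SpaceTime) (f.normed volume) (fun z => -z) m I := by
  refine ⟨_, ⟨f.continuous_normed.measurable, by fun_prop, fun z => f.nonneg_normed z, ?_, le_rfl⟩⟩
  have : Continuous fun z : SpaceTime => f.normed volume z * Real.exp (-(m * (-z).2)) := by
    have := f.continuous_normed (μ := (volume : Measure SpaceTime))
    fun_prop
  exact this.integrable_of_hasCompactSupport f.hasCompactSupport_normed.mul_right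

/-- Approximation of compactly supported functions in `C^n` by smooth ones. -/
lemma exists_smooth_approx {n : ℕ} {φ : SpaceTime → ℝ} (hφ : ContDiff ℝ n φ) {R : ℝ}
    (hR : tsupport φ ⊆ closedBall 0 R) {m ε : ℝ} (hm : 0 ≤ m) (hε : 0 < ε) :
    ∃ ψ : SpaceTime → ℝ, ContDiff ℝ (⊤ : ℕ∞) ψ ∧ tsupport ψ ⊆ closedBall 0 (R + 1) ∧
      DerivBound n ε m (fun p => φ p - ψ p) := by
  have hc : HasCompactSupport φ := HasCompactSupport.of_support_subset_isCompact
    (isCompact_closedBall (0 : SpaceTime) R) ((subset_tsupport φ).trans hR)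
  obtain ⟨D, hD⟩ := exists_derivBound hφ hc m
  -- The weight exp(−mt) is at least exp(−m(R+1)) on the enlarged ball, so uniform ε'-closeness
  -- gives ε-closeness in the weighted norm.
  set ε' := ε * Real.exp (-(m * (R + 1))) with hε'
  have hε'0 : 0 < ε' := by positivity
  have huc : ∀ j : ℕ, ∃ δ > 0, j ≤ n → ∀ p p', dist p p' < δ →
      dist (iteratedFDeriv ℝ j φ p) (iteratedFDeriv ℝ j φ p') < ε' := by
    intro j
    by_cases hj : j ≤ n
    · have := (hc.iteratedFDeriv (𝕜 := ℝ) j).uniformContinuous_of_continuous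
        (hφ.continuous_iteratedFDeriv (by exact_mod_cast hj))
      obtain ⟨δ, hδ, h⟩ := Metric.uniformContinuous_iff.1 this ε' hε'0
      exact ⟨δ, hδ, fun _ p p' => @h p p'⟩
    · exact ⟨1, one_pos, fun h => absurd h hj⟩
  choose δ hδ0 hδ using huc
  obtain ⟨d, hd0, hd1, hd⟩ : ∃ d > 0, d ≤ 1 ∧ ∀ j ≤ n, d ≤ δ j := by
    have hne : (Finset.range (n + 1)).Nonempty := ⟨0, by simp⟩
    refine ⟨min 1 ((Finset.range (n + 1)).inf' hne δ), ?_, min_le_left _ _, fun j hj =>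
      (min_le_right _ _).trans (Finset.inf'_le _ (Finset.mem_range.2 (by omega)))⟩
    rw [gt_iff_lt, lt_min_iff]
    exact ⟨one_pos, (Finset.lt_inf'_iff hne).2 fun j _ => hδ0 j⟩
  let f : ContDiffBump (0 : SpaceTime) := ⟨d / 2, d, by positivity, by linarith⟩
  obtain ⟨I, hf⟩ := avgData_bump f m
  set ψ := avg (volume : Measure SpaceTime) (f.normed volume) (fun z => -z) φ with hψ
  have hconv : ∀ {E : Type} [NormedAddCommGroup E] [NormedSpace ℝ E] (g : SpaceTime → E),
      avg (volume : Measure SpaceTime) (f.normed volume) (fun z => -z) g =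
      convolution (f.normed volume) g (ContinuousLinearMap.lsmul ℝ ℝ) volume := by
    intro E _ _ g
    funext p
    simp only [avg, convolution, ContinuousLinearMap.lsmul_apply, sub_eq_add_neg]
  have hψs : tsupport ψ ⊆ closedBall 0 (R + 1) := by
    refine closure_minimal (fun p hp => ?_) isClosed_closedBall
    by_contra hp'
    refine hp ?_
    simp only [hψ, avg]
    rw [integral_eq_zero_of_ae]
    refine Eventually.of_forall fun z => ?_
    by_cases hz : z ∈ Function.support (f.normed (volume : Measure SpaceTime))
    · rw [f.support_normed_eq, mem_ball_zero_iff] at hz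
      have hz : ‖z‖ < d := hz
      have h1 : φ (p + -z) = 0 := image_eq_zero_of_notMem_tsupport fun h => by
        have h2 := hR h
        rw [mem_closedBall_zero_iff] at h2 hp'
        have := norm_add_le (p + -z) z
        rw [neg_add_cancel_right] at this
        linarith
      simp [h1]
    · simp [Function.notMem_support.1 hz]
  refine ⟨ψ, ?_, hψs, hφ.sub (hf.derivBound hm hD).contDiff, fun j hj p => ?_⟩
  · rw [hψ, hconv]
    exact f.hasCompactSupport_normed.contDiff_convolution_left _ f.contDiff_normed
      hφ.continuous.locallyIntegrable
  · have hj' : ((j : ℕ) : WithTop ℕ∞) ≤ n := by exact_mod_cast hj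
    have hsub : iteratedFDeriv ℝ j (fun p => φ p - ψ p) p =
        iteratedFDeriv ℝ j φ p - iteratedFDeriv ℝ j ψ p :=
      iteratedFDeriv_sub_apply (hφ.of_le hj').contDiffAt
        ((hf.derivBound hm hD).contDiff.of_le hj').contDiffAt
    rw [hsub, hf.iteratedFDeriv_avg hm hD j hj, hconv]
    by_cases hp : p ∈ closedBall (0 : SpaceTime) (R + 1)
    · have h1 : dist (convolution (f.normed volume) (iteratedFDeriv ℝ j φ)
          (ContinuousLinearMap.lsmul ℝ ℝ) volume p) (iteratedFDeriv ℝ j φ p) ≤ ε' := by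
        refine ContDiffBump.dist_normed_convolution_le
          (hφ.continuous_iteratedFDeriv hj').aestronglyMeasurable fun p' hp' => ?_
        exact (hδ j hj p' p (lt_of_lt_of_le hp' (hd j hj))).le
      rw [dist_comm, dist_eq_norm] at h1
      refine h1.trans ?_
      rw [hε']
      have h2 : p.2 ≤ R + 1 := by
        have := (norm_snd_le p).trans (mem_closedBall_zero_iff.1 hp)
        exact (le_abs_self _).trans this
      gcongr
    · have h1 : iteratedFDeriv ℝ j φ p = 0 := by
        refine image_eq_zero_of_notMem_tsupport fun h => hp ?_
        have := hR (tsupport_iteratedFDeriv_subset j h)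
        exact closedBall_subset_closedBall (by linarith) this
      have h2 : iteratedFDeriv ℝ j ψ p = 0 :=
        image_eq_zero_of_notMem_tsupport fun h => hp (hψs (tsupport_iteratedFDeriv_subset j h))
      rw [← hconv, ← hf.iteratedFDeriv_avg hm hD j hj, ← hψ, h1, h2, sub_zero, norm_zero]
      positivity

end Mollification

/-! ### The advanced potential as an inverse of the wave operator -/

section AdvancedPotential

lemma advPot_sub {χ ψ : SpaceTime → ℝ} {D D' m : ℝ} (hm : 0 < m) (hχ : DerivBound 7 D m χ)
    (hψ : DerivBound 7 D' m ψ) (p : SpaceTime) :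
    advPot (fun p => χ p - ψ p) p = advPot χ p - advPot ψ p := by
  have hb : ∀ {D : ℝ} {χ : SpaceTime → ℝ}, DerivBound 7 D m χ →
      ∀ p, ‖χ p‖ ≤ D * Real.exp (-(m * p.2)) := fun h p => by
    simpa using h.bound 0 (by norm_num) p
  have h1 := (avgData_retarded hm).integrable_integrand hχ.contDiff.continuous (hb hχ) p
  have h2 := (avgData_retarded hm).integrable_integrand hψ.contDiff.continuous (hb hψ) p
  simp only [advPot_eq_avg, avg]
  rw [← integral_sub h1 h2]
  simp only [smul_sub]

lemma advPot_eq_zero {φ : SpaceTime → ℝ} {R : ℝ} (hR : tsupport φ ⊆ closedBall 0 R)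
    {p : SpaceTime} (hp : ∀ z : R3, R < ‖p.1 + z‖ ∨ R < p.2 + ‖z‖) : advPot φ p = 0 := by
  unfold advPot
  rw [integral_eq_zero_of_ae]
  refine Eventually.of_forall fun z => ?_
  have : φ (p.1 + z, p.2 + ‖z‖) = 0 := image_eq_zero_of_notMem_tsupport fun h => by
    have h1 := mem_closedBall_zero_iff.1 (hR h)
    rcases hp z with h2 | h2
    · exact absurd ((norm_fst_le _).trans h1) (not_le.2 h2)
    · exact absurd ((le_abs_self _).trans ((norm_snd_le _).trans h1)) (not_le.2 h2)
  simp [this]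

/-- Two differentiations under the integral move the wave operator onto φ, and
`integral_retarded_box` evaluates the result. -/
lemma box_advPot {φ : SpaceTime → ℝ} (hφ : ContDiff ℝ 2 φ) (hc : HasCompactSupport φ)
    (p : SpaceTime) : box (advPot φ) p = φ p := by
  have hA := avgData_retarded (m := 1) one_pos
  obtain ⟨D, hD⟩ := exists_derivBound (n := 2) (by exact_mod_cast hφ) hc 1
  have h1 : ContDiff ℝ 1 (fderiv ℝ φ) := hφ.fderiv_right (by norm_num)
  have b0 : ∀ p, ‖φ p‖ ≤ D * Real.exp (-(1 * p.2)) := fun p => by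
    simpa using hD.bound 0 (by norm_num) p
  have b1 : ∀ p, ‖fderiv ℝ φ p‖ ≤ D * Real.exp (-(1 * p.2)) := fun p => by
    simpa [norm_iteratedFDeriv_one] using hD.bound 1 (by norm_num) p
  have b2 : ∀ p, ‖hess φ p‖ ≤ D * Real.exp (-(1 * p.2)) := fun p => by
    have := hD.bound 2 le_rfl p
    rwa [← norm_iteratedFDeriv_fderiv (n := 1), norm_iteratedFDeriv_one] at this
  have e1 : fderiv ℝ (advPot φ) = advPot (fderiv ℝ φ) := by
    funext p
    exact (hA.hasFDerivAt_avg zero_le_one (hφ.of_le (by norm_num)) b0 b1 p).fderiv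
  have e2 : ∀ p, hess (advPot φ) p = advPot (hess φ) p := by
    intro p
    rw [hess, e1]
    exact (hA.hasFDerivAt_avg zero_le_one h1 b1 b2 p).fderiv
  have hi := hA.integrable_integrand (h1.continuous_fderiv one_ne_zero) b2 p
  have e3 : ∀ v w, hess (advPot φ) p v w =
      ∫ z : R3, (4 * Real.pi * ‖z‖)⁻¹ • hess φ (p.1 + z, p.2 + ‖z‖) v w := by
    intro v w
    rw [e2, advPot_eq_avg, avg, ContinuousLinearMap.integral_apply hi,
      ContinuousLinearMap.integral_apply (hi.apply_continuousLinearMap v)]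
    rfl
  have hi' : ∀ v w, Integrable fun z : R3 =>
      (4 * Real.pi * ‖z‖)⁻¹ • hess φ (p.1 + z, p.2 + ‖z‖) v w := fun v w =>
    (hi.apply_continuousLinearMap v).apply_continuousLinearMap w
  rw [box, e3]
  simp only [e3]
  rw [← integral_finsetSum _ fun i _ => hi' _ _,
    ← integral_sub (hi' _ _) (integrable_finsetSum _ fun i _ => hi' _ _)]
  rw [← integral_retarded_box hφ hc p.1 p.2]
  congr 1
  funext z
  rw [box, smul_sub, Finset.smul_sum]

/-- A compactly supported multiple of the advanced potential of a test function. -/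
def potTest (g : SpaceTime → ℝ) (hg : ContDiff ℝ 7 g) (hgc : HasCompactSupport g)
    (φ : 𝓓^{7}((⊤ : Opens SpaceTime), ℝ)) : 𝓓^{7}((⊤ : Opens SpaceTime), ℝ) where
  toFun p := g p * advPot φ p
  contDiff' := by
    obtain ⟨D, hD⟩ := exists_derivBound (n := 7) φ.contDiff φ.hasCompactSupport 1
    exact hg.mul ((avgData_retarded one_pos).derivBound zero_le_one hD).contDiff
  hasCompactSupport' := hgc.mul_right
  tsupport_subset' := fun _ _ => trivial

lemma potTest_apply {g : SpaceTime → ℝ} (hg : ContDiff ℝ 7 g) (hgc : HasCompactSupport g)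
    (φ : 𝓓^{7}((⊤ : Opens SpaceTime), ℝ)) (p : SpaceTime) :
    potTest g hg hgc φ p = g p * advPot φ p := rfl

end AdvancedPotential

/-! ### Uniqueness for distributions of order seven -/

section Uniqueness

/-- A distribution of order seven is bounded by the `C^7` norm on a fixed compact set. -/
lemma exists_dist_bound (W : 𝓓^{7}((⊤ : Opens SpaceTime), ℝ) →L[ℝ] ℂ) (R m : ℝ) (hm : 0 ≤ m) :
    ∃ C, 0 ≤ C ∧ ∀ (φ : 𝓓^{7}((⊤ : Opens SpaceTime), ℝ)) (D : ℝ), tsupport φ ⊆ closedBall 0 R →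
      DerivBound 7 D m φ → ‖W φ‖ ≤ C * D := by
  let K : Compacts SpaceTime := ⟨closedBall 0 R, isCompact_closedBall 0 R⟩
  have hK : (K : Set SpaceTime) ⊆ (⊤ : Opens SpaceTime) := fun _ _ => trivial
  let V := W.comp (TestFunction.ofSupportedInCLM ℝ hK)
  obtain ⟨s, C, hC⟩ := Seminorm.bound_of_continuous
    (ContDiffMapSupportedIn.withSeminorms ℝ SpaceTime ℝ 7 K) ((normSeminorm ℝ ℂ).comp V.toLinearMap)
    (V.continuous.norm)
  obtain ⟨-, hC⟩ := hC
  refine ⟨C * Real.exp (m * R), by positivity, fun φ D hφ hD => ?_⟩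
  let f : 𝓓^{7}_{K}(SpaceTime, ℝ) :=
    ContDiffMapSupportedIn.of_support_subset φ.contDiff ((subset_tsupport φ).trans hφ)
  have hf : TestFunction.ofSupportedIn hK f = φ := rfl
  have h1 : ‖W φ‖ ≤ C * (s.sup (ContDiffMapSupportedIn.seminorm ℝ SpaceTime ℝ 7 K)) f := hC f
  have hD0 := hD.nonneg
  have h2 : (s.sup (ContDiffMapSupportedIn.seminorm ℝ SpaceTime ℝ 7 K)) f ≤
      D * Real.exp (m * R) := by
    refine Seminorm.finset_sup_apply_le (by positivity) fun i _ => ?_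
    refine (ContDiffMapSupportedIn.seminorm_le_iff ℝ (by positivity) i f).2 fun hi p hp => ?_
    have hi' : i ≤ 7 := by exact_mod_cast hi
    refine (hD.bound i hi' p).trans ?_
    have h3 : |p.2| ≤ R := (norm_snd_le p).trans (mem_closedBall_zero_iff.1 hp)
    have h4 : -R ≤ p.2 := (abs_le.1 h3).1
    gcongr
    nlinarith
  calc ‖W φ‖ ≤ C * (D * Real.exp (m * R)) := h1.trans (by gcongr)
    _ = _ := by ring

/-- The time cutoff. -/
def timeCut (t : ℝ) : ℝ := Real.smoothTransition (t + 2)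

lemma contDiff_timeCut {n : WithTop ℕ∞} (hn : n ≤ (⊤ : ℕ∞)) : ContDiff ℝ n timeCut :=
  (Real.smoothTransition.contDiff.of_le hn).comp (contDiff_id.add contDiff_const)

/-- The spatial factor times a cutoff to bounded times. -/
def cutPot (g : R3 → ℝ) (R : ℝ) (p : SpaceTime) : ℝ :=
  g p.1 * (timeCut p.2 * Real.smoothTransition (R + 2 - p.2))

lemma contDiff_cutPot {g : R3 → ℝ} (hg : ContDiff ℝ 7 g) (R : ℝ) : ContDiff ℝ 7 (cutPot g R) := by
  have h7 : (7 : WithTop ℕ∞) ≤ (⊤ : ℕ∞) := by exact WithTop.coe_le_coe.2 (le_top : (7 : ℕ∞) ≤ ⊤)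
  exact (hg.comp contDiff_fst).mul (((contDiff_timeCut h7).comp contDiff_snd).mul
    ((Real.smoothTransition.contDiff.of_le h7).comp (contDiff_const.sub contDiff_snd)))

lemma timeCut_of_le {t : ℝ} (ht : t ≤ -2) : timeCut t = 0 :=
  Real.smoothTransition.zero_of_nonpos (by linarith)

lemma timeCut_of_ge {t : ℝ} (ht : -1 ≤ t) : timeCut t = 1 :=
  Real.smoothTransition.one_of_one_le (by linarith)

lemma tsupport_cutPot {g : R3 → ℝ} (hg : ∀ x, 1 < ‖x‖ → g x = 0) {R : ℝ} (hR : 0 ≤ R) :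
    tsupport (cutPot g R) ⊆ closedBall 0 (R + 2) := by
  refine closure_minimal (fun p hp => ?_) isClosed_closedBall
  rw [mem_closedBall_zero_iff]
  refine norm_prod_le_iff.2 ⟨?_, ?_⟩
  · by_contra h
    exact hp (by rw [cutPot, hg p.1 (by linarith), zero_mul])
  · rw [Real.norm_eq_abs, abs_le]
    constructor
    · by_contra h
      exact hp (by rw [cutPot, timeCut_of_le (by linarith)]; ring)
    · by_contra h
      exact hp (by
        rw [cutPot, Real.smoothTransition.zero_of_nonpos (show R + 2 - p.2 ≤ 0 by linarith)]; ring)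

lemma hasCompactSupport_cutPot {g : R3 → ℝ} (hg : ∀ x, 1 < ‖x‖ → g x = 0) {R : ℝ} (hR : 0 ≤ R) :
    HasCompactSupport (cutPot g R) :=
  HasCompactSupport.of_support_subset_isCompact (isCompact_closedBall _ _)
    ((subset_tsupport _).trans (tsupport_cutPot hg hR))

/-- The cutoff at late times is invisible because the advanced potential vanishes after the support
of φ. Only the cutoff at early times remains. -/
lemma cutPot_mul_advPot {g : R3 → ℝ} {φ : SpaceTime → ℝ} {R : ℝ}
    (hR : tsupport φ ⊆ closedBall 0 R) (p : SpaceTime) :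
    cutPot g R p * advPot φ p = g p.1 * (timeCut p.2 * advPot φ p) := by
  by_cases h : p.2 ≤ R + 1
  · rw [cutPot, Real.smoothTransition.one_of_one_le (by linarith)]
    ring
  · rw [advPot_eq_zero hR fun z => Or.inr (by linarith [norm_nonneg z])]
    ring

variable {Q : Potential} {a : R3}

lemma Potential.eq_zero_of_one_lt (Q : Potential) {x : R3} (hx : 1 < ‖x‖) : Q x = 0 :=
  image_eq_zero_of_notMem_tsupport fun h => by
    have h1 : x ∈ ball (0 : R3) 1 := Q.tsupport_subset h
    rw [mem_ball_zero_iff] at h1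
    linarith

/-- `W` is a solution of the homogeneous problem with zero initial data. -/
structure IsHomogeneousSolution (Q : Potential) (W : 𝓓^{7}((⊤ : Opens SpaceTime), ℝ) →L[ℝ] ℂ) :
    Prop where
  eqn : ∀ φ : 𝓓((⊤ : Opens SpaceTime), ℝ), W (toTest7 (boxTest φ)) =
    W (mulTest _ Q.contDiff_re φ) + Complex.I * W (mulTest _ Q.contDiff_im φ)
  zero : ∀ φ : 𝓓^{7}((⊤ : Opens SpaceTime), ℝ), tsupport φ ⊆ {p : SpaceTime | p.2 < 0} → W φ = 0

lemma Potential.re_eq_zero (Q : Potential) (x : R3) (hx : 1 < ‖x‖) : (Q x).re = 0 := by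
  rw [Q.eq_zero_of_one_lt hx, Complex.zero_re]

lemma Potential.im_eq_zero (Q : Potential) (x : R3) (hx : 1 < ‖x‖) : (Q x).im = 0 := by
  rw [Q.eq_zero_of_one_lt hx, Complex.zero_im]

/-- The right hand side of the integral equation for the real part of the potential. -/
def rePot (Q : Potential) {R : ℝ} (hR : 0 ≤ R) (φ : 𝓓^{7}((⊤ : Opens SpaceTime), ℝ)) :
    𝓓^{7}((⊤ : Opens SpaceTime), ℝ) :=
  potTest _ (contDiff_cutPot Q.contDiff_re R) (hasCompactSupport_cutPot Q.re_eq_zero hR) φ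

/-- The right hand side of the integral equation for the imaginary part of the potential. -/
def imPot (Q : Potential) {R : ℝ} (hR : 0 ≤ R) (φ : 𝓓^{7}((⊤ : Opens SpaceTime), ℝ)) :
    𝓓^{7}((⊤ : Opens SpaceTime), ℝ) :=
  potTest _ (contDiff_cutPot Q.contDiff_im R) (hasCompactSupport_cutPot Q.im_eq_zero hR) φ

/-- The integral equation for smooth test functions. -/
lemma IsHomogeneousSolution.eqn_smooth {W : 𝓓^{7}((⊤ : Opens SpaceTime), ℝ) →L[ℝ] ℂ}
    (hW : IsHomogeneousSolution Q W) (φ : 𝓓((⊤ : Opens SpaceTime), ℝ)) {R : ℝ} (hR0 : 0 ≤ R)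
    (hR : tsupport φ ⊆ closedBall 0 R) :
    W (toTest7 φ) = W (rePot Q hR0 (toTest7 φ)) + Complex.I * W (imPot Q hR0 (toTest7 φ)) := by
  have hsm : ContDiff ℝ (⊤ : ℕ∞) (advPot φ) := by
    rw [contDiff_infty]
    intro n
    obtain ⟨D, hD⟩ := exists_derivBound (n := n)
      (φ.contDiff.of_le (by exact_mod_cast (le_top : (n : ℕ∞) ≤ ⊤))) φ.hasCompactSupport 1
    exact ((avgData_retarded one_pos).derivBound zero_le_one hD).contDiff
  have hsupp : Function.support (fun p : SpaceTime => timeCut p.2 * advPot φ p) ⊆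
      closedBall 0 (2 * R + 2) := by
    intro p hp
    by_contra h
    refine hp ?_
    simp only
    by_cases h2 : p.2 ≤ -2
    · rw [timeCut_of_le h2, zero_mul]
    · rw [advPot_eq_zero hR, mul_zero]
      intro z
      by_contra hz
      push Not at hz
      refine h (mem_closedBall_zero_iff.2 (norm_prod_le_iff.2 ⟨?_, ?_⟩))
      · have := norm_sub_le (p.1 + z) z
        rw [add_sub_cancel_right] at this
        linarith [hz.1, hz.2]
      · rw [Real.norm_eq_abs, abs_le]
        constructor <;> linarith [norm_nonneg z, hz.2]
  let ψ : 𝓓((⊤ : Opens SpaceTime), ℝ) :=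
    ⟨fun p => timeCut p.2 * advPot φ p, ((contDiff_timeCut le_rfl).comp contDiff_snd).mul hsm,
      HasCompactSupport.of_support_subset_isCompact (isCompact_closedBall _ _) hsupp,
      fun _ _ => trivial⟩
  have hψ : ∀ p, ψ p = timeCut p.2 * advPot φ p := fun _ => rfl
  -- For t > −1 the cutoff is 1 and `boxTest ψ` equals φ, so the difference lives where W vanishes.
  have h1 : toTest7 φ - toTest7 (boxTest ψ) ∈ {χ : 𝓓^{7}((⊤ : Opens SpaceTime), ℝ) |
      tsupport χ ⊆ {p : SpaceTime | p.2 < 0}} := by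
    have hcl : IsClosed {p : SpaceTime | p.2 ≤ -1} := isClosed_le continuous_snd continuous_const
    refine (closure_minimal (fun p hp => ?_) hcl).trans fun p (hp : p.2 ≤ -1) => 
      show p.2 < 0 by linarith
    by_contra h
    have h : -1 < p.2 := not_le.1 h
    refine hp ?_
    have e : (toTest7 φ - toTest7 (boxTest ψ)) p = φ p - boxTest ψ p := rfl
    rw [e, boxTest_apply]
    have hev : (ψ : SpaceTime → ℝ) =ᶠ[𝓝 p] advPot φ := by
      filter_upwards [(isOpen_lt continuous_const continuous_snd).mem_nhds h] with p' hp'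
      have hp' : -1 < p'.2 := hp'
      rw [hψ, timeCut_of_ge hp'.le, one_mul]
    have hh : hess ψ p = hess (advPot φ) p := hev.fderiv.fderiv_eq
    rw [box, hh]
    have := box_advPot (φ.contDiff.of_le two_le_infty) φ.hasCompactSupport p
    rw [box] at this
    rw [this, sub_self]
  have h2 := hW.zero _ h1
  rw [map_sub, sub_eq_zero, hW.eqn ψ] at h2
  rw [h2]
  congr 3
  · ext p
    exact (cutPot_mul_advPot (g := fun x => (Q x).re) hR p).symm
  · ext p
    exact (cutPot_mul_advPot (g := fun x => (Q x).im) hR p).symm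

/-- In space the potential confines the support, at early times the cutoff does, at late times the
support of φ does. The ball thus reproduces itself, and one continuity bound of W serves every step
of the iteration. -/
lemma tsupport_potTest_cutPot {g : R3 → ℝ} (hg : ContDiff ℝ 7 g) (hg0 : ∀ x, 1 < ‖x‖ → g x = 0)
    {R R' : ℝ} (hR : 0 ≤ R) (hR' : 2 ≤ R') {φ : 𝓓^{7}((⊤ : Opens SpaceTime), ℝ)}
    (hφ : tsupport φ ⊆ closedBall 0 R') :
    tsupport (potTest _ (contDiff_cutPot hg R) (hasCompactSupport_cutPot hg0 hR) φ) ⊆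
      closedBall 0 R' := by
  refine closure_minimal (fun p hp => ?_) isClosed_closedBall
  rw [mem_closedBall_zero_iff]
  refine norm_prod_le_iff.2 ⟨?_, ?_⟩
  · by_contra h
    exact hp (by rw [potTest_apply, cutPot, hg0 p.1 (by linarith)]; ring)
  · rw [Real.norm_eq_abs, abs_le]
    constructor
    · by_contra h
      exact hp (by rw [potTest_apply, cutPot, timeCut_of_le (by linarith)]; ring)
    · by_contra h
      exact hp (by
        rw [potTest_apply, advPot_eq_zero hφ fun z => Or.inr (by linarith [norm_nonneg z])]; ring)

lemma exists_iteratedFDeriv_bound {g : SpaceTime → ℝ} (hg : ContDiff ℝ 7 g)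
    (hgc : HasCompactSupport g) : ∃ G, ∀ j ≤ 7, ∀ p, ‖iteratedFDeriv ℝ j g p‖ ≤ G := by
  obtain ⟨D, hD⟩ := exists_derivBound (n := 7) hg hgc 0
  exact ⟨D, fun j hj p => by simpa using hD.bound j hj p⟩

/-- Uniqueness for the homogeneous problem. -/
theorem IsHomogeneousSolution.eq_zero {W : 𝓓^{7}((⊤ : Opens SpaceTime), ℝ) →L[ℝ] ℂ}
    (hW : IsHomogeneousSolution Q W) (φ : 𝓓^{7}((⊤ : Opens SpaceTime), ℝ)) : W φ = 0 := by
  obtain ⟨R₀, hR₀⟩ := φ.hasCompactSupport.isCompact.isBounded.subset_closedBall (0 : SpaceTime)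
  set R : ℝ := max 2 R₀ with hRdef
  have hR2 : 2 ≤ R := le_max_left _ _
  -- Smoothing enlarges supports by one, so the cutoffs are adapted to the ball of radius R + 1.
  have hR1 : 0 ≤ R + 1 := by linarith
  have hφR : tsupport φ ⊆ closedBall 0 R :=
    hR₀.trans (closedBall_subset_closedBall (le_max_right _ _))
  obtain ⟨G₁, hG₁⟩ := exists_iteratedFDeriv_bound (contDiff_cutPot Q.contDiff_re (R + 1))
    (hasCompactSupport_cutPot Q.re_eq_zero hR1)
  obtain ⟨G₂, hG₂⟩ := exists_iteratedFDeriv_bound (contDiff_cutPot Q.contDiff_im (R + 1))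
    (hasCompactSupport_cutPot Q.im_eq_zero hR1)
  have hG₁0 : 0 ≤ G₁ := (norm_nonneg _).trans (hG₁ 0 (by norm_num) 0)
  have hG₂0 : 0 ≤ G₂ := (norm_nonneg _).trans (hG₂ 0 (by norm_num) 0)
  -- The Leibniz rule costs 2⁷ and the advanced potential gains 1/m². With this m the operations for
  -- the real and imaginary parts together have norm at most 1/2.
  set m : ℝ := 1 + 2 ^ 8 * (G₁ + G₂) with hm
  have hm1 : 1 ≤ m := by rw [hm]; nlinarith
  have hm0 : 0 < m := by linarith
  have hsmall : 2 ^ 7 * G₁ * (1 / m ^ 2) + 2 ^ 7 * G₂ * (1 / m ^ 2) ≤ 1 / 2 := by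
    rw [← add_mul, mul_one_div, div_le_div_iff₀ (by positivity) (by norm_num)]
    nlinarith
  have hre : ∀ (χ : 𝓓^{7}((⊤ : Opens SpaceTime), ℝ)) (D : ℝ), DerivBound 7 D m χ →
      DerivBound 7 (2 ^ 7 * G₁ * (1 / m ^ 2) * D) m (rePot Q hR1 χ) := fun χ D hD => by
    have := ((avgData_retarded hm0).derivBound hm0.le hD).mul
      (contDiff_cutPot Q.contDiff_re (R + 1)) hG₁
    rwa [← mul_assoc] at this
  have him : ∀ (χ : 𝓓^{7}((⊤ : Opens SpaceTime), ℝ)) (D : ℝ), DerivBound 7 D m χ →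
      DerivBound 7 (2 ^ 7 * G₂ * (1 / m ^ 2) * D) m (imPot Q hR1 χ) := fun χ D hD => by
    have := ((avgData_retarded hm0).derivBound hm0.le hD).mul
      (contDiff_cutPot Q.contDiff_im (R + 1)) hG₂
    rwa [← mul_assoc] at this
  obtain ⟨C₁, hC₁0, hC₁⟩ := exists_dist_bound W (R + 1) m hm0.le
  have hsub : ∀ {s t : ℝ}, s ≤ t → closedBall (0 : SpaceTime) s ⊆ closedBall 0 t := fun h =>
    closedBall_subset_closedBall h
  have hcomb : ∀ {R' C : ℝ}, 2 ≤ R' → 0 ≤ C →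
      (∀ (ψ : 𝓓^{7}((⊤ : Opens SpaceTime), ℝ)) (D' : ℝ), tsupport ψ ⊆ closedBall 0 R' →
        DerivBound 7 D' m ψ → ‖W ψ‖ ≤ C * D') →
      ∀ (χ : 𝓓^{7}((⊤ : Opens SpaceTime), ℝ)) (D : ℝ), tsupport χ ⊆ closedBall 0 R' →
        DerivBound 7 D m χ →
      ‖W (rePot Q hR1 χ) + Complex.I * W (imPot Q hR1 χ)‖ ≤ C / 2 * D := by
    intro R' C hR' hC0 hC χ D hχ hD
    have h1 := hC (rePot Q hR1 χ) _ (tsupport_potTest_cutPot Q.contDiff_re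
      Q.re_eq_zero hR1 hR' hχ) (hre χ D hD)
    have h2 := hC (imPot Q hR1 χ) _ (tsupport_potTest_cutPot Q.contDiff_im
      Q.im_eq_zero hR1 hR' hχ) (him χ D hD)
    have hD0 := hD.nonneg
    refine (norm_add_le _ _).trans ?_
    rw [norm_mul, Complex.norm_I, one_mul]
    calc _ ≤ C * (2 ^ 7 * G₁ * (1 / m ^ 2) * D) + C * (2 ^ 7 * G₂ * (1 / m ^ 2) * D) :=
          add_le_add h1 h2
      _ = C * D * (2 ^ 7 * G₁ * (1 / m ^ 2) + 2 ^ 7 * G₂ * (1 / m ^ 2)) := by ring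
      _ ≤ C * D * (1 / 2) := by gcongr
      _ = _ := by ring
  -- the integral equation for test functions of class `C^7`
  have heq : ∀ χ : 𝓓^{7}((⊤ : Opens SpaceTime), ℝ), tsupport χ ⊆ closedBall 0 R →
      W χ = W (rePot Q hR1 χ) + Complex.I * W (imPot Q hR1 χ) := by
    intro χ hχ
    rw [← sub_eq_zero, ← norm_le_zero_iff]
    refine le_of_forall_pos_le_add fun ε hε => ?_
    rw [zero_add]
    obtain ⟨ψ, hψ, hψs, hψd⟩ := exists_smooth_approx (n := 7) χ.contDiff hχ hm0.le
      (show 0 < ε / (2 * (C₁ + 1)) by positivity)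
    let Ψ : 𝓓((⊤ : Opens SpaceTime), ℝ) := ⟨ψ, hψ, HasCompactSupport.of_support_subset_isCompact
      (isCompact_closedBall _ _) ((subset_tsupport _).trans hψs), fun _ _ => trivial⟩
    have e1 := hW.eqn_smooth Ψ hR1 hψs
    have hd : DerivBound 7 (ε / (2 * (C₁ + 1))) m (χ - toTest7 Ψ) := hψd
    have hadv : ∀ p, advPot (χ - toTest7 Ψ) p = advPot χ p - advPot (toTest7 Ψ) p := by
      obtain ⟨D₁, hD₁⟩ := exists_derivBound (n := 7) χ.contDiff χ.hasCompactSupport m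
      obtain ⟨D₂, hD₂⟩ := exists_derivBound (n := 7) (toTest7 Ψ).contDiff
        (toTest7 Ψ).hasCompactSupport m
      exact fun p => advPot_sub hm0 hD₁ hD₂ p
    have e2 : rePot Q hR1 (χ - toTest7 Ψ) = rePot Q hR1 χ - rePot Q hR1 (toTest7 Ψ) := by
      ext p
      change _ * advPot (χ - toTest7 Ψ) p = _ * advPot χ p - _ * advPot (toTest7 Ψ) p
      rw [hadv, mul_sub]
    have e3 : imPot Q hR1 (χ - toTest7 Ψ) = imPot Q hR1 χ - imPot Q hR1 (toTest7 Ψ) := by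
      ext p
      change _ * advPot (χ - toTest7 Ψ) p = _ * advPot χ p - _ * advPot (toTest7 Ψ) p
      rw [hadv, mul_sub]
    have hs : tsupport (χ - toTest7 Ψ) ⊆ closedBall 0 (R + 1) := by
      refine closure_minimal (fun p hp => ?_) isClosed_closedBall
      by_contra h
      refine hp ?_
      have h1 : χ p = 0 := image_eq_zero_of_notMem_tsupport fun h' =>
        h (hsub (by linarith) (hχ h'))
      have h2 : ψ p = 0 := image_eq_zero_of_notMem_tsupport fun h' =>
        h (hψs h')
      change χ p - ψ p = 0
      rw [h1, h2, sub_zero]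
    have e4 : W χ - (W (rePot Q hR1 χ) + Complex.I * W (imPot Q hR1 χ)) = W (χ - toTest7 Ψ) -
        (W (rePot Q hR1 (χ - toTest7 Ψ)) + Complex.I * W (imPot Q hR1 (χ - toTest7 Ψ))) := by
      rw [e2, e3, map_sub, map_sub, map_sub, e1]
      ring
    rw [e4]
    have b1 := hC₁ _ _ hs hd
    have b2 := hcomb (by linarith) hC₁0 hC₁ _ _ hs hd
    refine (norm_sub_le _ _).trans ((add_le_add b1 b2).trans ?_)
    have : C₁ * (ε / (2 * (C₁ + 1))) ≤ ε / 2 := by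
      rw [mul_div_assoc', div_le_div_iff₀ (by positivity) (by norm_num)]
      nlinarith
    linarith
  -- halving the bound
  have hhalf : ∀ k : ℕ, ∀ (χ : 𝓓^{7}((⊤ : Opens SpaceTime), ℝ)) (D : ℝ),
      tsupport χ ⊆ closedBall 0 R → DerivBound 7 D m χ → ‖W χ‖ ≤ C₁ * (1 / 2) ^ k * D := by
    intro k
    induction k with
    | zero =>
      intro χ D hχ hD
      simpa using hC₁ χ D (hχ.trans (hsub (by linarith))) hD
    | succ k ih =>
      intro χ D hχ hD
      rw [heq χ hχ]
      refine (hcomb hR2 (by positivity) ih χ D hχ hD).trans (le_of_eq ?_)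
      rw [pow_succ]
      ring
  obtain ⟨D, hD⟩ := exists_derivBound (n := 7) φ.contDiff φ.hasCompactSupport m
  have hlim : Tendsto (fun k : ℕ => C₁ * (1 / 2 : ℝ) ^ k * D) atTop (𝓝 0) := by
    have := (tendsto_pow_atTop_nhds_zero_of_lt_one (by norm_num : (0:ℝ) ≤ 1 / 2)
      (by norm_num)).const_mul C₁ |>.mul_const D
    simpa using this
  exact norm_le_zero_iff.1 (ge_of_tendsto' hlim fun k => hhalf k φ D hφR hD)

theorem IsPointSourceSolution.unique {U₁ U₂ : Dist7} (h₁ : IsPointSourceSolution Q a U₁)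
    (h₂ : IsPointSourceSolution Q a U₂) : U₁ = U₂ := by
  let W : 𝓓^{7}((⊤ : Opens SpaceTime), ℝ) →L[ℝ] ℂ :=
    (U₁ : 𝓓^{7}((⊤ : Opens SpaceTime), ℝ) →L[ℝ] ℂ) - (U₂ : 𝓓^{7}((⊤ : Opens SpaceTime), ℝ) →L[ℝ] ℂ)
  have hWa : ∀ φ, W φ = U₁ φ - U₂ φ := fun _ => rfl
  have hW : IsHomogeneousSolution Q W := by
    constructor
    · intro φ
      have e := (h₁.1 φ).trans (h₂.1 φ).symm
      unfold potentialPairing at e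
      rw [hWa, hWa, hWa]
      linear_combination e
    · intro φ hφ
      rw [hWa, h₁.2 φ hφ, h₂.2 φ hφ, sub_zero]
  ext φ
  exact sub_eq_zero.1 (hW.eq_zero φ)

end Uniqueness

/-! ### The bilinear identity for two potentials -/

section Backscatter

variable {a : R3} {M h C D l m K : ℝ} {q q₁ q₂ : R3 → ℂ} {r r₁ r₂ P : SpaceTime → ℂ} {η : ℝ → ℂ}

theorem IsTailDensity.isTail (hP : IsTailDensity a q K l P) (hq : PotBound M h q)
    (ha : ‖a‖ = 1) (hh : 0 < h) (hl : 1 ≤ l) : IsTail a q (M + K) l (waveTail a q P) where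
  measurable := hP.measurable_waveTail hq ha hh hl
  continuousOn := hP.continuousOn_waveTail hq ha hh hl
  zero := fun _ => waveTail_of_notMem
  bound := hP.norm_waveTail_le hq hl
  eqn := fun _ hp => hP.waveTail_eq hq ha hh hl hp

/-- The correlation of `r(x, ·)` with a profile `η`. -/
def timePairing (r : SpaceTime → ℂ) (η : ℝ → ℂ) (p : SpaceTime) : ℂ :=
  ∫ t, r (p.1, t) * η (t + p.2)

/-- The incoming spherical wave with profile `η`. -/
def incident (a : R3) (η : ℝ → ℂ) (p : SpaceTime) : ℂ :=
  (4 * Real.pi * ‖p.1 - a‖)⁻¹ • η (‖p.1 - a‖ + p.2)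

/-- The backward wave generated at `a` by the profile `η`. -/
def adjWave (a : R3) (r : SpaceTime → ℂ) (η : ℝ → ℂ) (p : SpaceTime) : ℂ :=
  incident a η p + timePairing r η p

lemma norm_shift_le (hη : ∀ t, ‖η t‖ ≤ D * Real.exp (-(m * t))) (s t : ℝ) :
    ‖η (t + s)‖ ≤ D * Real.exp (-(m * s)) * Real.exp (-(m * t)) := by
  refine (hη _).trans (le_of_eq ?_)
  rw [mul_assoc, ← Real.exp_add]
  ring_nf

lemma measurable_timePairing (hr : Measurable r) (hη : Measurable η) :
    Measurable (timePairing r η) := by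
  have h1 : Measurable fun x : SpaceTime × ℝ => r (x.1.1, x.2) * η (x.2 + x.1.2) :=
    (hr.comp (by fun_prop)).mul (hη.comp (by fun_prop))
  exact (h1.stronglyMeasurable.integral_prod_right).measurable

lemma measurable_incident (hη : Measurable η) : Measurable (incident a η) := by
  have h1 : Measurable fun p : SpaceTime => (4 * Real.pi * ‖p.1 - a‖)⁻¹ := by fun_prop
  exact h1.smul (hη.comp (by fun_prop))

lemma measurable_adjWave (hr : Measurable r) (hη : Measurable η) :
    Measurable (adjWave a r η) :=
  (measurable_incident hη).add (measurable_timePairing hr hη)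

lemma IsTail.norm_timePairing_le (hr : IsTail a q C l r) (hlm : l < m)
    (hη : ∀ t, ‖η t‖ ≤ D * Real.exp (-(m * t))) (p : SpaceTime) :
    ‖timePairing r η p‖ ≤ C * D * (2 / (m - l)) * Real.exp (-(m * p.2)) := by
  have hC := hr.nonneg
  have hD : 0 ≤ D := by simpa using (norm_nonneg _).trans (hη 0)
  have hml : 0 < m - l := by linarith
  refine (norm_integral_cone_mul_le hr.zero hr.bound (norm_shift_le hη p.2) hlm p.1).trans ?_
  have h1 : Real.exp (-((m - l) / 2 * ‖p.1 - a‖)) ≤ 1 :=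
    Real.exp_le_one_iff.2 (by have := norm_nonneg (p.1 - a); nlinarith)
  calc _ ≤ C * (D * Real.exp (-(m * p.2))) * (1 * (2 / (m - l))) := by gcongr
    _ = _ := by ring

/-- The singularity of the spherical wave at a is harmless because q vanishes within distance h of
a. -/
lemma PotBound.norm_mul_incident_le (hq : PotBound M h q) (ha : ‖a‖ = 1) (hh : 0 < h)
    (hm : 0 ≤ m) (hη : ∀ t, ‖η t‖ ≤ D * Real.exp (-(m * t))) (p : SpaceTime) :
    ‖q p.1 * incident a η p‖ ≤ M * ((4 * Real.pi * h)⁻¹ * D) * Real.exp (-(m * p.2)) := by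
  have hD : 0 ≤ D := by simpa using (norm_nonneg _).trans (hη 0)
  have hM := hq.nonneg
  have hpi := Real.pi_pos
  rcases lt_or_ge ‖p.1 - a‖ h with hp | hp
  · rw [hq.eq_zero_near ha hp]
    simp only [zero_mul, norm_zero]
    positivity
  · rw [norm_mul, mul_assoc M, incident, norm_smul, Real.norm_of_nonneg (by positivity)]
    refine mul_le_mul (hq.bound _) ?_ (by positivity) hM
    rw [mul_assoc _ D]
    have h1 : (4 * Real.pi * ‖p.1 - a‖)⁻¹ ≤ (4 * Real.pi * h)⁻¹ :=
      inv_anti₀ (by positivity) (by gcongr)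
    have h2 : Real.exp (-(m * (‖p.1 - a‖ + p.2))) ≤ Real.exp (-(m * p.2)) := by
      gcongr
      nlinarith [norm_nonneg (p.1 - a)]
    exact mul_le_mul h1 ((hη _).trans (mul_le_mul_of_nonneg_left h2 hD)) (norm_nonneg _)
      (by positivity)

lemma IsTail.norm_mul_timePairing_le (hr : IsTail a q C l r) (hq : PotBound M h q₁) (hlm : l < m)
    (hη : ∀ t, ‖η t‖ ≤ D * Real.exp (-(m * t))) (p : SpaceTime) :
    ‖q₁ p.1 * timePairing r η p‖ ≤ M * (C * D * (2 / (m - l))) * Real.exp (-(m * p.2)) := by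
  rw [norm_mul, mul_assoc]
  exact mul_le_mul (hq.bound _) (hr.norm_timePairing_le hlm hη p) (norm_nonneg _) hq.nonneg

/-- Reciprocity: by the moment formula for r, the wave V = `adjWave a r η` satisfies V = `incident a
η` + `advPot` (q V). It is thus the wave backward in time with the same potential. -/
theorem IsTail.timePairing_eq (hr : IsTail a q C l r) (hq : PotBound M h q) (ha : ‖a‖ = 1)
    (hh : 0 < h) (hl : 0 < l) (hlm : l < m) (hηm : Measurable η)
    (hη : ∀ t, ‖η t‖ ≤ D * Real.exp (-(m * t))) (p : SpaceTime) :
    timePairing r η p = advPot (fun p => q p.1 * adjWave a r η p) p := by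
  have hm : 0 < m := hl.trans hlm
  have hqm := hq.contDiff.continuous.measurable
  have h1 := integrable_advanced hm ((hqm.comp measurable_fst).mul (measurable_incident hηm))
    (hq.norm_mul_incident_le ha hh hm.le hη) p
  have h2 := integrable_advanced hm
    ((hqm.comp measurable_fst).mul (measurable_timePairing hr.measurable hηm))
    (hr.norm_mul_timePairing_le hq hlm hη) p
  simp only [Function.comp, Pi.mul_apply] at h1 h2
  rw [timePairing, hr.integral_mul hq hl hlm (k := fun t => η (t + p.2)) (by fun_prop)
    (norm_shift_le hη p.2) p.1, advPot]
  simp only [adjWave, mul_add, smul_add]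
  rw [integral_add h1 h2]
  congr 1
  · refine integral_congr_ae (Eventually.of_forall fun z => ?_)
    simp only [incident, mul_smul_comm]
    rw [show ‖z‖ + ‖p.1 + z - a‖ + p.2 = ‖p.1 + z - a‖ + (p.2 + ‖z‖) by ring]
  · refine integral_congr_ae (Eventually.of_forall fun z => ?_)
    simp only [timePairing, add_assoc, add_comm ‖z‖]

/-- The difference of the backscattered fields, tested against `η`. -/
theorem IsTail.timePairing_sub (h₁ : IsTail a q₁ C l r₁) (h₂ : IsTail a q₂ C l r₂)
    (hq₁ : PotBound M h q₁) (hq₂ : PotBound M h q₂) (ha : ‖a‖ = 1) (hh : 0 < h) (hl : 0 < l)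
    (hlm : l < m) (hηm : Measurable η) (hη : ∀ t, ‖η t‖ ≤ D * Real.exp (-(m * t))) :
    timePairing r₁ η (a, 0) - timePairing r₂ η (a, 0) =
      waveFun a r₂ fun p => (q₁ p.1 - q₂ p.1) * adjWave a r₁ η p := by
  have hm : 0 < m := hl.trans hlm
  have hm₁ := hq₁.contDiff.continuous.measurable
  have hm₂ := hq₂.contDiff.continuous.measurable
  have mi := measurable_incident (a := a) hηm
  have mt := measurable_timePairing h₁.measurable hηm
  -- bounds for the four products
  have b11 := hq₁.norm_mul_incident_le ha hh hm.le hη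
  have b12 := h₁.norm_mul_timePairing_le hq₁ hlm hη
  have b21 := hq₂.norm_mul_incident_le ha hh hm.le hη
  have b22 := h₁.norm_mul_timePairing_le hq₂ hlm hη
  have m11 := (hm₁.comp measurable_fst).mul mi
  have m12 := (hm₁.comp measurable_fst).mul mt
  have m21 := (hm₂.comp measurable_fst).mul mi
  have m22 := (hm₂.comp measurable_fst).mul mt
  have i11 := (integrable_advanced hm m11 b11 (a, 0))
  have i12 := (integrable_advanced hm m12 b12 (a, 0))
  have i21 := (integrable_advanced hm m21 b21 (a, 0))
  have i22 := (integrable_advanced hm m22 b22 (a, 0))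
  have j11 := integrable_cone_mul h₂.measurable h₂.zero h₂.bound m11 b11 hlm
  have j12 := integrable_cone_mul h₂.measurable h₂.zero h₂.bound m12 b12 hlm
  have j21 := integrable_cone_mul h₂.measurable h₂.zero h₂.bound m21 b21 hlm
  have j22 := integrable_cone_mul h₂.measurable h₂.zero h₂.bound m22 b22 hlm
  simp only [zero_add, Function.comp, Pi.mul_apply] at i11 i12 i21 i22 j11 j12 j21 j22
  have hsum : ∀ p : SpaceTime, ‖q₁ p.1 * adjWave a r₁ η p‖ ≤
      (M * ((4 * Real.pi * h)⁻¹ * D) + M * (C * D * (2 / (m - l)))) * Real.exp (-(m * p.2)) := by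
    intro p
    rw [adjWave, mul_add, add_mul]
    exact (norm_add_le _ _).trans (add_le_add (b11 p) (b12 p))
  -- The source is q₁ times the backward wave, whose advanced potential is the pairing of r₁. This
  -- introduces the products of r₂ with both potentials.
  have hsource := h₂.integral_mul_source hq₂ hl hlm
    (χ := fun p => q₁ p.1 * adjWave a r₁ η p)
    ((hm₁.comp measurable_fst).mul (measurable_adjWave h₁.measurable hηm)) hsum
  simp only [← h₁.timePairing_eq hq₁ ha hh hl hlm hηm hη] at hsource
  have e1 := h₁.timePairing_eq hq₁ ha hh hl hlm hηm hη (a, 0)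
  -- The equation of r₂ is used only once here; its interaction with the first potential is already
  -- contained in `hsource`.
  have e2 : timePairing r₂ η (a, 0) =
      (∫ z, (4 * Real.pi * ‖z‖)⁻¹ • (q₂ (a + z) * incident a η (a + z, ‖z‖))) +
        ∫ p, r₂ p * (q₂ p.1 * incident a η p) := by
    rw [timePairing, h₂.integral_mul hq₂ hl hlm (k := fun t => η (t + 0)) (by fun_prop)
      (norm_shift_le hη 0) a]
    congr 1
    · refine integral_congr_ae (Eventually.of_forall fun z => ?_)
      simp only [incident, mul_smul_comm, add_zero, add_comm ‖z‖]
    · rw [show (volume : Measure SpaceTime) = (volume : Measure R3).prod volume from rfl] at j21 ⊢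
      rw [integral_prod (fun p : SpaceTime => r₂ p * (q₂ p.1 * incident a η p)) j21]
      conv_rhs => rw [← integral_add_left_eq_self _ a]
      refine integral_congr_ae (Eventually.of_forall fun z => ?_)
      simp only [incident, add_zero, add_sub_cancel_left]
      rw [← integral_const_mul, ← integral_smul]
      refine integral_congr_ae (Eventually.of_forall fun t => ?_)
      simp only [Complex.real_smul, add_comm ‖z‖]
      ring
  rw [e1, e2]
  simp only [advPot, adjWave, zero_add, waveFun, mul_add, sub_mul, smul_add, smul_sub, mul_sub]
    at hsource ⊢
  rw [integral_add i11 i12]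
  have A1 := integral_add (i11.sub i21) (i12.sub i22)
  have A2 := integral_sub i11 i21
  have A3 := integral_sub i12 i22
  have B1 := integral_add (j11.sub j21) (j12.sub j22)
  have B2 := integral_sub j11 j21
  have B3 := integral_sub j12 j22
  have B4 := integral_add j11 j12
  simp only [Pi.sub_apply] at A1 B1
  rw [B4] at hsource
  rw [A1, A2, A3, B1, B2, B3]
  linear_combination -hsource

end Backscatter

/-! ### Step profiles and integration by parts in time -/

section IntegratedProfiles

variable {a : R3} {M h C D l m K B : ℝ} {q q' : R3 → ℂ} {P r : SpaceTime → ℂ}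

/-- The indicator function of `(0, B]` as a time profile. -/
def stepProfile (B : ℝ) : ℝ → ℂ := (Ioc 0 B).indicator 1

/-- The primitive `(B - t)₊` as a time profile. -/
def rampProfile (B t : ℝ) : ℂ := (max (B - t) 0 : ℝ)

lemma measurable_stepProfile : Measurable (stepProfile B) :=
  measurable_one.indicator measurableSet_Ioc

lemma continuous_rampProfile : Continuous (rampProfile B) := by
  unfold rampProfile; fun_prop

lemma norm_stepProfile_le (hm : 0 ≤ m) (t : ℝ) :
    ‖stepProfile B t‖ ≤ Real.exp (m * B) * Real.exp (-(m * t)) := by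
  rw [← Real.exp_add]
  by_cases ht : t ∈ Ioc 0 B
  · rw [stepProfile, indicator_of_mem ht, Pi.one_apply, norm_one]
    exact Real.one_le_exp (by nlinarith [ht.2])
  · rw [stepProfile, indicator_of_notMem ht, norm_zero]
    positivity

lemma norm_rampProfile_le (hm : 1 ≤ m) (t : ℝ) :
    ‖rampProfile B t‖ ≤ Real.exp (m * B) * Real.exp (-(m * t)) := by
  rw [← Real.exp_add, rampProfile, Complex.norm_real, Real.norm_of_nonneg (le_max_right _ _)]
  refine max_le ?_ (Real.exp_pos _).le
  rcases le_or_gt (B - t) 0 with h0 | h0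
  · exact h0.trans (Real.exp_pos _).le
  · have h1 := Real.add_one_le_exp (m * B + -(m * t))
    nlinarith

lemma rampProfile_of_le {t : ℝ} (ht : B ≤ t) : rampProfile B t = 0 := by
  rw [rampProfile, max_eq_right (by linarith), Complex.ofReal_zero]

lemma rampProfile_of_ge {t : ℝ} (ht : t ≤ B) : rampProfile B t = ((B - t : ℝ) : ℂ) := by
  rw [rampProfile, max_eq_left (by linarith)]

lemma IsTailDensity.hasDerivAt_fullTail (hP : IsTailDensity a q K l P) {x : R3} {t : ℝ}
    (ht : ‖x - a‖ < t) : HasDerivAt (fun t => fullTail a q P (x, t)) (P (x, t)) t := by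
  have hPm := hP.measurable
  have hc : ContinuousAt (fun s => P (x, s)) t :=
    (hP.continuousOn.continuousAt ((isOpen_lightCone a).mem_nhds (x := (x, t)) ht)).comp
      (f := fun s : ℝ => ((x, s) : SpaceTime)) (by fun_prop)
  have h1 : HasDerivAt (fun t => ∫ s in (0:ℝ)..t, P (x, s)) (P (x, t)) t :=
    intervalIntegral.integral_hasDerivAt_right (intervalIntegrable_of_bound hPm hP.bound x 0 t)
      ((hPm.comp measurable_prodMk_left).stronglyMeasurable.stronglyMeasurableAtFilter) hc
  exact h1.const_add (coneVal a q x)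

/-- Integration by parts in time. -/
lemma IsTailDensity.timePairing_step (hP : IsTailDensity a q K l P) (hq : PotBound M h q)
    (ha : ‖a‖ = 1) (hh : 0 < h) (hl : 1 ≤ l) (x : R3) {s : ℝ} (hs : 0 ≤ s) :
    timePairing (waveTail a q P) (stepProfile B) (x, s) =
      coneVal a q x * rampProfile B (‖x - a‖ + s) + ∫ t, P (x, t) * rampProfile B (t + s) := by
  have h0 := norm_nonneg (x - a)
  rcases le_or_gt (B - s) ‖x - a‖ with hb | hb
  · rw [rampProfile_of_le (by linarith), mul_zero, zero_add, timePairing, integral_eq_zero_of_ae,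
      integral_eq_zero_of_ae]
    · refine Eventually.of_forall fun t => ?_
      by_cases ht : (x, t) ∈ lightCone a
      · have : ‖x - a‖ < t := ht
        simp [rampProfile_of_le (B := B) (t := t + s) (by linarith)]
      · simp [hP.zero _ ht]
    · refine Eventually.of_forall fun t => ?_
      by_cases ht : (x, t) ∈ lightCone a
      · have : ‖x - a‖ < t := ht
        have h2 : t + s ∉ Ioc 0 B := fun h => by linarith [h.2]
        simp [stepProfile, indicator_of_notMem h2]
      · simp [waveTail_of_notMem ht]
  · have e1 : timePairing (waveTail a q P) (stepProfile B) (x, s) =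
        ∫ t in ‖x - a‖..(B - s), fullTail a q P (x, t) := by
      rw [intervalIntegral.integral_of_le hb.le, ← integral_indicator measurableSet_Ioc,
        timePairing]
      refine integral_congr_ae (Eventually.of_forall fun t => ?_)
      by_cases ht : (x, t) ∈ lightCone a
      · have ht' : ‖x - a‖ < t := ht
        by_cases htb : t ≤ B - s
        · have h2 : t + s ∈ Ioc 0 B := ⟨by linarith, by linarith⟩
          simp [stepProfile, indicator_of_mem h2, waveTail_of_mem ht,
            indicator_of_mem (show t ∈ Ioc ‖x - a‖ (B - s) from ⟨ht', htb⟩)]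
        · have h2 : t + s ∉ Ioc 0 B := fun h => htb (by linarith [h.2])
          simp [stepProfile, indicator_of_notMem h2,
            indicator_of_notMem (show t ∉ Ioc ‖x - a‖ (B - s) from fun h => htb h.2)]
      · simp [waveTail_of_notMem ht,
          indicator_of_notMem (show t ∉ Ioc ‖x - a‖ (B - s) from fun h => ht h.1)]
    have e2 : ∫ t, P (x, t) * rampProfile B (t + s) =
        ∫ t in ‖x - a‖..(B - s), ((B - s - t : ℝ) : ℂ) * P (x, t) := by
      rw [intervalIntegral.integral_of_le hb.le, ← integral_indicator measurableSet_Ioc]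
      refine integral_congr_ae (Eventually.of_forall fun t => ?_)
      by_cases ht : (x, t) ∈ lightCone a
      · have ht' : ‖x - a‖ < t := ht
        by_cases htb : t ≤ B - s
        · simp only
          rw [indicator_of_mem (show t ∈ Ioc ‖x - a‖ (B - s) from ⟨ht', htb⟩),
            rampProfile_of_ge (by linarith), mul_comm]
          congr 2
          ring
        · simp only
          rw [indicator_of_notMem (show t ∉ Ioc ‖x - a‖ (B - s) from fun h => htb h.2),
            rampProfile_of_le (by linarith), mul_zero]
      · simp [hP.zero _ ht,
          indicator_of_notMem (show t ∉ Ioc ‖x - a‖ (B - s) from fun h => ht h.1)]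
    have hc : Continuous fun t => fullTail a q P (x, t) :=
      (hP.continuous_fullTail hq ha hh hl).comp (by fun_prop)
    have hPi := intervalIntegrable_of_bound hP.measurable hP.bound x ‖x - a‖ (B - s)
    have hi2 : IntervalIntegrable (fun t => ((B - s - t : ℝ) : ℂ) * P (x, t)) volume
        ‖x - a‖ (B - s) :=
      hPi.continuousOn_mul (by fun_prop : Continuous fun t : ℝ => ((B - s - t : ℝ) : ℂ)).continuousOn
    -- The ramp vanishes at the upper end; at the lower end, on the cone, it meets the limit value
    -- `coneVal`.
    have key := intervalIntegral.integral_eq_sub_of_hasDerivAt_of_le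
      (f := fun t => -((B - s - t : ℝ) : ℂ) * fullTail a q P (x, t))
      (f' := fun t => fullTail a q P (x, t) - ((B - s - t : ℝ) : ℂ) * P (x, t)) hb.le
      (by fun_prop) (fun t ht => by
        have h1 : HasDerivAt (fun t : ℝ => -((B - s - t : ℝ) : ℂ)) 1 t := by
          have h2 : HasDerivAt (fun t : ℝ => (((t - (B - s) : ℝ)) : ℂ)) ((1 : ℝ) : ℂ) t :=
            ((hasDerivAt_id t).sub_const (B - s)).ofReal_comp
          refine (h2.congr_deriv Complex.ofReal_one).congr_of_eventuallyEq
            (Eventually.of_forall fun t => ?_)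
          push_cast
          ring
        refine (h1.mul (hP.hasDerivAt_fullTail ht.1)).congr_deriv ?_
        ring) ((hc.intervalIntegrable _ _).sub hi2)
    rw [intervalIntegral.integral_sub (hc.intervalIntegrable _ _) hi2] at key
    have hz : fullTail a q P (x, ‖x - a‖) = coneVal a q x := by
      have hx : ((x, ‖x - a‖) : SpaceTime) ∉ lightCone a := fun h' => lt_irrefl ‖x - a‖ h'
      rw [fullTail, timePrim_of_notMem hP.zero hx, add_zero]
    rw [hz] at key
    rw [e1, e2, rampProfile_of_ge (by linarith)]
    push_cast at key ⊢
    linear_combination key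

end IntegratedProfiles

/-! ### Sorting by arrival time -/

section Shear

variable {Z : Type*} [MeasurableSpace Z] {μ : Measure Z} [SFinite μ]

/-- Collecting the contributions with the same arrival time. -/
lemma integral_arrival {F : Z × ℝ → ℂ} {k : ℝ → ℂ} {s : Z → ℝ} (hs : Measurable s)
    (hint : Integrable (fun p : Z × ℝ => F p * k (p.2 + s p.1)) (μ.prod volume)) :
    ∫ p, F p * k (p.2 + s p.1) ∂(μ.prod volume) = ∫ T, k T * ∫ z, F (z, T - s z) ∂μ := by
  have hmp : MeasurePreserving (fun p : Z × ℝ => (p.1, p.2 - s p.1)) (μ.prod volume)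
      (μ.prod volume) :=
    (MeasurePreserving.id μ).skew_product (g := fun z t => t - s z) (by fun_prop)
      (Eventually.of_forall fun z => (measurePreserving_sub_right volume (s z)).map_eq)
  have h2 := hmp.integrable_comp_of_integrable hint
  simp only [Function.comp_def, sub_add_cancel] at h2
  rw [integral_prod (fun p : Z × ℝ => F p * k (p.2 + s p.1)) hint]
  have h3 : ∀ z, ∫ t, F (z, t) * k (t + s z) = ∫ T, F (z, T - s z) * k T := fun z => by
    rw [← integral_sub_right_eq_self _ (s z)]
    simp only [sub_add_cancel]
  simp only [h3]
  rw [integral_integral_swap h2]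
  refine integral_congr_ae (Eventually.of_forall fun T => ?_)
  simp only [mul_comm _ (k T)]
  exact integral_const_mul _ _

/-- Collecting the contributions of the spheres around `a`. -/
lemma integral_arrival_sphere {a : R3} {g : R3 → ℂ} {k : ℝ → ℂ}
    (hint : Integrable fun y => g y * k (2 * ‖y - a‖)) :
    ∫ y, g y * k (2 * ‖y - a‖) =
      ∫ T in Ioi (0:ℝ), k T * ((T ^ 2 / 8) • ∫ ω, g (a + (T / 2) • ω) ∂sph) := by
  have h1 := hint.comp_add_left a
  rw [← integral_add_left_eq_self _ a, integral_polar h1]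
  -- A point at distance σ from a is seen after the two-way time T = 2σ, and σ² dσ = (T²/8) dT.
  have h2 := integral_comp_mul_left_Ioi (fun T : ℝ => k T * ((T ^ 2 / 8) • ∫ ω, g (a + (T / 2) • ω) ∂sph)) 0
    (two_pos)
  rw [mul_zero] at h2
  have h3 : ∀ I : ℂ, I = (2:ℝ) • ((2:ℝ)⁻¹ • I) := fun I => by rw [smul_smul]; norm_num
  conv_rhs => rw [h3 (∫ T in Ioi (0:ℝ), _), ← h2, ← integral_smul]
  refine setIntegral_congr_fun measurableSet_Ioi fun s hs => ?_
  have hs' : (0:ℝ) < s := hs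
  simp only [add_sub_cancel_left]
  have h4 : ∫ ω, g (a + s • ω) * k (2 * ‖s • ω‖) ∂sph = ∫ ω, g (a + s • ω) * k (2 * s) ∂sph := by
    refine integral_congr_ae ?_
    filter_upwards [sph_ae_norm] with ω hω
    simp only [norm_smul, hω, mul_one, Real.norm_of_nonneg hs'.le]
  rw [h4, integral_mul_const, mul_div_cancel_left₀ _ (two_ne_zero (α := ℝ))]
  simp only [Complex.real_smul]
  push_cast
  ring

end Shear

/-! ### Contributions to the backscattered difference -/

section ArrivalTimes

variable {a : R3} {M M' h C D l m K B : ℝ} {q q' q₁ q₂ : R3 → ℂ} {P P₁ P₂ r : SpaceTime → ℂ}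

/-- `q(y) / (4π |y - a|)`. -/
def damped (a : R3) (q : R3 → ℂ) (y : R3) : ℂ := (4 * Real.pi * ‖y - a‖)⁻¹ • q y

/-- Contribution of a density on the cone `t = |y - a|`. -/
def sphPart (a : R3) (g : R3 → ℂ) (T : ℝ) : ℂ := (T ^ 2 / 8) • ∫ ω, g (a + (T / 2) • ω) ∂sph

/-- Contribution of a density inside the cone. -/
def conePart (a : R3) (F : SpaceTime → ℂ) (T : ℝ) : ℂ := ∫ y, F (y, T - ‖y - a‖)

/-- Contribution of a double scattering density. -/
def convPart (W P : SpaceTime → ℂ) (T : ℝ) : ℂ := ∫ p : SpaceTime, W p * P (p.1, T - p.2)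

lemma PotBound.hasCompactSupport (hq : PotBound M h q) (hh : 0 < h) : HasCompactSupport q :=
  HasCompactSupport.of_support_subset_isCompact (isCompact_closedBall (0 : R3) 1) fun x hx => by
    by_contra hc
    rw [mem_closedBall_zero_iff, not_le] at hc
    exact hx (hq.zero x (by linarith))

lemma PotBound.continuous_damped (hq : PotBound M h q) (ha : ‖a‖ = 1) (hh : 0 < h) :
    Continuous (damped a q) := by
  have hqc := hq.contDiff.continuous
  refine continuous_iff_continuousAt.2 fun x => ?_
  by_cases hx : x = a
  · refine continuousAt_const.congr (f := fun _ => (0 : ℂ)) ?_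
    filter_upwards [Metric.ball_mem_nhds x hh] with y hy
    rw [damped, hq.eq_zero_near ha (by rwa [hx, mem_ball_iff_norm] at hy), smul_zero]
  · have h1 : 4 * Real.pi * ‖x - a‖ ≠ 0 := by
      have := Real.pi_pos
      have := norm_pos_iff.2 (sub_ne_zero.2 hx)
      positivity
    unfold damped
    fun_prop (disch := exact h1)

lemma PotBound.hasCompactSupport_damped (hq : PotBound M h q) (hh : 0 < h) :
    HasCompactSupport (damped a q) :=
  HasCompactSupport.smul_left (f := fun y => (4 * Real.pi * ‖y - a‖)⁻¹) (hq.hasCompactSupport hh)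

lemma PotBound.norm_damped_le (hq : PotBound M h q) (ha : ‖a‖ = 1) (hh : 0 < h) (y : R3) :
    ‖damped a q y‖ ≤ (4 * Real.pi * h)⁻¹ * ‖q y‖ := by
  rcases lt_or_ge ‖y - a‖ h with hp | hp
  · simp [damped, hq.eq_zero_near ha hp]
  · have := Real.pi_pos
    rw [damped, norm_smul, Real.norm_of_nonneg (by positivity)]
    gcongr

lemma mul_incident (p : SpaceTime) (η : ℝ → ℂ) :
    q p.1 * incident a η p = damped a q p.1 * η (p.2 + ‖p.1 - a‖) := by
  simp only [incident, damped, Complex.real_smul, add_comm p.2]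
  ring

/-- Arrival times of the single scattering contribution. -/
lemma IsTailDensity.integral_damped_mul (hP : IsTailDensity a q' K l P) (hq : PotBound M h q)
    (hq' : PotBound M' h q') (ha : ‖a‖ = 1) (hh : 0 < h) (hl : 1 ≤ l) :
    ∫ y, damped a q y * timePairing (waveTail a q' P) (stepProfile B) (y, ‖y - a‖) =
      (∫ T in Ioi (0:ℝ), rampProfile B T * sphPart a (fun y => damped a q y * coneVal a q' y) T) +
      ∫ T, rampProfile B T * conePart a (fun p => damped a q p.1 * P p) T := by
  have hm : 1 ≤ l + 1 := by linarith
  have hqm := hq.contDiff.continuous.measurable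
  have hd := hq.continuous_damped ha hh
  have hrc := continuous_rampProfile (B := B)
  have hcc := hq'.continuous_coneVal ha hh
  have i1 : Integrable fun y =>
      damped a q y * coneVal a q' y * rampProfile B (2 * ‖y - a‖) := by
    refine Continuous.integrable_of_hasCompactSupport (by fun_prop) ?_
    exact ((hq.hasCompactSupport_damped hh).mul_right (f' := coneVal a q')).mul_right
      (f' := fun y => rampProfile B (2 * ‖y - a‖))
  have i2 : Integrable fun p : SpaceTime =>
      damped a q p.1 * P p * rampProfile B (p.2 + ‖p.1 - a‖) := by
    have := integrable_cone_mul hP.measurable hP.zero hP.bound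
      ((hqm.comp measurable_fst).mul (measurable_incident hrc.measurable))
      (hq.norm_mul_incident_le ha hh (by linarith) (norm_rampProfile_le (B := B) hm))
      (lt_add_one l)
    refine this.congr (Eventually.of_forall fun p => ?_)
    simp only [Pi.mul_apply, Function.comp, mul_incident]
    ring
  rw [show (volume : Measure SpaceTime) = (volume : Measure R3).prod volume from rfl] at i2
  have e2 := integral_arrival (μ := (volume : Measure R3)) (F := fun p => damped a q p.1 * P p)
    (k := rampProfile B) (s := fun y => ‖y - a‖) (by fun_prop) i2
  have e1 := integral_arrival_sphere (a := a) (g := fun y => damped a q y * coneVal a q' y)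
    (k := rampProfile B) i1
  unfold sphPart conePart
  rw [← e1, ← e2, integral_prod _ i2, ← integral_add i1 i2.integral_prod_left]
  refine integral_congr_ae (Eventually.of_forall fun y => ?_)
  simp only
  rw [hP.timePairing_step hq' ha hh hl y (norm_nonneg _), mul_add, ← integral_const_mul,
    two_mul, mul_assoc]
  simp only [mul_assoc]

/-- Arrival times of the contribution of the direct wave. -/
lemma IsTail.integral_mul_incident (hr : IsTail a q' C l r) (hq : PotBound M h q) (ha : ‖a‖ = 1)
    (hh : 0 < h) (hl : 0 ≤ l) :
    ∫ p, r p * (q p.1 * incident a (stepProfile B) p) =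
      ∫ y, damped a q y * timePairing r (stepProfile B) (y, ‖y - a‖) := by
  have hqm := hq.contDiff.continuous.measurable
  have i1 := integrable_cone_mul hr.measurable hr.zero hr.bound
      ((hqm.comp measurable_fst).mul (measurable_incident (a := a) (measurable_stepProfile (B := B))))
      (hq.norm_mul_incident_le ha hh (by linarith) (norm_stepProfile_le (B := B)
        (by linarith : (0:ℝ) ≤ l + 1))) (lt_add_one l)
  rw [show (volume : Measure SpaceTime) = (volume : Measure R3).prod volume from rfl] at i1 ⊢
  simp only [Pi.mul_apply, Function.comp, mul_incident] at i1 ⊢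
  rw [integral_prod _ i1]
  refine integral_congr_ae (Eventually.of_forall fun y => ?_)
  simp only [timePairing]
  rw [← integral_const_mul]
  refine integral_congr_ae (Eventually.of_forall fun t => ?_)
  ring

/-- The decay of the ramp in the total time t + s factors into decay in each of the two times,
enough to integrate both densities. -/
lemma integrable_double {W : SpaceTime → ℂ} (hWm : Measurable W)
    (hW0 : ∀ p ∉ lightCone a, W p = 0) (hW : ∀ p, ‖W p‖ ≤ C * Real.exp (l * p.2))
    (hP : IsTailDensity a q' K l P) (hl : 1 ≤ l) :
    Integrable (fun p : SpaceTime × ℝ => W p.1 * P (p.1.1, p.2) * rampProfile B (p.2 + p.1.2))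
      ((volume : Measure SpaceTime).prod volume) := by
  have hC : 0 ≤ C := by simpa using (norm_nonneg _).trans (hW 0)
  have hK := hP.nonneg
  have hhalf : (0:ℝ) < (l + 1 - l) / 2 := by linarith
  have h1 := ((integrable_exp_neg_norm hhalf a).mul_prod (integrable_expIndicator hhalf))
  have h2 := (h1.mul_prod (integrable_expIndicator hhalf)).const_mul
    (C * 1 * (K * Real.exp ((l + 1) * B)))
  have hrm := (continuous_rampProfile (B := B)).measurable
  refine h2.mono' ?_ (Eventually.of_forall fun p => ?_)
  · exact ((hWm.comp (by fun_prop)).mul (hP.measurable.comp (by fun_prop))).mul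
      (hrm.comp (by fun_prop)) |>.aestronglyMeasurable
  · obtain ⟨p, t⟩ := p
    have b1 := norm_cone_mul_le (χ := fun p => ((Real.exp (-((l + 1) * p.2)) : ℝ) : ℂ)) hW0 hW
      (D := 1) (m := l + 1) (fun p => by
        rw [one_mul, Complex.norm_real, Real.norm_of_nonneg (Real.exp_pos _).le]) (lt_add_one l) p
    have b2 := norm_cone_mul_le (χ := fun p => ((Real.exp (-((l + 1) * p.2)) : ℝ) : ℂ)) hP.zero
      hP.bound (D := 1) (m := l + 1) (fun p => by
        rw [one_mul, Complex.norm_real, Real.norm_of_nonneg (Real.exp_pos _).le]) (lt_add_one l)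
      (p.1, t)
    rw [norm_mul, Complex.norm_real, Real.norm_of_nonneg (Real.exp_pos _).le] at b1 b2
    have b3 := norm_rampProfile_le (B := B) (m := l + 1) (by linarith) (t + p.2)
    have hi : ∀ t, 0 ≤ (Ioi (0:ℝ)).indicator (fun t => Real.exp (-((l + 1 - l) / 2 * t))) t :=
      fun t => indicator_nonneg (fun _ _ => (Real.exp_pos _).le) _
    have b4 : Real.exp (-((l + 1) / 2 * 0)) = 1 := by simp
    have b5 : Real.exp (-((l + 1 - l) / 2 * ‖p.1 - a‖)) ≤ 1 :=
      Real.exp_le_one_iff.2 (by nlinarith [norm_nonneg (p.1 - a)])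
    have b6 : ‖P (p.1, t)‖ * Real.exp (-((l + 1) * t)) ≤
        K * (Ioi (0:ℝ)).indicator (fun t => Real.exp (-((l + 1 - l) / 2 * t))) t := by
      refine b2.trans ?_
      have := mul_le_mul_of_nonneg_right b5 (hi t)
      rw [one_mul] at this
      simp only [mul_one]
      exact mul_le_mul_of_nonneg_left this hK
    calc ‖W p * P (p.1, t) * rampProfile B (t + p.2)‖
        = ‖W p‖ * ‖P (p.1, t)‖ * ‖rampProfile B (t + p.2)‖ := by rw [norm_mul, norm_mul]
      _ ≤ ‖W p‖ * ‖P (p.1, t)‖ * (Real.exp ((l + 1) * B) * Real.exp (-((l + 1) * (t + p.2)))) := by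
        gcongr
      _ = (‖W p‖ * Real.exp (-((l + 1) * p.2))) * (‖P (p.1, t)‖ * Real.exp (-((l + 1) * t))) *
          Real.exp ((l + 1) * B) := by
        rw [show -((l + 1) * (t + p.2)) = -((l + 1) * p.2) + -((l + 1) * t) by ring, Real.exp_add]
        ring
      _ ≤ (C * 1 * (Real.exp (-((l + 1 - l) / 2 * ‖p.1 - a‖)) *
          (Ioi (0:ℝ)).indicator (fun t => Real.exp (-((l + 1 - l) / 2 * t))) p.2)) *
          (K * (Ioi (0:ℝ)).indicator (fun t => Real.exp (-((l + 1 - l) / 2 * t))) t) *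
          Real.exp ((l + 1) * B) := by
        have h3 := hi p.2
        have h4 := hi t
        refine mul_le_mul_of_nonneg_right (mul_le_mul b1 b6 (by positivity) ?_)
          (Real.exp_pos _).le
        exact mul_nonneg (by linarith) (mul_nonneg (Real.exp_pos _).le h3)
      _ = _ := by ring

/-- Arrival times of the multiple scattering contribution. -/
lemma IsTailDensity.integral_mul_timePairing (hP : IsTailDensity a q₁ K l P)
    (hr : IsTail a q' C l r) (hq : PotBound M h q)
    (hq₁ : PotBound M' h q₁) (ha : ‖a‖ = 1) (hh : 0 < h) (hl : 1 ≤ l) :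
    ∫ p, r p * (q p.1 * timePairing (waveTail a q₁ P) (stepProfile B) p) =
      (∫ T, rampProfile B T * conePart a (fun p => q p.1 * coneVal a q₁ p.1 * r p) T) +
      ∫ T, rampProfile B T * convPart (fun p => r p * q p.1) P T := by
  have hm : 1 ≤ l + 1 := by linarith
  have hM := hq.nonneg
  have hM' := hq₁.nonneg
  have hC := hr.nonneg
  have hqm := hq.contDiff.continuous.measurable
  have hcm := (hq₁.continuous_coneVal ha hh).measurable
  have hrm := (continuous_rampProfile (B := B)).measurable
  have i1 : Integrable fun p : SpaceTime =>
      q p.1 * coneVal a q₁ p.1 * r p * rampProfile B (p.2 + ‖p.1 - a‖) := by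
    have := integrable_cone_mul (D := M * M' * Real.exp ((l + 1) * B)) (m := l + 1)
      (χ := fun p : SpaceTime => q p.1 * coneVal a q₁ p.1 * rampProfile B (p.2 + ‖p.1 - a‖))
      hr.measurable hr.zero hr.bound
      (((hqm.comp measurable_fst).mul (hcm.comp measurable_fst)).mul (hrm.comp (by fun_prop)))
      (fun p => by
        rw [norm_mul, norm_mul, mul_assoc (M * M')]
        have h1 := norm_rampProfile_le (B := B) hm (p.2 + ‖p.1 - a‖)
        have h2 : Real.exp (-((l + 1) * (p.2 + ‖p.1 - a‖))) ≤ Real.exp (-((l + 1) * p.2)) := by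
          gcongr
          nlinarith [norm_nonneg (p.1 - a)]
        refine mul_le_mul (mul_le_mul (hq.bound _) (hq₁.norm_coneVal_le _) (norm_nonneg _) hM)
          (h1.trans ?_) (norm_nonneg _) (by positivity)
        gcongr) (lt_add_one l)
    refine this.congr (Eventually.of_forall fun p => ?_)
    ring
  have i2 := integrable_double (B := B) (W := fun p => r p * q p.1) (C := C * M) (l := l)
    (hr.measurable.mul (hqm.comp measurable_fst))
    (fun p hp => by simp [hr.zero p hp]) (fun p => by
      rw [norm_mul, mul_right_comm]
      exact mul_le_mul (hr.bound p) (hq.bound _) (norm_nonneg _) (by positivity)) hP hl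
  have e2 := integral_arrival (μ := (volume : Measure SpaceTime))
    (F := fun p => r p.1 * q p.1.1 * P (p.1.1, p.2))
    (k := rampProfile B) (s := fun p => p.2) measurable_snd i2
  have i1' := i1
  rw [show (volume : Measure SpaceTime) = (volume : Measure R3).prod volume from rfl] at i1'
  have e1 := integral_arrival (μ := (volume : Measure R3))
    (F := fun p => q p.1 * coneVal a q₁ p.1 * r p)
    (k := rampProfile B) (s := fun y => ‖y - a‖) (by fun_prop) i1'
  unfold conePart convPart
  rw [← e1, ← e2, integral_prod _ i2]
  rw [show (volume : Measure R3).prod (volume : Measure ℝ) = (volume : Measure SpaceTime) from rfl,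
    ← integral_add i1 i2.integral_prod_left]
  refine integral_congr_ae (Eventually.of_forall fun p => ?_)
  by_cases hp : p ∈ lightCone a
  · have h0 : 0 ≤ p.2 := (norm_nonneg _).trans hp.le
    have := hP.timePairing_step (B := B) hq₁ ha hh hl p.1 h0
    simp only
    rw [this]
    simp only [mul_add, ← integral_const_mul, add_comm ‖p.1 - a‖]
    congr 1
    · ring
    · refine integral_congr_ae (Eventually.of_forall fun t => ?_)
      ring
  · simp [hr.zero p hp]

end ArrivalTimes

/-! ### Continuity of the contributions in the arrival time -/

section PartContinuity

variable {a : R3} {M M' h C G D l m K B : ℝ} {q q' q₁ q₂ g : R3 → ℂ} {F P P₁ P₂ r W : SpaceTime → ℂ}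

lemma continuous_sphPart (hg : Continuous g) (hG : ∀ y, ‖g y‖ ≤ G) : Continuous (sphPart a g) := by
  unfold sphPart
  have h1 : Continuous fun T : ℝ => ∫ ω, g (a + (T / 2) • ω) ∂sph := continuous_of_dominated (bound := fun _ => G)
    (fun T => (hg.comp (by fun_prop)).aestronglyMeasurable)
    (fun T => Eventually.of_forall fun ω => hG _) (integrable_const _)
    (Eventually.of_forall fun ω => hg.comp (by fun_prop))
  fun_prop

/-- A density supported in the forward cone and in a ball, continuous inside the cone. -/
structure IsConeDensity (a : R3) (G l : ℝ) (F : SpaceTime → ℂ) : Prop where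
  continuousOn : ContinuousOn F (lightCone a)
  zero : ∀ p ∉ lightCone a, F p = 0
  bound : ∀ p, ‖F p‖ ≤ G * Real.exp (l * p.2)
  support : ∀ p : SpaceTime, 1 < ‖p.1‖ → F p = 0

lemma IsConeDensity.measurable (hF : IsConeDensity a G l F) : Measurable F :=
  measurable_of_continuousOn_cone hF.continuousOn hF.zero

lemma IsConeDensity.nonneg (hF : IsConeDensity a G l F) : 0 ≤ G := by
  simpa using (norm_nonneg _).trans (hF.bound 0)

lemma continuousAt_of_ne_cone (hc : ContinuousOn F (lightCone a)) (h0 : ∀ p ∉ lightCone a, F p = 0)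
    {p : SpaceTime} (hp : ‖p.1 - a‖ ≠ p.2) : ContinuousAt F p := by
  rcases lt_or_gt_of_ne hp with h1 | h1
  · exact hc.continuousAt ((isOpen_lightCone a).mem_nhds h1)
  · refine continuousAt_const.congr (f := fun _ => (0 : ℂ)) ?_
    have : {p : SpaceTime | p.2 < ‖p.1 - a‖} ∈ 𝓝 p :=
      (isOpen_lt (by fun_prop) (by fun_prop)).mem_nhds h1
    filter_upwards [this] with p' hp'
    exact (h0 p' (not_lt.2 (le_of_lt hp'))).symm

/-- The density may jump on its cone, but for given T only the points with |y−a| = T/2 are affected,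
a null set. -/
lemma IsConeDensity.continuous_conePart (hF : IsConeDensity a G l F) (hl : 0 ≤ l) :
    Continuous (conePart a F) := by
  have hG := hF.nonneg
  refine continuous_iff_continuousAt.2 fun T => ?_
  unfold conePart
  refine continuousAt_of_dominated
    (bound := (closedBall (0 : R3) 1).indicator fun _ => G * Real.exp (l * (T + 1))) ?_ ?_ ?_ ?_
  · exact Eventually.of_forall fun T => (hF.measurable.comp (by fun_prop)).aestronglyMeasurable
  · filter_upwards [Iio_mem_nhds (lt_add_one T)] with T' hT'
    refine Eventually.of_forall fun y => ?_
    by_cases hy : y ∈ closedBall (0 : R3) 1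
    · rw [indicator_of_mem hy]
      refine (hF.bound _).trans ?_
      have : T' < T + 1 := hT'
      have := norm_nonneg (y - a)
      gcongr
      simp only
      linarith
    · rw [indicator_of_notMem hy, hF.support _ (by simpa using hy), norm_zero]
  · rw [integrable_indicator_iff measurableSet_closedBall]
    exact integrableOn_const (measure_closedBall_lt_top).ne
  · have hz := volume_ellipsoid (x := a) (a := a) T
    filter_upwards [measure_eq_zero_iff_ae_notMem.1 hz] with y hy
    have hne : ‖y - a‖ ≠ T - ‖y - a‖ := fun h => hy (by
      rw [norm_sub_rev]
      linarith)
    exact (continuousAt_of_ne_cone hF.continuousOn hF.zero (p := (y, T - ‖y - a‖)) hne).comp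
      (f := fun T : ℝ => ((y, T - ‖y - a‖) : SpaceTime)) (by fun_prop)

lemma IsConeDensity.conePart_of_nonpos (hF : IsConeDensity a G l F) {T : ℝ} (hT : T ≤ 0) :
    conePart a F T = 0 := by
  refine integral_eq_zero_of_ae (Eventually.of_forall fun y => hF.zero _ fun hy => ?_)
  have h1 : ‖y - a‖ < T - ‖y - a‖ := hy
  linarith [norm_nonneg (y - a)]

/-- For given T the jump of P meets the integration variable on the cone |x−a| = T − t, which is
null because each x allows one time t. -/
lemma IsConeDensity.continuous_convPart (hW : IsConeDensity a G l W)
    (hP : IsTailDensity a q K l P) (hl : 0 ≤ l) : Continuous (convPart W P) := by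
  have hG := hW.nonneg
  have hK := hP.nonneg
  refine continuous_iff_continuousAt.2 fun T => ?_
  unfold convPart
  refine continuousAt_of_dominated (bound := (closedBall (0 : R3) 1 ×ˢ Icc 0 (T + 1)).indicator
      fun _ => G * K * Real.exp (l * (T + 1))) ?_ ?_ ?_ ?_
  · exact Eventually.of_forall fun T =>
      (hW.measurable.mul (hP.measurable.comp (by fun_prop))).aestronglyMeasurable
  · filter_upwards [Iio_mem_nhds (lt_add_one T)] with T' hT'
    have hT' : T' < T + 1 := hT'
    refine Eventually.of_forall fun p => ?_
    by_cases hp : p ∈ closedBall (0 : R3) 1 ×ˢ Icc 0 (T + 1)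
    · rw [indicator_of_mem hp, norm_mul]
      have h1 := mul_le_mul (hW.bound p) (hP.bound (p.1, T' - p.2)) (norm_nonneg _)
        (by positivity)
      refine h1.trans ?_
      calc _ = G * K * (Real.exp (l * p.2) * Real.exp (l * (T' - p.2))) := by ring
        _ = G * K * Real.exp (l * T') := by rw [← Real.exp_add]; ring_nf
        _ ≤ _ := by gcongr
    · rw [indicator_of_notMem hp]
      suffices hs : W p * P (p.1, T' - p.2) = 0 by rw [hs, norm_zero]
      by_cases h1 : p.1 ∈ closedBall (0 : R3) 1
      · by_cases h2 : p ∈ lightCone a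
        · have h3 : ‖p.1 - a‖ < p.2 := h2
          have h0 := norm_nonneg (p.1 - a)
          rw [hP.zero _ (fun h4 => ?_), mul_zero]
          have h5 : ‖p.1 - a‖ < T' - p.2 := h4
          exact hp ⟨h1, by linarith, by linarith⟩
        · rw [hW.zero _ h2, zero_mul]
      · rw [hW.support _ (by simpa using h1), zero_mul]
  · rw [integrable_indicator_iff (measurableSet_closedBall.prod measurableSet_Icc)]
    exact integrableOn_const (((isCompact_closedBall _ _).prod isCompact_Icc).measure_lt_top).ne
  · have hms : MeasurableSet {p : SpaceTime | ‖p.1 - a‖ = T - p.2} :=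
      measurableSet_eq_fun (by fun_prop) (by fun_prop)
    have hz : volume {p : SpaceTime | ‖p.1 - a‖ = T - p.2} = 0 := by
      rw [show (volume : Measure SpaceTime) = (volume : Measure R3).prod volume from rfl,
        Measure.measure_prod_null hms]
      refine Eventually.of_forall fun y => ?_
      refine measure_mono_null (t := {T - ‖y - a‖}) (fun t ht => ?_) (by simp)
      have : ‖y - a‖ = T - t := ht
      simp only [mem_singleton_iff]
      linarith
    filter_upwards [measure_eq_zero_iff_ae_notMem.1 hz] with p hp
    refine ContinuousAt.mul continuousAt_const ?_
    exact (continuousAt_of_ne_cone hP.continuousOn hP.zero (p := (p.1, T - p.2)) hp).comp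
      (f := fun T : ℝ => ((p.1, T - p.2) : SpaceTime)) (by fun_prop)

lemma IsConeDensity.convPart_of_nonpos (hW : IsConeDensity a G l W)
    (hP : IsTailDensity a q K l P) {T : ℝ} (hT : T ≤ 0) : convPart W P T = 0 := by
  refine integral_eq_zero_of_ae (Eventually.of_forall fun p => ?_)
  by_cases h2 : p ∈ lightCone a
  · have h3 : ‖p.1 - a‖ < p.2 := h2
    have h0 := norm_nonneg (p.1 - a)
    simp only
    rw [hP.zero _ (fun h4 => ?_), mul_zero, Pi.zero_apply]
    have h5 : ‖p.1 - a‖ < T - p.2 := h4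
    linarith
  · simp only
    rw [hW.zero _ h2, zero_mul, Pi.zero_apply]

end PartContinuity

/-! ### The backscattering formula -/

section BackscatterFormula

variable {a : R3} {M M' h C G D l m K B : ℝ} {q q' q₁ q₂ g : R3 → ℂ} {F P P₁ P₂ r W : SpaceTime → ℂ}

lemma PotBound.sub (hq₁ : PotBound M h q₁) (hq₂ : PotBound M h q₂) :
    PotBound (2 * M) h (fun y => q₁ y - q₂ y) := by
  have hd : ∀ x, fderiv ℝ (fun y => q₁ y - q₂ y) x = fderiv ℝ q₁ x - fderiv ℝ q₂ x := fun x =>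
    fderiv_fun_sub (hq₁.contDiff.differentiable one_ne_zero x)
      (hq₂.contDiff.differentiable one_ne_zero x)
  refine ⟨hq₁.contDiff.sub hq₂.contDiff, fun x => ?_, fun x => ?_, fun x y => ?_, fun x hx => ?_⟩
  · rw [two_mul]
    exact (norm_sub_le _ _).trans (add_le_add (hq₁.bound x) (hq₂.bound x))
  · rw [hd, two_mul]
    exact (norm_sub_le _ _).trans (add_le_add (hq₁.bound_fderiv x) (hq₂.bound_fderiv x))
  · rw [hd, hd, sub_sub_sub_comm, two_mul, add_mul]
    exact (norm_sub_le _ _).trans (add_le_add (hq₁.lipschitz x y) (hq₂.lipschitz x y))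
  · rw [hq₁.zero x hx, hq₂.zero x hx, sub_zero]

/-- The rate of change of the remainder in the backscattering formula. -/
def arrivalDensity (a : R3) (q₁ q₂ : R3 → ℂ) (P₁ P₂ : SpaceTime → ℂ) (T : ℝ) : ℂ :=
  -- Each wave has a spherical front, a limit value of its regular part on the cone, and a density
  -- P. The first four terms pair one front with the limit value or the density of the other wave;
  -- the last two pair r₂ with the limit value and the density of the first. Front against front
  -- gives `sphMean`.
  sphPart a (fun y => damped a (fun y => q₁ y - q₂ y) y * coneVal a q₁ y) T +
  sphPart a (fun y => damped a (fun y => q₁ y - q₂ y) y * coneVal a q₂ y) T +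
  conePart a (fun p => damped a (fun y => q₁ y - q₂ y) p.1 * P₁ p) T +
  conePart a (fun p => damped a (fun y => q₁ y - q₂ y) p.1 * P₂ p) T +
  conePart a (fun p => (q₁ p.1 - q₂ p.1) * coneVal a q₁ p.1 * waveTail a q₂ P₂ p) T +
  convPart (fun p => waveTail a q₂ P₂ p * (q₁ p.1 - q₂ p.1)) P₁ T

lemma IsTailDensity.isConeDensity_damped (hP : IsTailDensity a q' K l P) (hq : PotBound M h q)
    (ha : ‖a‖ = 1) (hh : 0 < h) :
    IsConeDensity a ((4 * Real.pi * h)⁻¹ * M * K) l (fun p => damped a q p.1 * P p) where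
  continuousOn := ((hq.continuous_damped ha hh).comp continuous_fst).continuousOn.mul hP.continuousOn
  zero := fun p hp => by rw [hP.zero p hp, mul_zero]
  bound := fun p => by
    have := Real.pi_pos
    have hM := hq.nonneg
    rw [norm_mul, mul_assoc _ K]
    refine mul_le_mul ((hq.norm_damped_le ha hh _).trans ?_) (hP.bound p) (norm_nonneg _)
      (by positivity)
    have := hq.bound p.1
    gcongr
  support := fun p hp => by rw [damped, hq.zero _ (by linarith), smul_zero, zero_mul]

lemma IsTail.isConeDensity_mul (hr : IsTail a q' C l r) (hq : PotBound M h q) (hh : 0 < h)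
    (hg : Continuous g) (hgb : ∀ y, ‖g y‖ ≤ G) :
    IsConeDensity a (M * G * C) l (fun p => q p.1 * g p.1 * r p) where
  continuousOn := ((hq.contDiff.continuous.comp continuous_fst).mul
    (hg.comp continuous_fst)).continuousOn.mul hr.continuousOn
  zero := fun p hp => by rw [hr.zero p hp, mul_zero]
  bound := fun p => by
    have hM := hq.nonneg
    have hG : 0 ≤ G := (norm_nonneg _).trans (hgb 0)
    rw [norm_mul, norm_mul, mul_assoc _ C]
    exact mul_le_mul (mul_le_mul (hq.bound _) (hgb _) (norm_nonneg _) hM) (hr.bound p)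
      (norm_nonneg _) (by positivity)
  support := fun p hp => by rw [hq.zero _ (by linarith), zero_mul, zero_mul]

lemma IsTail.isConeDensity (hr : IsTail a q' C l r) (hq : PotBound M h q) (hh : 0 < h) :
    IsConeDensity a (M * 1 * C) l (fun p => r p * q p.1) := by
  have h1 := hr.isConeDensity_mul hq hh (g := fun _ => 1) continuous_const (G := 1) (by simp)
  refine (funext fun p => ?_ : (fun p : SpaceTime => r p * q p.1) = fun p => q p.1 * 1 * r p) ▸ h1
  ring

lemma integral_rampProfile_mul (hB : 0 ≤ B) {f : ℝ → ℂ} (h0 : ∀ T ≤ 0, f T = 0) :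
    ∫ T, rampProfile B T * f T = ∫ T in (0:ℝ)..B, ((B - T : ℝ) : ℂ) * f T := by
  rw [intervalIntegral.integral_of_le hB, ← integral_indicator measurableSet_Ioc]
  refine integral_congr_ae (Eventually.of_forall fun T => ?_)
  simp only
  by_cases hT : T ∈ Ioc 0 B
  · rw [indicator_of_mem hT, rampProfile_of_ge hT.2]
  · rw [indicator_of_notMem hT]
    rcases le_or_gt T 0 with h1 | h1
    · rw [h0 T h1, mul_zero]
    · rw [rampProfile_of_le (not_lt.1 fun h2 => hT ⟨h1, h2.le⟩), zero_mul]

lemma setIntegral_rampProfile_mul (hB : 0 ≤ B) (f : ℝ → ℂ) :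
    ∫ T in Ioi (0:ℝ), rampProfile B T * f T = ∫ T in (0:ℝ)..B, ((B - T : ℝ) : ℂ) * f T := by
  rw [← integral_indicator measurableSet_Ioi, intervalIntegral.integral_of_le hB,
    ← integral_indicator measurableSet_Ioc]
  refine integral_congr_ae (Eventually.of_forall fun T => ?_)
  by_cases hT : T ∈ Ioc 0 B
  · rw [indicator_of_mem hT, indicator_of_mem (show T ∈ Ioi (0:ℝ) from hT.1),
      rampProfile_of_ge hT.2]
  · rw [indicator_of_notMem hT]
    by_cases h1 : T ∈ Ioi (0:ℝ)
    · rw [indicator_of_mem h1, rampProfile_of_le (not_lt.1 fun h2 => hT ⟨h1, h2.le⟩), zero_mul]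
    · rw [indicator_of_notMem h1]

lemma timePairing_step_zero (r : SpaceTime → ℂ) (hB : 0 ≤ B) :
    timePairing r (stepProfile B) (a, 0) = ∫ T in (0:ℝ)..B, r (a, T) := by
  rw [timePairing, intervalIntegral.integral_of_le hB, ← integral_indicator measurableSet_Ioc]
  refine integral_congr_ae (Eventually.of_forall fun T => ?_)
  by_cases hT : T ∈ Ioc 0 B
  · simp [indicator_of_mem hT, stepProfile]
  · simp [indicator_of_notMem hT, stepProfile]

/-- Spherical averages of `q` around `a`, as a function of the two-way travel time. -/
def sphMean (a : R3) (q : R3 → ℂ) (T : ℝ) : ℂ :=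
  (32 * Real.pi ^ 2)⁻¹ • ∫ ω, q (a + (T / 2) • ω) ∂sph

/-- Single scattering: the density is q(y)/(16π²|y−a|²), and the factor T²/8 at |y−a| = T/2 makes
the weight the constant (32π²)⁻¹. -/
lemma PotBound.integral_incident (hq : PotBound M h q) (ha : ‖a‖ = 1) (hh : 0 < h) (hB : 0 ≤ B) :
    ∫ z, (4 * Real.pi * ‖z‖)⁻¹ • (q (a + z) * incident a (stepProfile B) (a + z, ‖z‖)) =
      ∫ T in (0:ℝ)..B, sphMean a q T := by
  have hqm := hq.contDiff.continuous.measurable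
  have i1 := (integrable_advanced (zero_lt_one' ℝ)
    ((hqm.comp measurable_fst).mul (measurable_incident (a := a) (measurable_stepProfile (B := B))))
    (hq.norm_mul_incident_le ha hh zero_le_one (norm_stepProfile_le zero_le_one)) (a, 0)).comp_sub_right a
  have hfe : ∀ y : R3, (4 * Real.pi * ‖y - a‖)⁻¹ •
      (q y * incident a (stepProfile B) (y, ‖y - a‖)) =
      damped a (damped a q) y * stepProfile B (2 * ‖y - a‖) := fun y => by
    simp only [incident, damped, Complex.real_smul, two_mul]
    ring
  simp only [Function.comp, Pi.mul_apply, zero_add, add_sub_cancel, hfe] at i1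
  have e1 := integral_arrival_sphere (a := a) i1
  rw [← integral_sub_right_eq_self _ a]
  simp only [add_sub_cancel, hfe]
  rw [e1, intervalIntegral.integral_of_le hB, ← integral_indicator measurableSet_Ioc,
    ← integral_indicator measurableSet_Ioi]
  refine integral_congr_ae (Eventually.of_forall fun T => ?_)
  by_cases hT0 : T ∈ Ioi (0:ℝ)
  · have hT' : (0:ℝ) < T := hT0
    have h2 : ∫ ω, damped a (damped a q) (a + (T / 2) • ω) ∂sph =
        ((4 * Real.pi * (T / 2))⁻¹ * (4 * Real.pi * (T / 2))⁻¹) •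
          ∫ ω, q (a + (T / 2) • ω) ∂sph := by
      rw [← integral_smul]
      refine integral_congr_ae ?_
      filter_upwards [sph_ae_norm] with ω hω
      simp only [damped, add_sub_cancel_left, norm_smul, hω, mul_one, smul_smul,
        Real.norm_of_nonneg (by positivity : 0 ≤ T / 2)]
    rw [indicator_of_mem hT0, h2, smul_smul]
    have hpi := Real.pi_pos
    have h3 : T ^ 2 / 8 * ((4 * Real.pi * (T / 2))⁻¹ * (4 * Real.pi * (T / 2))⁻¹) =
        (32 * Real.pi ^ 2)⁻¹ := by
      field_simp
      norm_num
    rw [h3]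
    by_cases hT : T ∈ Ioc 0 B
    · rw [indicator_of_mem hT, stepProfile, indicator_of_mem hT, Pi.one_apply, one_mul, sphMean]
    · rw [indicator_of_notMem hT, stepProfile, indicator_of_notMem hT, zero_mul]
  · rw [indicator_of_notMem hT0, indicator_of_notMem fun h => hT0 h.1]

lemma PotBound.continuous_sphPart_damped (hq : PotBound M h q) (hq' : PotBound M' h q')
    (ha : ‖a‖ = 1) (hh : 0 < h) :
    Continuous (sphPart a fun y => damped a q y * coneVal a q' y) := by
  have hpi := Real.pi_pos
  have hM := hq.nonneg
  refine continuous_sphPart (G := (4 * Real.pi * h)⁻¹ * M * M')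
    ((hq.continuous_damped ha hh).mul (hq'.continuous_coneVal ha hh)) fun y => ?_
  rw [norm_mul]
  refine mul_le_mul ((hq.norm_damped_le ha hh y).trans ?_) (hq'.norm_coneVal_le y) (norm_nonneg _)
    (by positivity)
  have := hq.bound y
  gcongr

/-- Time-integrated form of the backscattering formula. -/
theorem integral_waveTail_sub (h₁ : IsTailDensity a q₁ K l P₁) (h₂ : IsTailDensity a q₂ K l P₂)
    (hq₁ : PotBound M h q₁) (hq₂ : PotBound M h q₂) (ha : ‖a‖ = 1) (hh : 0 < h) (hl : 1 ≤ l)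
    (hB : 0 ≤ B) :
    (∫ T in (0:ℝ)..B, waveTail a q₁ P₁ (a, T)) - (∫ T in (0:ℝ)..B, waveTail a q₂ P₂ (a, T)) =
      (∫ T in (0:ℝ)..B, sphMean a (fun y => q₁ y - q₂ y) T) +
      ∫ T in (0:ℝ)..B, ((B - T : ℝ) : ℂ) * arrivalDensity a q₁ q₂ P₁ P₂ T := by
  have t₁ := h₁.isTail hq₁ ha hh hl
  have t₂ := h₂.isTail hq₂ ha hh hl
  have hq := hq₁.sub hq₂
  have hl0 : 0 < l := by linarith
  have hqm := hq.contDiff.continuous.measurable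
  have hsm := measurable_stepProfile (B := B)
  have hsb := norm_stepProfile_le (B := B) (m := l + 1) (by linarith)
  have mi := (hqm.comp measurable_fst).mul (measurable_incident (a := a) hsm)
  have mt := (hqm.comp measurable_fst).mul (measurable_timePairing t₁.measurable hsm)
  have bi := hq.norm_mul_incident_le ha hh (by linarith) hsb
  have bt := t₁.norm_mul_timePairing_le hq (lt_add_one l) hsb
  have i1 := integrable_advanced (by linarith) mi bi (a, 0)
  have i2 := integrable_advanced (by linarith) mt bt (a, 0)
  have i3 := integrable_cone_mul t₂.measurable t₂.zero t₂.bound mi bi (lt_add_one l)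
  have i4 := integrable_cone_mul t₂.measurable t₂.zero t₂.bound mt bt (lt_add_one l)
  simp only [Function.comp, Pi.mul_apply, zero_add] at i1 i2 i3 i4
  have key := t₁.timePairing_sub t₂ hq₁ hq₂ ha hh hl0 (lt_add_one l) hsm hsb
  rw [timePairing_step_zero _ hB, timePairing_step_zero _ hB] at key
  rw [key, waveFun]
  simp only [adjWave, mul_add, smul_add]
  rw [integral_add i1 i2, integral_add i3 i4, hq.integral_incident ha hh hB,
    t₂.integral_mul_incident hq ha hh hl0.le, h₂.integral_damped_mul hq hq₂ ha hh hl,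
    h₁.integral_mul_timePairing t₂ hq hq₁ ha hh hl]
  have e2 : ∫ z, (4 * Real.pi * ‖z‖)⁻¹ • ((q₁ (a + z) - q₂ (a + z)) *
      timePairing (waveTail a q₁ P₁) (stepProfile B) (a + z, ‖z‖)) =
      ∫ y, damped a (fun y => q₁ y - q₂ y) y *
        timePairing (waveTail a q₁ P₁) (stepProfile B) (y, ‖y - a‖) := by
    rw [← integral_sub_right_eq_self _ a]
    refine integral_congr_ae (Eventually.of_forall fun y => ?_)
    simp only [add_sub_cancel, damped, smul_mul_assoc]
  rw [e2, h₁.integral_damped_mul hq hq₁ ha hh hl]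
  have d1 := h₁.isConeDensity_damped hq ha hh
  have d2 := h₂.isConeDensity_damped hq ha hh
  have d3 := t₂.isConeDensity_mul hq hh (hq₁.continuous_coneVal ha hh) hq₁.norm_coneVal_le
  have d4 := t₂.isConeDensity hq hh
  rw [integral_rampProfile_mul hB fun T hT => d1.conePart_of_nonpos hT,
    integral_rampProfile_mul hB fun T hT => d2.conePart_of_nonpos hT,
    integral_rampProfile_mul hB fun T hT => d3.conePart_of_nonpos hT,
    integral_rampProfile_mul hB fun T hT => d4.convPart_of_nonpos h₁ hT,
    setIntegral_rampProfile_mul hB, setIntegral_rampProfile_mul hB]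
  have hi : ∀ f : ℝ → ℂ, Continuous f →
      IntervalIntegrable (fun T => ((B - T : ℝ) : ℂ) * f T) volume 0 B := fun f hf =>
    Continuous.intervalIntegrable (by fun_prop) _ _
  have c1 := hi _ (hq.continuous_sphPart_damped hq₁ ha hh)
  have c2 := hi _ (hq.continuous_sphPart_damped hq₂ ha hh)
  have c3 := hi _ (d1.continuous_conePart hl0.le)
  have c4 := hi _ (d2.continuous_conePart hl0.le)
  have c5 := hi _ (d3.continuous_conePart hl0.le)
  have c6 := hi _ (d4.continuous_convPart h₁ hl0.le)
  simp only [arrivalDensity, mul_add]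
  rw [intervalIntegral.integral_add ((((c1.add c2).add c3).add c4).add c5) c6,
    intervalIntegral.integral_add (((c1.add c2).add c3).add c4) c5,
    intervalIntegral.integral_add ((c1.add c2).add c3) c4,
    intervalIntegral.integral_add (c1.add c2) c3, intervalIntegral.integral_add c1 c2]
  ring

lemma continuous_arrivalDensity (h₁ : IsTailDensity a q₁ K l P₁) (h₂ : IsTailDensity a q₂ K l P₂)
    (hq₁ : PotBound M h q₁) (hq₂ : PotBound M h q₂) (ha : ‖a‖ = 1) (hh : 0 < h) (hl : 1 ≤ l) :
    Continuous (arrivalDensity a q₁ q₂ P₁ P₂) := by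
  have t₂ := h₂.isTail hq₂ ha hh hl
  have hq := hq₁.sub hq₂
  have hl0 : 0 ≤ l := by linarith
  exact (((((hq.continuous_sphPart_damped hq₁ ha hh).add
    (hq.continuous_sphPart_damped hq₂ ha hh)).add
    ((h₁.isConeDensity_damped hq ha hh).continuous_conePart hl0)).add
    ((h₂.isConeDensity_damped hq ha hh).continuous_conePart hl0)).add
    ((t₂.isConeDensity_mul hq hh (hq₁.continuous_coneVal ha hh)
      hq₁.norm_coneVal_le).continuous_conePart hl0)).add
    ((t₂.isConeDensity hq hh).continuous_convPart h₁ hl0)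

lemma PotBound.continuous_sphMean (hq : PotBound M h q) : Continuous (sphMean a q) := by
  have hqc := hq.contDiff.continuous
  unfold sphMean
  have h1 : Continuous fun T : ℝ => ∫ ω, q (a + (T / 2) • ω) ∂sph := continuous_of_dominated
    (bound := fun _ => M) (fun T => (hqc.comp (by fun_prop)).aestronglyMeasurable)
    (fun T => Eventually.of_forall fun ω => hq.bound _) (integrable_const _)
    (Eventually.of_forall fun ω => hqc.comp (by fun_prop))
  fun_prop

/-- The backscattering formula. -/
theorem waveTail_sub_eq (h₁ : IsTailDensity a q₁ K l P₁) (h₂ : IsTailDensity a q₂ K l P₂)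
    (hq₁ : PotBound M h q₁) (hq₂ : PotBound M h q₂) (ha : ‖a‖ = 1) (hh : 0 < h) (hl : 1 ≤ l)
    {T : ℝ} (hT : 0 < T) :
    waveTail a q₁ P₁ (a, T) - waveTail a q₂ P₂ (a, T) =
      sphMean a (fun y => q₁ y - q₂ y) T + ∫ s in (0:ℝ)..T, arrivalDensity a q₁ q₂ P₁ P₂ s := by
  have hd : ∀ {q : R3 → ℂ} {P : SpaceTime → ℂ}, IsTailDensity a q K l P → PotBound M h q →
      HasDerivAt (fun B => ∫ s in (0:ℝ)..B, waveTail a q P (a, s)) (waveTail a q P (a, T)) T := by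
    intro q P hP hq
    have hm := hP.measurable_waveTail hq ha hh hl
    refine intervalIntegral.integral_hasDerivAt_right
      (intervalIntegrable_of_bound hm (hP.norm_waveTail_le hq hl) a 0 T)
      ((hm.comp measurable_prodMk_left).stronglyMeasurable.stronglyMeasurableAtFilter) ?_
    have hmem : ((a, T) : SpaceTime) ∈ lightCone a := by
      change ‖a - a‖ < T
      simpa using hT
    exact ((hP.continuousOn_waveTail hq ha hh hl).continuousAt
      ((isOpen_lightCone a).mem_nhds hmem)).comp (f := fun s : ℝ => ((a, s) : SpaceTime))
      (by fun_prop)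
  have hc := continuous_arrivalDensity h₁ h₂ hq₁ hq₂ ha hh hl
  have hs := (hq₁.sub hq₂).continuous_sphMean (a := a)
  have hL := (hd h₁ hq₁).sub (hd h₂ hq₂)
  have hm1 := intervalIntegral.integral_hasDerivAt_right (hs.intervalIntegrable 0 T)
    hs.stronglyMeasurable.stronglyMeasurableAtFilter hs.continuousAt
  have hm2 := intervalIntegral.integral_hasDerivAt_right (hc.intervalIntegrable 0 T)
    hc.stronglyMeasurable.stronglyMeasurableAtFilter hc.continuousAt
  have hc' : Continuous fun s : ℝ => (s : ℂ) * arrivalDensity a q₁ q₂ P₁ P₂ s := by fun_prop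
  have hm3 := intervalIntegral.integral_hasDerivAt_right (hc'.intervalIntegrable 0 T)
    hc'.stronglyMeasurable.stronglyMeasurableAtFilter hc'.continuousAt
  have hid : HasDerivAt (fun B : ℝ => (B : ℂ)) 1 T := by
    simpa using (hasDerivAt_id T).ofReal_comp
  have hR := hm1.add ((hid.mul hm2).sub hm3)
  -- Splitting B − s makes the remainder a combination of primitives. On differentiation in B the
  -- two terms with the density at the endpoint cancel, and its integral up to B remains.
  have heq : (fun B => (∫ s in (0:ℝ)..B, waveTail a q₁ P₁ (a, s)) -
      ∫ s in (0:ℝ)..B, waveTail a q₂ P₂ (a, s)) =ᶠ[𝓝 T]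
      fun B => (∫ s in (0:ℝ)..B, sphMean a (fun y => q₁ y - q₂ y) s) +
        ((B : ℂ) * (∫ s in (0:ℝ)..B, arrivalDensity a q₁ q₂ P₁ P₂ s) -
          ∫ s in (0:ℝ)..B, (s : ℂ) * arrivalDensity a q₁ q₂ P₁ P₂ s) := by
    filter_upwards [Ioi_mem_nhds hT] with B hB
    rw [integral_waveTail_sub h₁ h₂ hq₁ hq₂ ha hh hl (le_of_lt hB),
      ← intervalIntegral.integral_const_mul, ← intervalIntegral.integral_sub
        (Continuous.intervalIntegrable (by fun_prop) _ _) (hc'.intervalIntegrable _ _)]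
    congr 1
    refine intervalIntegral.integral_congr fun s _ => ?_
    push_cast
    ring
  have := hL.unique (hR.congr_of_eventuallyEq heq)
  rw [this]
  ring

lemma norm_sphPart_le {A T : ℝ} (hT : 0 ≤ T) (hT2 : T ≤ 2) (hq : PotBound M h q)
    (hg : ∀ y, ‖g y‖ ≤ A * ‖q y‖) :
    ‖sphPart a g T‖ ≤ A * ∫ ω, ‖q (a + (T / 2) • ω)‖ ∂sph := by
  have hqc := hq.contDiff.continuous
  have h1 : ‖∫ ω, g (a + (T / 2) • ω) ∂sph‖ ≤ ∫ ω, A * ‖q (a + (T / 2) • ω)‖ ∂sph :=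
    norm_integral_le_of_norm_le (Continuous.integrable_sph (by fun_prop))
      (Eventually.of_forall fun ω => hg _)
  rw [integral_const_mul] at h1
  rw [sphPart, norm_smul, Real.norm_of_nonneg (by positivity)]
  have h2 : T ^ 2 / 8 ≤ 1 := by nlinarith
  exact (mul_le_mul h2 h1 (norm_nonneg _) zero_le_one).trans (one_mul _).le

/-- The density is evaluated at time T − |y−a| inside the cone, which forces 2|y−a| < T. -/
lemma norm_conePart_le {A T : ℝ} (hl : 0 ≤ l) (hq : PotBound M h q)
    (h0 : ∀ p ∉ lightCone a, F p = 0) (hF : ∀ p, ‖F p‖ ≤ A * Real.exp (l * p.2) * ‖q p.1‖) 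
    (hA : 0 ≤ A) :
    ‖conePart a F T‖ ≤ A * Real.exp (l * T) * ∫ y in ball a (T / 2), ‖q y‖ := by
  have hqc := hq.contDiff.continuous
  rw [← integral_const_mul, ← integral_indicator measurableSet_ball]
  refine norm_integral_le_of_norm_le ?_ (Eventually.of_forall fun y => ?_)
  · rw [integrable_indicator_iff measurableSet_ball]
    exact ((by fun_prop : Continuous fun y => A * Real.exp (l * T) * ‖q y‖).continuousOn.integrableOn_compact
      (isCompact_closedBall a (T / 2))).mono_set ball_subset_closedBall
  · by_cases hy : (y, T - ‖y - a‖) ∈ lightCone a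
    · have h1 : ‖y - a‖ < T - ‖y - a‖ := hy
      have h2 : y ∈ ball a (T / 2) := by
        rw [mem_ball_iff_norm]; linarith
      rw [indicator_of_mem h2]
      refine (hF _).trans ?_
      have := norm_nonneg (y - a)
      gcongr
      simp only
      linarith
    · rw [h0 _ hy, norm_zero]
      exact indicator_nonneg (fun _ _ => by positivity) _

/-- Both factors must lie in the cone, at times t and T − t, so |x−a| < T/2 and 0 < t < T; the
exponential growths multiply to exp(lT). -/
lemma norm_convPart_le {T : ℝ} (hq : PotBound M h q) (hT : 0 ≤ T)
    (hr0 : ∀ p ∉ lightCone a, r p = 0) (hr : ∀ p, ‖r p‖ ≤ C * Real.exp (l * p.2))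
    (hP : IsTailDensity a q' K l P) :
    ‖convPart (fun p => r p * q p.1) P T‖ ≤
      C * K * Real.exp (l * T) * T * ∫ y in ball a (T / 2), ‖q y‖ := by
  have hqc := hq.contDiff.continuous
  have hC : 0 ≤ C := by simpa using (norm_nonneg _).trans (hr 0)
  have hK := hP.nonneg
  have hi1 : Integrable ((ball a (T / 2)).indicator fun y => ‖q y‖) := by
    rw [integrable_indicator_iff measurableSet_ball]
    exact (hqc.norm.continuousOn.integrableOn_compact
      (isCompact_closedBall a (T / 2))).mono_set ball_subset_closedBall
  have hi2 : Integrable ((Ioo 0 T).indicator fun _ : ℝ => (1:ℝ)) := by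
    rw [integrable_indicator_iff measurableSet_Ioo]
    exact integrableOn_const (by simp)
  have h1 : ‖convPart (fun p => r p * q p.1) P T‖ ≤ ∫ p : SpaceTime, C * K * Real.exp (l * T) *
      ((ball a (T / 2)).indicator (fun y => ‖q y‖) p.1 *
        (Ioo 0 T).indicator (fun _ : ℝ => (1:ℝ)) p.2) := by
    refine norm_integral_le_of_norm_le ((hi1.mul_prod hi2).const_mul _)
      (Eventually.of_forall fun p => ?_)
    have hnn : 0 ≤ C * K * Real.exp (l * T) *
      ((ball a (T / 2)).indicator (fun y => ‖q y‖) p.1 *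
        (Ioo 0 T).indicator (fun _ : ℝ => (1:ℝ)) p.2) :=
      mul_nonneg (by positivity) (mul_nonneg (indicator_nonneg (fun _ _ => norm_nonneg _) _)
        (indicator_nonneg (fun _ _ => zero_le_one) _))
    by_cases hp1 : p ∈ lightCone a
    · by_cases hp2 : (p.1, T - p.2) ∈ lightCone a
      · have h3 : ‖p.1 - a‖ < p.2 := hp1
        have h4 : ‖p.1 - a‖ < T - p.2 := hp2
        have h0 := norm_nonneg (p.1 - a)
        rw [indicator_of_mem (show p.1 ∈ ball a (T / 2) by rw [mem_ball_iff_norm]; linarith),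
          indicator_of_mem (show p.2 ∈ Ioo 0 T from ⟨by linarith, by linarith⟩), norm_mul, norm_mul]
        calc _ ≤ (C * Real.exp (l * p.2) * ‖q p.1‖) * (K * Real.exp (l * (T - p.2))) :=
              mul_le_mul (mul_le_mul_of_nonneg_right (hr p) (norm_nonneg _))
                (hP.bound (p.1, T - p.2)) (norm_nonneg _) (by positivity)
          _ = C * K * (Real.exp (l * p.2) * Real.exp (l * (T - p.2))) * ‖q p.1‖ := by ring
          _ = C * K * Real.exp (l * T) * (‖q p.1‖ * 1) := by
            rw [← Real.exp_add]; ring_nf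
          _ ≤ _ := le_rfl
      · rw [hP.zero _ hp2, mul_zero, norm_zero]
        exact hnn
    · simp only
      rw [hr0 _ hp1, zero_mul, zero_mul, norm_zero]
      exact hnn
  refine h1.trans (le_of_eq ?_)
  rw [integral_const_mul, show (volume : Measure SpaceTime) =
    (volume : Measure R3).prod volume from rfl, integral_prod_mul,
    integral_indicator measurableSet_ball, integral_indicator measurableSet_Ioo]
  simp [hT]
  ring

/-- A bound for the arrival density in terms of the difference of the potentials. -/
theorem norm_arrivalDensity_le (h₁ : IsTailDensity a q₁ K l P₁) (h₂ : IsTailDensity a q₂ K l P₂)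
    (hq₁ : PotBound M h q₁) (hq₂ : PotBound M h q₂) (ha : ‖a‖ = 1) (hh : 0 < h) (hl : 1 ≤ l)
    {T : ℝ} (hT : 0 ≤ T) (hT2 : T ≤ 2) :
    ‖arrivalDensity a q₁ q₂ P₁ P₂ T‖ ≤
      2 * ((4 * Real.pi * h)⁻¹ * M) * (∫ ω, ‖q₁ (a + (T / 2) • ω) - q₂ (a + (T / 2) • ω)‖ ∂sph) +
      (2 * ((4 * Real.pi * h)⁻¹ * K) + M * (M + K) + 2 * ((M + K) * K)) * Real.exp (2 * l) *
        ∫ y in ball a (T / 2), ‖q₁ y - q₂ y‖ := by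
  have hpi := Real.pi_pos
  have hM := hq₁.nonneg
  have hK := h₁.nonneg
  have t₂ := h₂.isTail hq₂ ha hh hl
  have hq := hq₁.sub hq₂
  have hl0 : 0 ≤ l := by linarith
  have hsp : ∀ {q' : R3 → ℂ}, PotBound M h q' → ∀ y,
      ‖damped a (fun y => q₁ y - q₂ y) y * coneVal a q' y‖ ≤
        (4 * Real.pi * h)⁻¹ * M * ‖q₁ y - q₂ y‖ := fun hq' y => by
    rw [norm_mul, mul_right_comm]
    exact mul_le_mul (hq.norm_damped_le ha hh y) (hq'.norm_coneVal_le y) (norm_nonneg _)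
      (by positivity)
  have hcp : ∀ {q' : R3 → ℂ} {P : SpaceTime → ℂ}, IsTailDensity a q' K l P → ∀ p : SpaceTime,
      ‖damped a (fun y => q₁ y - q₂ y) p.1 * P p‖ ≤
        (4 * Real.pi * h)⁻¹ * K * Real.exp (l * p.2) * ‖q₁ p.1 - q₂ p.1‖ := fun hP p => by
    rw [norm_mul, mul_assoc _ K, mul_right_comm]
    exact mul_le_mul (hq.norm_damped_le ha hh _) (hP.bound p) (norm_nonneg _) (by positivity)
  have b1 := norm_sphPart_le (a := a) hT hT2 hq (hsp hq₁)
  have b2 := norm_sphPart_le (a := a) hT hT2 hq (hsp hq₂)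
  have b3 := norm_conePart_le (T := T) hl0 hq (fun p hp => by rw [h₁.zero p hp, mul_zero]) (hcp h₁)
    (by positivity)
  have b4 := norm_conePart_le (T := T) hl0 hq (fun p hp => by rw [h₂.zero p hp, mul_zero]) (hcp h₂)
    (by positivity)
  have b5 := norm_conePart_le (T := T) (A := M * (M + K)) hl0 hq
    (F := fun p => (q₁ p.1 - q₂ p.1) * coneVal a q₁ p.1 * waveTail a q₂ P₂ p)
    (fun p hp => by rw [t₂.zero p hp, mul_zero]) (fun p => by
      rw [norm_mul, norm_mul]
      calc _ ≤ ‖q₁ p.1 - q₂ p.1‖ * M * ((M + K) * Real.exp (l * p.2)) :=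
            mul_le_mul (mul_le_mul_of_nonneg_left (hq₁.norm_coneVal_le _) (norm_nonneg _))
              (t₂.bound p) (norm_nonneg _) (by positivity)
        _ = _ := by ring) (by positivity)
  have b6 := norm_convPart_le (T := T) hq hT t₂.zero t₂.bound h₁
  set I := ∫ y in ball a (T / 2), ‖q₁ y - q₂ y‖
  set J := ∫ ω, ‖q₁ (a + (T / 2) • ω) - q₂ (a + (T / 2) • ω)‖ ∂sph
  have hI : 0 ≤ I := integral_nonneg fun _ => norm_nonneg _
  have hexp : Real.exp (l * T) ≤ Real.exp (2 * l) :=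
    Real.exp_le_exp.2 (by nlinarith)
  have x3 : (4 * Real.pi * h)⁻¹ * K * Real.exp (l * T) * I ≤
      (4 * Real.pi * h)⁻¹ * K * Real.exp (2 * l) * I := by gcongr
  have x5 : M * (M + K) * Real.exp (l * T) * I ≤ M * (M + K) * Real.exp (2 * l) * I := by gcongr
  have x6 : (M + K) * K * Real.exp (l * T) * T * I ≤
      (M + K) * K * Real.exp (2 * l) * 2 * I := by gcongr
  unfold arrivalDensity
  refine (norm_add_le _ _).trans ((add_le_add_left ((norm_add_le _ _).trans (add_le_add_left
    ((norm_add_le _ _).trans (add_le_add_left ((norm_add_le _ _).trans (add_le_add_left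
    (norm_add_le _ _) _)) _)) _)) _).trans ?_)
  linarith

end BackscatterFormula

/-! ### The angular measure without the sine factor -/

section FlatAngles

lemma exists_frame {e : R3} (he : ‖e‖ = 1) : ∃ b : OrthonormalBasis (Fin 3) ℝ R3, b 2 = e := by
  have h1 : Orthonormal ℝ (({2} : Set (Fin 3)).domRestrict fun _ => e) := by
    refine ⟨fun _ => he, fun i j hij => absurd (Subsingleton.elim i j) hij⟩
  obtain ⟨b, hb⟩ := h1.exists_orthonormalBasis_extension_of_card_eq (by simp)
  exact ⟨b, hb 2 rfl⟩

/-- The measure `dθ dφ` in spherical coordinates. -/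
def flat : Measure (ℝ × ℝ) :=
  (volume.restrict (Ioo 0 Real.pi)).prod (volume.restrict (Ioo (-Real.pi) Real.pi))

lemma flat_univ : flat univ = ENNReal.ofReal (2 * Real.pi ^ 2) := by
  rw [flat, ← univ_prod_univ, Measure.prod_prod, Measure.restrict_apply_univ,
    Measure.restrict_apply_univ, Real.volume_Ioo, Real.volume_Ioo,
    ← ENNReal.ofReal_mul (by simp [Real.pi_pos.le])]
  congr 1
  ring

lemma angular_eq_withDensity :
    angular = flat.withDensity fun p => ENNReal.ofReal (Real.sin p.1) := by
  rw [angular, flat, prod_withDensity_left (by fun_prop)]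

lemma flat_ae_mem : ∀ᵐ p ∂flat, p.1 ∈ Ioo 0 Real.pi := by
  exact (Measure.quasiMeasurePreserving_fst (μ := volume.restrict (Ioo 0 Real.pi))
    (ν := volume.restrict (Ioo (-Real.pi) Real.pi))).ae (ae_restrict_mem measurableSet_Ioo)

lemma integral_angular_eq_flat {E : Type*} [NormedAddCommGroup E] [NormedSpace ℝ E]
    (g : ℝ × ℝ → E) : ∫ p, g p ∂angular = ∫ p, Real.sin p.1 • g p ∂flat := by
  rw [angular_eq_withDensity, integral_withDensity_eq_integral_toReal_smul (by fun_prop)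
    (Eventually.of_forall fun _ => ENNReal.ofReal_lt_top)]
  refine integral_congr_ae ?_
  filter_upwards [flat_ae_mem] with p hp
  rw [ENNReal.toReal_ofReal (Real.sin_pos_of_mem_Ioo hp).le]

/-- The density of `dθ dφ` with respect to the surface measure, polar axis `e`. -/
def polarWeight (e ω : R3) : ℝ := (√(1 - ⟪ω, e⟫ ^ 2))⁻¹

lemma inner_sphPt (b : OrthonormalBasis (Fin 3) ℝ R3) (p : ℝ × ℝ) :
    ⟪sphPt b p, b 2⟫ = Real.cos p.1 := by
  have h := b.orthonormal
  simp only [sphPt, inner_add_left, real_inner_smul_left, b.inner_eq_ite]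
  simp

lemma polarWeight_sphPt (b : OrthonormalBasis (Fin 3) ℝ R3) {p : ℝ × ℝ}
    (hp : p.1 ∈ Ioo 0 Real.pi) : polarWeight (b 2) (sphPt b p) = (Real.sin p.1)⁻¹ := by
  rw [polarWeight, inner_sphPt, ← Real.sin_sq, Real.sqrt_sq (Real.sin_pos_of_mem_Ioo hp).le]

lemma measurable_polarWeight : Measurable fun p : R3 × R3 => polarWeight p.1 p.2 := by
  unfold polarWeight; fun_prop

lemma lintegral_flat (b : OrthonormalBasis (Fin 3) ℝ R3) {F : R3 → ℝ≥0∞} (hF : Measurable F) :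
    ∫⁻ p, F (sphPt b p) ∂flat = ∫⁻ ω, ENNReal.ofReal (polarWeight (b 2) ω) * F ω ∂sph := by
  have hw : Measurable fun ω => ENNReal.ofReal (polarWeight (b 2) ω) * F ω :=
    ((measurable_polarWeight.comp measurable_prodMk_left).ennreal_ofReal).mul hF
  rw [sph_eq_map b, lintegral_map hw (continuous_sphPt b).measurable, angular_eq_withDensity,
    lintegral_withDensity_eq_lintegral_mul _ (by fun_prop)
      (show Measurable fun p => ENNReal.ofReal (polarWeight (b 2) (sphPt b p)) * F (sphPt b p) from
        hw.comp (continuous_sphPt b).measurable)]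
  refine lintegral_congr_ae ?_
  filter_upwards [flat_ae_mem] with p hp
  have hs := Real.sin_pos_of_mem_Ioo hp
  simp only [Pi.mul_apply]
  rw [polarWeight_sphPt b hp, ← mul_assoc, ← ENNReal.ofReal_mul hs.le, mul_inv_cancel₀ hs.ne',
    ENNReal.ofReal_one, one_mul]

lemma lintegral_sq_le {X : Type*} [MeasurableSpace X] (μ : Measure X) {f : X → ℝ≥0∞}
    (hf : AEMeasurable f μ) : (∫⁻ x, f x ∂μ) ^ 2 ≤ μ univ * ∫⁻ x, f x ^ 2 ∂μ := by
  have h := ENNReal.lintegral_mul_le_Lp_mul_Lq μ (Real.HolderConjugate.two_two) hf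
    (aemeasurable_const (b := (1 : ℝ≥0∞)))
  simp only [Pi.mul_apply, mul_one, ENNReal.one_rpow, lintegral_one] at h
  calc _ ≤ ((∫⁻ x, f x ^ (2:ℝ) ∂μ) ^ (1 / 2 : ℝ) * μ univ ^ (1 / 2 : ℝ)) ^ 2 := by gcongr
    _ = _ := by
      rw [mul_pow, ← ENNReal.rpow_natCast, ← ENNReal.rpow_natCast, ← ENNReal.rpow_mul,
        ← ENNReal.rpow_mul]
      norm_num
      rw [mul_comm]

end FlatAngles

/-! ### From the spherical mean to a boundary value and angular derivatives -/

section SphericalMeanDerivative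

variable {a : R3} {M h : ℝ} {q : R3 → ℂ}

/-- The derivative of `τ ∫ q(a + τ ω) dω`. -/
def meanDeriv (a : R3) (q : R3 → ℂ) (τ : ℝ) : ℂ :=
  ∫ ω, (q (a + τ • ω) + τ • fderiv ℝ q (a + τ • ω) ω) ∂sph

lemma PotBound.hasDerivAt_mean (hq : PotBound M h q) (τ : ℝ) :
    HasDerivAt (fun τ : ℝ => τ • ∫ ω, q (a + τ • ω) ∂sph) (meanDeriv a q τ) τ := by
  have hqc := hq.contDiff.continuous
  have hdc := hq.continuous_fderiv
  have hdiff := hq.contDiff.differentiable one_ne_zero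
  have h1 : HasDerivAt (fun τ : ℝ => ∫ ω, q (a + τ • ω) ∂sph)
      (∫ ω, fderiv ℝ q (a + τ • ω) ω ∂sph) τ := by
    refine (hasDerivAt_integral_of_dominated_loc_of_deriv_le (bound := fun _ => M)
      (F := fun (τ : ℝ) ω => q (a + τ • ω)) (F' := fun (τ : ℝ) ω => fderiv ℝ q (a + τ • ω) ω)
      (s := univ) univ_mem ?_ ?_ ?_ ?_ (integrable_const _) ?_).2
    · exact Eventually.of_forall fun τ => (hqc.comp (by fun_prop)).aestronglyMeasurable
    · exact Continuous.integrable_sph (hqc.comp (by fun_prop))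
    · exact (by fun_prop : Continuous fun ω => fderiv ℝ q (a + τ • ω) ω).aestronglyMeasurable
    · filter_upwards [sph_ae_norm] with ω hω τ _
      have := (fderiv ℝ q (a + τ • ω)).le_opNorm ω
      rw [hω, mul_one] at this
      exact this.trans (hq.bound_fderiv _)
    · refine Eventually.of_forall fun ω τ _ => ?_
      have h2 : HasDerivAt (fun τ : ℝ => a + τ • ω) ω τ := by
        simpa using ((hasDerivAt_id τ).smul_const ω).const_add a
      exact (hdiff _).hasFDerivAt.comp_hasDerivAt τ h2
  refine ((hasDerivAt_id τ).smul h1).congr_deriv ?_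
  rw [meanDeriv, integral_add (Continuous.integrable_sph (by fun_prop))
    (Continuous.integrable_sph (by fun_prop)), integral_smul]
  simp [add_comm]

lemma PotBound.continuous_meanDeriv (hq : PotBound M h q) : Continuous (meanDeriv a q) := by
  have hqc := hq.contDiff.continuous
  have hdc := hq.continuous_fderiv
  unfold meanDeriv
  refine continuous_iff_continuousAt.2 fun τ => ?_
  refine continuousAt_of_dominated (bound := fun _ => M + (|τ| + 1) * M) ?_ ?_
    (integrable_const _) ?_
  · exact Eventually.of_forall fun τ => Continuous.aestronglyMeasurable (by fun_prop)
  · have h1 : ∀ᶠ τ' in 𝓝 τ, |τ'| < |τ| + 1 :=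
      continuous_abs.continuousAt.eventually (Iio_mem_nhds (lt_add_one |τ|))
    filter_upwards [h1] with τ' hτ'
    filter_upwards [sph_ae_norm] with ω hω
    have h2 := (fderiv ℝ q (a + τ' • ω)).le_opNorm ω
    rw [hω, mul_one] at h2
    refine (norm_add_le _ _).trans (add_le_add (hq.bound _) ?_)
    rw [norm_smul, Real.norm_eq_abs]
    exact mul_le_mul hτ'.le (h2.trans (hq.bound_fderiv _)) (norm_nonneg _) (by positivity)
  · exact Eventually.of_forall fun ω => Continuous.continuousAt (by fun_prop)

/-- The sum of squares of the angular derivatives. -/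
def angSq (q : R3 → ℂ) (x : R3) : ℝ := ∑ i : Fin 3, ∑ j ∈ Finset.Ioi i, ‖angularD i j q x‖ ^ 2

lemma angSq_eq (q : R3 → ℂ) (x : R3) : angSq q x =
    ‖angularD 0 1 q x‖ ^ 2 + ‖angularD 0 2 q x‖ ^ 2 + ‖angularD 1 2 q x‖ ^ 2 := by
  rw [angSq, Fin.sum_univ_three, show Finset.Ioi (0 : Fin 3) = {1, 2} from rfl,
    show Finset.Ioi (1 : Fin 3) = {2} from rfl, show Finset.Ioi (2 : Fin 3) = ∅ from rfl]
  simp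

lemma fderiv_apply_eq (q : R3 → ℂ) (x v : R3) : fderiv ℝ q x v =
    (v 0 : ℂ) * partialD 0 q x + (v 1 : ℂ) * partialD 1 q x + (v 2 : ℂ) * partialD 2 q x := by
  have h1 : v = v 0 • stdVec 0 + v 1 • stdVec 1 + v 2 • stdVec 2 := by
    ext i
    fin_cases i <;> simp [stdVec]
  conv_lhs => rw [h1]
  simp [partialD]

/-- The derivative along a rotation field is controlled by the angular derivatives. -/
lemma norm_fderiv_rotation_le (q : R3 → ℂ) {x u v : R3} (hu : ‖u‖ = 1) (hv : ‖v‖ = 1)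
    (huv : ⟪u, v⟫ = 0) : ‖fderiv ℝ q x (⟪x, u⟫ • v - ⟪x, v⟫ • u)‖ ^ 2 ≤ angSq q x := by
  have hin : ∀ x y : R3, ⟪x, y⟫ = x 0 * y 0 + x 1 * y 1 + x 2 * y 2 := fun x y => by
    simp [PiLp.inner_apply, Fin.sum_univ_three, mul_comm]
  have hu' : u 0 * u 0 + u 1 * u 1 + u 2 * u 2 = 1 := by
    rw [← hin, real_inner_self_eq_norm_sq, hu, one_pow]
  have hv' : v 0 * v 0 + v 1 * v 1 + v 2 * v 2 = 1 := by
    rw [← hin, real_inner_self_eq_norm_sq, hv, one_pow]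
  rw [hin] at huv
  set c01 := u 0 * v 1 - u 1 * v 0
  set c02 := u 0 * v 2 - u 2 * v 0
  set c12 := u 1 * v 2 - u 2 * v 1
  -- The components of u ∧ v form a unit vector by Lagrange's identity, so Cauchy–Schwarz costs no
  -- constant below.
  have hc : c01 ^ 2 + c02 ^ 2 + c12 ^ 2 = 1 := by
    have : c01 ^ 2 + c02 ^ 2 + c12 ^ 2 = (u 0 * u 0 + u 1 * u 1 + u 2 * u 2) *
        (v 0 * v 0 + v 1 * v 1 + v 2 * v 2) - (u 0 * v 0 + u 1 * v 1 + u 2 * v 2) ^ 2 := by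
      simp only [c01, c02, c12]; ring
    rw [this, hu', hv', huv]; norm_num
  have he : fderiv ℝ q x (⟪x, u⟫ • v - ⟪x, v⟫ • u) =
      (c01 : ℂ) * angularD 0 1 q x + (c02 : ℂ) * angularD 0 2 q x +
        (c12 : ℂ) * angularD 1 2 q x := by
    rw [fderiv_apply_eq, hin, hin]
    simp only [angularD, c01, c02, c12, PiLp.sub_apply, PiLp.smul_apply, smul_eq_mul]
    push_cast
    ring
  rw [he, angSq_eq]
  have h1 : ‖(c01 : ℂ) * angularD 0 1 q x + (c02 : ℂ) * angularD 0 2 q x +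
        (c12 : ℂ) * angularD 1 2 q x‖ ≤ |c01| * ‖angularD 0 1 q x‖ + |c02| * ‖angularD 0 2 q x‖ +
        |c12| * ‖angularD 1 2 q x‖ := by
    refine (norm_add₃_le).trans (le_of_eq ?_)
    simp
  set A := ‖angularD 0 1 q x‖
  set B := ‖angularD 0 2 q x‖
  set C := ‖angularD 1 2 q x‖
  have hc' : |c01| ^ 2 + |c02| ^ 2 + |c12| ^ 2 = 1 := by simpa only [sq_abs] using hc
  calc _ ≤ (|c01| * A + |c02| * B + |c12| * C) ^ 2 := by gcongr
    _ ≤ (|c01| ^ 2 + |c02| ^ 2 + |c12| ^ 2) * (A ^ 2 + B ^ 2 + C ^ 2) := by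
      nlinarith [sq_nonneg (|c01| * B - |c02| * A), sq_nonneg (|c01| * C - |c12| * A),
        sq_nonneg (|c02| * C - |c12| * B)]
    _ = _ := by rw [hc', one_mul]

/-- The direction obtained from `sin θ ω` by removing a multiple of `∂_θ`; it is tangent to the
spheres around the origin. -/
def tangentDir (b : OrthonormalBasis (Fin 3) ℝ R3) (τ : ℝ) (p : ℝ × ℝ) : R3 :=
  (1 - τ * Real.cos p.1) • (Real.cos p.2 • b 0 + Real.sin p.2 • b 1) +
    (τ * Real.sin p.1) • b 2

lemma tangentDir_eq (b : OrthonormalBasis (Fin 3) ℝ R3) (τ : ℝ) (p : ℝ × ℝ) :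
    tangentDir b τ p =
      ⟪-b 2 + τ • sphPt b p, -b 2⟫ • (Real.cos p.2 • b 0 + Real.sin p.2 • b 1) -
      ⟪-b 2 + τ • sphPt b p, Real.cos p.2 • b 0 + Real.sin p.2 • b 1⟫ • (-b 2) := by
  have h := b.orthonormal
  have h1 : ⟪-b 2 + τ • sphPt b p, -b 2⟫ = 1 - τ * Real.cos p.1 := by
    rw [inner_neg_right, inner_add_left, real_inner_smul_left, inner_sphPt, inner_neg_left,
      real_inner_self_eq_norm_sq, h.1 2]
    ring
  have h2 : ⟪-b 2 + τ • sphPt b p, Real.cos p.2 • b 0 + Real.sin p.2 • b 1⟫ =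
      τ * Real.sin p.1 := by
    simp only [sphPt, inner_add_left, inner_add_right, inner_neg_left, real_inner_smul_left,
      real_inner_smul_right, b.inner_eq_ite]
    simp only [Fin.isValue, Fin.reduceEq, if_true, if_false]
    linear_combination (τ * Real.sin p.1) * Real.sin_sq_add_cos_sq p.2
  rw [h1, h2, tangentDir, smul_neg, sub_neg_eq_add]

lemma norm_fderiv_tangentDir_le (b : OrthonormalBasis (Fin 3) ℝ R3) (q : R3 → ℂ) (τ : ℝ)
    (p : ℝ × ℝ) : ‖fderiv ℝ q (-b 2 + τ • sphPt b p) (tangentDir b τ p)‖ ^ 2 ≤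
      angSq q (-b 2 + τ • sphPt b p) := by
  have h := b.orthonormal
  rw [tangentDir_eq]
  refine norm_fderiv_rotation_le q (by rw [norm_neg]; exact h.1 2) ?_ ?_
  · have h1 := norm_sq_comb b (Real.cos p.2) (Real.sin p.2) 0
    rw [zero_smul, add_zero, Real.cos_sq_add_sin_sq] at h1
    nlinarith [norm_nonneg (Real.cos p.2 • b 0 + Real.sin p.2 • b 1)]
  · simp [inner_add_right, inner_neg_left, real_inner_smul_right, b.inner_eq_ite]

lemma continuous_tangentDir (b : OrthonormalBasis (Fin 3) ℝ R3) (τ : ℝ) :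
    Continuous (tangentDir b τ) := by
  unfold tangentDir; fun_prop

/-- The derivative of spherical coordinates in the polar angle. -/
def polarDir (b : OrthonormalBasis (Fin 3) ℝ R3) (p : ℝ × ℝ) : R3 :=
  (Real.cos p.1 * Real.cos p.2) • b 0 + (Real.cos p.1 * Real.sin p.2) • b 1 - Real.sin p.1 • b 2

lemma continuous_polarDir (b : OrthonormalBasis (Fin 3) ℝ R3) : Continuous (polarDir b) := by
  unfold polarDir; fun_prop

lemma hasDerivAt_sphPt_polar (b : OrthonormalBasis (Fin 3) ℝ R3) (θ φ : ℝ) :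
    HasDerivAt (fun θ => sphPt b (θ, φ)) (polarDir b (θ, φ)) θ := by
  unfold sphPt polarDir
  refine (((((Real.hasDerivAt_sin θ).mul_const (Real.cos φ)).smul_const (b 0)).add
    (((Real.hasDerivAt_sin θ).mul_const (Real.sin φ)).smul_const (b 1))).add
    ((Real.hasDerivAt_cos θ).smul_const (b 2))).congr_deriv ?_
  simp only [neg_smul, sub_eq_add_neg]

/-- The coefficient τ − cos θ is the one for which the remainder is tangent to the sphere about the
origin through −`b 2` + τω. The radial derivative thus splits into a polar derivative, to be
integrated by parts, and an angular one. -/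
lemma sin_smul_sphPt (b : OrthonormalBasis (Fin 3) ℝ R3) (τ : ℝ) (p : ℝ × ℝ) :
    Real.sin p.1 • sphPt b p = (τ - Real.cos p.1) • polarDir b p + tangentDir b τ p := by
  have e1 : Real.sin p.1 * (Real.sin p.1 * Real.cos p.2) =
      (τ - Real.cos p.1) * (Real.cos p.1 * Real.cos p.2) +
        (1 - τ * Real.cos p.1) * Real.cos p.2 := by
    linear_combination Real.cos p.2 * Real.sin_sq_add_cos_sq p.1
  have e2 : Real.sin p.1 * (Real.sin p.1 * Real.sin p.2) =
      (τ - Real.cos p.1) * (Real.cos p.1 * Real.sin p.2) +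
        (1 - τ * Real.cos p.1) * Real.sin p.2 := by
    linear_combination Real.sin p.2 * Real.sin_sq_add_cos_sq p.1
  simp only [sphPt, polarDir, tangentDir, smul_add, smul_sub, smul_smul]
  rw [e1, e2]
  module

lemma Continuous.integrable_flat {E : Type*} [NormedAddCommGroup E] {g : ℝ × ℝ → E}
    (hg : Continuous g) : Integrable g flat := by
  rw [flat, Measure.prod_restrict]
  exact (hg.continuousOn.integrableOn_compact (isCompact_Icc.prod isCompact_Icc)).mono_set
    (prod_mono Ioo_subset_Icc_self Ioo_subset_Icc_self)

/-- Integration by parts in the polar angle turns the radial derivative into an angular one. -/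
theorem PotBound.meanDeriv_eq (hq : PotBound M h q) (hh : 0 < h)
    (b : OrthonormalBasis (Fin 3) ℝ R3) {τ : ℝ} (hτ : 0 ≤ τ) :
    meanDeriv (-b 2) q τ = (2 * Real.pi * (1 - τ)) • q ((1 - τ) • (-b 2)) +
      τ • ∫ p, fderiv ℝ q (-b 2 + τ • sphPt b p) (tangentDir b τ p) ∂flat := by
  have hqc := hq.contDiff.continuous
  have hdc := hq.continuous_fderiv
  have hdiff := hq.contDiff.differentiable one_ne_zero
  have hsc := continuous_sphPt b
  have htc := continuous_tangentDir b τ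
  have hpc := continuous_polarDir b
  have hg : Continuous fun ω => q (-b 2 + τ • ω) + τ • fderiv ℝ q (-b 2 + τ • ω) ω := by fun_prop
  rw [meanDeriv, integral_sph b hg.aestronglyMeasurable, integral_angular_eq_flat]
  have hpt : ∀ p : ℝ × ℝ, Real.sin p.1 • (q (-b 2 + τ • sphPt b p) +
      τ • fderiv ℝ q (-b 2 + τ • sphPt b p) (sphPt b p)) =
      (Real.sin p.1 • q (-b 2 + τ • sphPt b p) + (τ - Real.cos p.1) •
        fderiv ℝ q (-b 2 + τ • sphPt b p) (τ • polarDir b p)) +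
      τ • fderiv ℝ q (-b 2 + τ • sphPt b p) (tangentDir b τ p) := fun p => by
    have h1 : Real.sin p.1 • fderiv ℝ q (-b 2 + τ • sphPt b p) (sphPt b p) =
        (τ - Real.cos p.1) • fderiv ℝ q (-b 2 + τ • sphPt b p) (polarDir b p) +
          fderiv ℝ q (-b 2 + τ • sphPt b p) (tangentDir b τ p) := by
      rw [← map_smul, sin_smul_sphPt b τ p, map_add, map_smul]
    rw [smul_add, smul_comm _ τ, h1, map_smul, smul_add, smul_comm τ]
    abel
  simp only [hpt]
  rw [integral_add (Continuous.integrable_flat (by fun_prop))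
    (Continuous.integrable_flat (by fun_prop)), integral_smul]
  congr 1
  have hI : Continuous fun p : ℝ × ℝ => Real.sin p.1 • q (-b 2 + τ • sphPt b p) +
      (τ - Real.cos p.1) • fderiv ℝ q (-b 2 + τ • sphPt b p) (τ • polarDir b p) := by fun_prop
  have hIi := hI.integrable_flat
  rw [flat] at hIi ⊢
  rw [integral_prod_symm _ hIi]
  have hinner : ∀ φ : ℝ, ∫ θ in Ioo 0 Real.pi, (Real.sin θ • q (-b 2 + τ • sphPt b (θ, φ)) +
      (τ - Real.cos θ) • fderiv ℝ q (-b 2 + τ • sphPt b (θ, φ)) (τ • polarDir b (θ, φ))) =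
      (1 - τ) • q ((1 - τ) • (-b 2)) := fun φ => by
    -- Since sin θ is the derivative of τ − cos θ, the integrand is exact. With a = −`b 2`, the end
    -- θ = π is the point (1+τ)a outside the support, and θ = 0 is the point (1−τ)a.
    have hd : ∀ θ : ℝ, HasDerivAt (fun θ => (τ - Real.cos θ) • q (-b 2 + τ • sphPt b (θ, φ)))
        (Real.sin θ • q (-b 2 + τ • sphPt b (θ, φ)) + (τ - Real.cos θ) •
          fderiv ℝ q (-b 2 + τ • sphPt b (θ, φ)) (τ • polarDir b (θ, φ))) θ := fun θ => by
      have h1 : HasDerivAt (fun θ => τ - Real.cos θ) (Real.sin θ) θ := by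
        simpa using (Real.hasDerivAt_cos θ).const_sub τ
      have h2 : HasDerivAt (fun θ => q (-b 2 + τ • sphPt b (θ, φ)))
          (fderiv ℝ q (-b 2 + τ • sphPt b (θ, φ)) (τ • polarDir b (θ, φ))) θ :=
        (hdiff _).hasFDerivAt.comp_hasDerivAt θ
          (((hasDerivAt_sphPt_polar b θ φ).const_smul τ).const_add (-b 2))
      exact (h1.smul h2).congr_deriv (add_comm _ _)
    rw [← integral_Ioc_eq_integral_Ioo, ← intervalIntegral.integral_of_le Real.pi_pos.le,
      intervalIntegral.integral_eq_sub_of_hasDerivAt (fun θ _ => hd θ)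
        (Continuous.intervalIntegrable (hI.comp (by fun_prop :
          Continuous fun θ : ℝ => ((θ, φ) : ℝ × ℝ))) _ _)]
    have e1 : -b 2 + τ • sphPt b (Real.pi, φ) = (1 + τ) • (-b 2) := by
      simp only [sphPt, Real.sin_pi, Real.cos_pi]; module
    have e2 : -b 2 + τ • sphPt b (0, φ) = (1 - τ) • (-b 2) := by
      simp only [sphPt, Real.sin_zero, Real.cos_zero]; module
    have e3 : q ((1 + τ) • (-b 2)) = 0 := by
      refine hq.zero _ ?_
      rw [norm_smul, norm_neg, b.orthonormal.1 2, mul_one, Real.norm_of_nonneg (by linarith)]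
      linarith
    rw [e1, e2, e3, Real.cos_pi, Real.cos_zero]
    simp only [Complex.real_smul]
    push_cast
    ring
  simp only [hinner]
  rw [integral_const, smul_smul]
  congr 1
  rw [measureReal_restrict_apply_univ, Real.volume_real_Ioo_of_le (by linarith [Real.pi_pos])]
  ring

/-- The deviation of `∂_τ (τ ∫ q(a + τ ω) dω)` from its boundary term. -/
theorem PotBound.enorm_meanDeriv_sub_le (hq : PotBound M h q) (hh : 0 < h) (ha : ‖a‖ = 1) {τ : ℝ}
    (hτ : 0 ≤ τ) (hτ1 : τ ≤ 1) :
    ‖meanDeriv a q τ - (2 * Real.pi * (1 - τ)) • q ((1 - τ) • a)‖ₑ ^ 2 ≤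
      ENNReal.ofReal (2 * Real.pi ^ 2) * ∫⁻ ω, ENNReal.ofReal (polarWeight a ω) *
        ENNReal.ofReal (angSq q (a + τ • ω)) ∂sph := by
  obtain ⟨b, hb⟩ := exists_frame (e := -a) (by rwa [norm_neg])
  obtain rfl : a = -b 2 := by rw [hb, neg_neg]
  have hdc := hq.continuous_fderiv
  have hsc := continuous_sphPt b
  have htc := continuous_tangentDir b τ
  have hw : ∀ ω, polarWeight (-b 2) ω = polarWeight (b 2) ω := fun ω => by
    simp [polarWeight, inner_neg_right]
  have hac : Continuous (angSq q) := by
    unfold angSq angularD partialD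
    fun_prop
  simp only [hw]
  rw [← lintegral_flat b (F := fun ω => ENNReal.ofReal (angSq q (-b 2 + τ • ω))) (by fun_prop),
    hq.meanDeriv_eq hh b hτ, add_sub_cancel_left]
  have h1 : ‖τ • ∫ p, fderiv ℝ q (-b 2 + τ • sphPt b p) (tangentDir b τ p) ∂flat‖ₑ ≤
      ∫⁻ p, ‖fderiv ℝ q (-b 2 + τ • sphPt b p) (tangentDir b τ p)‖ₑ ∂flat := by
    rw [enorm_smul]
    refine (mul_le_of_le_one_left zero_le ?_).trans (enorm_integral_le_lintegral_enorm _)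
    rw [Real.enorm_of_nonneg hτ, ← ENNReal.ofReal_one]
    exact ENNReal.ofReal_le_ofReal hτ1
  calc _ ≤ (∫⁻ p, ‖fderiv ℝ q (-b 2 + τ • sphPt b p) (tangentDir b τ p)‖ₑ ∂flat) ^ 2 := by gcongr
    _ ≤ _ := lintegral_sq_le flat (by fun_prop)
    _ ≤ _ := by
      rw [flat_univ]
      gcongr with p
      rw [← ofReal_norm, ← ENNReal.ofReal_pow (norm_nonneg _)]
      exact ENNReal.ofReal_le_ofReal (norm_fderiv_tangentDir_le b q τ p)

end SphericalMeanDerivative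

/-! ### Averaging over rotations by half turns -/

section RotationAverage

/-- The rotation by the angle `π` around the axis `n`, for unit vectors `n`. -/
def halfTurn (n x : R3) : R3 := (2 * ⟪n, x⟫) • n - x

lemma halfTurn_eq_reflection {n : R3} (hn : ‖n‖ = 1) (x : R3) :
    halfTurn n x = (ℝ ∙ n).reflection x := by
  rw [Submodule.reflection_singleton_apply, halfTurn, hn]
  simp [two_smul, add_smul, two_mul]

lemma inner_halfTurn {n : R3} (hn : ‖n‖ = 1) (x : R3) : ⟪n, halfTurn n x⟫ = ⟪n, x⟫ := by
  rw [halfTurn, inner_sub_right, real_inner_smul_right, real_inner_self_eq_norm_sq, hn]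
  ring

lemma lintegral_sph (b : OrthonormalBasis (Fin 3) ℝ R3) {F : R3 → ℝ≥0∞} (hF : Measurable F) :
    ∫⁻ ω, F ω ∂sph = ∫⁻ φ in Ioo (-Real.pi) Real.pi, ∫⁻ θ in Ioo 0 Real.pi,
      ENNReal.ofReal (Real.sin θ) * F (sphPt b (θ, φ)) := by
  rw [sph_eq_map b, lintegral_map hF (continuous_sphPt b).measurable]
  exact lintegral_angular (g := fun p => F (sphPt b p)) (hF.comp (continuous_sphPt b).measurable)

lemma lintegral_sph_isometry (L : R3 ≃ₗᵢ[ℝ] R3) (F : R3 → ℝ≥0∞) :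
    ∫⁻ ω, F (L ω) ∂sph = ∫⁻ ω, F ω ∂sph := by
  conv_rhs => rw [← sph_map_isometry L]
  exact (L.toHomeomorph.measurableEmbedding.lintegral_map F).symm

lemma halfTurn_sphPt (b : OrthonormalBasis (Fin 3) ℝ R3) (p : ℝ × ℝ) :
    halfTurn (sphPt b p) (b 2) = sphPt b (2 * p.1, p.2) := by
  rw [halfTurn, inner_sphPt]
  simp only [sphPt, Real.sin_two_mul, Real.cos_two_mul]
  module

lemma halfTurn_axis_sphPt (b : OrthonormalBasis (Fin 3) ℝ R3) (θ φ : ℝ) :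
    halfTurn (b 2) (sphPt b (θ, φ)) = sphPt b (2 * Real.pi - θ, φ) := by
  rw [halfTurn, real_inner_comm, inner_sphPt]
  simp only [sphPt, Real.sin_two_pi_sub, Real.cos_two_pi_sub]
  module

lemma lintegral_Ioo_scale {s : Set ℝ} (hs : MeasurableSet s) {c d : ℝ} (hd : d ≠ 0)
    (g : ℝ → ℝ≥0∞) : ∫⁻ x in (fun γ => c + d * γ) '' s, g x =
      ENNReal.ofReal |d| * ∫⁻ γ in s, g (c + d * γ) := by
  rw [lintegral_image_eq_lintegral_abs_deriv_mul hs (f' := fun _ => d)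
    (fun x _ => by simpa using (((hasDerivAt_id x).const_mul d).const_add c).hasDerivWithinAt)
    (fun x _ y _ hxy => by simpa [hd] using hxy), lintegral_const_mul' _ _ ENNReal.ofReal_ne_top]

/-- Half turns around axes distributed with density `2 |⟨n, e⟩|` move `e` to a uniformly
distributed point. -/
theorem lintegral_halfTurn {e : R3} (he : ‖e‖ = 1) {F : R3 → ℝ≥0∞} (hF : Measurable F) :
    ∫⁻ n, ENNReal.ofReal (2 * |⟪n, e⟫|) * F (halfTurn n e) ∂sph = ∫⁻ ω, F ω ∂sph := by
  obtain ⟨b, rfl⟩ := exists_frame he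
  have hpi := Real.pi_pos
  have hm : Measurable fun n : R3 => ENNReal.ofReal (2 * |⟪n, b 2⟫|) * F (halfTurn n (b 2)) := by
    have h0 : Measurable fun n : R3 => halfTurn n (b 2) := by unfold halfTurn; fun_prop
    have h1 : Measurable fun n : R3 => F (halfTurn n (b 2)) := hF.comp h0
    have h2 : Measurable fun n : R3 => ENNReal.ofReal (2 * |⟪n, b 2⟫|) := by fun_prop
    exact h2.mul h1
  have hsm := (continuous_sphPt b).measurable
  have hscale : ∀ φ : ℝ, ∫⁻ θ in Ioo 0 Real.pi, ENNReal.ofReal (Real.sin θ) *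
      (ENNReal.ofReal (2 * |⟪sphPt b (θ, φ), b 2⟫|) * F (halfTurn (sphPt b (θ, φ)) (b 2))) =
      ENNReal.ofReal (1 / 2) * ((∫⁻ γ in Ioo 0 Real.pi, ENNReal.ofReal (Real.sin γ) *
        F (sphPt b (γ, φ))) + ∫⁻ γ in Ioo 0 Real.pi, ENNReal.ofReal (Real.sin γ) *
        F (halfTurn (b 2) (sphPt b (γ, φ)))) := fun φ => by
    -- A half turn doubles the polar angle, and the density 2|cos θ| makes sin θ into |sin 2θ|. Each
    -- half of the θ-interval then covers the sphere with weight 1/2, the second one after a half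
    -- turn about the polar axis.
    have e0 : ∀ θ ∈ Ioo 0 Real.pi, ENNReal.ofReal (Real.sin θ) *
        (ENNReal.ofReal (2 * |⟪sphPt b (θ, φ), b 2⟫|) * F (halfTurn (sphPt b (θ, φ)) (b 2))) =
        ENNReal.ofReal |Real.sin (2 * θ)| * F (sphPt b (2 * θ, φ)) := fun θ hθ => by
      rw [halfTurn_sphPt, inner_sphPt, ← mul_assoc, ← ENNReal.ofReal_mul
        (Real.sin_pos_of_mem_Ioo hθ).le, Real.sin_two_mul, abs_mul, abs_mul,
        abs_of_pos (Real.sin_pos_of_mem_Ioo hθ), abs_of_pos (two_pos (α := ℝ))]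
      congr 2
      ring
    rw [setLIntegral_congr_fun measurableSet_Ioo e0]
    have hu : Ioo 0 Real.pi =ᵐ[volume] (Ioo 0 (Real.pi / 2) ∪ Ioo (Real.pi / 2) Real.pi : Set ℝ) := by
      have h1 : Ioo 0 Real.pi \ {Real.pi / 2} =
          (Ioo 0 (Real.pi / 2) ∪ Ioo (Real.pi / 2) Real.pi : Set ℝ) := by
        ext x
        simp only [Set.mem_sdiff, mem_Ioo, mem_singleton_iff, mem_union]
        constructor
        · rintro ⟨⟨h1, h2⟩, h3⟩
          rcases lt_or_gt_of_ne h3 with h4 | h4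
          · exact Or.inl ⟨h1, h4⟩
          · exact Or.inr ⟨h4, h2⟩
        · rintro (⟨h1, h2⟩ | ⟨h1, h2⟩)
          · exact ⟨⟨h1, by linarith⟩, h2.ne⟩
          · exact ⟨⟨by linarith, h2⟩, h1.ne'⟩
      rw [← h1]
      exact (sdiff_null_ae_eq_self (by simp)).symm
    have hdis : Disjoint (Ioo 0 (Real.pi / 2)) (Ioo (Real.pi / 2) Real.pi) := by
      rw [Set.disjoint_left]
      intro x hx hx'
      exact absurd hx.2 (not_lt.2 hx'.1.le)
    have i1 : Ioo 0 (Real.pi / 2) = (fun γ => 0 + (1 / 2 : ℝ) * γ) '' Ioo 0 Real.pi := by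
      ext x
      simp only [mem_Ioo, mem_image]
      exact ⟨fun hx => ⟨2 * x, ⟨by linarith, by linarith⟩, by ring⟩,
        fun ⟨y, hy, hyx⟩ => ⟨by linarith, by linarith⟩⟩
    have i2 : Ioo (Real.pi / 2) Real.pi =
        (fun γ => Real.pi + (-(1 / 2) : ℝ) * γ) '' Ioo 0 Real.pi := by
      ext x
      simp only [mem_Ioo, mem_image]
      exact ⟨fun hx => ⟨2 * (Real.pi - x), ⟨by linarith, by linarith⟩, by ring⟩,
        fun ⟨y, hy, hyx⟩ => ⟨by linarith, by linarith⟩⟩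
    rw [setLIntegral_congr hu, lintegral_union measurableSet_Ioo hdis, i1, i2,
      lintegral_Ioo_scale measurableSet_Ioo (by norm_num),
      lintegral_Ioo_scale measurableSet_Ioo (by norm_num), mul_add, abs_neg,
      abs_of_pos (by norm_num : (0:ℝ) < 1 / 2)]
    congr 2
    · refine setLIntegral_congr_fun measurableSet_Ioo fun γ hγ => ?_
      rw [show 2 * (0 + 1 / 2 * γ) = γ by ring, abs_of_pos (Real.sin_pos_of_mem_Ioo hγ)]
    · refine setLIntegral_congr_fun measurableSet_Ioo fun γ hγ => ?_
      rw [show 2 * (Real.pi + -(1 / 2) * γ) = 2 * Real.pi - γ by ring, halfTurn_axis_sphPt,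
        Real.sin_two_pi_sub, abs_neg, abs_of_pos (Real.sin_pos_of_mem_Ioo hγ)]
  rw [lintegral_sph b hm]
  simp only [hscale]
  have h0 : Measurable fun x : R3 => halfTurn (b 2) x := by unfold halfTurn; fun_prop
  have hturn : Measurable fun x => F (halfTurn (b 2) x) := hF.comp h0
  have hmeas : Measurable fun φ => ∫⁻ γ in Ioo 0 Real.pi, ENNReal.ofReal (Real.sin γ) *
        F (sphPt b (γ, φ)) := by
    refine Measurable.lintegral_prod_right' (f := fun p : ℝ × ℝ =>
      ENNReal.ofReal (Real.sin p.2) * F (sphPt b (p.2, p.1))) ?_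
    exact Measurable.mul (by fun_prop) (hF.comp (hsm.comp (by fun_prop)))
  rw [lintegral_const_mul' _ _ ENNReal.ofReal_ne_top, lintegral_add_left hmeas,
    ← lintegral_sph b hF, ← lintegral_sph b hturn]
  have hr : ∫⁻ ω, F (halfTurn (b 2) ω) ∂sph = ∫⁻ ω, F ω ∂sph := by
    simp only [halfTurn_eq_reflection he]
    exact lintegral_sph_isometry _ F
  have h2 : ENNReal.ofReal (1 / 2) * 2 = 1 := by
    rw [← ENNReal.ofReal_ofNat 2, ← ENNReal.ofReal_mul (by norm_num)]
    norm_num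
  rw [hr, ← two_mul, ← mul_assoc, h2, one_mul]

/-- Averaging over spheres does not change integrals with respect to a rotation invariant measure. -/
theorem lintegral_sphere_average {κ : Measure R3} [SFinite κ]
    (hκ : ∀ (L : R3 ≃ₗᵢ[ℝ] R3) (F : R3 → ℝ≥0∞), Measurable F → ∫⁻ x, F (L x) ∂κ = ∫⁻ x, F x ∂κ)
    (h0 : ∀ᵐ x ∂κ, x ≠ 0) {F : R3 → ℝ≥0∞} (hF : Measurable F) :
    ∫⁻ x, ∫⁻ ω, F (‖x‖ • ω) ∂sph ∂κ = ENNReal.ofReal (4 * Real.pi) * ∫⁻ x, F x ∂κ := by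
  have hturn : Measurable fun p : R3 × R3 => halfTurn p.2 p.1 := by unfold halfTurn; fun_prop
  have hFt : Measurable fun p : R3 × R3 => F (halfTurn p.2 p.1) := hF.comp hturn
  have hwm' : Measurable fun p : R3 × R3 =>
      ENNReal.ofReal (2 * |⟪p.2, ‖p.1‖⁻¹ • p.1⟫|) := by fun_prop
  have hwm : Measurable fun p : R3 × R3 =>
      ENNReal.ofReal (2 * |⟪p.1, ‖p.2‖⁻¹ • p.2⟫|) := by fun_prop
  have hunit : ∀ x : R3, x ≠ 0 → ‖‖x‖⁻¹ • x‖ = 1 := fun x hx => by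
    rw [norm_smul, norm_inv, norm_norm, inv_mul_cancel₀ (norm_ne_zero_iff.2 hx)]
  calc ∫⁻ x, ∫⁻ ω, F (‖x‖ • ω) ∂sph ∂κ
      = ∫⁻ x, ∫⁻ n, ENNReal.ofReal (2 * |⟪n, ‖x‖⁻¹ • x⟫|) * F (halfTurn n x) ∂sph ∂κ := by
        refine lintegral_congr_ae ?_
        filter_upwards [h0] with x hx
        rw [← lintegral_halfTurn (hunit x hx) (F := fun ω => F (‖x‖ • ω))
          (hF.comp (by fun_prop))]
        refine lintegral_congr fun n => ?_
        have h1 : ‖x‖ • halfTurn n (‖x‖⁻¹ • x) = halfTurn n x := by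
          have h2 : ‖x‖ • ‖x‖⁻¹ • x = x := by
            rw [smul_smul, mul_inv_cancel₀ (norm_ne_zero_iff.2 hx), one_smul]
          rw [halfTurn, smul_sub, h2, smul_smul, real_inner_smul_right, halfTurn]
          congr 2
          field_simp [norm_ne_zero_iff.2 hx]
        rw [h1]
    _ = ∫⁻ n, ∫⁻ x, ENNReal.ofReal (2 * |⟪n, ‖x‖⁻¹ • x⟫|) * F (halfTurn n x) ∂κ ∂sph := by
        exact lintegral_lintegral_swap (hwm'.mul hFt).aemeasurable
    -- For a fixed axis the half turn is an isometry preserving κ, |x| and ⟪n, x⟫. Integration over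
    -- axes thus plays the role of Haar measure on the rotation group.
    _ = ∫⁻ n, ∫⁻ x, ENNReal.ofReal (2 * |⟪n, ‖x‖⁻¹ • x⟫|) * F x ∂κ ∂sph := by
        refine lintegral_congr_ae ?_
        filter_upwards [sph_ae_norm] with n hn
        have hG : Measurable fun x : R3 => ENNReal.ofReal (2 * |⟪n, ‖x‖⁻¹ • x⟫|) * F x :=
          (hwm.comp measurable_prodMk_left).mul hF
        rw [← hκ ((ℝ ∙ n).reflection) _ hG]
        refine lintegral_congr fun x => ?_
        rw [LinearIsometryEquiv.norm_map, ← halfTurn_eq_reflection hn, real_inner_smul_right,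
          real_inner_smul_right, inner_halfTurn hn]
    _ = ∫⁻ x, ∫⁻ n, ENNReal.ofReal (2 * |⟪n, ‖x‖⁻¹ • x⟫|) * F x ∂sph ∂κ := by
        exact lintegral_lintegral_swap (hwm.mul (hF.comp measurable_snd)).aemeasurable
    _ = ∫⁻ x, ENNReal.ofReal (4 * Real.pi) * F x ∂κ := by
        refine lintegral_congr_ae ?_
        filter_upwards [h0] with x hx
        have h1 := lintegral_halfTurn (hunit x hx) (F := fun _ => F x) measurable_const
        rw [h1, lintegral_const, sph_univ, mul_comm]
    _ = _ := lintegral_const_mul _ hF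

/-- The distance from the origin to the point at distance `τ` from a unit vector `a` in the direction
making the angle `θ` with `-a`. -/
def sideLength (τ θ : ℝ) : ℝ := √(1 + τ ^ 2 - 2 * τ * Real.cos θ)

lemma norm_add_smul_sphPt (b : OrthonormalBasis (Fin 3) ℝ R3) (τ : ℝ) (p : ℝ × ℝ) :
    ‖-b 2 + τ • sphPt b p‖ = sideLength τ p.1 := by
  have h : ‖-b 2 + τ • sphPt b p‖ ^ 2 = 1 + τ ^ 2 - 2 * τ * Real.cos p.1 := by
    rw [norm_add_sq_real, norm_neg, b.orthonormal.1 2, norm_smul, norm_sphPt, inner_neg_left,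
      real_inner_smul_right, real_inner_comm, inner_sphPt, mul_one, Real.norm_eq_abs, sq_abs]
    ring
  rw [sideLength, ← h, Real.sqrt_sq (norm_nonneg _)]

lemma polarWeight_isometry (L : R3 ≃ₗᵢ[ℝ] R3) (a ω : R3) :
    polarWeight (L a) (L ω) = polarWeight a ω := by
  rw [polarWeight, LinearIsometryEquiv.inner_map_map, polarWeight]

/-- Averages over spheres centred on the unit sphere, in terms of averages over spheres centred at
the origin. -/
theorem lintegral_shifted_spheres {τ : ℝ} (hτ : 0 ≤ τ) (hτ1 : τ < 1) {F : R3 → ℝ≥0∞}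
    (hF : Measurable F) :
    ∫⁻ a, ∫⁻ ω, ENNReal.ofReal (polarWeight a ω) * F (a + τ • ω) ∂sph ∂sph =
      ENNReal.ofReal (2 * Real.pi) *
        ∫⁻ θ in Ioo 0 Real.pi, ∫⁻ ω, F (sideLength τ θ • ω) ∂sph := by
  have hpi := Real.pi_pos
  have hw : Measurable fun p : R3 × R3 => ENNReal.ofReal (polarWeight p.1 p.2) :=
    measurable_polarWeight.ennreal_ofReal
  have hT : Measurable fun p : R3 × R3 => p.1 + τ • p.2 := by fun_prop
  -- The weighted distribution of a + τω is rotation invariant, so F may be replaced by its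
  -- spherical averages. These depend only on |a + τω| = `sideLength τ θ`, and in flat angles the
  -- weight disappears.
  set κ : Measure R3 := ((sph.prod sph).withDensity fun p : R3 × R3 =>
    ENNReal.ofReal (polarWeight p.1 p.2)).map fun p => p.1 + τ • p.2 with hκdef
  have hκ : ∀ F : R3 → ℝ≥0∞, Measurable F → ∫⁻ x, F x ∂κ =
      ∫⁻ a, ∫⁻ ω, ENNReal.ofReal (polarWeight a ω) * F (a + τ • ω) ∂sph ∂sph := fun F hF => by
    have hm : Measurable fun p : R3 × R3 => F (p.1 + τ • p.2) := hF.comp hT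
    rw [hκdef, lintegral_map hF hT, lintegral_withDensity_eq_lintegral_mul _ hw hm,
      lintegral_prod _ (hw.mul hm).aemeasurable]
    rfl
  have hinv : ∀ (L : R3 ≃ₗᵢ[ℝ] R3) (F : R3 → ℝ≥0∞), Measurable F →
      ∫⁻ x, F (L x) ∂κ = ∫⁻ x, F x ∂κ := fun L F hF => by
    have hFL : Measurable fun x => F (L x) := hF.comp L.continuous.measurable
    rw [hκ _ hFL, hκ _ hF,
      ← lintegral_sph_isometry L fun a => ∫⁻ ω, ENNReal.ofReal (polarWeight a ω) *
        F (a + τ • ω) ∂sph]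
    refine lintegral_congr fun a => ?_
    rw [← lintegral_sph_isometry L fun ω => ENNReal.ofReal (polarWeight (L a) ω) *
        F (L a + τ • ω)]
    refine lintegral_congr fun ω => ?_
    rw [polarWeight_isometry, map_add, map_smul]
  have h0 : ∀ᵐ x ∂κ, x ≠ 0 := by
    rw [ae_iff, show {x : R3 | ¬ x ≠ 0} = {0} by ext; simp, ← lintegral_indicator_one
      (measurableSet_singleton _), hκ _ (measurable_one.indicator (measurableSet_singleton _))]
    rw [lintegral_eq_zero_iff' (Measurable.aemeasurable ?_)]
    · filter_upwards [sph_ae_norm] with a ha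
      rw [Pi.zero_apply, lintegral_eq_zero_iff' (Measurable.aemeasurable ?_)]
      · filter_upwards [sph_ae_norm] with ω hω
        have h1 : a + τ • ω ∉ ({0} : Set R3) := fun h => by
          have h2 : a = -(τ • ω) := eq_neg_of_add_eq_zero_left h
          have h3 : ‖a‖ = τ := by
            rw [h2, norm_neg, norm_smul, hω, mul_one, Real.norm_of_nonneg hτ]
          linarith
        rw [indicator_of_notMem h1, mul_zero, Pi.zero_apply]
      · exact (hw.comp measurable_prodMk_left).mul
          ((measurable_one.indicator (measurableSet_singleton _)).comp (by fun_prop))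
    · refine Measurable.lintegral_prod_right' (f := fun p : R3 × R3 =>
        ENNReal.ofReal (polarWeight p.1 p.2) * ({0} : Set R3).indicator 1 (p.1 + τ • p.2)) ?_
      exact hw.mul ((measurable_one.indicator (measurableSet_singleton _)).comp hT)
  have key := lintegral_sphere_average hinv h0 hF
  have hFm : Measurable fun x : R3 => ∫⁻ ω, F (‖x‖ • ω) ∂sph :=
    Measurable.lintegral_prod_right' (f := fun p : R3 × R3 => F (‖p.1‖ • p.2))
      (hF.comp (by fun_prop))
  have hFr : Measurable fun θ : ℝ => ∫⁻ ω, F (sideLength τ θ • ω) ∂sph :=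
    Measurable.lintegral_prod_right' (f := fun p : ℝ × R3 => F (sideLength τ p.1 • p.2))
      (hF.comp (by unfold sideLength; fun_prop))
  rw [hκ _ hFm, hκ _ hF] at key
  have hinner : ∀ᵐ a ∂sph, ∫⁻ ω, ENNReal.ofReal (polarWeight a ω) *
      (∫⁻ ω', F (‖a + τ • ω‖ • ω') ∂sph) ∂sph = ENNReal.ofReal (2 * Real.pi) *
        ∫⁻ θ in Ioo 0 Real.pi, ∫⁻ ω, F (sideLength τ θ • ω) ∂sph := by
    filter_upwards [sph_ae_norm] with a ha
    obtain ⟨b, hb⟩ := exists_frame (e := -a) (by rwa [norm_neg])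
    obtain rfl : a = -b 2 := by rw [hb, neg_neg]
    have hwn : ∀ ω, polarWeight (-b 2) ω = polarWeight (b 2) ω := fun ω => by
      simp [polarWeight, inner_neg_right]
    simp only [hwn]
    rw [← lintegral_flat b (F := fun ω => ∫⁻ ω', F (‖-b 2 + τ • ω‖ • ω') ∂sph)
      (hFm.comp (by fun_prop))]
    simp only [norm_add_smul_sphPt]
    rw [flat, lintegral_prod_symm' (fun p : ℝ × ℝ => ∫⁻ ω', F (sideLength τ p.1 • ω') ∂sph)
      (hFr.comp measurable_fst)]
    simp only [lintegral_const, Measure.restrict_apply_univ, Real.volume_Ioo]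
    rw [mul_comm]
    congr 2
    ring
  rw [lintegral_congr_ae hinner, lintegral_const, sph_univ, mul_comm] at key
  exact ((ENNReal.mul_right_inj (by simpa using by positivity) ENNReal.ofReal_ne_top).1 key).symm

end RotationAverage

/-! ### The derivative of the data and the pointwise estimate -/

section DataDerivative

variable {a : R3} {M h l K : ℝ} {q q₁ q₂ : R3 → ℂ} {P₁ P₂ : SpaceTime → ℂ}

/-- The derivative of the backscattering data. -/
def dataDeriv (a : R3) (q₁ q₂ : R3 → ℂ) (P₁ P₂ : SpaceTime → ℂ) (τ : ℝ) : ℂ :=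
  (32 * Real.pi ^ 2)⁻¹ • meanDeriv a (fun y => q₁ y - q₂ y) τ +
    ((∫ s in (0:ℝ)..(2 * τ), arrivalDensity a q₁ q₂ P₁ P₂ s) +
      (2 * τ) • arrivalDensity a q₁ q₂ P₁ P₂ (2 * τ))

lemma hasDerivAt_data (h₁ : IsTailDensity a q₁ K l P₁) (h₂ : IsTailDensity a q₂ K l P₂)
    (hq₁ : PotBound M h q₁) (hq₂ : PotBound M h q₂) (ha : ‖a‖ = 1) (hh : 0 < h) (hl : 1 ≤ l)
    {τ : ℝ} (hτ : 0 < τ) :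
    HasDerivAt (fun τ : ℝ => (τ : ℂ) *
      (waveTail a q₁ P₁ (a, 2 * τ) - waveTail a q₂ P₂ (a, 2 * τ)))
      (dataDeriv a q₁ q₂ P₁ P₂ τ) τ := by
  have hc := continuous_arrivalDensity h₁ h₂ hq₁ hq₂ ha hh hl
  have hm := ((hq₁.sub hq₂).hasDerivAt_mean (a := a) τ).const_smul (32 * Real.pi ^ 2)⁻¹
  have h3 : HasDerivAt (fun τ : ℝ => ∫ s in (0:ℝ)..(2 * τ), arrivalDensity a q₁ q₂ P₁ P₂ s)
      ((2 : ℝ) • arrivalDensity a q₁ q₂ P₁ P₂ (2 * τ)) τ := by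
    have h4 := intervalIntegral.integral_hasDerivAt_right (hc.intervalIntegrable 0 (2 * τ))
      hc.stronglyMeasurable.stronglyMeasurableAtFilter hc.continuousAt
    have h5 : HasDerivAt (fun τ : ℝ => 2 * τ) 2 τ := by
      simpa using (hasDerivAt_id τ).const_mul 2
    exact h4.scomp τ h5
  have h6 := hm.add ((hasDerivAt_id τ).smul h3)
  refine (h6.congr_of_eventuallyEq ?_).congr_deriv ?_
  · filter_upwards [Ioi_mem_nhds hτ] with τ' hτ'
    have hτ0 : (0:ℝ) < τ' := hτ'
    rw [waveTail_sub_eq h₁ h₂ hq₁ hq₂ ha hh hl (by positivity : 0 < 2 * τ'), sphMean,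
      mul_div_cancel_left₀ _ (two_ne_zero (α := ℝ))]
    simp only [Pi.add_apply, Pi.smul_apply, Pi.smul_apply', id, Complex.real_smul]
    ring
  · simp only [dataDeriv, id, one_smul, smul_smul, mul_comm τ, add_comm]

lemma continuous_dataDeriv (h₁ : IsTailDensity a q₁ K l P₁) (h₂ : IsTailDensity a q₂ K l P₂)
    (hq₁ : PotBound M h q₁) (hq₂ : PotBound M h q₂) (ha : ‖a‖ = 1) (hh : 0 < h) (hl : 1 ≤ l) :
    Continuous (dataDeriv a q₁ q₂ P₁ P₂) := by
  have hc := continuous_arrivalDensity h₁ h₂ hq₁ hq₂ ha hh hl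
  have hm := (hq₁.sub hq₂).continuous_meanDeriv (a := a)
  have hp : Continuous fun τ : ℝ => ∫ s in (0:ℝ)..(2 * τ), arrivalDensity a q₁ q₂ P₁ P₂ s :=
    (intervalIntegral.continuous_primitive (fun a b => hc.intervalIntegrable a b) 0).comp
      (by fun_prop)
  unfold dataDeriv
  fun_prop

/-- The integral of `|q|` over the sphere of radius `σ` around `a`, without the factor `σ²`. -/
def sphAbs (a : R3) (q : R3 → ℂ) (σ : ℝ) : ℝ := ∫ ω, ‖q (a + σ • ω)‖ ∂sph

/-- The integral of `|q|` over the ball of radius `σ` around `a`. -/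
def ballAbs (a : R3) (q : R3 → ℂ) (σ : ℝ) : ℝ := ∫ y in ball a σ, ‖q y‖

lemma sphAbs_nonneg (a : R3) (q : R3 → ℂ) (σ : ℝ) : 0 ≤ sphAbs a q σ :=
  integral_nonneg fun _ => norm_nonneg _

lemma ballAbs_nonneg (a : R3) (q : R3 → ℂ) (σ : ℝ) : 0 ≤ ballAbs a q σ :=
  integral_nonneg fun _ => norm_nonneg _

lemma PotBound.integrableOn_ball (hq : PotBound M h q) (σ : ℝ) :
    IntegrableOn (fun y => ‖q y‖) (ball a σ) :=
  (hq.contDiff.continuous.norm.continuousOn.integrableOn_compact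
    (isCompact_closedBall a σ)).mono_set ball_subset_closedBall

lemma PotBound.ballAbs_mono (hq : PotBound M h q) {σ σ' : ℝ} (hσ : σ ≤ σ') :
    ballAbs a q σ ≤ ballAbs a q σ' :=
  setIntegral_mono_set (hq.integrableOn_ball σ') (Eventually.of_forall fun _ => norm_nonneg _)
    (ball_subset_ball hσ).eventuallyLE

lemma PotBound.sphAbs_eq_zero (hq : PotBound M h q) (ha : ‖a‖ = 1) {σ : ℝ} (hσ0 : 0 ≤ σ)
    (hσ : σ < h) : sphAbs a q σ = 0 := by
  refine integral_eq_zero_of_ae ?_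
  filter_upwards [sph_ae_norm] with ω hω
  rw [hq.eq_zero_near ha, norm_zero, Pi.zero_apply]
  rwa [add_sub_cancel_left, norm_smul, hω, mul_one, Real.norm_of_nonneg hσ0]

lemma PotBound.continuous_sphAbs (hq : PotBound M h q) : Continuous (sphAbs a q) := by
  have hqc := hq.contDiff.continuous
  exact continuous_of_dominated (bound := fun _ => M)
    (fun T => Continuous.aestronglyMeasurable (by fun_prop))
    (fun T => Eventually.of_forall fun ω => by simpa using hq.bound _) (integrable_const _)
    (Eventually.of_forall fun ω => by fun_prop)

/-- Polar coordinates about a produce the factor σ², which is at least h² wherever the spherical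
integral is nonzero. -/
lemma PotBound.integral_sphAbs_le (hq : PotBound M h q) (ha : ‖a‖ = 1) (hh : 0 < h) {τ : ℝ}
    (hτ : 0 ≤ τ) : ∫ σ in (0:ℝ)..τ, sphAbs a q σ ≤ (h ^ 2)⁻¹ * ballAbs a q τ := by
  have hqc := hq.contDiff.continuous
  have hi : Integrable ((ball a τ).indicator fun y => ‖q y‖) :=
    (hq.integrableOn_ball τ).integrable_indicator measurableSet_ball
  have h1 : ballAbs a q τ = ∫ σ in (0:ℝ)..τ, σ ^ 2 * sphAbs a q σ := by
    rw [ballAbs, ← integral_indicator measurableSet_ball, ← integral_add_left_eq_self _ a,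
      integral_polar (hi.comp_add_left a), intervalIntegral.integral_of_le hτ,
      integral_Ioc_eq_integral_Ioo, ← integral_indicator measurableSet_Ioi,
      ← integral_indicator measurableSet_Ioo]
    refine integral_congr_ae (Eventually.of_forall fun σ => ?_)
    by_cases hσ0 : σ ∈ Ioi (0:ℝ)
    · have hσp : (0:ℝ) < σ := hσ0
      rw [indicator_of_mem hσ0]
      by_cases hσ1 : σ < τ
      · rw [indicator_of_mem (show σ ∈ Ioo 0 τ from ⟨hσp, hσ1⟩), smul_eq_mul, sphAbs]
        congr 1
        refine integral_congr_ae ?_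
        filter_upwards [sph_ae_norm] with ω hω
        rw [indicator_of_mem]
        rw [mem_ball_iff_norm, add_sub_cancel_left, norm_smul, hω, mul_one,
          Real.norm_of_nonneg hσp.le]
        exact hσ1
      · rw [indicator_of_notMem (show σ ∉ Ioo 0 τ from fun h' => hσ1 h'.2)]
        rw [integral_eq_zero_of_ae, smul_zero]
        filter_upwards [sph_ae_norm] with ω hω
        rw [indicator_of_notMem, Pi.zero_apply]
        rw [mem_ball_iff_norm, add_sub_cancel_left, norm_smul, hω, mul_one,
          Real.norm_of_nonneg hσp.le]
        exact hσ1
    · rw [indicator_of_notMem hσ0, indicator_of_notMem fun h' => hσ0 h'.1]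
  have hc := hq.continuous_sphAbs (a := a)
  rw [h1, ← intervalIntegral.integral_const_mul]
  refine intervalIntegral.integral_mono_on hτ (hc.intervalIntegrable _ _)
    (Continuous.intervalIntegrable (by fun_prop) _ _) fun σ hσ => ?_
  rcases lt_or_ge σ h with h2 | h2
  · rw [hq.sphAbs_eq_zero ha hσ.1 h2, mul_zero, mul_zero]
  · have h3 : 1 ≤ (h ^ 2)⁻¹ * σ ^ 2 := by
      rw [inv_mul_eq_div, one_le_div (by positivity)]
      gcongr
    have := mul_le_mul_of_nonneg_right h3 (sphAbs_nonneg a q σ)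
    linarith

/-- The constant in the bound for the multiple scattering part of the data. -/
def scatterBound (M h K l : ℝ) : ℝ :=
  4 * ((4 * Real.pi * h)⁻¹ * M) + 4 * ((4 * Real.pi * h)⁻¹ * M) * (h ^ 2)⁻¹ +
  4 * ((2 * ((4 * Real.pi * h)⁻¹ * K) + M * (M + K) + 2 * ((M + K) * K)) * Real.exp (2 * l))

lemma norm_arrival_terms_le (h₁ : IsTailDensity a q₁ K l P₁) (h₂ : IsTailDensity a q₂ K l P₂)
    (hq₁ : PotBound M h q₁) (hq₂ : PotBound M h q₂) (ha : ‖a‖ = 1) (hh : 0 < h) (hl : 1 ≤ l)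
    {τ : ℝ} (hτ : 0 ≤ τ) (hτ1 : τ ≤ 1) :
    ‖(∫ s in (0:ℝ)..(2 * τ), arrivalDensity a q₁ q₂ P₁ P₂ s) +
      (2 * τ) • arrivalDensity a q₁ q₂ P₁ P₂ (2 * τ)‖ ≤
    scatterBound M h K l * (sphAbs a (fun y => q₁ y - q₂ y) τ +
      ballAbs a (fun y => q₁ y - q₂ y) τ) := by
  have hpi := Real.pi_pos
  have hM := hq₁.nonneg
  have hK := h₁.nonneg
  have hq := hq₁.sub hq₂
  set A := 2 * ((4 * Real.pi * h)⁻¹ * M) with hA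
  set B := (2 * ((4 * Real.pi * h)⁻¹ * K) + M * (M + K) + 2 * ((M + K) * K)) * Real.exp (2 * l)
    with hB
  have hA0 : 0 ≤ A := by positivity
  have hB0 : 0 ≤ B := by positivity
  have hb : ∀ T, 0 ≤ T → T ≤ 2 → ‖arrivalDensity a q₁ q₂ P₁ P₂ T‖ ≤
      A * sphAbs a (fun y => q₁ y - q₂ y) (T / 2) + B * ballAbs a (fun y => q₁ y - q₂ y) (T / 2) :=
    fun T hT hT2 => norm_arrivalDensity_le h₁ h₂ hq₁ hq₂ ha hh hl hT hT2
  set m := sphAbs a (fun y => q₁ y - q₂ y) with hm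
  set n := ballAbs a (fun y => q₁ y - q₂ y) with hn
  have hmc : Continuous m := hq.continuous_sphAbs
  have hm0 := sphAbs_nonneg a (fun y => q₁ y - q₂ y) τ
  have hn0 := ballAbs_nonneg a (fun y => q₁ y - q₂ y) τ
  rw [← hm] at hm0
  rw [← hn] at hn0
  have e1 : ‖∫ s in (0:ℝ)..(2 * τ), arrivalDensity a q₁ q₂ P₁ P₂ s‖ ≤
      ∫ s in (0:ℝ)..(2 * τ), (A * m (s / 2) + B * n τ) := by
    refine intervalIntegral.norm_integral_le_of_norm_le (by positivity)
      (Eventually.of_forall fun s hs => ?_) (Continuous.intervalIntegrable (by fun_prop) _ _)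
    refine (hb s hs.1.le (by linarith [hs.2])).trans ?_
    have : n (s / 2) ≤ n τ := hq.ballAbs_mono (by linarith [hs.2])
    gcongr
  have e2 : ∫ s in (0:ℝ)..(2 * τ), (A * m (s / 2) + B * n τ) =
      A * (2 * ∫ σ in (0:ℝ)..τ, m σ) + 2 * τ * (B * n τ) := by
    rw [intervalIntegral.integral_add (Continuous.intervalIntegrable (by fun_prop) _ _)
      (Continuous.intervalIntegrable (by fun_prop) _ _), intervalIntegral.integral_const_mul,
      intervalIntegral.integral_comp_div m two_ne_zero, intervalIntegral.integral_const]
    simp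
  have e3 : ∫ σ in (0:ℝ)..τ, m σ ≤ (h ^ 2)⁻¹ * n τ := hq.integral_sphAbs_le ha hh hτ
  have e4 := hb (2 * τ) (by positivity) (by linarith)
  rw [mul_div_cancel_left₀ _ (two_ne_zero (α := ℝ))] at e4
  have e5 : ‖(2 * τ) • arrivalDensity a q₁ q₂ P₁ P₂ (2 * τ)‖ ≤ 2 * (A * m τ + B * n τ) := by
    rw [norm_smul, Real.norm_of_nonneg (by positivity)]
    exact mul_le_mul (by linarith) e4 (norm_nonneg _) (by positivity)
  have e6 : A * (2 * ∫ σ in (0:ℝ)..τ, m σ) ≤ A * (2 * ((h ^ 2)⁻¹ * n τ)) := by gcongr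
  have e7 : 2 * τ * (B * n τ) ≤ 2 * (B * n τ) := by
    have : 0 ≤ B * n τ := by positivity
    nlinarith
  have e8 : 0 ≤ A * (h ^ 2)⁻¹ * m τ := by positivity
  have e9 : 0 ≤ A * n τ := by positivity
  have e10 : 0 ≤ B * m τ := by positivity
  have hsb : scatterBound M h K l = 2 * A + 2 * A * (h ^ 2)⁻¹ + 4 * B := by
    rw [scatterBound, hA, hB]; ring
  rw [hsb]
  refine (norm_add_le _ _).trans ?_
  rw [e2] at e1
  linarith

/-- The pointwise estimate for the difference of the potentials. -/
lemma norm_point_le (h₁ : IsTailDensity a q₁ K l P₁) (h₂ : IsTailDensity a q₂ K l P₂)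
    (hq₁ : PotBound M h q₁) (hq₂ : PotBound M h q₂) (ha : ‖a‖ = 1) (hh : 0 < h) (hl : 1 ≤ l)
    {τ : ℝ} (hτ : 0 ≤ τ) (hτ1 : τ ≤ 1) :
    (1 - τ) * ‖q₁ ((1 - τ) • a) - q₂ ((1 - τ) • a)‖ ≤
      16 * Real.pi * ‖dataDeriv a q₁ q₂ P₁ P₂ τ‖ +
      ‖meanDeriv a (fun y => q₁ y - q₂ y) τ - (2 * Real.pi * (1 - τ)) •
        (q₁ ((1 - τ) • a) - q₂ ((1 - τ) • a))‖ +
      16 * Real.pi * scatterBound M h K l * (sphAbs a (fun y => q₁ y - q₂ y) τ +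
      ballAbs a (fun y => q₁ y - q₂ y) τ) := by
  have hpi := Real.pi_gt_three
  have hs := norm_arrival_terms_le h₁ h₂ hq₁ hq₂ ha hh hl hτ hτ1
  set R := (∫ s in (0:ℝ)..(2 * τ), arrivalDensity a q₁ q₂ P₁ P₂ s) +
      (2 * τ) • arrivalDensity a q₁ q₂ P₁ P₂ (2 * τ) with hR
  set E := meanDeriv a (fun y => q₁ y - q₂ y) τ - (2 * Real.pi * (1 - τ)) •
        (q₁ ((1 - τ) • a) - q₂ ((1 - τ) • a)) with hE
  set Q := q₁ ((1 - τ) • a) - q₂ ((1 - τ) • a) with hQ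
  -- The boundary value enters the data derivative as 2π(1−τ)Q/(32π²); the factor 16π = 32π²/(2π)
  -- isolates (1−τ)Q.
  have e1 : (1 - τ) • Q = (16 * Real.pi) • dataDeriv a q₁ q₂ P₁ P₂ τ - (2 * Real.pi)⁻¹ • E -
      (16 * Real.pi) • R := by
    rw [dataDeriv, ← hR, hE]
    simp only [smul_add, smul_sub, smul_smul]
    have c1 : 16 * Real.pi * (32 * Real.pi ^ 2)⁻¹ = (2 * Real.pi)⁻¹ := by
      field_simp
      norm_num
    have c2 : (2 * Real.pi)⁻¹ * (2 * Real.pi * (1 - τ)) = 1 - τ := by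
      field_simp
    rw [c1, c2]
    abel
  have e2 : (1 - τ) * ‖Q‖ = ‖(1 - τ) • Q‖ := by
    rw [norm_smul, Real.norm_of_nonneg (by linarith)]
  rw [e2, e1]
  have c3 : (2 * Real.pi)⁻¹ ≤ 1 := inv_le_one_of_one_le₀ (by linarith)
  have e3 : ‖(2 * Real.pi)⁻¹ • E‖ ≤ ‖E‖ := by
    rw [norm_smul, Real.norm_of_nonneg (by positivity)]
    exact mul_le_of_le_one_left (norm_nonneg _) c3
  have e4 : ‖(16 * Real.pi) • R‖ ≤ 16 * Real.pi * (scatterBound M h K l *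
      (sphAbs a (fun y => q₁ y - q₂ y) τ + ballAbs a (fun y => q₁ y - q₂ y) τ)) := by
    rw [norm_smul, Real.norm_of_nonneg (by positivity)]
    gcongr
  have e5 : ‖(16 * Real.pi) • dataDeriv a q₁ q₂ P₁ P₂ τ‖ =
      16 * Real.pi * ‖dataDeriv a q₁ q₂ P₁ P₂ τ‖ := by
    rw [norm_smul, Real.norm_of_nonneg (by positivity)]
  have e6 := norm_sub_le ((16 * Real.pi) • dataDeriv a q₁ q₂ P₁ P₂ τ - (2 * Real.pi)⁻¹ • E)
    ((16 * Real.pi) • R)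
  have e7 := norm_sub_le ((16 * Real.pi) • dataDeriv a q₁ q₂ P₁ P₂ τ) ((2 * Real.pi)⁻¹ • E)
  linarith

end DataDerivative

/-! ### The integral inequality for norms on spheres about the origin -/

section IntegratedEstimate

variable {a : R3} {M h τ : ℝ} {q : R3 → ℂ}

/-- The square of the `L²` norm over the sphere of radius `r` around the origin. -/
def sphSq (q : R3 → ℂ) (r : ℝ) : ℝ≥0∞ := ENNReal.ofReal (r ^ 2) * ∫⁻ ω, ‖q (r • ω)‖ₑ ^ 2 ∂sph

/-- The mean square of the angular derivatives on the sphere of radius `r` around the origin. -/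
def angMean (q : R3 → ℂ) (r : ℝ) : ℝ≥0∞ := ∫⁻ ω, ENNReal.ofReal (angSq q (r • ω)) ∂sph

lemma PotBound.measurable_angSq (hq : PotBound M h q) : Measurable (angSq q) := by
  have hdc := hq.continuous_fderiv
  unfold angSq angularD partialD
  exact Continuous.measurable (by fun_prop)

lemma ofReal_sphAbs (hq : PotBound M h q) :
    ENNReal.ofReal (sphAbs a q τ) = ∫⁻ ω, ‖q (a + τ • ω)‖ₑ ∂sph := by
  have hqc := hq.contDiff.continuous
  rw [sphAbs, ofReal_integral_norm_eq_lintegral_enorm (Continuous.integrable_sph (by fun_prop))]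

/-- After Cauchy–Schwarz in dθ dφ the factor sin²θ is left. From |a+τω|² = (1 + τ cos θ)² + τ² sin²θ
and τ ≥ h (otherwise the left side vanishes) it is at most |a+τω|²/h², which supplies the r² in
`sphSq`. -/
lemma PotBound.sphAbs_sq_le (hq : PotBound M h q) (hh : 0 < h) (ha : ‖a‖ = 1) (hτ : 0 ≤ τ) :
    ENNReal.ofReal (sphAbs a q τ ^ 2) ≤ ENNReal.ofReal (2 * Real.pi ^ 2 * (h ^ 2)⁻¹) *
      ∫⁻ ω, ENNReal.ofReal (polarWeight a ω) *
        (ENNReal.ofReal (‖a + τ • ω‖ ^ 2) * ‖q (a + τ • ω)‖ₑ ^ 2) ∂sph := by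
  rcases lt_or_ge τ h with h1 | h1
  · simp [hq.sphAbs_eq_zero ha hτ h1]
  have hqc := hq.contDiff.continuous
  obtain ⟨b, rfl⟩ := exists_frame ha
  have hpi := Real.pi_pos
  have hm : Measurable fun ω => ENNReal.ofReal (‖b 2 + τ • ω‖ ^ 2) * ‖q (b 2 + τ • ω)‖ₑ ^ 2 :=
    (by fun_prop : Measurable fun ω => ENNReal.ofReal (‖b 2 + τ • ω‖ ^ 2)).mul
      (by fun_prop : Continuous fun ω => ‖q (b 2 + τ • ω)‖ₑ ^ 2).measurable
  rw [ENNReal.ofReal_pow (sphAbs_nonneg _ _ _), ofReal_sphAbs hq,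
    ← lintegral_flat b (F := fun ω => ENNReal.ofReal (‖b 2 + τ • ω‖ ^ 2) *
      ‖q (b 2 + τ • ω)‖ₑ ^ 2) hm,
    sph_eq_map b, lintegral_map (f := fun ω => ‖q (b 2 + τ • ω)‖ₑ)
      (Continuous.measurable (by fun_prop)) (continuous_sphPt b).measurable, angular_eq_withDensity,
    lintegral_withDensity_eq_lintegral_mul _ (by fun_prop) (by
      have := continuous_sphPt b
      exact Continuous.measurable (by fun_prop))]
  refine (lintegral_sq_le _ ?_).trans ?_
  · have := continuous_sphPt b
    exact (Measurable.mul (by fun_prop) (Continuous.measurable (by fun_prop))).aemeasurable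
  rw [flat_univ, ENNReal.ofReal_mul (p := 2 * Real.pi ^ 2) (by positivity), mul_assoc]
  gcongr
  rw [← lintegral_const_mul' _ _ ENNReal.ofReal_ne_top]
  refine lintegral_mono_ae ?_
  filter_upwards [flat_ae_mem] with p hp
  have hs := Real.sin_pos_of_mem_Ioo hp
  simp only [Pi.mul_apply]
  rw [mul_pow, ← mul_assoc, ← ENNReal.ofReal_mul (by positivity), ← ENNReal.ofReal_pow hs.le]
  gcongr
  have h2 : ‖b 2 + τ • sphPt b p‖ ^ 2 = 1 + 2 * (τ * Real.cos p.1) + τ ^ 2 := by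
    rw [norm_add_sq_real, b.orthonormal.1 2, norm_smul, norm_sphPt, real_inner_smul_right,
      real_inner_comm, inner_sphPt, mul_one, Real.norm_eq_abs, sq_abs]
    ring
  rw [h2, inv_mul_eq_div, le_div_iff₀ (by positivity)]
  have h3 : h ^ 2 ≤ τ ^ 2 := by gcongr
  nlinarith [Real.sin_sq_add_cos_sq p.1, sq_nonneg (1 + τ * Real.cos p.1), sq_nonneg (Real.sin p.1)]

lemma PotBound.lintegral_exterior (hq : PotBound M h q) {s : ℝ} (hs : 0 ≤ s) :
    ∫⁻ y in {y : R3 | s < ‖y‖}, ‖q y‖ₑ ^ 2 = ∫⁻ r in Ioi s, sphSq q r := by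
  have hqc := hq.contDiff.continuous
  have hm : MeasurableSet {y : R3 | s < ‖y‖} := measurableSet_lt measurable_const measurable_norm
  have hF : Measurable fun y => ‖q y‖ₑ ^ 2 := Continuous.measurable (by fun_prop)
  rw [← lintegral_indicator hm, lintegral_polar (hF.indicator hm),
    ← lintegral_indicator measurableSet_Ioi, ← lintegral_indicator measurableSet_Ioi]
  refine lintegral_congr fun r => ?_
  by_cases hr : r ∈ Ioi s
  · have hr0 : 0 < r := hs.trans_lt hr
    rw [indicator_of_mem hr, indicator_of_mem (show r ∈ Ioi (0:ℝ) from hr0), sphSq]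
    congr 1
    refine lintegral_congr_ae ?_
    filter_upwards [sph_ae_norm] with ω hω
    rw [indicator_of_mem]
    rw [mem_ofPred_eq, norm_smul, hω, mul_one, Real.norm_of_nonneg hr0.le]
    exact hr
  · rw [indicator_of_notMem hr]
    by_cases hr0 : r ∈ Ioi (0:ℝ)
    · rw [indicator_of_mem hr0, lintegral_eq_zero_of_ae_eq_zero, mul_zero]
      filter_upwards [sph_ae_norm] with ω hω
      rw [indicator_of_notMem, Pi.zero_apply]
      rw [mem_ofPred_eq, norm_smul, hω, mul_one, Real.norm_of_nonneg (le_of_lt hr0)]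
      exact hr
    · rw [indicator_of_notMem hr0]

/-- Cauchy–Schwarz, with the volume of the unit ball as the constant; the ball of radius τ about a
unit vector lies in |y| > 1 − τ. -/
lemma PotBound.ballAbs_sq_le (hq : PotBound M h q) (ha : ‖a‖ = 1) (hτ1 : τ ≤ 1) :
    ENNReal.ofReal (ballAbs a q τ ^ 2) ≤ ENNReal.ofReal (Real.pi * 4 / 3) *
      ∫⁻ r in Ioi (1 - τ), sphSq q r := by
  have hqc := hq.contDiff.continuous
  rw [ENNReal.ofReal_pow (ballAbs_nonneg _ _ _), ballAbs,
    ofReal_integral_norm_eq_lintegral_enorm ((integrable_norm_iff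
      hqc.aestronglyMeasurable).1 (hq.integrableOn_ball τ)), ← hq.lintegral_exterior (by linarith)]
  refine (lintegral_sq_le _ (Continuous.measurable (by fun_prop)).aemeasurable).trans ?_
  have h1 : volume (ball a 1) = ENNReal.ofReal (Real.pi * 4 / 3) := by
    rw [EuclideanSpace.volume_ball_fin_three]
    simp
  rw [Measure.restrict_apply_univ, ← h1]
  gcongr
  intro y hy
  rw [mem_ball_iff_norm'] at hy
  have := norm_sub_norm_le a y
  rw [mem_ofPred_eq]
  linarith

/-- The constant in the integral inequality for `sphSq`. -/
def sphSqConst (k h : ℝ) : ℝ := 4 * k ^ 2 * (4 * Real.pi ^ 3 * (1 + (h ^ 2)⁻¹) + 6 * Real.pi ^ 2)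

/-- The integral inequality for the `L²` norms over spheres around the origin. -/
theorem PotBound.sphSq_le (hq : PotBound M h q) (hh : 0 < h) (hτ : 0 ≤ τ) (hτ1 : τ < 1) {k : ℝ}
    (hk : 1 ≤ k) {D : R3 → ℂ}
    (hD : ∀ a : R3, ‖a‖ = 1 → (1 - τ) * ‖q ((1 - τ) • a)‖ ≤ k * ‖D a‖ +
      ‖meanDeriv a q τ - (2 * Real.pi * (1 - τ)) • q ((1 - τ) • a)‖ +
      k * (sphAbs a q τ + ballAbs a q τ)) :
    sphSq q (1 - τ) ≤ ENNReal.ofReal (sphSqConst k h) * (∫⁻ a, ‖D a‖ₑ ^ 2 ∂sph +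
      (∫⁻ θ in Ioo 0 Real.pi, (angMean q (sideLength τ θ) + sphSq q (sideLength τ θ))) +
      ∫⁻ r in Ioi (1 - τ), sphSq q r) := by
  have hpi := Real.pi_gt_three
  have hqc := hq.contDiff.continuous
  set T := ∫⁻ r in Ioi (1 - τ), sphSq q r with hT
  set F : R3 → ℝ≥0∞ := fun x =>
    ENNReal.ofReal (angSq q x) + ENNReal.ofReal (‖x‖ ^ 2) * ‖q x‖ₑ ^ 2 with hF
  have hFm : Measurable F := hq.measurable_angSq.ennreal_ofReal.add (by fun_prop)
  set c := 2 * Real.pi ^ 2 * (1 + (h ^ 2)⁻¹) with hc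
  have hc0 : 0 ≤ c := by positivity
  set G : R3 → ℝ≥0∞ := fun a => ∫⁻ ω, ENNReal.ofReal (polarWeight a ω) * F (a + τ • ω) ∂sph with hG
  have hGm : Measurable G := Measurable.lintegral_prod_right' (f := fun p : R3 × R3 =>
    ENNReal.ofReal (polarWeight p.1 p.2) * F (p.1 + τ • p.2))
    (measurable_polarWeight.ennreal_ofReal.mul (hFm.comp (by fun_prop)))
  have h1 : ∀ a : R3, ‖a‖ = 1 → ENNReal.ofReal ((1 - τ) ^ 2) * ‖q ((1 - τ) • a)‖ₑ ^ 2 ≤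
      ENNReal.ofReal (4 * k ^ 2) * (‖D a‖ₑ ^ 2 + (ENNReal.ofReal c * G a +
        ENNReal.ofReal (Real.pi * 4 / 3) * T)) := fun a ha => by
    set E := meanDeriv a q τ - (2 * Real.pi * (1 - τ)) • q ((1 - τ) • a) with hE
    have e1 := hD a ha
    have e2 : ((1 - τ) * ‖q ((1 - τ) • a)‖) ^ 2 ≤
        4 * k ^ 2 * (‖D a‖ ^ 2 + (‖E‖ ^ 2 + sphAbs a q τ ^ 2 + ballAbs a q τ ^ 2)) := by
      have e3 := pow_le_pow_left₀ (mul_nonneg (by linarith) (norm_nonneg _)) e1 2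
      refine e3.trans ?_
      set x := ‖D a‖
      set y := ‖E‖
      set z := sphAbs a q τ
      set w := ballAbs a q τ
      have e4 : (k * x + y + k * (z + w)) ^ 2 ≤
          4 * ((k * x) ^ 2 + y ^ 2 + (k * z) ^ 2 + (k * w) ^ 2) := by
        nlinarith [sq_nonneg (k * x - y), sq_nonneg (k * x - k * z), sq_nonneg (k * x - k * w),
          sq_nonneg (y - k * z), sq_nonneg (y - k * w), sq_nonneg (k * z - k * w)]
      have e5 : y ^ 2 ≤ k ^ 2 * y ^ 2 := le_mul_of_one_le_left (sq_nonneg _) (one_le_pow₀ hk)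
      nlinarith
    have e6 := ENNReal.ofReal_le_ofReal e2
    rw [mul_pow, ENNReal.ofReal_mul (by positivity), ENNReal.ofReal_mul (by positivity),
      ENNReal.ofReal_add (by positivity) (by positivity),
      ENNReal.ofReal_add (by positivity) (by positivity),
      ENNReal.ofReal_add (by positivity) (by positivity),
      ENNReal.ofReal_pow (norm_nonneg _), ENNReal.ofReal_pow (norm_nonneg _),
      ENNReal.ofReal_pow (norm_nonneg _), ofReal_norm, ofReal_norm, ofReal_norm] at e6
    refine e6.trans ?_
    -- Both quantities are bounded with the same polar weight, so one average of F covers them, and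
    -- one application of `lintegral_shifted_spheres` integrates it over a.
    have e7 : ‖E‖ₑ ^ 2 + ENNReal.ofReal (sphAbs a q τ ^ 2) ≤ ENNReal.ofReal c * G a := by
      have e8 := hq.enorm_meanDeriv_sub_le hh ha hτ hτ1.le
      have e9 := hq.sphAbs_sq_le hh ha hτ
      have hw : Measurable fun ω => ENNReal.ofReal (polarWeight a ω) :=
        (measurable_polarWeight.comp measurable_prodMk_left).ennreal_ofReal
      have e10 : G a = ∫⁻ ω, ENNReal.ofReal (polarWeight a ω) *
            ENNReal.ofReal (angSq q (a + τ • ω)) ∂sph + ∫⁻ ω, ENNReal.ofReal (polarWeight a ω) *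
            (ENNReal.ofReal (‖a + τ • ω‖ ^ 2) * ‖q (a + τ • ω)‖ₑ ^ 2) ∂sph := by
        simp only [hG, hF, mul_add]
        exact lintegral_add_left (hw.mul ((hq.measurable_angSq.comp
          (by fun_prop : Measurable fun ω => a + τ • ω)).ennreal_ofReal)) _
      rw [e10, mul_add]
      have c1 : 2 * Real.pi ^ 2 ≤ c := by
        rw [hc]; exact le_mul_of_one_le_right (by positivity) (by simp; positivity)
      have c2 : 2 * Real.pi ^ 2 * (h ^ 2)⁻¹ ≤ c := by rw [hc]; gcongr; linarith
      exact add_le_add (e8.trans (by gcongr)) (e9.trans (by gcongr))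
    gcongr
    exact hq.ballAbs_sq_le ha hτ1.le
  have h2 : ∫⁻ a, G a ∂sph = ENNReal.ofReal (2 * Real.pi) *
      ∫⁻ θ in Ioo 0 Real.pi, (angMean q (sideLength τ θ) + sphSq q (sideLength τ θ)) := by
    rw [hG, lintegral_shifted_spheres hτ hτ1 hFm]
    congr 1
    refine lintegral_congr fun θ => ?_
    rw [angMean, sphSq, ← lintegral_const_mul' _ _ ENNReal.ofReal_ne_top]
    refine (lintegral_add_left ((hq.measurable_angSq.comp
      (by fun_prop : Measurable fun ω => sideLength τ θ • ω)).ennreal_ofReal) _).trans ?_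
    congr 1
    refine lintegral_congr_ae ?_
    filter_upwards [sph_ae_norm] with ω hω
    rw [norm_smul, hω, mul_one, Real.norm_eq_abs, sq_abs]
  have h3 : sphSq q (1 - τ) ≤ ENNReal.ofReal (4 * k ^ 2) * (∫⁻ a, ‖D a‖ₑ ^ 2 ∂sph +
      (ENNReal.ofReal c * ∫⁻ a, G a ∂sph +
        ENNReal.ofReal (Real.pi * 4 / 3) * T * ENNReal.ofReal (4 * Real.pi))) := by
    rw [← sph_univ, ← lintegral_const, ← lintegral_const_mul _ hGm,
      ← lintegral_add_left (hGm.const_mul _),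
      ← lintegral_add_right _ ((hGm.const_mul _).add_const _),
      ← lintegral_const_mul' _ _ ENNReal.ofReal_ne_top, sphSq,
      ← lintegral_const_mul' _ _ ENNReal.ofReal_ne_top]
    refine lintegral_mono_ae ?_
    filter_upwards [sph_ae_norm] with a ha using h1 a ha
  refine h3.trans ?_
  have hp2 : (0:ℝ) < Real.pi ^ 2 := by positivity
  -- The first summand is 2πc, from the shifted spheres; 6π² exceeds (4π/3)·4π, from the ball term;
  -- and B ≥ 1 covers the data term.
  set B := 4 * Real.pi ^ 3 * (1 + (h ^ 2)⁻¹) + 6 * Real.pi ^ 2 with hB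
  have hi : 0 ≤ (h ^ 2)⁻¹ := by positivity
  have hBc : B = c * (2 * Real.pi) + 6 * Real.pi ^ 2 := by rw [hB, hc]; ring
  have b1 : 1 ≤ B := by rw [hBc]; nlinarith [mul_nonneg hc0 Real.pi_pos.le]
  have b2 : c * (2 * Real.pi) ≤ B := by rw [hBc]; linarith
  have b3 : Real.pi * 4 / 3 * (4 * Real.pi) ≤ B := by
    rw [hBc]; nlinarith [mul_nonneg hc0 Real.pi_pos.le]
  rw [sphSqConst, ← hB, ENNReal.ofReal_mul (p := 4 * k ^ 2) (by positivity),
    mul_assoc (ENNReal.ofReal (4 * k ^ 2)), h2, ← mul_assoc (ENNReal.ofReal c),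
    ← ENNReal.ofReal_mul hc0, mul_right_comm (ENNReal.ofReal (Real.pi * 4 / 3)),
    ← ENNReal.ofReal_mul (by positivity), mul_add (ENNReal.ofReal B),
    mul_add (ENNReal.ofReal B), add_assoc]
  gcongr
  exact le_mul_of_one_le_left zero_le (by simpa using b1)

end IntegratedEstimate

/-! ### A Gronwall estimate with quadratic delay -/

section Gronwall

/-- By the law of cosines ℓ² − (1−τ)² = 2τ(1 − cos θ), where ℓ + (1−τ) ≤ 2 and 1 − cos θ ≥ 2θ²/π².
-/
lemma sideLength_sub_ge {h τ θ : ℝ} (hh : 0 < h) (hτ : h ≤ τ) (hθ : θ ∈ Ioo 0 Real.pi) :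
    2 * h / Real.pi ^ 2 * θ ^ 2 ≤ sideLength τ θ - (1 - τ) := by
  have hpi := Real.pi_pos
  have hτ0 : 0 < τ := hh.trans_le hτ
  have h1 := Real.cos_le_one_sub_mul_cos_sq (x := θ) (abs_le.2 ⟨by linarith [hθ.1], hθ.2.le⟩)
  have h2 : 0 ≤ 1 + τ ^ 2 - 2 * τ * Real.cos θ := by
    nlinarith [Real.cos_le_one θ, sq_nonneg (1 - τ)]
  have h3 : sideLength τ θ ^ 2 = 1 + τ ^ 2 - 2 * τ * Real.cos θ := Real.sq_sqrt h2
  have h4 : 0 ≤ sideLength τ θ := Real.sqrt_nonneg _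
  have h5 : sideLength τ θ ≤ 1 + τ := by
    refine Real.sqrt_le_iff.2 ⟨by linarith, ?_⟩
    nlinarith [Real.neg_one_le_cos θ]
  have h6 : 1 - τ ≤ sideLength τ θ := by
    refine Real.le_sqrt_of_sq_le ?_
    nlinarith [Real.cos_le_one θ]
  have h7 : 2 * h / Real.pi ^ 2 * θ ^ 2 ≤ τ * (2 / Real.pi ^ 2 * θ ^ 2) := by
    rw [mul_div_right_comm, show 2 / Real.pi ^ 2 * h * θ ^ 2 = h * (2 / Real.pi ^ 2 * θ ^ 2) by ring]
    gcongr
  have h8 : τ * (2 / Real.pi ^ 2 * θ ^ 2) ≤ τ * (1 - Real.cos θ) := by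
    gcongr; linarith
  nlinarith

lemma le_sideLength {τ θ : ℝ} (hτ : 0 ≤ τ) : 1 - τ ≤ sideLength τ θ :=
  Real.le_sqrt_of_sq_le (by nlinarith [Real.cos_le_one θ])

lemma lintegral_gaussian_le {c : ℝ} (hc : 0 < c) :
    ∫⁻ θ in Ioo 0 Real.pi, ENNReal.ofReal (Real.exp (-c * θ ^ 2)) ≤
      ENNReal.ofReal √(Real.pi / c) := by
  rw [← integral_gaussian, ofReal_integral_eq_lintegral_ofReal (integrable_exp_neg_mul_sq hc)
    (Eventually.of_forall fun _ => (Real.exp_pos _).le)]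
  exact setLIntegral_le_lintegral _ _

lemma lintegral_exp_Ioi {c s : ℝ} (hc : 0 < c) :
    ∫⁻ r in Ioi s, ENNReal.ofReal (Real.exp (c * (1 - r))) =
      ENNReal.ofReal (c⁻¹) * ENNReal.ofReal (Real.exp (c * (1 - s))) := by
  have hi := integrableOn_exp_mul_Ioi (neg_lt_zero.2 hc) s
  have h1 : ∀ r : ℝ, ENNReal.ofReal (Real.exp (c * (1 - r))) =
      ENNReal.ofReal (Real.exp c) * ENNReal.ofReal (Real.exp (-c * r)) := fun r => by
    rw [← ENNReal.ofReal_mul (Real.exp_pos _).le, ← Real.exp_add]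
    ring_nf
  simp only [h1]
  rw [lintegral_const_mul' _ _ ENNReal.ofReal_ne_top, ← ofReal_integral_eq_lintegral_ofReal hi
    (Eventually.of_forall fun _ => (Real.exp_pos _).le), integral_exp_mul_Ioi (neg_lt_zero.2 hc),
    mul_left_comm, neg_div_neg_eq, div_eq_inv_mul, ENNReal.ofReal_mul (by positivity)]

/-- The growth rate in the Gronwall estimate. -/
def gronwallRate (h C Λ : ℝ) : ℝ := 16 * (C * Λ) ^ 2 * Real.pi / (2 * h / Real.pi ^ 2) + 4 * C

/-- A Gronwall estimate for the averages occurring in the backscattering inequality. -/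
theorem gronwall_sideLength {u : ℝ → ℝ≥0∞} {h s₀ N C Λ : ℝ} {d : ℝ≥0∞} (hh : 0 < h)
    (hC : 0 < C) (hΛ : 0 ≤ Λ) (hN : ∀ r, u r ≤ ENNReal.ofReal N) (hz : ∀ r, 1 - h < r → u r = 0)
    (hu : ∀ s, s₀ ≤ s → s < 1 → u s ≤ ENNReal.ofReal C * (d + ENNReal.ofReal Λ *
      (∫⁻ θ in Ioo 0 Real.pi, u (sideLength (1 - s) θ)) + ∫⁻ r in Ioi s, u r))
    {s : ℝ} (hs : s₀ ≤ s) :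
    u s ≤ ENNReal.ofReal (2 * C) * d * ENNReal.ofReal (Real.exp (gronwallRate h C Λ * (1 - s))) := by
  have hpi := Real.pi_pos
  set κ := 2 * h / Real.pi ^ 2 with hκ
  have hκ0 : 0 < κ := by positivity
  set c := gronwallRate h C Λ with hc
  have hc0 : 0 < c := by rw [hc, gronwallRate]; positivity
  have hc1 : C * c⁻¹ ≤ 1 / 4 := by
    rw [← div_eq_mul_inv, div_le_iff₀ hc0, hc, gronwallRate]
    have : 0 ≤ 16 * (C * Λ) ^ 2 * Real.pi / (2 * h / Real.pi ^ 2) := by positivity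
    linarith
  -- The Gaussian term requires c of order (CΛ)², the tail integral c ≥ 4C; `gronwallRate` is the
  -- sum of the two requirements. Each contribution is then at most a quarter.
  have hc2 : C * Λ * √(Real.pi / (c * κ)) ≤ 1 / 4 := by
    rw [← Real.sqrt_sq (by positivity : 0 ≤ C * Λ), ← Real.sqrt_mul (by positivity)]
    refine Real.sqrt_le_iff.2 ⟨by norm_num, ?_⟩
    rw [mul_div_assoc', div_le_iff₀ (by positivity)]
    have h1 : c * κ = 16 * (C * Λ) ^ 2 * Real.pi + 4 * C * κ := by
      rw [hc, gronwallRate, ← hκ]; field_simp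
    have h2 : 0 < C * κ := by positivity
    nlinarith
  -- Start from the a priori bound N and reinsert the estimate into the inequality. All radii that
  -- occur are at least s, so the hypothesis applies again, and the part due to N is halved each
  -- time.
  have step : ∀ k : ℕ, ∀ s, s₀ ≤ s → u s ≤ (ENNReal.ofReal (2 * C) * d +
      ENNReal.ofReal (N * (1 / 2) ^ k)) * ENNReal.ofReal (Real.exp (c * (1 - s))) := by
    intro k
    induction k with
    | zero =>
      intro s _
      rcases lt_or_ge (1 - h) s with h1 | h1
      · simp [hz s h1]
      have h2 : 1 ≤ ENNReal.ofReal (Real.exp (c * (1 - s))) := by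
        simpa using mul_nonneg hc0.le (by linarith : 0 ≤ 1 - s)
      refine (hN s).trans ((le_mul_of_one_le_right zero_le h2).trans ?_)
      gcongr
      simp
    | succ k ih =>
      intro s hs
      rcases lt_or_ge (1 - h) s with h1 | h1
      · simp [hz s h1]
      set W := ENNReal.ofReal (2 * C) * d + ENNReal.ofReal (N * (1 / 2) ^ k) with hW
      set E := ENNReal.ofReal (Real.exp (c * (1 - s))) with hE
      have hE1 : 1 ≤ E := by
        simpa [hE] using mul_nonneg hc0.le (by linarith : 0 ≤ 1 - s)
      -- The weight at the larger radius is smaller by exp(−cκθ²), by the quadratic growth of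
      -- `sideLength`.
      have e1 : ∫⁻ θ in Ioo 0 Real.pi, u (sideLength (1 - s) θ) ≤
          W * E * ENNReal.ofReal √(Real.pi / (c * κ)) := by
        refine le_trans ?_ (mul_le_mul_right (lintegral_gaussian_le (c := c * κ) (by positivity)) _)
        rw [← lintegral_const_mul _ (by fun_prop)]
        refine setLIntegral_mono' measurableSet_Ioo fun θ hθ => ?_
        refine (ih _ (hs.trans ((sub_sub_cancel 1 s).symm.le.trans (le_sideLength (by linarith))))).trans ?_
        rw [mul_assoc, hE, ← ENNReal.ofReal_mul (Real.exp_pos _).le, ← Real.exp_add]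
        gcongr
        have := sideLength_sub_ge hh (by linarith : h ≤ 1 - s) hθ
        rw [← hκ] at this
        nlinarith
      have e2 : ∫⁻ r in Ioi s, u r ≤ W * E * ENNReal.ofReal c⁻¹ := by
        rw [mul_assoc, mul_comm E, ← lintegral_exp_Ioi hc0, ← lintegral_const_mul _ (by fun_prop)]
        exact setLIntegral_mono' measurableSet_Ioi fun r hr => ih r (hs.trans (le_of_lt hr))
      have e3 : ENNReal.ofReal C * (ENNReal.ofReal Λ * (W * E * ENNReal.ofReal √(Real.pi / (c * κ))) +
          W * E * ENNReal.ofReal c⁻¹) ≤ W * E * ENNReal.ofReal (1 / 2) := by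
        calc _ = W * E * ENNReal.ofReal (C * Λ * √(Real.pi / (c * κ)) + C * c⁻¹) := by
              rw [ENNReal.ofReal_add (by positivity) (by positivity), ENNReal.ofReal_mul (by positivity),
                ENNReal.ofReal_mul hC.le, ENNReal.ofReal_mul hC.le]
              ring
          _ ≤ _ := by gcongr; linarith
      have e4 : W * ENNReal.ofReal (1 / 2) = ENNReal.ofReal C * d +
          ENNReal.ofReal (N * (1 / 2) ^ (k + 1)) := by
        rw [hW, add_mul, mul_right_comm, ← ENNReal.ofReal_mul (by positivity),
          ← ENNReal.ofReal_mul' (by positivity), pow_succ]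
        ring_nf
      calc u s ≤ ENNReal.ofReal C * d + ENNReal.ofReal C * (ENNReal.ofReal Λ *
            (W * E * ENNReal.ofReal √(Real.pi / (c * κ))) + W * E * ENNReal.ofReal c⁻¹) := by
            refine (hu s hs (by linarith)).trans ?_
            rw [← mul_add, ← add_assoc]
            gcongr
        _ ≤ ENNReal.ofReal C * d * E + W * E * ENNReal.ofReal (1 / 2) := by
            exact add_le_add (le_mul_of_one_le_right zero_le hE1) e3
        _ = _ := by
            rw [mul_right_comm W, e4, ENNReal.ofReal_mul two_pos.le, ENNReal.ofReal_ofNat]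
            ring
  have hlim : Tendsto (fun k : ℕ => (ENNReal.ofReal (2 * C) * d +
      ENNReal.ofReal (N * (1 / 2) ^ k)) * ENNReal.ofReal (Real.exp (c * (1 - s)))) atTop
      (𝓝 ((ENNReal.ofReal (2 * C) * d + ENNReal.ofReal (N * 0)) *
        ENNReal.ofReal (Real.exp (c * (1 - s))))) := by
    refine ENNReal.Tendsto.mul_const (Tendsto.const_add _ (ENNReal.tendsto_ofReal
      (Tendsto.const_mul _ ?_))) (Or.inr ENNReal.ofReal_ne_top)
    exact tendsto_pow_atTop_nhds_zero_of_lt_one (by norm_num) (by norm_num)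
  simpa using ge_of_tendsto' hlim fun k => step k s hs

end Gronwall

/-! ### From the norm of the class to bounds on derivatives -/

section Potentials

lemma norm_le_sum_stdVec {F : Type*} [NormedAddCommGroup F] [NormedSpace ℝ F] (L : R3 →L[ℝ] F) :
    ‖L‖ ≤ ∑ i, ‖L (stdVec i)‖ := by
  refine L.opNorm_le_bound (Finset.sum_nonneg fun _ _ => norm_nonneg _) fun x => ?_
  have hx : x = ∑ i, x i • stdVec i := by
    ext j
    simp [stdVec, Fin.sum_univ_three]
    fin_cases j <;> simp
  conv_lhs => rw [hx]
  rw [map_sum, Finset.sum_mul]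
  refine (norm_sum_le _ _).trans (Finset.sum_le_sum fun i _ => ?_)
  rw [map_smul, norm_smul, mul_comm]
  gcongr
  exact PiLp.norm_apply_le x i

lemma norm_multiD_le {M : ℝ} (hM : 0 ≤ M) {f : R3 → ℂ} {s : ℕ} (hf : cNorm s f ≤ ENNReal.ofReal M)
    {α : Fin 3 → ℕ} (hα : ∑ i, α i ≤ s) {x : R3} (hx : x ∈ ball (0 : R3) 1) :
    ‖multiD α f x‖ ≤ M := by
  have h1 : ‖multiD α f x‖ₑ ≤ cNorm s f := by
    refine (le_iSup₂ (f := fun x (_ : x ∈ ball (0 : R3) 1) => ‖multiD α f x‖ₑ) x hx).trans ?_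
    refine (Finset.single_le_sum (f := fun α => ⨆ x ∈ ball (0 : R3) 1, ‖multiD α f x‖ₑ)
      (fun _ _ => zero_le) (?_ : α ∈ Finset.piAntidiag Finset.univ (∑ i, α i))).trans
      (Finset.single_le_sum (f := fun k => ∑ α ∈ Finset.piAntidiag Finset.univ k,
        ⨆ x ∈ ball (0 : R3) 1, ‖multiD α f x‖ₑ) (fun _ _ => zero_le)
        (Finset.mem_range.2 (by omega)))
    simp
  rw [← ofReal_norm] at h1
  exact (ENNReal.ofReal_le_ofReal_iff hM).1 (h1.trans hf)

lemma fderiv_fderiv_stdVec {q : R3 → ℂ} (hq : ContDiff ℝ 2 q) (i j : Fin 3) (x : R3) :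
    fderiv ℝ (fderiv ℝ q) x (stdVec i) (stdVec j) = partialD i (partialD j q) x := by
  have h1 : DifferentiableAt ℝ (fderiv ℝ q) x :=
    (hq.fderiv_right (m := 1) (by norm_num)).differentiable one_ne_zero x
  have h2 := h1.hasFDerivAt.clm_apply (hasFDerivAt_const (stdVec j) x)
  unfold partialD
  rw [h2.fderiv]
  simp

/-- The factor 9 counts the second partial derivatives. The Lipschitz bound is the mean value
inequality on ℝ³, where extension by zero keeps the derivative bounds. -/
theorem Admissible.potBound {M h : ℝ} {q : Potential} (hM : 0 ≤ M) (hh1 : h < 1)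
    (hq : Admissible M h q) : PotBound (9 * M) h q := by
  have hc2 : ContDiff ℝ 2 q := q.contDiff.of_le (by norm_num)
  have hball : tsupport q ⊆ ball (0 : R3) 1 := q.tsupport_subset
  have hout : ∀ x ∉ ball (0 : R3) 1, (q : R3 → ℂ) =ᶠ[𝓝 x] fun _ => 0 := fun x hx =>
    notMem_tsupport_iff_eventuallyEq.1 fun h' => hx (hball h')
  have b0 : ∀ x, ‖q x‖ ≤ M := fun x => by
    by_cases hx : x ∈ ball (0 : R3) 1
    · exact norm_multiD_le (α := 0) hM hq.1 (by simp) hx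
    · simpa [(hout x hx).self_of_nhds] using hM
  have b1 : ∀ x, ‖fderiv ℝ q x‖ ≤ 9 * M := fun x => by
    by_cases hx : x ∈ ball (0 : R3) 1
    · refine (norm_le_sum_stdVec _).trans ?_
      have : ∀ i, ‖fderiv ℝ q x (stdVec i)‖ ≤ M := fun i => by
        have h1 := norm_multiD_le (α := Pi.single i 1) hM hq.1 (by simp) hx
        fin_cases i <;> exact h1
      refine (Finset.sum_le_sum fun i _ => this i).trans ?_
      simp; linarith
    · simpa [(hout x hx).fderiv_eq] using hM
  have b2 : ∀ x, ‖fderiv ℝ (fderiv ℝ q) x‖ ≤ 9 * M := fun x => by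
    by_cases hx : x ∈ ball (0 : R3) 1
    · have hle : ∀ i j, i ≤ j → ‖fderiv ℝ (fderiv ℝ q) x (stdVec i) (stdVec j)‖ ≤ M :=
        fun i j hij => by
          rw [fderiv_fderiv_stdVec hc2]
          have h1 := norm_multiD_le (α := Pi.single i 1 + Pi.single j 1) hM hq.1
            (by simp [Finset.sum_add_distrib]) hx
          fin_cases i <;> fin_cases j <;> first | exact h1 | simp at hij
      have hij : ∀ i j, ‖fderiv ℝ (fderiv ℝ q) x (stdVec i) (stdVec j)‖ ≤ M := fun i j => by
        rcases le_total i j with h1 | h1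
        · exact hle i j h1
        · rw [(hc2.contDiffAt.isSymmSndFDerivAt (by simp)) (stdVec i) (stdVec j)]
          exact hle j i h1
      refine (norm_le_sum_stdVec _).trans ((Finset.sum_le_sum fun i _ =>
        (norm_le_sum_stdVec _).trans (Finset.sum_le_sum fun j _ => hij i j)).trans ?_)
      simp; linarith
    · have h1 : fderiv ℝ q =ᶠ[𝓝 x] 0 := by simpa using (hout x hx).fderiv
      have h2 : fderiv ℝ (fderiv ℝ q) x = 0 := by
        rw [h1.fderiv_eq]
        exact fderiv_const_apply (0 : R3 →L[ℝ] ℂ)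
      rw [h2]
      exact (norm_zero (E := R3 →L[ℝ] R3 →L[ℝ] ℂ)).trans_le (by linarith)
  refine ⟨hc2.of_le (by norm_num), fun x => (b0 x).trans (by linarith), b1, fun x y => ?_,
    fun x hx => ?_⟩
  · exact convex_univ.norm_image_sub_le_of_norm_fderiv_le (fun z _ =>
      (hc2.fderiv_right (m := 1) (by norm_num)).differentiable one_ne_zero z) (fun z _ => b2 z)
      (mem_univ y) (mem_univ x)
  · by_contra hne
    have hxs : x ∈ tsupport q := subset_tsupport _ hne
    have hx1 : ‖x‖ < 1 := by simpa using hball hxs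
    have hx0 : 0 < ‖x‖ := by linarith
    -- The radial projection is at distance 1 − |x| on the unit sphere.
    have hy := hq.2 x hxs (‖x‖⁻¹ • x) (by simp [norm_smul, hx0.ne'])
    rw [dist_eq_norm, show x - ‖x‖⁻¹ • x = (1 - ‖x‖⁻¹) • x by rw [sub_smul, one_smul], norm_smul,
      Real.norm_eq_abs, abs_of_nonpos (by simpa using (one_le_inv₀ hx0).2 hx1.le), neg_sub, sub_mul,
      inv_mul_cancel₀ hx0.ne'] at hy
    linarith

end Potentials

/-! ### Norms on spheres, angular control and radial symmetry -/

section Spheres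

variable {M h : ℝ} {q : R3 → ℂ}

lemma lintegral_sphereMeasure (r : ℝ) {F : R3 → ℝ≥0∞} (hF : Measurable F) :
    ∫⁻ x, F x ∂(sphereMeasure r) = ENNReal.ofReal (r ^ 2) * ∫⁻ ω, F (r • ω) ∂sph := by
  rw [sphereMeasure, lintegral_smul_measure, lintegral_map hF (by fun_prop), sph,
    lintegral_map (f := fun ω : R3 => F (r • ω)) (hF.comp (by fun_prop)) measurable_subtype_coe, smul_eq_mul]

lemma sphereMeasure_one : sphereMeasure 1 = sph := by
  simp [sphereMeasure, sph]

lemma eLpNorm_two_le_iff {μ : Measure R3} {f : R3 → ℂ} {c : ℝ≥0∞} :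
    eLpNorm f 2 μ ≤ c ↔ ∫⁻ x, ‖f x‖ₑ ^ 2 ∂μ ≤ c ^ 2 := by
  have h1 := eLpNorm_nnreal_pow_eq_lintegral (f := f) (μ := μ) (two_ne_zero (α := ℝ≥0))
  have h2 : eLpNorm f 2 μ ^ 2 = ∫⁻ x, ‖f x‖ₑ ^ 2 ∂μ := by
    simpa using h1
  rw [← h2, ENNReal.pow_le_pow_left_iff two_ne_zero]

lemma PotBound.eLpNorm_sphere_le_iff (hq : PotBound M h q) {r : ℝ} {c : ℝ≥0∞} :
    eLpNorm q 2 (sphereMeasure r) ≤ c ↔ sphSq q r ≤ c ^ 2 := by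
  have hqc := hq.contDiff.continuous
  rw [eLpNorm_two_le_iff, lintegral_sphereMeasure r (Continuous.measurable (by fun_prop)), sphSq]

lemma PotBound.sphSq_eq_zero (hq : PotBound M h q) {r : ℝ} (hr : 1 - h < |r|) : sphSq q r = 0 := by
  rw [sphSq, lintegral_eq_zero_of_ae_eq_zero, mul_zero]
  filter_upwards [sph_ae_norm] with ω hω
  simp [hq.zero (r • ω) (by rwa [norm_smul, hω, mul_one])]

lemma PotBound.sphSq_le_sq (hq : PotBound M h q) (r : ℝ) :
    sphSq q r ≤ ENNReal.ofReal (r ^ 2 * (4 * Real.pi * M ^ 2)) := by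
  have hM := hq.nonneg
  have h1 : ∫⁻ ω, ‖q (r • ω)‖ₑ ^ 2 ∂sph ≤ ∫⁻ _, ENNReal.ofReal (M ^ 2) ∂sph := by
    refine lintegral_mono fun ω => ?_
    rw [← ofReal_norm, ← ENNReal.ofReal_pow (norm_nonneg _)]
    gcongr
    exact hq.bound _
  rw [lintegral_const, sph_univ, ← ENNReal.ofReal_mul (by positivity)] at h1
  rw [sphSq, ENNReal.ofReal_mul (by positivity), mul_comm (4 * Real.pi)]
  gcongr

lemma PotBound.sphSq_le_const (hq : PotBound M h q) (hh : 0 < h) (r : ℝ) :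
    sphSq q r ≤ ENNReal.ofReal (4 * Real.pi * M ^ 2) := by
  rcases lt_or_ge (1 - h) |r| with h1 | h1
  · simp [hq.sphSq_eq_zero h1]
  · refine (hq.sphSq_le_sq r).trans (ENNReal.ofReal_le_ofReal ?_)
    have : r ^ 2 ≤ 1 := (sq_le_one_iff_abs_le_one r).2 (by linarith)
    exact mul_le_of_le_one_left (by positivity) this

/-- A uniform bound over the spheres gives a bound over the unit ball. -/
lemma PotBound.eLpNorm_ball_le (hq : PotBound M h q) (hh : 0 < h) {c : ℝ≥0∞}
    (hc : ∀ r, 0 < r → r < 1 → sphSq q r ≤ c ^ 2) :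
    eLpNorm q 2 (volume.restrict (ball (0 : R3) 1)) ≤ c := by
  have hqc := hq.contDiff.continuous
  rw [eLpNorm_two_le_iff]
  refine (setLIntegral_le_lintegral _ _).trans ?_
  rw [lintegral_polar (Continuous.measurable (by fun_prop))]
  have h1 : ∫⁻ r in Ioi (0 : ℝ), sphSq q r ≤ ∫⁻ r, (Ioo (0:ℝ) 1).indicator (fun _ => c ^ 2) r := by
    rw [← lintegral_indicator measurableSet_Ioi]
    refine lintegral_mono fun r => ?_
    by_cases hr : r ∈ Ioo (0:ℝ) 1
    · rw [indicator_of_mem hr, indicator_of_mem (mem_Ioi.2 hr.1)]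
      exact hc r hr.1 hr.2
    · by_cases hr0 : r ∈ Ioi (0:ℝ)
      · rw [indicator_of_mem hr0, hq.sphSq_eq_zero]
        · exact zero_le
        · have hr1 : 1 ≤ r := not_lt.1 fun h' => hr ⟨hr0, h'⟩
          exact (by linarith : 1 - h < r).trans_le (le_abs_self r)
      · rw [indicator_of_notMem hr0]
        exact zero_le
  refine h1.trans ?_
  rw [lintegral_indicator measurableSet_Ioo]
  simp

lemma angMean_eq_zero_of_forall {r : ℝ} (hr : ∀ x : R3, ‖x‖ = |r| → ∀ i j, angularD i j q x = 0) :
    angMean q r = 0 := by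
  refine lintegral_eq_zero_of_ae_eq_zero ?_
  filter_upwards [sph_ae_norm] with ω hω
  have h1 : ‖r • ω‖ = |r| := by rw [norm_smul, hω, mul_one, Real.norm_eq_abs]
  simp [angSq, hr _ h1]

lemma PotBound.angMean_eq_zero (hq : PotBound M h q) {r : ℝ} (hr : 1 - h < |r|) :
    angMean q r = 0 := by
  refine angMean_eq_zero_of_forall fun x hx i j => ?_
  have h1 : q =ᶠ[𝓝 x] fun _ => 0 := by
    filter_upwards [(isOpen_lt continuous_const continuous_norm).mem_nhds
      (show 1 - h < ‖x‖ by rwa [hx])] with y hy using hq.zero y hy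
  simp [angularD, partialD, h1.fderiv_eq]

/-- The field w of the rotation is orthogonal to x, so x + tw and x − tw have equal norms. Along
this line q is even in t, and its derivative at 0 vanishes. -/
lemma RadiallySymmetric.angMean_eq_zero (hr : RadiallySymmetric q) (hq : PotBound M h q) (r : ℝ) :
    angMean q r = 0 := by
  refine angMean_eq_zero_of_forall fun x _ i j => ?_
  set w : R3 := x i • stdVec j - x j • stdVec i with hw
  have h1 : angularD i j q x = fderiv ℝ q x w := by
    simp [angularD, partialD, hw]
  have hxw : ⟪x, w⟫ = 0 := by
    simp [hw, inner_sub_right, real_inner_smul_right, stdVec, EuclideanSpace.inner_single_right,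
      mul_comm]
  have hn : ∀ t : ℝ, ‖x + t • w‖ = ‖x + (-t) • w‖ := fun t => by
    rw [← sq_eq_sq₀ (norm_nonneg _) (norm_nonneg _), norm_add_sq_real, norm_add_sq_real]
    simp [real_inner_smul_right, hxw, norm_smul]
  have hl : ∀ v : R3, HasDerivAt (fun t : ℝ => q (x + t • v)) (fderiv ℝ q x v) 0 := fun v => by
    have h2 : HasDerivAt (fun t : ℝ => x + t • v) v 0 := by
      simpa using ((hasDerivAt_id (0:ℝ)).smul_const v).const_add x
    have h3 : HasFDerivAt q (fderiv ℝ q x) (x + (0:ℝ) • v) := by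
      simpa using (hq.contDiff.differentiable one_ne_zero x).hasFDerivAt
    exact h3.comp_hasDerivAt 0 h2
  have h4 := hl (-w)
  simp only [smul_neg, ← neg_smul] at h4
  have h5 := (hl w).unique (h4.congr_of_eventuallyEq (Eventually.of_forall fun t => hr _ _ (hn t)))
  rw [h1]
  rw [map_neg] at h5
  exact self_eq_neg.1 h5

/-- `sphSq` contains the area factor s² while `angMean` does not, hence S²/s², at most S²/s₀². For s
≥ 1 the angular term vanishes. -/
lemma AngularlyControlled.angMean_le {S : ℝ} (hS : AngularlyControlled S q) (hq : PotBound M h q)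
    (hh : 0 < h) {s₀ s : ℝ} (hs₀ : 0 < s₀) (hs : s₀ ≤ s) :
    angMean q s + sphSq q s ≤ ENNReal.ofReal (S ^ 2 / s₀ ^ 2 + 1) * sphSq q s := by
  have hqc := hq.contDiff.continuous
  have hdc := hq.continuous_fderiv
  have hs0 : 0 < s := hs₀.trans_le hs
  rw [ENNReal.ofReal_add (by positivity) zero_le_one, ENNReal.ofReal_one, add_mul, one_mul]
  gcongr
  rcases lt_or_ge s 1 with h1 | h1
  · have h2 := hS s hs0 h1
    have hm : ∀ i j, Measurable fun x => ‖angularD i j q x‖ₑ ^ 2 := fun i j => by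
      unfold angularD partialD
      exact Continuous.measurable (by fun_prop)
    rw [lintegral_sphereMeasure s (Continuous.measurable (by fun_prop))] at h2
    simp only [lintegral_sphereMeasure s (hm _ _), ← Finset.mul_sum] at h2
    have h3 : angMean q s = ∑ i : Fin 3, ∑ j ∈ Finset.Ioi i,
        ∫⁻ ω, ‖angularD i j q (s • ω)‖ₑ ^ 2 ∂sph := by
      have hm' : ∀ i j, Measurable fun ω => ‖angularD i j q (s • ω)‖ₑ ^ 2 := fun i j =>
        (hm i j).comp (by fun_prop)
      simp only [← lintegral_finsetSum _ fun j _ => hm' _ j]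
      rw [← lintegral_finsetSum _ fun i _ => Finset.measurable_sum _ fun j _ => hm' i j, angMean]
      refine lintegral_congr fun ω => ?_
      rw [angSq, ENNReal.ofReal_sum_of_nonneg fun _ _ => Finset.sum_nonneg fun _ _ => by positivity]
      refine Finset.sum_congr rfl fun i _ => ?_
      rw [ENNReal.ofReal_sum_of_nonneg fun _ _ => by positivity]
      refine Finset.sum_congr rfl fun j _ => ?_
      rw [ENNReal.ofReal_pow (norm_nonneg _), ofReal_norm]
    rw [← h3] at h2
    have h4 : angMean q s = ENNReal.ofReal (s ^ 2)⁻¹ * (ENNReal.ofReal (s ^ 2) * angMean q s) := by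
      rw [← mul_assoc, ← ENNReal.ofReal_mul (by positivity), inv_mul_cancel₀ (by positivity),
        ENNReal.ofReal_one, one_mul]
    rw [h4]
    calc _ ≤ ENNReal.ofReal (s ^ 2)⁻¹ * (ENNReal.ofReal (S ^ 2) * sphSq q s) := by
          rw [sphSq]; gcongr ENNReal.ofReal (s ^ 2)⁻¹ * ?_
      _ = ENNReal.ofReal (S ^ 2 / s ^ 2) * sphSq q s := by
          rw [← mul_assoc, ← ENNReal.ofReal_mul (by positivity), inv_mul_eq_div]
      _ ≤ _ := by gcongr
  · rw [hq.angMean_eq_zero ((by linarith : 1 - h < s).trans_le (le_abs_self s))]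
    exact zero_le

end Spheres

/-! ### The stability estimate on spheres -/

section Stability

variable {a : R3} {M h l K : ℝ} {q₁ q₂ : R3 → ℂ} {P₁ P₂ : R3 → SpaceTime → ℂ}

lemma scatterBound_nonneg (hM : 0 ≤ M) (hh : 0 < h) (hK : 0 ≤ K) : 0 ≤ scatterBound M h K l := by
  have := Real.pi_pos
  unfold scatterBound
  positivity

/-- The constant in the integral inequality for the difference of two potentials. -/
def stabConst (M h K l : ℝ) : ℝ := sphSqConst (16 * Real.pi * (1 + scatterBound M h K l)) h

lemma stabConst_pos (hM : 0 ≤ M) (hh : 0 < h) (hK : 0 ≤ K) : 0 < stabConst M h K l := by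
  have := Real.pi_pos
  have := scatterBound_nonneg (l := l) hM hh hK
  unfold stabConst sphSqConst
  positivity

/-- The stability estimate on spheres around the origin in terms of the backscattering data. -/
theorem sphSq_sub_le (h₁ : ∀ a, ‖a‖ = 1 → IsTailDensity a q₁ K l (P₁ a))
    (h₂ : ∀ a, ‖a‖ = 1 → IsTailDensity a q₂ K l (P₂ a)) (hq₁ : PotBound M h q₁)
    (hq₂ : PotBound M h q₂) (hh : 0 < h) (hl : 1 ≤ l) (hK : 0 ≤ K) {d : ℝ≥0∞}
    (hd : ∀ τ ∈ Ioo (0:ℝ) 1, ∫⁻ a, ‖dataDeriv a q₁ q₂ (P₁ a) (P₂ a) τ‖ₑ ^ 2 ∂sph ≤ d)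
    {s₀ Λ : ℝ} (hs₀ : 0 < s₀) (hΛ : 0 ≤ Λ)
    (hang : ∀ s, s₀ ≤ s → angMean (fun y => q₁ y - q₂ y) s + sphSq (fun y => q₁ y - q₂ y) s ≤
      ENNReal.ofReal Λ * sphSq (fun y => q₁ y - q₂ y) s) :
    sphSq (fun y => q₁ y - q₂ y) s₀ ≤ ENNReal.ofReal (2 * stabConst M h K l) * d *
      ENNReal.ofReal (Real.exp (gronwallRate h (stabConst M h K l) Λ * (1 - s₀))) := by
  have hpi := Real.pi_gt_three
  have hM := hq₁.nonneg
  have hq := hq₁.sub hq₂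
  have hsc := scatterBound_nonneg (l := l) hM hh hK
  refine gronwall_sideLength hh (stabConst_pos hM hh hK) hΛ (hq.sphSq_le_const hh)
    (fun r hr => hq.sphSq_eq_zero (hr.trans_le (le_abs_self r))) (fun s hs hs1 => ?_) le_rfl
  have hτ : 1 - s ∈ Ioo (0:ℝ) 1 := ⟨by linarith, by linarith⟩
  have h3 := hq.sphSq_le hh hτ.1.le hτ.2 (k := 16 * Real.pi * (1 + scatterBound M h K l))
    (D := fun a => dataDeriv a q₁ q₂ (P₁ a) (P₂ a) (1 - s)) (by nlinarith) fun a ha => by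
      have h4 := norm_point_le (h₁ a ha) (h₂ a ha) hq₁ hq₂ ha hh hl hτ.1.le hτ.2.le
      have h5 : 16 * Real.pi ≤ 16 * Real.pi * (1 + scatterBound M h K l) :=
        le_mul_of_one_le_right (by positivity) (by linarith)
      have h6 : 16 * Real.pi * scatterBound M h K l ≤ 16 * Real.pi * (1 + scatterBound M h K l) := by
        gcongr; linarith
      exact h4.trans (add_le_add (add_le_add (mul_le_mul_of_nonneg_right h5 (norm_nonneg _)) le_rfl)
        (mul_le_mul_of_nonneg_right h6 (add_nonneg (sphAbs_nonneg _ _ _) (ballAbs_nonneg _ _ _))))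
  rw [sub_sub_cancel] at h3
  refine h3.trans ?_
  rw [stabConst]
  gcongr
  · exact hd _ hτ
  · rw [← lintegral_const_mul' _ _ ENNReal.ofReal_ne_top]
    refine lintegral_mono fun θ => hang _ (hs.trans ?_)
    exact (sub_sub_cancel 1 s).symm.le.trans (le_sideLength hτ.1.le)

/-- An a priori bound independent of a and τ, which makes the measurement norm finite. -/
lemma norm_dataDeriv_le {P₁ P₂ : SpaceTime → ℂ} (h₁ : IsTailDensity a q₁ K l P₁)
    (h₂ : IsTailDensity a q₂ K l P₂) (hq₁ : PotBound M h q₁) (hq₂ : PotBound M h q₂)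
    (ha : ‖a‖ = 1) (hh : 0 < h) (hl : 1 ≤ l) {τ : ℝ} (hτ : 0 ≤ τ) (hτ1 : τ ≤ 1) :
    ‖dataDeriv a q₁ q₂ P₁ P₂ τ‖ ≤ 16 * Real.pi * M +
      scatterBound M h K l * (8 * Real.pi * M + 2 * M * (Real.pi * 4 / 3)) := by
  have hpi := Real.pi_gt_three
  have hM := hq₁.nonneg
  have hq := hq₁.sub hq₂
  have hsc := scatterBound_nonneg (l := l) hM hh h₁.nonneg
  have e1 : ‖meanDeriv a (fun y => q₁ y - q₂ y) τ‖ ≤ (4 * M) * sph.real univ := by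
    refine norm_integral_le_of_norm_le_const ?_
    filter_upwards [sph_ae_norm] with ω hω
    refine (norm_add_le _ _).trans ?_
    rw [norm_smul, Real.norm_of_nonneg hτ]
    have e2 := hq.bound (a + τ • ω)
    have e3 := (fderiv ℝ (fun y => q₁ y - q₂ y) (a + τ • ω)).le_opNorm ω
    rw [hω, mul_one] at e3
    have e4 := e3.trans (hq.bound_fderiv _)
    have e5 := mul_le_mul hτ1 e4 (norm_nonneg _) zero_le_one
    linarith
  have e6 : sphAbs a (fun y => q₁ y - q₂ y) τ ≤ 2 * M * sph.real univ := by
    refine (Real.le_norm_self _).trans (norm_integral_le_of_norm_le_const ?_)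
    exact Eventually.of_forall fun ω => by rw [norm_norm]; exact hq.bound _
  have hvol : volume.real (ball a 1) = Real.pi * 4 / 3 := by
    rw [Measure.real, EuclideanSpace.volume_ball_fin_three]
    simp [show 0 ≤ Real.pi * 4 / 3 by positivity]
  have e7 : ballAbs a (fun y => q₁ y - q₂ y) τ ≤ 2 * M * (Real.pi * 4 / 3) := by
    rw [← hvol]
    refine (hq.ballAbs_mono hτ1).trans ((Real.le_norm_self _).trans
      (norm_setIntegral_le_of_norm_le_const measure_ball_lt_top fun y _ => ?_))
    rw [norm_norm]
    exact hq.bound _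
  rw [sph_real_univ] at e1 e6
  have e8 := norm_arrival_terms_le h₁ h₂ hq₁ hq₂ ha hh hl hτ hτ1
  rw [dataDeriv]
  refine (norm_add_le _ _).trans (add_le_add ?_ (e8.trans ?_))
  · rw [norm_smul, Real.norm_of_nonneg (by positivity)]
    have : (32 * Real.pi ^ 2)⁻¹ ≤ 1 := inv_le_one_of_one_le₀ (by nlinarith)
    exact (mul_le_of_le_one_left (norm_nonneg _) this).trans (by linarith)
  · gcongr
    linarith

end Stability

/-! ### Identification of the measured data -/

section PointSources

variable {a : R3} {M h l K : ℝ} {q q₁ q₂ : Potential} {U₁ U₂ : R3 → Dist7}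
  {P₁ P₂ : R3 → SpaceTime → ℂ}

lemma IsPointSourceSolution.hasPointValue {P : SpaceTime → ℂ} {U : Dist7}
    (hU : IsPointSourceSolution q a U) (hP : IsTailDensity a q K l P) (hq : PotBound M h q)
    (ha : ‖a‖ = 1) (hh : 0 < h) (hl : 1 ≤ l) {τ : ℝ} (hτ : 0 < τ) :
    HasPointValue U (a, 2 * τ) (waveTail a q P (a, 2 * τ)) := by
  have ht := hP.isTail hq ha hh hl
  rw [hU.unique (ht.isPointSourceSolution hq (by linarith))]
  exact ht.hasPointValue (by simpa [lightCone] using hτ)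

lemma hasDerivAt_backscatterDiff (hU₁ : IsPointSourceSolution q₁ a (U₁ a))
    (hU₂ : IsPointSourceSolution q₂ a (U₂ a)) (h₁ : IsTailDensity a q₁ K l (P₁ a))
    (h₂ : IsTailDensity a q₂ K l (P₂ a)) (hq₁ : PotBound M h q₁) (hq₂ : PotBound M h q₂)
    (ha : ‖a‖ = 1) (hh : 0 < h) (hl : 1 ≤ l) {τ : ℝ} (hτ : 0 < τ) :
    HasDerivAt (backscatterDiff U₁ U₂ a) (dataDeriv a q₁ q₂ (P₁ a) (P₂ a) τ) τ := by
  refine (hasDerivAt_data h₁ h₂ hq₁ hq₂ ha hh hl hτ).congr_of_eventuallyEq ?_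
  filter_upwards [Ioi_mem_nhds hτ] with τ' hτ'
  rw [backscatterDiff, (hU₁.hasPointValue h₁ hq₁ ha hh hl hτ').pointValue_eq,
    (hU₂.hasPointValue h₂ hq₂ ha hh hl hτ').pointValue_eq]

lemma contDiffOn_backscatterDiff (hU₁ : IsPointSourceSolution q₁ a (U₁ a))
    (hU₂ : IsPointSourceSolution q₂ a (U₂ a)) (h₁ : IsTailDensity a q₁ K l (P₁ a))
    (h₂ : IsTailDensity a q₂ K l (P₂ a)) (hq₁ : PotBound M h q₁) (hq₂ : PotBound M h q₂)
    (ha : ‖a‖ = 1) (hh : 0 < h) (hl : 1 ≤ l) :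
    ContDiffOn ℝ 1 (backscatterDiff U₁ U₂ a) (Ioo 0 1) := by
  have hd : ∀ τ ∈ Ioo (0:ℝ) 1, HasDerivAt (backscatterDiff U₁ U₂ a)
      (dataDeriv a q₁ q₂ (P₁ a) (P₂ a) τ) τ := fun τ hτ =>
    hasDerivAt_backscatterDiff hU₁ hU₂ h₁ h₂ hq₁ hq₂ ha hh hl hτ.1
  rw [show (1 : WithTop ℕ∞) = 0 + 1 from rfl, contDiffOn_succ_iff_deriv_of_isOpen isOpen_Ioo]
  refine ⟨fun τ hτ => (hd τ hτ).differentiableAt.differentiableWithinAt, by simp, ?_⟩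
  rw [contDiffOn_zero]
  exact (continuous_dataDeriv h₁ h₂ hq₁ hq₂ ha hh hl).continuousOn.congr fun τ hτ => (hd τ hτ).deriv

lemma dataNorm_sq (U₁ U₂ : R3 → Dist7) : dataNorm U₁ U₂ ^ 2 = ⨆ τ ∈ Ioo (0 : ℝ) 1,
    ∫⁻ a, ‖deriv (backscatterDiff U₁ U₂ a) τ‖ₑ ^ 2 ∂sph := by
  rw [dataNorm, sphereMeasure_one, ← ENNReal.rpow_natCast, ← ENNReal.rpow_mul]
  norm_num

end PointSources

/-! ### The growth rate at small radii -/

section Constants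

lemma ofReal_sq_mul_sq (c : ℝ) (hc : 0 ≤ c) (d : ℝ≥0∞) :
    (ENNReal.ofReal c * d) ^ 2 = ENNReal.ofReal (c ^ 2) * d ^ 2 := by
  rw [mul_pow, ENNReal.ofReal_pow hc]

/-- Apart from a constant term the rate is quadratic in Λ, and Λ ≤ (S²+1)/r². This is the origin of
the power r⁻⁴. -/
lemma gronwallRate_le {h C S r : ℝ} (hh : 0 < h) (hC : 0 < C) (hr : 0 < r) (hr1 : r ≤ 1) :
    2 * C * Real.exp (gronwallRate h C (S ^ 2 / r ^ 2 + 1) * (1 - r)) ≤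
      Real.exp ((gronwallRate h C (S ^ 2 + 1) + 2 * C) / r ^ 4) := by
  have hpi := Real.pi_pos
  have h4 : 1 ≤ (r ^ 4)⁻¹ := (one_le_inv₀ (by positivity)).2 (pow_le_one₀ hr.le hr1)
  have h2 : 1 ≤ (r ^ 2)⁻¹ := (one_le_inv₀ (by positivity)).2 (pow_le_one₀ hr.le hr1)
  have e1 : S ^ 2 / r ^ 2 + 1 ≤ (S ^ 2 + 1) * (r ^ 2)⁻¹ := by
    rw [add_mul, ← div_eq_mul_inv]; linarith
  have e2 : gronwallRate h C (S ^ 2 / r ^ 2 + 1) ≤ gronwallRate h C (S ^ 2 + 1) * (r ^ 4)⁻¹ := by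
    have e3 : gronwallRate h C ((S ^ 2 + 1) * (r ^ 2)⁻¹) ≤
        gronwallRate h C (S ^ 2 + 1) * (r ^ 4)⁻¹ := by
      have e4 : gronwallRate h C (S ^ 2 + 1) * (r ^ 4)⁻¹ - gronwallRate h C ((S ^ 2 + 1) * (r ^ 2)⁻¹) =
          4 * C * ((r ^ 4)⁻¹ - 1) := by
        unfold gronwallRate; ring
      have : 0 ≤ 4 * C * ((r ^ 4)⁻¹ - 1) := mul_nonneg (by positivity) (by linarith)
      linarith
    refine le_trans ?_ e3
    unfold gronwallRate
    gcongr
  have e5 : 0 ≤ gronwallRate h C (S ^ 2 / r ^ 2 + 1) := by unfold gronwallRate; positivity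
  -- The prefactor is absorbed into the exponent, using x ≤ exp x and r ≤ 1.
  have e6 : 2 * C ≤ Real.exp (2 * C * (r ^ 4)⁻¹) := by
    have := Real.add_one_le_exp (2 * C * (r ^ 4)⁻¹)
    have := le_mul_of_one_le_right (by positivity : 0 ≤ 2 * C) h4
    linarith
  rw [div_eq_mul_inv _ (r ^ 4), add_mul, add_comm (_ * _), Real.exp_add]
  exact mul_le_mul e6 (Real.exp_le_exp.2 ((mul_le_of_le_one_right e5 (by linarith)).trans e2))
    (Real.exp_pos _).le (Real.exp_pos _).le

end Constants

/-! ### From spheres to the ball -/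

section SphereBounds

variable {M h : ℝ} {q : R3 → ℂ}

/-- From exponential bounds on spheres to a logarithmic bound on the ball. -/
lemma PotBound.eLpNorm_ball_le_log (hq : PotBound M h q) (hh : 0 < h) {A : ℝ} (hA : 0 < A)
    {d : ℝ≥0∞} (hd : d < ENNReal.ofReal (Real.exp (-1)))
    (hb : ∀ r, 0 < r → r < 1 → sphSq q r ≤ ENNReal.ofReal (Real.exp (A / r ^ 4)) * d ^ 2)
    {D : ℝ} (hD0 : 0 ≤ D) (hD : 4 * Real.pi * M ^ 2 * √A + 1 ≤ D ^ 2) :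
    eLpNorm q 2 (volume.restrict (ball (0 : R3) 1)) ≤
      ENNReal.ofReal (D * Real.log (1 / d.toReal) ^ (-(1 / 4) : ℝ)) := by
  have hpi := Real.pi_pos
  refine hq.eLpNorm_ball_le hh fun r hr hr1 => ?_
  rcases eq_or_ne d 0 with rfl | hd0
  · refine (hb r hr hr1).trans ?_
    simp
  have hdt : d ≠ ∞ := (hd.trans ENNReal.ofReal_lt_top).ne
  set x := d.toReal with hx
  have hx0 : 0 < x := ENNReal.toReal_pos hd0 hdt
  have hdx : d = ENNReal.ofReal x := (ENNReal.ofReal_toReal hdt).symm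
  have hx1 : x < Real.exp (-1) := by
    rwa [hdx, ENNReal.ofReal_lt_ofReal_iff (Real.exp_pos _)] at hd
  set L := Real.log (1 / x) with hL
  have hLx : L = -Real.log x := by rw [hL, one_div, Real.log_inv]
  have hL1 : 1 < L := by
    have := Real.log_lt_log hx0 hx1
    rw [Real.log_exp] at this
    linarith
  have hxL : x = Real.exp (-L) := by rw [hLx, neg_neg, Real.exp_log hx0]
  have hL0 : 0 < L := by linarith
  have hsq : (ENNReal.ofReal (D * L ^ (-(1 / 4) : ℝ))) ^ 2 = ENNReal.ofReal (D ^ 2 * (√L)⁻¹) := by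
    rw [← ENNReal.ofReal_pow (by positivity), mul_pow, ← Real.rpow_natCast (L ^ _),
      ← Real.rpow_mul hL0.le, Real.sqrt_eq_rpow, ← Real.rpow_neg hL0.le]
    norm_num
  rw [hsq]
  have hsL : 0 < √L := Real.sqrt_pos.2 hL0
  have hN : 0 ≤ 4 * Real.pi * M ^ 2 := by positivity
  -- The split at r⁴ = A/L. Below it, the trivial bound gives r² ≤ √(A/L). Above it, exp(A/r⁴) uses
  -- up one of the two factors exp(−L) in the squared data norm, and the other is smaller than
  -- L^(−1/2).
  rcases le_or_gt (r ^ 4) (A / L) with h1 | h1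
  · refine (hq.sphSq_le_sq r).trans (ENNReal.ofReal_le_ofReal ?_)
    have h2 : r ^ 2 ≤ √A * (√L)⁻¹ := by
      rw [← div_eq_mul_inv, ← Real.sqrt_div' _ hL0.le]
      exact Real.le_sqrt_of_sq_le (by rwa [← pow_mul])
    calc r ^ 2 * (4 * Real.pi * M ^ 2) ≤ √A * (√L)⁻¹ * (4 * Real.pi * M ^ 2) := by gcongr
      _ = 4 * Real.pi * M ^ 2 * √A * (√L)⁻¹ := by ring
      _ ≤ _ := by gcongr; linarith
  · refine (hb r hr hr1).trans ?_
    rw [hdx, ← ENNReal.ofReal_pow hx0.le, ← ENNReal.ofReal_mul (Real.exp_pos _).le]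
    refine ENNReal.ofReal_le_ofReal ?_
    have h2 : A / r ^ 4 ≤ L := by
      rw [div_le_iff₀ (by positivity), mul_comm]
      exact ((div_lt_iff₀ hL0).1 h1).le
    have h3 : Real.exp (A / r ^ 4) * x ^ 2 ≤ Real.exp (-L) := by
      rw [hxL, ← Real.exp_nat_mul, ← Real.exp_add]
      exact Real.exp_le_exp.2 (by push_cast; linarith)
    have h4 : Real.exp (-L) ≤ (√L)⁻¹ := by
      rw [Real.exp_neg]
      refine inv_anti₀ hsL ?_
      have h5 : √L ≤ L := Real.sqrt_le_iff.2 ⟨hL0.le, by nlinarith⟩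
      linarith [Real.add_one_le_exp L]
    have h6 : 1 ≤ D ^ 2 := by
      have : 0 ≤ 4 * Real.pi * M ^ 2 * √A := by positivity
      linarith
    exact (h3.trans h4).trans (le_mul_of_one_le_left (by positivity) h6)

/-- For data bounded below the a priori bound on q suffices; the factor exp 2 compensates the square
of exp(−1). -/
lemma PotBound.eLpNorm_ball_le_const (hq : PotBound M h q) (hh : 0 < h) {d : ℝ≥0∞}
    (hd : ENNReal.ofReal (Real.exp (-1)) ≤ d) {D : ℝ} (hD0 : 0 ≤ D)
    (hD : 4 * Real.pi * M ^ 2 * Real.exp 2 ≤ D ^ 2) :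
    eLpNorm q 2 (volume.restrict (ball (0 : R3) 1)) ≤ ENNReal.ofReal D * d := by
  have hpi := Real.pi_pos
  refine hq.eLpNorm_ball_le hh fun r _ _ => (hq.sphSq_le_const hh r).trans ?_
  refine le_trans ?_ (pow_le_pow_left₀ zero_le (mul_le_mul_right hd _) 2)
  rw [← ENNReal.ofReal_mul hD0, ← ENNReal.ofReal_pow (by positivity), mul_pow, ← Real.exp_nat_mul]
  refine ENNReal.ofReal_le_ofReal ?_
  calc 4 * Real.pi * M ^ 2 = 4 * Real.pi * M ^ 2 * Real.exp 2 * Real.exp (-2) := by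
        rw [mul_assoc _ (Real.exp 2), ← Real.exp_add]; simp
    _ ≤ D ^ 2 * Real.exp (-2) := by gcongr
    _ = _ := by norm_num

/-- For d ≤ 1 the linear estimate is weakened by d² ≤ d; for d ≥ 1 the a priori bound on q is
enough. -/
lemma PotBound.eLpNorm_ball_le_sqrt (hq : PotBound M h q) (hh : 0 < h) {A : ℝ} (hA : 0 ≤ A)
    {d : ℝ≥0∞} (hb : ∀ r, 0 < r → r < 1 → sphSq q r ≤ ENNReal.ofReal A * d ^ 2)
    {D : ℝ} (hD0 : 0 ≤ D) (hD : 4 * Real.pi * M ^ 2 + A ≤ D ^ 2) :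
    eLpNorm q 2 (volume.restrict (ball (0 : R3) 1)) ≤ ENNReal.ofReal D * d ^ (1 / 2 : ℝ) := by
  have hpi := Real.pi_pos
  refine hq.eLpNorm_ball_le hh fun r hr hr1 => ?_
  have h1 : (d ^ (1 / 2 : ℝ)) ^ 2 = d := by
    rw [← ENNReal.rpow_natCast, ← ENNReal.rpow_mul]
    norm_num
  rw [mul_pow, h1, ← ENNReal.ofReal_pow hD0]
  have hN : 0 ≤ 4 * Real.pi * M ^ 2 := by positivity
  rcases le_total d 1 with h2 | h2
  · refine (hb r hr hr1).trans ?_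
    have h3 : d ^ 2 ≤ d := by
      rw [sq]; exact mul_le_of_le_one_left zero_le h2
    gcongr
    linarith
  · refine (hq.sphSq_le_const hh r).trans (le_trans ?_ (le_mul_of_one_le_right zero_le h2))
    exact ENNReal.ofReal_le_ofReal (by linarith)

end SphereBounds

end

theorem theorem1p1 (M h : ℝ) (hM : 0 < M) (hh : 0 < h) (hh1 : h < 1) :
    ∃ α : ℝ, 0 < α ∧ ∀ S : ℝ, 0 < S → ∃ C D : ℝ, 0 < C ∧ 0 < D ∧
      ∀ q₁ q₂ : Potential, Admissible M h q₁ → Admissible M h q₂ →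
        -- the point source problems are uniquely solvable
        (∀ a ∈ sphere (0 : R3) 1,
          (∃! U, IsPointSourceSolution q₁ a U) ∧ ∃! U, IsPointSourceSolution q₂ a U) ∧
        ∀ U₁ U₂ : R3 → Dist7,
          (∀ a ∈ sphere (0 : R3) 1, IsPointSourceSolution q₁ a (U₁ a)) →
          (∀ a ∈ sphere (0 : R3) 1, IsPointSourceSolution q₂ a (U₂ a)) →
          -- the backscattering data and their norm are well defined
          (∀ a ∈ sphere (0 : R3) 1,
            (∀ τ ∈ Ioo (0 : ℝ) 1, (∃ c, HasPointValue (U₁ a) (a, 2 * τ) c) ∧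
              ∃ c, HasPointValue (U₂ a) (a, 2 * τ) c) ∧
            ContDiffOn ℝ 1 (backscatterDiff U₁ U₂ a) (Ioo 0 1)) ∧
          dataNorm U₁ U₂ < ∞ ∧
          -- angular control
          (AngularlyControlled S (fun x => q₁ x - q₂ x) →
            (∀ r : ℝ, 0 < r →
              eLpNorm (fun x => q₁ x - q₂ x) 2 (sphereMeasure r)
                ≤ ENNReal.ofReal (Real.exp (C / r ^ 4)) * dataNorm U₁ U₂) ∧
            (dataNorm U₁ U₂ < ENNReal.ofReal (Real.exp (-1)) →
              eLpNorm (fun x => q₁ x - q₂ x) 2 (volume.restrict (ball (0 : R3) 1))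
                ≤ ENNReal.ofReal
                    (D * (Real.log (1 / (dataNorm U₁ U₂).toReal)) ^ (-(1 / 4) : ℝ))) ∧
            (ENNReal.ofReal (Real.exp (-1)) ≤ dataNorm U₁ U₂ →
              eLpNorm (fun x => q₁ x - q₂ x) 2 (volume.restrict (ball (0 : R3) 1))
                ≤ ENNReal.ofReal D * dataNorm U₁ U₂)) ∧
          -- radial symmetry
          (RadiallySymmetric (fun x => q₁ x - q₂ x) →
            (∀ r : ℝ, 0 < r →
              eLpNorm (fun x => q₁ x - q₂ x) 2 (sphereMeasure r)
                ≤ ENNReal.ofReal (C * r ^ (-α)) * dataNorm U₁ U₂) ∧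
            eLpNorm (fun x => q₁ x - q₂ x) 2 (volume.restrict (ball (0 : R3) 1))
              ≤ ENNReal.ofReal D * dataNorm U₁ U₂ ^ (1 / (1 + α))) := by
  have hpi := Real.pi_pos
  set N := 9 * M with hN
  have hN0 : 0 < N := by positivity
  set l := 1 + 2 * N with hl
  have hl1 : 1 ≤ l := by linarith
  set K := 2 * (N + 8 * Real.pi * N ^ 2) with hK
  have hK0 : 0 ≤ K := by positivity
  set Cs := stabConst N h K l with hCs
  have hCs0 : 0 < Cs := stabConst_pos hN0.le hh hK0
  -- The radial estimate proved below is uniform in r, so a loss r^(−α) is not needed; α = 1 turns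
  -- the last exponent into 1/2.
  refine ⟨1, one_pos, fun S hS => ?_⟩
  set A := gronwallRate h Cs (S ^ 2 + 1) + 2 * Cs with hA
  have hA0 : 0 < A := by rw [hA, gronwallRate]; positivity
  set B := 2 * Cs * Real.exp (gronwallRate h Cs 1) with hB
  have hB0 : 0 < B := by positivity
  set N₀ := 4 * Real.pi * (2 * N) ^ 2 with hN₀
  have hN₀0 : 0 < N₀ := by positivity
  -- One constant for all three estimates on the ball. They require lower bounds on D², which follow
  -- from D ≥ 1; N₀ has 2N because it refers to the difference of two potentials.
  set D := N₀ * √A + N₀ * Real.exp 2 + N₀ + B + 1 with hD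
  have hD1 : 1 ≤ D := by
    rw [hD, le_add_iff_nonneg_left]; positivity
  have hDsq : D ≤ D ^ 2 := by nlinarith
  have p1 : 0 ≤ N₀ * √A := by positivity
  have p2 : 0 ≤ N₀ * Real.exp 2 := by positivity
  refine ⟨A + B + 1, D, by positivity, by linarith, fun q₁ q₂ hq₁ hq₂ => ?_⟩
  have b₁ : PotBound N h q₁ := hq₁.potBound hM.le hh1
  have b₂ : PotBound N h q₂ := hq₂.potBound hM.le hh1
  have b := b₁.sub b₂
  -- Total functions of a are needed for the choice; off the unit sphere the value 0 is never used.
  have hex₁ : ∀ a : R3, ∃ P, ‖a‖ = 1 → IsTailDensity a q₁ K l P := fun a => by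
    by_cases ha : ‖a‖ = 1
    · obtain ⟨P, hP⟩ := b₁.exists_tailDensity ha hh
      exact ⟨P, fun _ => hP⟩
    · exact ⟨0, fun h' => absurd h' ha⟩
  have hex₂ : ∀ a : R3, ∃ P, ‖a‖ = 1 → IsTailDensity a q₂ K l P := fun a => by
    by_cases ha : ‖a‖ = 1
    · obtain ⟨P, hP⟩ := b₂.exists_tailDensity ha hh
      exact ⟨P, fun _ => hP⟩
    · exact ⟨0, fun h' => absurd h' ha⟩
  choose P₁ h₁ using hex₁
  choose P₂ h₂ using hex₂
  refine ⟨fun a ha => ?_, fun U₁ U₂ hU₁ hU₂ => ?_⟩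
  · have ha1 : ‖a‖ = 1 := by simpa using ha
    exact ⟨⟨_, ((h₁ a ha1).isTail b₁ ha1 hh hl1).isPointSourceSolution b₁ (by linarith),
        fun U hU => hU.unique
          (((h₁ a ha1).isTail b₁ ha1 hh hl1).isPointSourceSolution b₁ (by linarith))⟩,
      ⟨_, ((h₂ a ha1).isTail b₂ ha1 hh hl1).isPointSourceSolution b₂ (by linarith),
        fun U hU => hU.unique
          (((h₂ a ha1).isTail b₂ ha1 hh hl1).isPointSourceSolution b₂ (by linarith))⟩⟩
  have hV₁ : ∀ a : R3, ‖a‖ = 1 → IsPointSourceSolution q₁ a (U₁ a) := fun a ha =>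
    hU₁ a (by simpa using ha)
  have hV₂ : ∀ a : R3, ‖a‖ = 1 → IsPointSourceSolution q₂ a (U₂ a) := fun a ha =>
    hU₂ a (by simpa using ha)
  set d := dataNorm U₁ U₂ with hd
  -- By uniqueness the given solutions are the constructed ones, so the abstract derivative is the
  -- explicit `dataDeriv` for almost every a.
  have hderiv : ∀ τ ∈ Ioo (0:ℝ) 1, ∫⁻ a, ‖deriv (backscatterDiff U₁ U₂ a) τ‖ₑ ^ 2 ∂sph =
      ∫⁻ a, ‖dataDeriv a q₁ q₂ (P₁ a) (P₂ a) τ‖ₑ ^ 2 ∂sph := fun τ hτ => by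
    refine lintegral_congr_ae ?_
    filter_upwards [sph_ae_norm] with a ha
    rw [(hasDerivAt_backscatterDiff (hV₁ a ha) (hV₂ a ha) (h₁ a ha) (h₂ a ha) b₁ b₂ ha hh hl1
      hτ.1).deriv]
  have hdata : ∀ τ ∈ Ioo (0:ℝ) 1,
      ∫⁻ a, ‖dataDeriv a q₁ q₂ (P₁ a) (P₂ a) τ‖ₑ ^ 2 ∂sph ≤ d ^ 2 := fun τ hτ => by
    rw [← hderiv τ hτ, hd, dataNorm_sq]
    exact le_iSup₂ (f := fun τ (_ : τ ∈ Ioo (0:ℝ) 1) =>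
      ∫⁻ a, ‖deriv (backscatterDiff U₁ U₂ a) τ‖ₑ ^ 2 ∂sph) τ hτ
  have hsph := fun {s₀ Λ : ℝ} => sphSq_sub_le h₁ h₂ b₁ b₂ hh hl1 hK0 hdata (s₀ := s₀) (Λ := Λ)
  have hout : ∀ r : ℝ, 1 ≤ r → sphSq (fun x => q₁ x - q₂ x) r = 0 := fun r hr =>
    b.sphSq_eq_zero ((by linarith : 1 - h < r).trans_le (le_abs_self r))
  refine ⟨fun a ha => ?_, ?_, fun hang => ?_, fun hrad => ?_⟩
  · have ha1 : ‖a‖ = 1 := by simpa using ha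
    exact ⟨fun τ hτ => ⟨⟨_, (hV₁ a ha1).hasPointValue (h₁ a ha1) b₁ ha1 hh hl1 hτ.1⟩,
      ⟨_, (hV₂ a ha1).hasPointValue (h₂ a ha1) b₂ ha1 hh hl1 hτ.1⟩⟩,
      contDiffOn_backscatterDiff (hV₁ a ha1) (hV₂ a ha1) (h₁ a ha1) (h₂ a ha1) b₁ b₂ ha1 hh hl1⟩
  · have hfin : d ^ 2 < ∞ := by
      rw [hd, dataNorm_sq]
      refine lt_of_le_of_lt (iSup₂_le fun τ hτ => (hderiv τ hτ).le.trans
        (lintegral_mono_ae (g := fun _ => ENNReal.ofReal (16 * Real.pi * N + scatterBound N h K l *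
          (8 * Real.pi * N + 2 * N * (Real.pi * 4 / 3))) ^ 2) ?_)) ?_
      · filter_upwards [sph_ae_norm] with a ha
        rw [← ofReal_norm]
        gcongr
        exact norm_dataDeriv_le (h₁ a ha) (h₂ a ha) b₁ b₂ ha hh hl1 hτ.1.le hτ.2.le
      · rw [lintegral_const, sph_univ]
        exact ENNReal.mul_lt_top (ENNReal.pow_lt_top ENNReal.ofReal_lt_top) ENNReal.ofReal_lt_top
    by_contra htop
    rw [not_lt_top_iff.1 htop] at hfin
    simp at hfin
  · have hb : ∀ r, 0 < r → r < 1 → sphSq (fun x => q₁ x - q₂ x) r ≤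
        ENNReal.ofReal (Real.exp (A / r ^ 4)) * d ^ 2 := fun r hr hr1 => by
      -- The estimate at radius r uses angular control only at radii at least r, so Λ, and with it
      -- the growth rate, is fixed by the smallest radius.
      refine (hsph hr (Λ := S ^ 2 / r ^ 2 + 1) (by positivity)
        fun s hs => hang.angMean_le b hh hr hs).trans ?_
      rw [mul_right_comm, ← ENNReal.ofReal_mul (by positivity)]
      gcongr
      exact gronwallRate_le hh hCs0 hr hr1.le
    refine ⟨fun r hr => ?_, fun hd1 => ?_, fun hd1 => ?_⟩
    · rw [b.eLpNorm_sphere_le_iff]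
      rcases le_or_gt 1 r with hr1 | hr1
      · simp [hout r hr1]
      · refine (hb r hr hr1).trans ?_
        rw [ofReal_sq_mul_sq _ (Real.exp_pos _).le, ← Real.exp_nat_mul]
        gcongr
        have e1 : A / r ^ 4 ≤ (A + B + 1) / r ^ 4 := by gcongr; linarith
        have e2 : 0 ≤ (A + B + 1) / r ^ 4 := by positivity
        push_cast
        linarith
    · exact b.eLpNorm_ball_le_log hh hA0 hd1 hb (by linarith) (by linarith)
    · exact b.eLpNorm_ball_le_const hh hd1 (by linarith) (by linarith)
  · have hb : ∀ r, 0 < r → r < 1 → sphSq (fun x => q₁ x - q₂ x) r ≤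
        ENNReal.ofReal B * d ^ 2 := fun r hr hr1 => by
      -- Without angular terms Λ = 1 at every radius, so the growth rate no longer depends on r.
      refine (hsph hr zero_le_one fun s _ => by simp [hrad.angMean_eq_zero b s]).trans ?_
      rw [mul_right_comm, ← ENNReal.ofReal_mul (by positivity)]
      refine mul_le_mul_left (ENNReal.ofReal_le_ofReal (mul_le_mul_of_nonneg_left
        (Real.exp_le_exp.2 (mul_le_of_le_one_right ?_ (by linarith))) (by positivity))) _
      rw [gronwallRate]
      positivity
    refine ⟨fun r hr => ?_, ?_⟩
    · rw [b.eLpNorm_sphere_le_iff]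
      rcases le_or_gt 1 r with hr1 | hr1
      · simp [hout r hr1]
      · refine (hb r hr hr1).trans ?_
        rw [ofReal_sq_mul_sq _ (by positivity), Real.rpow_neg_one]
        gcongr
        have e1 : A + B + 1 ≤ (A + B + 1) * r⁻¹ :=
          le_mul_of_one_le_right (by positivity) ((one_le_inv₀ hr).2 hr1.le)
        nlinarith
    · rw [one_add_one_eq_two]
      exact b.eLpNorm_ball_le_sqrt hh hB0.le hb (by linarith) (by linarith)
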